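/- **Conventions.** Let $k$ be a field of characteristic $p>2$. A restricted Lie superalgebra $\mathfrak g=\mathfrak g_{\bar 0}\oplus\mathfrak g_{\bar 1}$ over $k$ (of arbitrary dimension) is a Lie superalgebra (with $[x,[x,x]]=0$ for odd $x$) such that $\mathfrak g_{\bar 0}$ is a restricted Lie algebra and $\mathrm{ad}(x^{[p]})=\mathrm{ad}(x)^p$ on $\mathfrak g$ for $x\in\mathfrak g_{\bar 0}$; $U'(\mathfrak g)$ is the quotient of its enveloping superalgebra by the relations $x^p=x^{[p]}$, $x\in\mathfrak g_{\bar 0}$. Let $\mathfrak h\subset\mathfrak g$ be a restricted Lie subsuperalgebra such that $\mathfrak g/\mathfrak h$ has finite dimension $(n,m)$ ($n$ even, $m$ odd dimensions), let $(\pi,V)$ be a restricted representation of $\mathfrak h$ on a superspace $V$ of arbitrary dimension, and $\pi^*$ its contragredient, $(Hf)(v)=-(-1)^{|H||f|}f(Hv)$. For $v\in V$, $f\in V^*$ write $\langle v,f\rangle=(-1)^{|v||f|}f(v)$. Let $\mathrm{strad}_{\mathfrak g/\mathfrak h}(H)$ be the supertrace of $\mathrm{ad}(H)$ on $\mathfrak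 g/\mathfrak h$; it is a character of $U'(\mathfrak h)$. Let $k_\chi$ be the one dimensional module of the character $\chi$, and $\Pi$ the change of parity. For a superspace $M$ of dimension $(r,s)$, $\mathrm{Ber}(M)=\Lambda^r M_{\bar 0}\otimes(\Lambda^s M_{\bar 1})^*$, of parity $s$ mod $2$, with the induced action of $\mathfrak{gl}(M)$ (through the diagonal blocks). For a restricted $\mathfrak h$-module $W$ put $\mathrm{Coind}(W)=\mathrm{Coind}_{U'(\mathfrak h)}^{U'(\mathfrak g)}(W)=\mathrm{Hom}_{U'(\mathfrak h)}(U'(\mathfrak g),W)$, that is, the linear maps $\mu$, written $u\mapsto\langle u,\mu\rangle$, with $\langle wu,\mu\rangle=w\langle u,\mu\rangle$ for $w\in U'(\mathfrak h)$; $\mathfrak g$ acts by $\langle u,X\cdot\mu\rangle=\langle uX,\mu\rangle$. Products are defined through the coproduct of $U'(\mathfrak g)$ by $\langle u,\lambda\mu\rangle=\sum(-1)^{|\lambda||u_{(2)}|}\langle u_{(1)},\lambda\rangle\langle u_{(2)},\mu\rangle$; thus $\mathcal A=\mathrm{Coind}(k)$ is a superalgebra, every $\mathrm{Coind}(W)$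 is a left $\mathcal A$-module, and there is a product $\mathrm{Coind}(W)\times\mathrm{Coind}(\Pi^m k_\chi)\to\mathrm{Coind}(W\otimes\Pi^m k_\chi)$. Let $e_1,\dots,e_n$ (even), $\epsilon_1,\dots,\epsilon_m$ (odd) be a basis of a supplement of $\mathfrak h$ in $\mathfrak g$. An element of $\mathrm{Coind}(W)$ amounts to an arbitrary family of values on the monomials $e^{a}\epsilon^{\alpha}=e_1^{a_1}\cdots e_n^{a_n}\epsilon_1^{\alpha_1}\cdots\epsilon_m^{\alpha_m}$, $0\le a_i\le p-1$, $\alpha_s\in\{0,1\}$. Let $\eta_i,\zeta_s\in\mathcal A$ be the elements that take the value $1$ on $e_i$, respectively $\epsilon_s$, and $0$ on the other monomials; let $\hat w\in\mathrm{Coind}(W)$ take the value $w$ on $1$ and $0$ on the other monomials; let $\partial_i$, $\bar\partial_s$ be the superderivations of $\mathcal A$ (even, respectively odd) with $\partial_i\eta_j=\delta_{ij}$, $\partial_i\zeta_t=0$, $\bar\partial_s\eta_j=0$, $\bar\partial_s\zeta_t=\delta_{st}$, given on the monomials by $\langle e^a\epsilon^\alpha,\partial_if\rangle=\langle e_1^{a_1}\cdots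 e_i^{a_i+1}\cdots\epsilon_m^{\alpha_m},f\rangle$ if $a_i<p-1$ and $0$ otherwise, and $\langle e^a\epsilon^\alpha,\bar\partial_sf\rangle=(-1)^{\alpha_{s+1}+\dots+\alpha_m}\langle e_1^{a_1}\cdots\epsilon_s^{1}\cdots\epsilon_m^{\alpha_m},f\rangle$ if $\alpha_s=0$ and $0$ otherwise. Write $\delta_X$ for the action of $X\in\mathfrak g$ on $\mathcal A$ and $$\mathrm{Div}(\delta_X)=\sum_i\partial_i(\delta_X\eta_i)-(-1)^{|X|}\sum_s\bar\partial_s(\delta_X\zeta_s).$$ Let $\Omega=\mathcal A\,\omega_{e}$ be the free $\mathcal A$-module on which $X\in\mathfrak g$ acts by the Lie derivative $L_X(f\omega_e)=(\delta_Xf+\mathrm{Div}(\delta_X)f)\,\omega_e$. **Theorem.** 1. $\mathrm{Ber}((\mathfrak g/\mathfrak h)^*)\simeq\Pi^mk_{-\mathrm{strad}_{\mathfrak g/\mathfrak h}}$ as $\mathfrak h$-modules and superspaces. 2. A homogeneous basis of a supplement exists, and for each one the above statements on values on monomials (for $W=k,\pi,\pi^*$) and on the superderivations $\partial_i,\bar\partial_s$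 hold. There is a linear bijection $\chi:\Omega\to\mathrm{Coind}(\Pi^mk_{-\mathrm{strad}_{\mathfrak g/\mathfrak h}})$ such that $\langle X_1\cdots X_t,\chi(f\omega_e)\rangle$ is the value at $1\in U'(\mathfrak g)$ of the coefficient of $\omega_e$ in $L_{X_1}\cdots L_{X_t}(f\omega_e)$, for all $t\ge 0$ and $X_1,\dots,X_t\in\mathfrak g$. 3. There is a bilinear map (the Berezin integral pairing) $$\Psi:\mathrm{Coind}_{U'(\mathfrak h)}^{U'(\mathfrak g)}(\pi)\times\mathrm{Coind}_{U'(\mathfrak h)}^{U'(\mathfrak g)}(\pi^*\otimes\Pi^mk_{-\mathrm{strad}_{\mathfrak g/\mathfrak h}})\to k$$ such that, for homogeneous $v\in V$, $f\in V^*$, $$\Psi\bigl(\eta^{a}\zeta^{\alpha}\hat v,\ (\eta^{b}\zeta^{\beta}\hat f)\,\chi(\omega_e)\bigr)=(-1)^{\mathrm{Inv}(\alpha,\beta)}(-1)^{|v||\beta|}\langle v,f\rangle$$ if $a_i+b_i=p-1$ for all $i$ and $\alpha_s+\beta_s=1$ for all $s$, and $0$ otherwise; here $|\beta|=\sum_s\beta_s$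 and $\mathrm{Inv}(\alpha,\beta)$ is the number of pairs $t<s$ with $\alpha_s=\beta_t=1$. This $\Psi$ is even; it is non-degenerate (both kernels vanish); and it is $\mathfrak g$-invariant: $\Psi(X\cdot\lambda,\mu)+(-1)^{|X||\lambda|}\Psi(\lambda,X\cdot\mu)=0$ for $X\in\mathfrak g$ and all $\lambda,\mu$. -/

import Mathlib

open scoped TensorProduct DirectSum

noncomputable section

namespace SuperDuality

/-! ### Superspaces -/

/-- The sign `(-1)^i` of a parity `i`. -/
def sgn (k : Type*) [Ring k] (i : ZMod 2) : k := if i = 0 then 1 else -1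

/-- A superspace structure on `V`: a decomposition `V = V₀ ⊕ V₁`. -/
@[ext]
structure SuperGrading (k V : Type*) [Field k] [AddCommGroup V] [Module k V] where
  gr : ZMod 2 → Submodule k V
  isCompl : IsCompl (gr 0) (gr 1)

section Grading

variable {k V : Type*} [Field k] [AddCommGroup V] [Module k V]

theorem sgn_zero : sgn k 0 = 1 := by simp [sgn]

theorem sgn_one : sgn k 1 = -1 := by simp [sgn]

theorem zmod2_cases (i : ZMod 2) : i = 0 ∨ i = 1 := by
  revert i; decide

theorem one_add_one_zmod2 : (1 : ZMod 2) + 1 = 0 := by decide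

theorem sgn_add (i j : ZMod 2) : sgn k (i + j) = sgn k i * sgn k j := by
  rcases zmod2_cases i with rfl | rfl <;> rcases zmod2_cases j with rfl | rfl <;>
    simp [sgn, one_add_one_zmod2]

theorem sgn_mul_self (i : ZMod 2) : sgn k i * sgn k i = 1 := by
  rcases zmod2_cases i with rfl | rfl <;> simp [sgn]

namespace SuperGrading

variable (S : SuperGrading k V)

/-- The projection of `V` onto its component of parity `i`. -/
def proj (i : ZMod 2) : V →ₗ[k] V :=
  if i = 0 then (S.gr 0).projection (S.gr 1) S.isCompl else
    (S.gr 1).projection (S.gr 0) S.isCompl.symm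

/-- The parity automorphism `v ↦ (-1)^{|v|} v`. -/
def flip : V →ₗ[k] V := S.proj 0 - S.proj 1

theorem proj_mem (i : ZMod 2) (v : V) : S.proj i v ∈ S.gr i := by
  rcases zmod2_cases i with rfl | rfl
  · simp [proj]
  · simp [proj]

theorem proj_add (v : V) : S.proj 0 v + S.proj 1 v = v := by
  simpa [proj] using Submodule.projection_add_projection_eq_self S.isCompl v

theorem proj_of_mem {i : ZMod 2} {v : V} (h : v ∈ S.gr i) : S.proj i v = v := by
  rcases zmod2_cases i with rfl | rfl
  · simpa [proj] using h
  · simpa [proj] using h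

theorem proj_of_mem_ne {i j : ZMod 2} (hij : i ≠ j) {v : V} (h : v ∈ S.gr i) :
    S.proj j v = 0 := by
  rcases zmod2_cases i with rfl | rfl <;> rcases zmod2_cases j with rfl | rfl
  · simp at hij
  · simpa [proj] using h
  · simpa [proj] using h
  · simp at hij

theorem flip_of_mem {i : ZMod 2} {v : V} (h : v ∈ S.gr i) : S.flip v = sgn k i • v := by
  rcases zmod2_cases i with rfl | rfl
  · simp [flip, S.proj_of_mem h, S.proj_of_mem_ne (j := 1) (by decide) h, sgn_zero]
  · simp [flip, S.proj_of_mem h, S.proj_of_mem_ne (j := 0) (by decide) h, sgn_one]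

/-- A property compatible with addition holds everywhere if it holds for homogeneous vectors. -/
theorem induction {P : V → Prop} (hadd : ∀ v w, P v → P w → P (v + w))
    (hom : ∀ i, ∀ v ∈ S.gr i, P v) (v : V) : P v := by
  rw [← S.proj_add v]
  exact hadd _ _ (hom 0 _ (S.proj_mem 0 v)) (hom 1 _ (S.proj_mem 1 v))

theorem flip_flip (v : V) : S.flip (S.flip v) = v := by
  induction v using S.induction with
  | hadd v w hv hw => simp [hv, hw]
  | hom i v hv => rw [S.flip_of_mem hv, map_smul, S.flip_of_mem hv, smul_smul, sgn_mul_self,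
      one_smul]

theorem flip_mem {i : ZMod 2} {v : V} (h : v ∈ S.gr i) : S.flip v ∈ S.gr i := by
  rw [S.flip_of_mem h]; exact Submodule.smul_mem _ _ h

end SuperGrading

theorem two_ne (k : Type*) [Field k] (p : ℕ) [CharP k p] [hp : Fact (2 < p)] : (2 : k) ≠ 0 := by
  have h := hp.out
  intro h2
  have : p ∣ 2 := by
    rw [← CharP.cast_eq_zero_iff k p 2]; exact_mod_cast h2
  exact absurd (Nat.le_of_dvd (by norm_num) this) (by omega)

end Grading

/-! ### Restricted Lie superalgebras -/

/-- Lie superalgebras over a field of characteristic different from `2`. The last axiom follows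
from the Jacobi identity if `3` is invertible and is part of the definition in
characteristic `3`. -/
class LieSuperalgebra (k L : Type*) [Field k] [AddCommGroup L] [Module k L] where
  grading : SuperGrading k L
  br : L →ₗ[k] L →ₗ[k] L
  br_mem : ∀ {i j : ZMod 2} {x y : L}, x ∈ grading.gr i → y ∈ grading.gr j →
    br x y ∈ grading.gr (i + j)
  br_skew : ∀ {i j : ZMod 2} {x y : L}, x ∈ grading.gr i → y ∈ grading.gr j →
    br x y = -(sgn k (i * j) • br y x)
  br_jacobi : ∀ {i j : ZMod 2} {x y : L} (z : L), x ∈ grading.gr i → y ∈ grading.gr j →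
    br x (br y z) = br (br x y) z + sgn k (i * j) • br y (br x z)
  br_cube : ∀ {x : L}, x ∈ grading.gr 1 → br x (br x x) = 0

/-- The coefficient of `t ^ i` in `ad (t x + y) ^ n (x)`. -/
def adCoeff {k L : Type*} [Field k] [AddCommGroup L] [Module k L] (br : L →ₗ[k] L →ₗ[k] L)
    (x y : L) : ℕ → ℕ → L
  | 0, 0 => x
  | 0, _ + 1 => 0
  | n + 1, 0 => br y (adCoeff br x y n 0)
  | n + 1, i + 1 => br x (adCoeff br x y n i) + br y (adCoeff br x y n (i + 1))

/-- Restricted Lie superalgebras over a field of characteristic `p > 2`: the Lie algebra `L₀` has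
a `p`-operation in the sense of Jacobson, where `s_i(x,y)` is `i⁻¹` times the coefficient of
`t ^ (i-1)` in `ad (t x + y) ^ (p-1) (x)`, and `ad x^[p] = (ad x)^p` holds on `L₀` and on `L₁`. -/
class RestrictedLieSuperalgebra (k : Type*) (p : ℕ) (L : Type*) [Field k] [AddCommGroup L]
    [Module k L] extends LieSuperalgebra k L where
  pmap : grading.gr 0 → grading.gr 0
  pmap_smul : ∀ (c : k) (x : grading.gr 0), pmap (c • x) = c ^ p • pmap x
  pmap_add : ∀ x y : grading.gr 0, (pmap (x + y) : L) = pmap x + pmap y +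
    ∑ i ∈ Finset.Icc 1 (p - 1), (i : k)⁻¹ • adCoeff br (x : L) (y : L) (p - 1) (i - 1)
  ad_pmap : ∀ (x : grading.gr 0) (y : L), br (pmap x : L) y = (br (x : L))^[p] y

/-- A restricted Lie subsuperalgebra: a graded subspace stable under the bracket and the
`p`-operation. -/
structure RestrictedSub (k : Type*) (p : ℕ) (L : Type*) [Field k] [AddCommGroup L] [Module k L]
    [RestrictedLieSuperalgebra k p L] where
  carrier : Submodule k L
  proj_mem : ∀ (i : ZMod 2) {x : L}, x ∈ carrier →
    (LieSuperalgebra.grading (k := k) (L := L)).proj i x ∈ carrier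
  br_mem : ∀ {x y : L}, x ∈ carrier → y ∈ carrier → LieSuperalgebra.br (k := k) x y ∈ carrier
  pmap_mem : ∀ x : (LieSuperalgebra.grading (k := k) (L := L)).gr 0, (x : L) ∈ carrier →
    (RestrictedLieSuperalgebra.pmap (p := p) x : L) ∈ carrier

section Sub

variable {k : Type*} {p : ℕ} {L : Type*} [Field k] [AddCommGroup L] [Module k L]
  [RestrictedLieSuperalgebra k p L]

/-- The induced grading of a graded subspace. -/
def RestrictedSub.subGrading (h : RestrictedSub k p L) : SuperGrading k h.carrier where
  gr i := ((LieSuperalgebra.grading (k := k) (L := L)).gr i).comap h.carrier.subtype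
  isCompl := by
    constructor
    · rw [Submodule.disjoint_def]
      intro x hx hy
      have := (Submodule.disjoint_def.1
        (LieSuperalgebra.grading (k := k) (L := L)).isCompl.disjoint) (x : L) hx hy
      exact Subtype.ext this
    · rw [codisjoint_iff, Submodule.eq_top_iff']
      intro x
      rw [Submodule.mem_sup]
      exact ⟨⟨_, h.proj_mem 0 x.2⟩, SuperGrading.proj_mem _ 0 (x : L),
        ⟨_, h.proj_mem 1 x.2⟩, SuperGrading.proj_mem _ 1 (x : L),
        Subtype.ext (SuperGrading.proj_add _ (x : L))⟩

/-- The induced bracket. -/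
def RestrictedSub.subBr (h : RestrictedSub k p L) :
    h.carrier →ₗ[k] h.carrier →ₗ[k] h.carrier :=
  LinearMap.mk₂ k (fun x y => ⟨LieSuperalgebra.br (k := k) (x : L) (y : L), h.br_mem x.2 y.2⟩)
    (by intros; ext; simp) (by intros; ext; simp) (by intros; ext; simp) (by intros; ext; simp)

theorem RestrictedSub.coe_subBr (h : RestrictedSub k p L) (x y : h.carrier) :
    (h.subBr x y : L) = LieSuperalgebra.br (k := k) (x : L) (y : L) := rfl

theorem RestrictedSub.coe_adCoeff (h : RestrictedSub k p L) (x y : h.carrier) (n i : ℕ) :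
    ((adCoeff h.subBr x y n i : h.carrier) : L) =
      adCoeff (LieSuperalgebra.br (k := k)) (x : L) (y : L) n i := by
  induction n generalizing i with
  | zero => cases i <;> simp [adCoeff]
  | succ n ih => cases i <;> simp [adCoeff, ih, RestrictedSub.coe_subBr]

/-- A restricted Lie subsuperalgebra is a restricted Lie superalgebra. -/
instance RestrictedSub.instRestricted (h : RestrictedSub k p L) :
    RestrictedLieSuperalgebra k p h.carrier where
  grading := h.subGrading
  br := h.subBr
  br_mem hx hy := LieSuperalgebra.br_mem (k := k) (L := L) hx hy
  br_skew hx hy := Subtype.ext (LieSuperalgebra.br_skew (k := k) (L := L) hx hy)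
  br_jacobi z hx hy := Subtype.ext (LieSuperalgebra.br_jacobi (k := k) (L := L) (z : L) hx hy)
  br_cube hx := Subtype.ext (LieSuperalgebra.br_cube (k := k) (L := L) hx)
  pmap x := ⟨⟨RestrictedLieSuperalgebra.pmap (k := k) (p := p) (L := L) ⟨x.1.1, x.2⟩,
    h.pmap_mem ⟨x.1.1, x.2⟩ x.1.2⟩,
    (RestrictedLieSuperalgebra.pmap (k := k) (p := p) (L := L) ⟨x.1.1, x.2⟩).2⟩
  pmap_smul c x := by
    apply Subtype.ext
    apply Subtype.ext
    have := congrArg Subtype.val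
      (RestrictedLieSuperalgebra.pmap_smul (k := k) (p := p) (L := L) c ⟨x.1.1, x.2⟩)
    exact this
  pmap_add x y := by
    apply Subtype.ext
    have := RestrictedLieSuperalgebra.pmap_add (k := k) (p := p) (L := L)
      ⟨x.1.1, x.2⟩ ⟨y.1.1, y.2⟩
    simp only [Submodule.coe_add, AddSubmonoidClass.coe_finsetSum, Submodule.coe_smul,
      RestrictedSub.coe_adCoeff]
    exact this
  ad_pmap x y := by
    apply Subtype.ext
    have := RestrictedLieSuperalgebra.ad_pmap (k := k) (p := p) (L := L) ⟨x.1.1, x.2⟩ (y : L)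
    refine this.trans ?_
    have key : ∀ n : ℕ, (LieSuperalgebra.br (k := k) (x.1 : L))^[n] (y : L) =
        (((h.subBr x.1)^[n] y : h.carrier) : L) := by
      intro n
      induction n with
      | zero => rfl
      | succ n ih => rw [Function.iterate_succ_apply', Function.iterate_succ_apply', ih]; rfl
    exact key p

end Sub

/-! ### The restricted enveloping superalgebra -/

section Env

variable (k : Type*) (p : ℕ) (L : Type*) [Field k] [AddCommGroup L] [Module k L]

/-- The relations of the enveloping superalgebra. -/
inductive EnvRel [LieSuperalgebra k L] : TensorAlgebra k L → TensorAlgebra k L → Prop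
  | comm {i j : ZMod 2} {x y : L}
      (hx : x ∈ (LieSuperalgebra.grading (k := k) (L := L)).gr i)
      (hy : y ∈ (LieSuperalgebra.grading (k := k) (L := L)).gr j) :
      EnvRel (TensorAlgebra.ι k x * TensorAlgebra.ι k y)
        (sgn k (i * j) • (TensorAlgebra.ι k y * TensorAlgebra.ι k x) +
          TensorAlgebra.ι k (LieSuperalgebra.br (k := k) x y))

/-- The enveloping superalgebra `U(L)`. -/
def Env [LieSuperalgebra k L] : Type _ := RingQuot (EnvRel k L)

instance [LieSuperalgebra k L] : Ring (Env k L) := inferInstanceAs (Ring (RingQuot (EnvRel k L)))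

instance [LieSuperalgebra k L] : Algebra k (Env k L) :=
  inferInstanceAs (Algebra k (RingQuot (EnvRel k L)))

/-- The quotient map `T(L) → U(L)`. -/
def Env.mk [LieSuperalgebra k L] : TensorAlgebra k L →ₐ[k] Env k L :=
  RingQuot.mkAlgHom k (EnvRel k L)

/-- The canonical map `L → U(L)`. -/
def Env.ι [LieSuperalgebra k L] : L →ₗ[k] Env k L :=
  (Env.mk k L).toLinearMap ∘ₗ TensorAlgebra.ι k

theorem Env.ι_comm [LieSuperalgebra k L] {i j : ZMod 2} {x y : L}
    (hx : x ∈ (LieSuperalgebra.grading (k := k) (L := L)).gr i)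
    (hy : y ∈ (LieSuperalgebra.grading (k := k) (L := L)).gr j) :
    Env.ι k L x * Env.ι k L y = sgn k (i * j) • (Env.ι k L y * Env.ι k L x) +
      Env.ι k L (LieSuperalgebra.br (k := k) x y) := by
  have h : Env.mk k L _ = Env.mk k L _ := RingQuot.mkAlgHom_rel k (EnvRel.comm hx hy)
  rw [map_mul, map_add, map_smul, map_mul] at h
  exact h

/-- The universal property of `U(L)`. -/
def Env.lift [LieSuperalgebra k L] {B : Type*} [Ring B] [Algebra k B] (f : L →ₗ[k] B)
    (hf : ∀ {i j : ZMod 2} {x y : L}, x ∈ (LieSuperalgebra.grading (k := k) (L := L)).gr i →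
      y ∈ (LieSuperalgebra.grading (k := k) (L := L)).gr j →
      f x * f y = sgn k (i * j) • (f y * f x) + f (LieSuperalgebra.br (k := k) x y)) :
    Env k L →ₐ[k] B :=
  RingQuot.liftAlgHom k ⟨TensorAlgebra.lift k f, by
    intro a b hab
    cases hab with
    | comm hx hy => simpa using hf hx hy⟩

theorem Env.lift_ι [LieSuperalgebra k L] {B : Type*} [Ring B] [Algebra k B] (f : L →ₗ[k] B)
    (hf) (x : L) : Env.lift k L f hf (Env.ι k L x) = f x :=
  (RingQuot.liftAlgHom_mkAlgHom_apply k _ _ _).trans (TensorAlgebra.lift_ι_apply f x)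

variable [RestrictedLieSuperalgebra k p L]

/-- The relations `x ^ p = x^[p]`, `x` even. -/
inductive PRel : Env k L → Env k L → Prop
  | pow (x : (LieSuperalgebra.grading (k := k) (L := L)).gr 0) :
      PRel (Env.ι k L (x : L) ^ p)
        (Env.ι k L (RestrictedLieSuperalgebra.pmap (p := p) x : L))

/-- The restricted enveloping superalgebra `U'(L)`. -/
def REnv : Type _ := RingQuot (PRel k p L)

instance : Ring (REnv k p L) := inferInstanceAs (Ring (RingQuot (PRel k p L)))

instance : Algebra k (REnv k p L) := inferInstanceAs (Algebra k (RingQuot (PRel k p L)))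

namespace REnv

/-- The quotient map `U(L) → U'(L)`. -/
def mk : Env k L →ₐ[k] REnv k p L := RingQuot.mkAlgHom k (PRel k p L)

/-- The canonical map `L → U'(L)`. -/
def ι : L →ₗ[k] REnv k p L := (mk k p L).toLinearMap ∘ₗ Env.ι k L

variable {L}

theorem ι_comm {i j : ZMod 2} {x y : L}
    (hx : x ∈ (LieSuperalgebra.grading (k := k) (L := L)).gr i)
    (hy : y ∈ (LieSuperalgebra.grading (k := k) (L := L)).gr j) :
    ι k p L x * ι k p L y = sgn k (i * j) • (ι k p L y * ι k p L x) +
      ι k p L (LieSuperalgebra.br (k := k) x y) := by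
  have h := congrArg (mk k p L) (Env.ι_comm k L hx hy)
  rw [map_mul, map_add, map_smul, map_mul] at h
  exact h

theorem ι_pow (x : (LieSuperalgebra.grading (k := k) (L := L)).gr 0) :
    ι k p L (x : L) ^ p = ι k p L (RestrictedLieSuperalgebra.pmap (p := p) x : L) := by
  have h : mk k p L _ = mk k p L _ := RingQuot.mkAlgHom_rel k (PRel.pow (p := p) x)
  rw [map_pow] at h
  exact h

variable {k p} {B : Type*} [Ring B] [Algebra k B]

/-- The universal property of `U'(L)`. -/
def lift (f : L →ₗ[k] B)
    (hf : ∀ {i j : ZMod 2} {x y : L}, x ∈ (LieSuperalgebra.grading (k := k) (L := L)).gr i →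
      y ∈ (LieSuperalgebra.grading (k := k) (L := L)).gr j →
      f x * f y = sgn k (i * j) • (f y * f x) + f (LieSuperalgebra.br (k := k) x y))
    (hp : ∀ x : (LieSuperalgebra.grading (k := k) (L := L)).gr 0,
      f (x : L) ^ p = f (RestrictedLieSuperalgebra.pmap (p := p) x : L)) :
    REnv k p L →ₐ[k] B :=
  RingQuot.liftAlgHom k ⟨Env.lift k L f hf, by
    intro a b hab
    cases hab with
    | pow x => rw [map_pow, Env.lift_ι, Env.lift_ι]; exact hp x⟩

@[simp]
theorem lift_ι (f : L →ₗ[k] B) (hf hp) (x : L) :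
    lift (p := p) f hf hp (ι k p L x) = f x := by
  exact (RingQuot.liftAlgHom_mkAlgHom_apply k _ _ _).trans (Env.lift_ι k L f hf x)

theorem algHom_ext {f g : REnv k p L →ₐ[k] B} (h : ∀ x : L, f (ι k p L x) = g (ι k p L x)) :
    f = g := by
  apply RingQuot.ringQuot_ext'
  apply RingQuot.ringQuot_ext'
  apply TensorAlgebra.hom_ext
  ext x
  exact h x

theorem adjoin_ι : Algebra.adjoin k (Set.range (ι k p L)) = ⊤ := by
  have hmem : ∀ x : L, ι k p L x ∈ Algebra.adjoin k (Set.range (ι k p L)) :=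
    fun x => Algebra.subset_adjoin ⟨x, rfl⟩
  let f : L →ₗ[k] Algebra.adjoin k (Set.range (ι k p L)) :=
    LinearMap.codRestrict
      (Subalgebra.toSubmodule (Algebra.adjoin k (Set.range (ι k p L)))) (ι k p L) hmem
  let F : REnv k p L →ₐ[k] Algebra.adjoin k (Set.range (ι k p L)) :=
    lift f (fun hx hy => Subtype.ext (ι_comm k p hx hy)) (fun x => Subtype.ext (ι_pow k p x))
  have hF : (Subalgebra.val _).comp F = AlgHom.id k _ := by
    apply algHom_ext
    intro x
    have : F (ι k p L x) = f x := lift_ι _ _ _ x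
    rw [AlgHom.comp_apply, this]
    rfl
  rw [eq_top_iff]
  intro u _
  have := congrArg (fun φ => φ u) hF
  have h2 : ((F u : Algebra.adjoin k (Set.range (ι k p L))) : REnv k p L) = u := this
  exact h2 ▸ (F u).2

/-- Induction on elements of `U'(L)`. -/
theorem induction {P : REnv k p L → Prop} (hscalar : ∀ c : k, P (algebraMap k _ c))
    (hadd : ∀ u w, P u → P w → P (u + w)) (hmul : ∀ u w, P u → P w → P (u * w))
    (hι : ∀ x : L, P (ι k p L x)) (u : REnv k p L) : P u := by
  have hu : u ∈ Algebra.adjoin k (Set.range (ι k p L)) := by rw [adjoin_ι]; trivial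
  induction hu using Algebra.adjoin_induction with
  | mem x hx => obtain ⟨y, rfl⟩ := hx; exact hι y
  | algebraMap c => exact hscalar c
  | add x y _ _ hx hy => exact hadd _ _ hx hy
  | mul x y _ _ hx hy => exact hmul _ _ hx hy

/-- The parity automorphism of `U'(L)`. -/
def parity : REnv k p L →ₐ[k] REnv k p L :=
  lift (ι k p L ∘ₗ (LieSuperalgebra.grading (k := k) (L := L)).flip)
    (by
      intro i j x y hx hy
      have hb := LieSuperalgebra.br_mem (k := k) (L := L) hx hy
      simp only [LinearMap.comp_apply, SuperGrading.flip_of_mem _ hx,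
        SuperGrading.flip_of_mem _ hy, SuperGrading.flip_of_mem _ hb, map_smul, smul_mul_assoc,
        mul_smul_comm, ι_comm k p hx hy, smul_add, smul_smul, sgn_add]
      rw [mul_comm (sgn k j) (sgn k i), mul_left_comm (sgn k j), mul_comm (sgn k j),
        mul_left_comm (sgn k i), mul_comm (sgn k i)])
    (by
      intro x
      simp only [LinearMap.comp_apply, SuperGrading.flip_of_mem _ x.2,
        SuperGrading.flip_of_mem _ (RestrictedLieSuperalgebra.pmap (p := p) x).2, sgn_zero,
        one_smul]
      exact ι_pow k p x)

theorem parity_ι {i : ZMod 2} {x : L}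
    (hx : x ∈ (LieSuperalgebra.grading (k := k) (L := L)).gr i) :
    parity (ι k p L x) = sgn k i • ι k p L x := by
  rw [parity, lift_ι, LinearMap.comp_apply, SuperGrading.flip_of_mem _ hx, map_smul]

theorem parity_parity (u : REnv k p L) : parity (parity u) = u := by
  have : (parity (k := k) (p := p) (L := L)).comp parity = AlgHom.id k _ := by
    apply algHom_ext
    intro x
    induction x using (LieSuperalgebra.grading (k := k) (L := L)).induction with
    | hadd v w hv hw => simp only [map_add, hv, hw]
    | hom i v hv =>
      simp only [AlgHom.comp_apply, parity_ι hv, map_smul, smul_smul, sgn_mul_self, one_smul,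
        AlgHom.id_apply]
  exact congrArg (fun φ => φ u) this

variable (k p L)

/-- The component of parity `i` of `U'(L)`, an eigenspace of the parity automorphism. -/
def gr (i : ZMod 2) : Submodule k (REnv k p L) where
  carrier := {u | parity u = sgn k i • u}
  add_mem' hu hw := by
    simp only [Set.mem_ofPred_eq] at *; rw [map_add, hu, hw, smul_add]
  zero_mem' := by simp
  smul_mem' c u hu := by
    simp only [Set.mem_ofPred_eq] at *; rw [map_smul, hu, smul_comm]

variable {k p L}

theorem mem_gr {i : ZMod 2} {u : REnv k p L} : u ∈ gr k p L i ↔ parity u = sgn k i • u := Iff.rfl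

theorem ι_mem_gr {i : ZMod 2} {x : L}
    (hx : x ∈ (LieSuperalgebra.grading (k := k) (L := L)).gr i) : ι k p L x ∈ gr k p L i :=
  parity_ι hx

variable [CharP k p] [Fact (2 < p)]

/-- The superspace structure of `U'(L)`. -/
def grading : SuperGrading k (REnv k p L) where
  gr := gr k p L
  isCompl := by
    have h2 := two_ne k p
    constructor
    · rw [Submodule.disjoint_def]
      intro u h0 h1
      rw [mem_gr, sgn_zero, one_smul] at h0
      rw [mem_gr, sgn_one, neg_one_smul, h0] at h1
      have : (2 : k) • u = 0 := by rw [two_smul]; nth_rewrite 1 [h1]; simp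
      exact (smul_eq_zero.1 this).resolve_left h2
    · rw [codisjoint_iff, Submodule.eq_top_iff']
      intro u
      rw [Submodule.mem_sup]
      refine ⟨(2 : k)⁻¹ • (u + parity u), ?_, (2 : k)⁻¹ • (u - parity u), ?_, ?_⟩
      · rw [mem_gr, map_smul, map_add, parity_parity, sgn_zero, one_smul, add_comm]
      · rw [mem_gr, map_smul, map_sub, parity_parity, sgn_one, neg_one_smul, ← smul_neg, neg_sub]
      · rw [← smul_add, add_add_sub_cancel, ← two_smul k, smul_smul, inv_mul_cancel₀ h2, one_smul]

instance : SetLike.GradedMonoid (gr k p L) where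
  one_mem := by rw [mem_gr, map_one, sgn_zero, one_smul]
  mul_mem i j u w hu hw := by
    rw [mem_gr] at *
    rw [map_mul, hu, hw, smul_mul_smul_comm, sgn_add]

instance : DirectSum.Decomposition (gr k p L) :=
  DirectSum.Decomposition.ofLinearMap _
    (DirectSum.lof k (ZMod 2) (fun i => gr k p L i) 0 ∘ₗ
        LinearMap.codRestrict _ (grading.proj 0) (grading.proj_mem 0) +
      DirectSum.lof k (ZMod 2) (fun i => gr k p L i) 1 ∘ₗ
        LinearMap.codRestrict _ (grading.proj 1) (grading.proj_mem 1))
    (by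
      ext u
      simp only [LinearMap.comp_apply, LinearMap.add_apply, map_add, DirectSum.coeLinearMap_lof]
      exact grading.proj_add u)
    (by
      apply DirectSum.linearMap_ext
      intro i
      ext1 u
      have hu : (u : REnv k p L) ∈ grading.gr i := u.2
      have e0 : LinearMap.codRestrict (gr k p L 0) (grading.proj 0) (grading.proj_mem 0)
          (u : REnv k p L) = ⟨_, grading.proj_mem 0 u⟩ := rfl
      have e1 : LinearMap.codRestrict (gr k p L 1) (grading.proj 1) (grading.proj_mem 1)
          (u : REnv k p L) = ⟨_, grading.proj_mem 1 u⟩ := rfl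
      simp only [LinearMap.comp_apply, LinearMap.add_apply, DirectSum.coeLinearMap_lof, e0, e1,
        LinearMap.id_apply]
      rcases zmod2_cases i with rfl | rfl
      · have h1 : (⟨_, grading.proj_mem 1 u⟩ : gr k p L 1) = 0 :=
          Subtype.ext (grading.proj_of_mem_ne (by decide) hu)
        have h0 : (⟨_, grading.proj_mem 0 u⟩ : gr k p L 0) = u :=
          Subtype.ext (grading.proj_of_mem hu)
        rw [h1, h0, map_zero, add_zero]
      · have h1 : (⟨_, grading.proj_mem 0 u⟩ : gr k p L 0) = 0 :=
          Subtype.ext (grading.proj_of_mem_ne (by decide) hu)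
        have h0 : (⟨_, grading.proj_mem 1 u⟩ : gr k p L 1) = u :=
          Subtype.ext (grading.proj_of_mem hu)
        rw [h1, h0, map_zero, zero_add])

instance : GradedAlgebra (gr k p L) where

end REnv

end Env

/-! ### Restricted representations -/

/-- A restricted representation of `L` on the superspace `V`. -/
@[ext]
structure RestrictedRep (k : Type*) (p : ℕ) (L V : Type*) [Field k] [AddCommGroup L] [Module k L]
    [RestrictedLieSuperalgebra k p L] [AddCommGroup V] [Module k V] where
  grading : SuperGrading k V
  ρ : L →ₗ[k] Module.End k V
  map_mem : ∀ {i j : ZMod 2} {x : L} {v : V},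
    x ∈ (LieSuperalgebra.grading (k := k) (L := L)).gr i → v ∈ grading.gr j →
      ρ x v ∈ grading.gr (i + j)
  map_br : ∀ {i j : ZMod 2} {x y : L}, x ∈ (LieSuperalgebra.grading (k := k) (L := L)).gr i →
    y ∈ (LieSuperalgebra.grading (k := k) (L := L)).gr j →
      ρ (LieSuperalgebra.br (k := k) x y) = ρ x * ρ y - sgn k (i * j) • (ρ y * ρ x)
  map_pmap : ∀ x : (LieSuperalgebra.grading (k := k) (L := L)).gr 0,
    ρ (RestrictedLieSuperalgebra.pmap (p := p) x : L) = ρ (x : L) ^ p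

/-- A character of `U'(L)`, given by its values on `L`. -/
@[ext]
structure RestrictedCharacter (k : Type*) (p : ℕ) (L : Type*) [Field k] [AddCommGroup L]
    [Module k L] [RestrictedLieSuperalgebra k p L] where
  χ : L →ₗ[k] k
  map_odd : ∀ {x : L}, x ∈ (LieSuperalgebra.grading (k := k) (L := L)).gr 1 → χ x = 0
  map_br : ∀ x y : L, χ (LieSuperalgebra.br (k := k) x y) = 0
  map_pmap : ∀ x : (LieSuperalgebra.grading (k := k) (L := L)).gr 0,
    χ (RestrictedLieSuperalgebra.pmap (p := p) x : L) = χ (x : L) ^ p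

/-- The superspace `Π^q V`. -/
def SuperGrading.shift {k V : Type*} [Field k] [AddCommGroup V] [Module k V]
    (S : SuperGrading k V) (q : ZMod 2) : SuperGrading k V where
  gr i := S.gr (i + q)
  isCompl := by
    rcases zmod2_cases q with rfl | rfl
    · simpa using S.isCompl
    · simpa [one_add_one_zmod2] using S.isCompl.symm

/-- The field `k` as an even superspace. -/
def SuperGrading.trivial (k : Type*) [Field k] : SuperGrading k k where
  gr i := if i = 0 then ⊤ else ⊥
  isCompl := by simpa using isCompl_top_bot

/-- The quotient of a superspace by a graded subspace. -/
def SuperGrading.quot {k V : Type*} [Field k] [AddCommGroup V] [Module k V]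
    (S : SuperGrading k V) (W : Submodule k V) (hW : ∀ i, ∀ v ∈ W, S.proj i v ∈ W) :
    SuperGrading k (V ⧸ W) where
  gr i := (S.gr i).map W.mkQ
  isCompl := by
    constructor
    · rw [Submodule.disjoint_def]
      rintro _ ⟨v, hv, rfl⟩ ⟨w, hw, hvw⟩
      rw [Submodule.mkQ_apply, Submodule.mkQ_apply, Submodule.Quotient.eq] at hvw
      have := hW 0 _ hvw
      rw [map_sub, S.proj_of_mem_ne (by decide) hw, S.proj_of_mem hv, zero_sub] at this
      rw [Submodule.mkQ_apply, Submodule.Quotient.mk_eq_zero]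
      simpa using this
    · rw [codisjoint_iff, ← Submodule.map_sup, codisjoint_iff.1 S.isCompl.codisjoint,
        Submodule.map_top, Submodule.range_mkQ]

/-- The dual superspace: `(V^*)_i` consists of the linear forms that vanish on `V_{i+1}`. -/
def SuperGrading.dual {k V : Type*} [Field k] [AddCommGroup V] [Module k V]
    (S : SuperGrading k V) : SuperGrading k (Module.Dual k V) where
  gr i := (S.gr (i + 1)).dualAnnihilator
  isCompl := by
    have := Subspace.isCompl_dualAnnihilator S.isCompl.symm
    simpa [one_add_one_zmod2] using this

/-- In characteristic `p`, the trace commutes with `p`-th powers. -/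
theorem trace_pow_char {k : Type*} [Field k] (p : ℕ) [Fact p.Prime] [CharP k p] {M : Type*}
    [AddCommGroup M] [Module k M] [FiniteDimensional k M] (f : Module.End k M) :
    LinearMap.trace k M (f ^ p) = LinearMap.trace k M f ^ p := by
  classical
  have hp : p.Prime := Fact.out
  have key : ∀ {n : Type} [Fintype n] [DecidableEq n] (A : Matrix n n k),
      Matrix.trace (A ^ p) = Matrix.trace A ^ p := by
    intro n _ _ A
    cases isEmpty_or_nonempty n
    · simp [Matrix.trace, hp.ne_zero]
    have h1 : A.charpoly ^ p = Polynomial.expand k p (A ^ p).charpoly := by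
      unfold Matrix.charpoly
      rw [AlgHom.map_det, ← Matrix.coe_detMonoidHom, ← map_pow]
      apply congrArg
      refine matPolyEquiv.injective ?_
      rw [map_pow, Matrix.matPolyEquiv_charmatrix, sub_pow_char_of_commute,
        ← Polynomial.C_pow]
      · exact (matPolyEquiv_eq_X_pow_sub_C p A).symm
      · exact (Polynomial.C A).commute_X
    have h2 : A.charpoly ^ p = Polynomial.expand k p (A.charpoly.map (frobenius k p)) := by
      rw [← Polynomial.map_frobenius_expand, Polynomial.map_expand]
    have h3 : (A ^ p).charpoly = A.charpoly.map (frobenius k p) :=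
      Polynomial.expand_injective hp.pos (h1.symm.trans h2)
    rw [Matrix.trace_eq_neg_charpoly_coeff, Matrix.trace_eq_neg_charpoly_coeff, h3,
      Polynomial.coeff_map, frobenius_def]
    rcases hp.eq_two_or_odd' with rfl | hodd
    · have h2 : (2 : k) = 0 := by exact_mod_cast CharP.cast_eq_zero k 2
      have hneg : ∀ a : k, -a = a := fun a => by
        have : a + a = 0 := by rw [← two_mul, h2, zero_mul]
        exact neg_eq_of_add_eq_zero_left this
      simp only [hneg]
    · rw [hodd.neg_pow]
  let b := Module.finBasis k M
  rw [LinearMap.trace_eq_matrix_trace k b, LinearMap.trace_eq_matrix_trace k b,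
    ← LinearMap.toMatrix_pow, key]

section Rep

variable {k : Type*} {p : ℕ} {L V M : Type*} [Field k] [AddCommGroup L] [Module k L]
  [RestrictedLieSuperalgebra k p L] [AddCommGroup V] [Module k V] [AddCommGroup M] [Module k M]

namespace RestrictedRep

/-- The action of `U'(L)`. -/
def toAlgHom (σ : RestrictedRep k p L V) : REnv k p L →ₐ[k] Module.End k V :=
  REnv.lift σ.ρ (fun hx hy => by rw [σ.map_br hx hy]; abel) (fun x => (σ.map_pmap x).symm)

@[simp]
theorem toAlgHom_ι (σ : RestrictedRep k p L V) (x : L) : σ.toAlgHom (REnv.ι k p L x) = σ.ρ x :=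
  REnv.lift_ι _ _ _ x

variable (k p L) in
/-- The trivial representation `k`. -/
def trivial [Fact p.Prime] : RestrictedRep k p L k where
  grading := SuperGrading.trivial k
  ρ := 0
  map_mem _ _ := by simp
  map_br _ _ := by simp
  map_pmap _ := by simp [(Fact.out : p.Prime).ne_zero]

/-- `σ ⊗ Π^q k_χ` on the space of `σ`, the vector `v` standing for `v ⊗ 1`. -/
def twist [Fact p.Prime] [CharP k p] (σ : RestrictedRep k p L V) (χ : RestrictedCharacter k p L)
    (q : ZMod 2) : RestrictedRep k p L V where
  grading := σ.grading.shift q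
  ρ := σ.ρ + χ.χ.smulRight (1 : Module.End k V)
  map_mem {i j x v} hx hv := by
    have h1 : σ.ρ x v ∈ (σ.grading.shift q).gr (i + j) := by
      have := σ.map_mem hx hv
      rwa [← add_assoc] at this
    refine Submodule.add_mem _ h1 ?_
    rcases zmod2_cases i with rfl | rfl
    · rw [zero_add]; exact Submodule.smul_mem _ _ hv
    · simp [χ.map_odd hx]
  map_br {i j x y} hx hy := by
    simp only [LinearMap.add_apply, LinearMap.smulRight_apply, χ.map_br, zero_smul, add_zero,
      σ.map_br hx hy, mul_add, add_mul, smul_mul_assoc, mul_smul_comm, mul_one, one_mul, smul_add]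
    rcases zmod2_cases i with rfl | rfl
    · simp only [zero_mul, sgn_zero, one_smul, smul_smul]
      module
    · rcases zmod2_cases j with rfl | rfl
      · simp only [mul_zero, sgn_zero, one_smul, smul_smul]
        module
      · simp [χ.map_odd hx, χ.map_odd hy]
  map_pmap x := by
    have hc : Commute (σ.ρ (x : L)) (χ.χ (x : L) • (1 : Module.End k V)) :=
      (Commute.one_right _).smul_right _
    have : CharP (Module.End k V) p ∨ Subsingleton (Module.End k V) := by
      rcases subsingleton_or_nontrivial V with hV | hV
      · right; infer_instance
      · left; exact charP_of_injective_algebraMap (algebraMap k _).injective p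
    rcases this with hch | hs
    · simp only [LinearMap.add_apply, LinearMap.smulRight_apply, χ.map_pmap, σ.map_pmap]
      rw [add_pow_char_of_commute _ hc, smul_pow, one_pow]
    · exact Subsingleton.elim _ _

theorem flip_ρ (σ : RestrictedRep k p L V) {i : ZMod 2} {x : L}
    (hx : x ∈ (LieSuperalgebra.grading (k := k) (L := L)).gr i) (v : V) :
    σ.grading.flip (σ.ρ x v) = sgn k i • σ.ρ x (σ.grading.flip v) := by
  induction v using σ.grading.induction with
  | hadd v w hv hw => simp only [map_add, hv, hw, smul_add]
  | hom j v hv =>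
    rw [σ.grading.flip_of_mem (σ.map_mem hx hv), σ.grading.flip_of_mem hv, map_smul, sgn_add,
      smul_smul]

theorem flip_mul (σ : RestrictedRep k p L V) {i : ZMod 2} {x : L}
    (hx : x ∈ (LieSuperalgebra.grading (k := k) (L := L)).gr i) :
    (σ.grading.flip : Module.End k V) * σ.ρ x =
      sgn k i • (σ.ρ x * (σ.grading.flip : Module.End k V)) := by
  ext v; exact σ.flip_ρ hx v

/-- The contragredient action `(x f)(v) = -(-1)^{|x||f|} f(x v)`. As `f (x v)` vanishes
unless `|f| = |x v|`, the sign is `-1` if `x` is even, and `-(-1)^{|x v|}` if `x` is odd. -/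
def dualρ (σ : RestrictedRep k p L V) : L →ₗ[k] Module.End k (Module.Dual k V) :=
  LinearMap.mk₂ k (fun x f => -(f ∘ₗ σ.ρ ((LieSuperalgebra.grading (k := k) (L := L)).proj 0 x)
      + f ∘ₗ σ.grading.flip ∘ₗ σ.ρ ((LieSuperalgebra.grading (k := k) (L := L)).proj 1 x)))
    (by intros; ext; simp; abel) (by intros; ext; simp)
    (by intros; ext; simp; abel) (by intros; ext; simp)

theorem dualρ_even (σ : RestrictedRep k p L V) {x : L}
    (hx : x ∈ (LieSuperalgebra.grading (k := k) (L := L)).gr 0) (f : Module.Dual k V) (v : V) :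
    σ.dualρ x f v = -f (σ.ρ x v) := by
  simp [dualρ, SuperGrading.proj_of_mem _ hx,
    SuperGrading.proj_of_mem_ne _ (show (0 : ZMod 2) ≠ 1 by decide) hx]

theorem dualρ_odd (σ : RestrictedRep k p L V) {x : L}
    (hx : x ∈ (LieSuperalgebra.grading (k := k) (L := L)).gr 1) (f : Module.Dual k V) (v : V) :
    σ.dualρ x f v = -f (σ.grading.flip (σ.ρ x v)) := by
  simp [dualρ, SuperGrading.proj_of_mem _ hx,
    SuperGrading.proj_of_mem_ne _ (show (1 : ZMod 2) ≠ 0 by decide) hx]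

/-- The sign rule that defines the contragredient action. -/
theorem dualρ_apply (σ : RestrictedRep k p L V) {i j : ZMod 2} {x : L}
    (hx : x ∈ (LieSuperalgebra.grading (k := k) (L := L)).gr i) {f : Module.Dual k V}
    (hf : f ∈ σ.grading.dual.gr j) (v : V) :
    σ.dualρ x f v = -(sgn k (i * j) * f (σ.ρ x v)) := by
  have hf' : ∀ w : V, f (σ.grading.flip w) = sgn k j * f w := by
    intro w
    induction w using σ.grading.induction with
    | hadd v w hv hw => simp only [map_add, hv, hw, mul_add]
    | hom l w hw =>
      rw [σ.grading.flip_of_mem hw, map_smul, smul_eq_mul]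
      by_cases hl : l = j
      · rw [hl]
      · have hlj : ∀ a b : ZMod 2, ¬a = b → a = b + 1 := by decide
        rw [hlj l j hl] at hw
        rw [(Submodule.mem_dualAnnihilator f).1 hf w hw, mul_zero, mul_zero]
  rcases zmod2_cases i with rfl | rfl
  · rw [σ.dualρ_even hx, zero_mul, sgn_zero, one_mul]
  · rw [σ.dualρ_odd hx, hf', one_mul]

/-- The contragredient representation. -/
def dual [Fact (2 < p)] [Fact p.Prime] (σ : RestrictedRep k p L V) :
    RestrictedRep k p L (Module.Dual k V) where
  grading := σ.grading.dual
  ρ := σ.dualρ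
  map_mem {i j x f} hx hf := by
    refine (Submodule.mem_dualAnnihilator _).2 fun v hv => ?_
    rw [σ.dualρ_apply hx hf, (Submodule.mem_dualAnnihilator f).1 hf, mul_zero, neg_zero]
    have := σ.map_mem hx hv
    have e : ∀ a b : ZMod 2, a + (a + b + 1) = b + 1 := by decide
    rwa [e] at this
  map_br {i j x y} hx hy := by
    have hb := LieSuperalgebra.br_mem (k := k) (L := L) hx hy
    ext f v
    have hyx := σ.flip_ρ hy (σ.grading.flip (σ.ρ x v))
    have hxy := σ.flip_ρ hx (σ.grading.flip (σ.ρ y v))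
    rw [σ.grading.flip_flip] at hyx hxy
    have hbr := congrArg (fun φ => φ v) (σ.map_br hx hy)
    simp only [LinearMap.sub_apply, LinearMap.smul_apply, Module.End.mul_apply] at hbr ⊢
    rcases zmod2_cases i with rfl | rfl <;> rcases zmod2_cases j with rfl | rfl <;>
    simp only [mul_zero, add_zero, zero_add, one_add_one_zmod2, mul_one, sgn_zero,
      sgn_one, one_smul, neg_smul] at hb hbr ⊢
    · rw [σ.dualρ_even hb, σ.dualρ_even hx, σ.dualρ_even hy, σ.dualρ_even hy, σ.dualρ_even hx,
        hbr, map_sub]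
      ring
    · rw [σ.dualρ_odd hb, σ.dualρ_even hx, σ.dualρ_odd hy, σ.dualρ_odd hy, σ.dualρ_even hx,
        hbr, map_sub, map_sub, σ.flip_ρ hx, sgn_zero, one_smul]
      ring
    · rw [σ.dualρ_odd hb, σ.dualρ_odd hx, σ.dualρ_even hy, σ.dualρ_even hy, σ.dualρ_odd hx,
        hbr, map_sub, map_sub, σ.flip_ρ hy, sgn_zero, one_smul]
      ring
    · rw [σ.dualρ_even hb, σ.dualρ_odd hx, σ.dualρ_odd hy, σ.dualρ_odd hy, σ.dualρ_odd hx,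
        hbr, hyx, hxy]
      simp only [map_neg, map_sub, neg_smul, one_smul, sgn_one]
      ring
  map_pmap x := by
    have hodd : Odd p := (Fact.out : p.Prime).odd_of_ne_two (Fact.out : 2 < p).ne'
    have key : ∀ (n : ℕ) (f : Module.Dual k V) (v : V),
        (σ.dualρ (x : L) ^ n) f v = (-1) ^ n * f ((σ.ρ (x : L) ^ n) v) := by
      intro n
      induction n with
      | zero => simp
      | succ n ih =>
        intro f v
        rw [pow_succ', Module.End.mul_apply, σ.dualρ_even x.2, ih, pow_succ (σ.ρ (x : L)),
          Module.End.mul_apply]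
        ring
    ext f v
    rw [σ.dualρ_even (RestrictedLieSuperalgebra.pmap (p := p) x).2, σ.map_pmap, key,
      hodd.neg_one_pow, neg_one_mul]

/-- The supertrace of the action on a finite dimensional representation: the trace on the even
part minus the trace on the odd part. -/
def str [Fact (2 < p)] [Fact p.Prime] [CharP k p] (σ : RestrictedRep k p L M)
    [FiniteDimensional k M] : RestrictedCharacter k p L where
  χ := LinearMap.trace k M ∘ₗ LinearMap.mulLeft k (σ.grading.flip : Module.End k M) ∘ₗ σ.ρ
  map_odd {x} hx := by
    have h := σ.flip_mul hx
    simp only [LinearMap.comp_apply, LinearMap.mulLeft_apply]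
    have h2 := LinearMap.trace_mul_comm k (σ.grading.flip : Module.End k M) (σ.ρ x)
    rw [h, sgn_one, neg_one_smul, map_neg] at h2 ⊢
    have : (2 : k) * LinearMap.trace k M (σ.ρ x * (σ.grading.flip : Module.End k M)) = 0 := by
      rw [two_mul]; nth_rewrite 1 [← h2]; ring
    rw [(mul_eq_zero.1 this).resolve_left (two_ne k p), neg_zero]
  map_br x y := by
    simp only [LinearMap.comp_apply, LinearMap.mulLeft_apply]
    induction x using (LieSuperalgebra.grading (k := k) (L := L)).induction with
    | hadd x x' hx hx' => simp only [map_add, LinearMap.add_apply, mul_add, hx, hx', add_zero]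
    | hom i x hx =>
      induction y using (LieSuperalgebra.grading (k := k) (L := L)).induction with
      | hadd y y' hy hy' => simp only [map_add, mul_add, hy, hy', add_zero]
      | hom j y hy =>
        rw [σ.map_br hx hy, mul_sub, map_sub, mul_smul_comm, map_smul]
        have e : LinearMap.trace k M ((σ.grading.flip : Module.End k M) * (σ.ρ y * σ.ρ x)) =
            sgn k j * LinearMap.trace k M
              ((σ.grading.flip : Module.End k M) * (σ.ρ x * σ.ρ y)) := by
          rw [← mul_assoc, σ.flip_mul hy, smul_mul_assoc, map_smul, smul_eq_mul, mul_assoc,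
            LinearMap.trace_mul_comm, mul_assoc]
        have e' : LinearMap.trace k M ((σ.grading.flip : Module.End k M) * (σ.ρ x * σ.ρ y)) =
            sgn k i * LinearMap.trace k M
              ((σ.grading.flip : Module.End k M) * (σ.ρ y * σ.ρ x)) := by
          rw [← mul_assoc, σ.flip_mul hx, smul_mul_assoc, map_smul, smul_eq_mul, mul_assoc,
            LinearMap.trace_mul_comm, mul_assoc]
        rw [smul_eq_mul]
        rcases zmod2_cases i with rfl | rfl <;> rcases zmod2_cases j with rfl | rfl <;>
        simp only [mul_zero, mul_one, sgn_zero, sgn_one, one_mul] at e e' ⊢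
        · linear_combination -e
        · linear_combination e'
        · linear_combination -e
        · linear_combination e
  map_pmap x := by
    have hodd : Odd p := (Fact.out : p.Prime).odd_of_ne_two (Fact.out : 2 < p).ne'
    simp only [LinearMap.comp_apply, LinearMap.mulLeft_apply]
    have hc : Commute (σ.grading.flip : Module.End k M) (σ.ρ (x : L)) := by
      have := σ.flip_mul x.2
      rwa [sgn_zero, one_smul] at this
    have hsq : (σ.grading.flip : Module.End k M) ^ 2 = 1 := by
      ext v; exact σ.grading.flip_flip v
    have hp : (σ.grading.flip : Module.End k M) ^ p = σ.grading.flip := by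
      obtain ⟨n, rfl⟩ := hodd
      rw [pow_succ, pow_mul, hsq, one_pow, one_mul]
    rw [σ.map_pmap, ← trace_pow_char p, hc.mul_pow, hp]

end RestrictedRep

/-- The opposite character. -/
def RestrictedCharacter.neg [Fact (2 < p)] [Fact p.Prime] (χ : RestrictedCharacter k p L) :
    RestrictedCharacter k p L where
  χ := -χ.χ
  map_odd hx := by simp [χ.map_odd hx]
  map_br x y := by simp [χ.map_br x y]
  map_pmap x := by
    have hodd : Odd p := (Fact.out : p.Prime).odd_of_ne_two (Fact.out : 2 < p).ne'
    simp [χ.map_pmap x, hodd.neg_pow]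

/-- The representation `ad_{L/h}` of `h` on `L/h`. -/
def RestrictedSub.adQuot (h : RestrictedSub k p L) : RestrictedRep k p h.carrier (L ⧸ h.carrier) where
  grading := (LieSuperalgebra.grading (k := k) (L := L)).quot h.carrier (fun i _ hv => h.proj_mem i hv)
  ρ :=
    { toFun := fun x => h.carrier.mapQ h.carrier (LieSuperalgebra.br (k := k) (x : L))
        (fun _ hy => h.br_mem x.2 hy)
      map_add' := by intros; ext; simp
      map_smul' := by intros; ext; simp }
  map_mem := by
    rintro i j x _ hx ⟨w, hw, rfl⟩
    exact ⟨_, LieSuperalgebra.br_mem (k := k) (L := L) hx hw, rfl⟩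
  map_br := by
    intro i j x y hx hy
    apply Submodule.linearMap_qext
    ext w
    have := LieSuperalgebra.br_jacobi (k := k) (L := L) w hx hy
    have e := congrArg h.carrier.mkQ this
    rw [map_add, map_smul] at e
    exact (sub_eq_of_eq_add e).symm
  map_pmap := by
    intro x
    apply Submodule.linearMap_qext
    ext w
    have := RestrictedLieSuperalgebra.ad_pmap (k := k) (p := p) (L := L) ⟨x.1.1, x.2⟩ w
    have e := congrArg h.carrier.mkQ this
    refine e.trans ?_
    have key : ∀ n : ℕ, h.carrier.mkQ ((LieSuperalgebra.br (k := k) (x.1 : L))^[n] w) =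
        ((h.carrier.mapQ h.carrier (LieSuperalgebra.br (k := k) (x.1 : L))
          (fun _ hy => h.br_mem x.1.2 hy) : Module.End k (L ⧸ h.carrier)) ^ n)
          (h.carrier.mkQ w) := by
      intro n
      induction n with
      | zero => rfl
      | succ n ih =>
        rw [Function.iterate_succ_apply', pow_succ', Module.End.mul_apply, ← ih]
        rfl
    exact key p

end Rep

/-! ### Coinduced representations -/

section Coind

open GradedTensorProduct

variable {k : Type*} {p : ℕ} {L : Type*} [Field k] [AddCommGroup L] [Module k L]
  [RestrictedLieSuperalgebra k p L]

/-- The algebra morphism `U'(h) → U'(L)` induced by the inclusion. -/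
def RestrictedSub.incl (h : RestrictedSub k p L) : REnv k p h.carrier →ₐ[k] REnv k p L :=
  REnv.lift (REnv.ι k p L ∘ₗ h.carrier.subtype)
    (fun {_ _ x y} hx hy => REnv.ι_comm k p (x := (x : L)) (y := (y : L)) hx hy)
    (fun x => REnv.ι_pow k p (L := L) ⟨x.1.1, x.2⟩)

theorem RestrictedSub.incl_ι (h : RestrictedSub k p L) (x : h.carrier) :
    h.incl (REnv.ι k p h.carrier x) = REnv.ι k p L (x : L) :=
  REnv.lift_ι _ _ _ x

section Modules

variable {V W Y : Type*} [AddCommGroup V] [Module k V] [AddCommGroup W] [Module k W]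
  [AddCommGroup Y] [Module k Y]

/-- The space `Hom_{U'(h)}(U'(L), V)` of the coinduced representation. A map `μ` is written on the
right of its argument, `⟨u, μ⟩ = μ u`, so that no signs occur in the definition. -/
def Coind (h : RestrictedSub k p L) (σ : RestrictedRep k p h.carrier V) :
    Submodule k (REnv k p L →ₗ[k] V) where
  carrier := {μ | ∀ (w : REnv k p h.carrier) (u : REnv k p L),
    μ (h.incl w * u) = σ.toAlgHom w (μ u)}
  add_mem' hμ hν w u := by simp [hμ w u, hν w u]
  zero_mem' w u := by simp
  smul_mem' c μ hμ w u := by simp [hμ w u]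

/-- It suffices to check equivariance on homogeneous elements of `h`. -/
theorem mem_coind {h : RestrictedSub k p L} {σ : RestrictedRep k p h.carrier V}
    {μ : REnv k p L →ₗ[k] V}
    (H : ∀ (i : ZMod 2), ∀ x ∈ (LieSuperalgebra.grading (k := k) (L := h.carrier)).gr i,
      ∀ u : REnv k p L, μ (REnv.ι k p L (x : L) * u) = σ.ρ x (μ u)) : μ ∈ Coind h σ := by
  intro w
  induction w using REnv.induction with
  | hscalar c =>
    intro u
    rw [AlgHom.commutes, AlgHom.commutes, ← Algebra.smul_def, map_smul]
    rfl
  | hadd u w hu hw => intro u'; simp [add_mul, hu, hw]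
  | hmul u w hu hw => intro u'; rw [map_mul h.incl, map_mul σ.toAlgHom, mul_assoc, hu, hw]; rfl
  | hι x =>
    induction x using (LieSuperalgebra.grading (k := k) (L := h.carrier)).induction with
    | hadd x y hx hy => intro u; simp only [map_add, add_mul, hx, hy, LinearMap.add_apply]
    | hom i x hx => intro u; rw [h.incl_ι, σ.toAlgHom_ι, H i x hx]

theorem coind_apply {h : RestrictedSub k p L} {σ : RestrictedRep k p h.carrier V}
    (μ : Coind h σ) (x : h.carrier) (u : REnv k p L) :
    μ.1 (REnv.ι k p L (x : L) * u) = σ.ρ x (μ.1 u) := by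
  have := μ.2 (REnv.ι k p h.carrier x) u
  rwa [h.incl_ι, σ.toAlgHom_ι] at this

/-- The action of `U'(L)` on the coinduced representation: `⟨w, u · μ⟩ = ⟨w u, μ⟩`. -/
def Coind.act {h : RestrictedSub k p L} {σ : RestrictedRep k p h.carrier V} (u : REnv k p L) :
    Coind h σ →ₗ[k] Coind h σ where
  toFun μ := ⟨μ.1 ∘ₗ LinearMap.mulRight k u, fun w v => by
    simp only [LinearMap.comp_apply, LinearMap.mulRight_apply]
    rw [mul_assoc, μ.2 w (v * u)]⟩
  map_add' _ _ := rfl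
  map_smul' _ _ := rfl

theorem charP_or_subsingleton (R : Type*) [Ring R] [Algebra k R] [CharP k p] :
    CharP R p ∨ Subsingleton R := by
  rcases subsingleton_or_nontrivial R with hR | hR
  · exact Or.inr hR
  · exact Or.inl (charP_of_injective_algebraMap (algebraMap k R).injective p)

theorem unit_smul_eq {N : Type*} [AddCommGroup N] [Module k N] (i : ZMod 2) (t : N) :
    ((-1 : ℤˣ) ^ i) • t = sgn k i • t := by
  rcases zmod2_cases i with rfl | rfl
  · simp [sgn_zero]
  · simp [sgn_one]

variable [CharP k p] [Fact (2 < p)]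

/-- The elements of parity `j` of the coinduced representation. -/
def Coind.gr (h : RestrictedSub k p L) (σ : RestrictedRep k p h.carrier V) (j : ZMod 2) :
    Submodule k (Coind h σ) where
  carrier := {μ | ∀ l, ∀ u ∈ REnv.gr k p L l, μ.1 u ∈ σ.grading.gr (j + l)}
  add_mem' hμ hν l u hu := Submodule.add_mem _ (hμ l u hu) (hν l u hu)
  zero_mem' _ _ _ := Submodule.zero_mem _
  smul_mem' c _ hμ l u hu := Submodule.smul_mem _ c (hμ l u hu)

theorem tmul_mul_tmul {i j : ZMod 2} (a : REnv k p L) {b : REnv k p L}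
    (hb : b ∈ REnv.gr k p L j) {a' : REnv k p L} (ha' : a' ∈ REnv.gr k p L i) (b' : REnv k p L) :
    (a ᵍ⊗ₜ[k] b * a' ᵍ⊗ₜ[k] b' : REnv.gr k p L ᵍ⊗[k] REnv.gr k p L) =
      sgn k (j * i) • ((a * a') ᵍ⊗ₜ[k] (b * b')) := by
  have := tmul_coe_mul_coe_tmul (R := k) (REnv.gr k p L) (REnv.gr k p L) a
    (⟨b, hb⟩ : REnv.gr k p L j) (⟨a', ha'⟩ : REnv.gr k p L i) b'
  rw [unit_smul_eq (k := k)] at this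
  exact this

variable (k p L) in
/-- The map `x ↦ x ⊗ 1 + 1 ⊗ x`. -/
def primitive : L →ₗ[k] (REnv.gr k p L ᵍ⊗[k] REnv.gr k p L) :=
  (includeLeft (REnv.gr k p L) (REnv.gr k p L)).toLinearMap ∘ₗ REnv.ι k p L +
    (includeRight (REnv.gr k p L) (REnv.gr k p L)).toLinearMap ∘ₗ REnv.ι k p L

theorem primitive_apply (x : L) :
    primitive k p L x = includeLeft (REnv.gr k p L) (REnv.gr k p L) (REnv.ι k p L x) +
      includeRight (REnv.gr k p L) (REnv.gr k p L) (REnv.ι k p L x) := rfl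

theorem includeRight_mul_includeLeft {i j : ZMod 2} {x y : L}
    (hx : x ∈ (LieSuperalgebra.grading (k := k) (L := L)).gr i)
    (hy : y ∈ (LieSuperalgebra.grading (k := k) (L := L)).gr j) :
    includeRight (REnv.gr k p L) (REnv.gr k p L) (REnv.ι k p L x) *
      includeLeft (REnv.gr k p L) (REnv.gr k p L) (REnv.ι k p L y) =
    sgn k (i * j) • (includeLeft (REnv.gr k p L) (REnv.gr k p L) (REnv.ι k p L y) *
      includeRight (REnv.gr k p L) (REnv.gr k p L) (REnv.ι k p L x)) := by
  have h1 := tmul_mul_tmul (1 : REnv k p L) (REnv.ι_mem_gr hx) (REnv.ι_mem_gr hy) 1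
  have h2 := tmul_one_mul_one_tmul (R := k) (𝒜 := REnv.gr k p L) (ℬ := REnv.gr k p L)
    (REnv.ι k p L y) (REnv.ι k p L x)
  rw [one_mul, mul_one, ← h2] at h1
  exact h1

/-- The parity automorphism `μ ↦ (-1)^{|μ|} μ` of `Hom(U'(L), V)`. -/
def homFlip (S : SuperGrading k V) (μ : REnv k p L →ₗ[k] V) : REnv k p L →ₗ[k] V :=
  S.flip ∘ₗ μ ∘ₗ REnv.parity.toLinearMap

/-- The map `u₁ ⊗ u₂ ↦ (-1)^{|μ| |u₂|} B (⟨u₁, μ⟩, ⟨u₂, ν⟩)`; the two summands correspond to the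
even and to the odd part of `u₂`. -/
def convTensor (S : SuperGrading k V) (B : V →ₗ[k] W →ₗ[k] Y) (μ : REnv k p L →ₗ[k] V)
    (ν : REnv k p L →ₗ[k] W) : (REnv.gr k p L ᵍ⊗[k] REnv.gr k p L) →ₗ[k] Y :=
  (TensorProduct.lift (B.compl₁₂ μ (ν ∘ₗ REnv.grading.proj 0)) +
    TensorProduct.lift (B.compl₁₂ (homFlip S μ) (ν ∘ₗ REnv.grading.proj 1))) ∘ₗ
  (GradedTensorProduct.of k (REnv.gr k p L) (REnv.gr k p L)).symm.toLinearMap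

theorem convTensor_even (S : SuperGrading k V) (B : V →ₗ[k] W →ₗ[k] Y) (μ : REnv k p L →ₗ[k] V)
    (ν : REnv k p L →ₗ[k] W) (a : REnv k p L) {b : REnv k p L} (hb : b ∈ REnv.gr k p L 0) :
    convTensor S B μ ν (a ᵍ⊗ₜ[k] b) = B (μ a) (ν b) := by
  have hb' : b ∈ REnv.grading.gr 0 := hb
  have e0 := REnv.grading.proj_of_mem hb'
  have e1 := REnv.grading.proj_of_mem_ne (show (0 : ZMod 2) ≠ 1 by decide) hb'
  have : convTensor S B μ ν (a ᵍ⊗ₜ[k] b) = B (μ a) (ν (REnv.grading.proj 0 b)) +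
    B (homFlip S μ a) (ν (REnv.grading.proj 1 b)) := rfl
  rw [this, e0, e1, map_zero, map_zero, add_zero]

theorem convTensor_odd (S : SuperGrading k V) (B : V →ₗ[k] W →ₗ[k] Y) (μ : REnv k p L →ₗ[k] V)
    (ν : REnv k p L →ₗ[k] W) (a : REnv k p L) {b : REnv k p L} (hb : b ∈ REnv.gr k p L 1) :
    convTensor S B μ ν (a ᵍ⊗ₜ[k] b) = B (S.flip (μ (REnv.parity a))) (ν b) := by
  have hb' : b ∈ REnv.grading.gr 1 := hb
  have e0 := REnv.grading.proj_of_mem hb'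
  have e1 := REnv.grading.proj_of_mem_ne (show (1 : ZMod 2) ≠ 0 by decide) hb'
  have : convTensor S B μ ν (a ᵍ⊗ₜ[k] b) = B (μ a) (ν (REnv.grading.proj 0 b)) +
    B (homFlip S μ a) (ν (REnv.grading.proj 1 b)) := rfl
  rw [this, e0, e1, map_zero, map_zero, zero_add]
  rfl

variable [Fact p.Prime]

variable (k p L) in
/-- The coproduct of the Hopf superalgebra `U'(L)`. -/
def coproduct : REnv k p L →ₐ[k] (REnv.gr k p L ᵍ⊗[k] REnv.gr k p L) :=
  REnv.lift (primitive k p L)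
    (by
      intro i j x y hx hy
      have hs : sgn k (j * i) = sgn k (i * j) := by rw [mul_comm]
      simp only [primitive_apply, add_mul, mul_add, ← map_mul, REnv.ι_comm k p hx hy,
        includeRight_mul_includeLeft hx hy, includeRight_mul_includeLeft hy hx, hs,
        map_add, map_smul, smul_add, smul_smul, sgn_mul_self, one_smul]
      abel)
    (by
      intro x
      have hc : Commute (includeLeft (REnv.gr k p L) (REnv.gr k p L) (REnv.ι k p L (x : L)))
          (includeRight (REnv.gr k p L) (REnv.gr k p L) (REnv.ι k p L (x : L))) := by
        have := includeRight_mul_includeLeft (p := p) x.2 x.2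
        rw [mul_zero, sgn_zero, one_smul] at this
        exact this.symm
      rcases charP_or_subsingleton (k := k) (p := p) (REnv.gr k p L ᵍ⊗[k] REnv.gr k p L) with
        hR | hR
      · rw [primitive_apply, primitive_apply, add_pow_char_of_commute _ hc, ← map_pow (includeLeft _ _),
          ← map_pow (includeRight _ _), REnv.ι_pow]
      · exact Subsingleton.elim _ _)

theorem coproduct_ι (x : L) : coproduct k p L (REnv.ι k p L x) = primitive k p L x :=
  REnv.lift_ι _ _ _ x

/-- The convolution of `μ : U'(L) → V` and `ν : U'(L) → W` along `B : V × W → Y`,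
`⟨u, μ * ν⟩ = ∑ (-1)^{|μ| |u₂|} B (⟨u₁, μ⟩, ⟨u₂, ν⟩)`. -/
def conv (S : SuperGrading k V) (B : V →ₗ[k] W →ₗ[k] Y) (μ : REnv k p L →ₗ[k] V)
    (ν : REnv k p L →ₗ[k] W) : REnv k p L →ₗ[k] Y :=
  convTensor S B μ ν ∘ₗ (coproduct k p L).toLinearMap

theorem conv_mem {h : RestrictedSub k p L} {σ : RestrictedRep k p h.carrier V}
    {τ : RestrictedRep k p h.carrier W} {υ : RestrictedRep k p h.carrier Y}
    (B : V →ₗ[k] W →ₗ[k] Y)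
    (hB0 : ∀ x ∈ (LieSuperalgebra.grading (k := k) (L := h.carrier)).gr 0, ∀ v w,
      υ.ρ x (B v w) = B (σ.ρ x v) w + B v (τ.ρ x w))
    (hB1 : ∀ x ∈ (LieSuperalgebra.grading (k := k) (L := h.carrier)).gr 1, ∀ v w,
      υ.ρ x (B v w) = B (σ.ρ x v) w + B (σ.grading.flip v) (τ.ρ x w))
    (μ : Coind h σ) (ν : Coind h τ) : conv σ.grading B μ.1 ν.1 ∈ Coind h υ := by
  apply mem_coind
  intro i x hx u
  have hxL : (x : L) ∈ (LieSuperalgebra.grading (k := k) (L := L)).gr i := hx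
  have key : ∀ t : REnv.gr k p L ᵍ⊗[k] REnv.gr k p L,
      convTensor σ.grading B μ.1 ν.1 (primitive k p L (x : L) * t) =
        υ.ρ x (convTensor σ.grading B μ.1 ν.1 t) := by
    intro t
    have ht : ∃ s : REnv k p L ⊗[k] REnv k p L,
        GradedTensorProduct.of k (REnv.gr k p L) (REnv.gr k p L) s = t := ⟨_, rfl⟩
    obtain ⟨s, rfl⟩ := ht
    induction s using TensorProduct.induction_on with
    | zero => simp
    | add s t hs ht => simp only [map_add, mul_add, hs, ht]
    | tmul a b =>
      induction a using (REnv.grading (k := k) (p := p) (L := L)).induction with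
      | hadd a a' ha ha' =>
        rw [TensorProduct.add_tmul]; simp only [map_add, mul_add, ha, ha']
      | hom l a ha =>
        induction b using (REnv.grading (k := k) (p := p) (L := L)).induction with
        | hadd b b' hb hb' =>
          rw [TensorProduct.tmul_add]; simp only [map_add, mul_add, hb, hb']
        | hom j b hb =>
          have ha' : a ∈ REnv.gr k p L l := ha
          have hb' : b ∈ REnv.gr k p L j := hb
          have hxb : REnv.ι k p L (x : L) * b ∈ REnv.gr k p L (i + j) :=
            SetLike.mul_mem_graded (REnv.ι_mem_gr hxL) hb'
          change convTensor σ.grading B μ.1 ν.1 (primitive k p L (x : L) * (a ᵍ⊗ₜ[k] b)) =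
            υ.ρ x (convTensor σ.grading B μ.1 ν.1 (a ᵍ⊗ₜ[k] b))
          have e1 : includeLeft (REnv.gr k p L) (REnv.gr k p L) (REnv.ι k p L (x : L)) *
              (a ᵍ⊗ₜ[k] b) = (REnv.ι k p L (x : L) * a) ᵍ⊗ₜ[k] b := by
            have := tmul_mul_tmul (REnv.ι k p L (x : L))
              (SetLike.GradedOne.one_mem (A := REnv.gr k p L)) ha' b
            rw [zero_mul, sgn_zero, one_smul, one_mul] at this
            exact this
          have e2 : includeRight (REnv.gr k p L) (REnv.gr k p L) (REnv.ι k p L (x : L)) *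
              (a ᵍ⊗ₜ[k] b) = sgn k (i * l) • (a ᵍ⊗ₜ[k] (REnv.ι k p L (x : L) * b)) := by
            have := tmul_mul_tmul (1 : REnv k p L) (REnv.ι_mem_gr (p := p) hxL) ha' b
            rw [one_mul] at this
            exact this
          have hpa : REnv.parity a = sgn k l • a := ha
          rw [primitive_apply, add_mul, e1, e2, map_add, map_smul]
          have hx' := REnv.parity_ι (p := p) hxL
          rcases zmod2_cases i with rfl | rfl <;> rcases zmod2_cases j with rfl | rfl <;>
          simp only [zero_mul, one_mul, add_zero, zero_add, one_add_one_zmod2, sgn_zero,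
            one_smul] at hxb ⊢
          · rw [convTensor_even _ _ _ _ _ hb', convTensor_even _ _ _ _ _ hb',
              convTensor_even _ _ _ _ _ hxb, hB0 x hx, coind_apply, coind_apply]
          · rw [convTensor_odd _ _ _ _ _ hb', convTensor_odd _ _ _ _ _ hb',
              convTensor_odd _ _ _ _ _ hxb, hB0 x hx, map_mul, hx', sgn_zero, one_smul,
              coind_apply, coind_apply, σ.flip_ρ hx, sgn_zero, one_smul]
          · rw [convTensor_even _ _ _ _ _ hb', convTensor_even _ _ _ _ _ hb',
              convTensor_odd _ _ _ _ _ hxb, hB1 x hx, coind_apply, coind_apply, hpa,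
              map_smul, map_smul, map_smul, LinearMap.smul_apply, smul_smul, sgn_mul_self,
              one_smul]
          · rw [convTensor_odd _ _ _ _ _ hb', convTensor_odd _ _ _ _ _ hb',
              convTensor_even _ _ _ _ _ hxb, hB1 x hx, map_mul, hx', sgn_one, hpa,
              σ.grading.flip_flip]
            simp only [mul_smul_comm, map_smul, LinearMap.smul_apply, coind_apply,
              σ.flip_ρ hx, sgn_one, neg_smul, one_smul, neg_mul, map_neg, smul_neg,
              neg_neg]
  have := key (coproduct k p L u)
  rw [← coproduct_ι, ← map_mul] at this
  exact this

/-- The algebra `𝒜 = Hom_{U'(h)}(U'(L), k)` of functions. -/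
abbrev FunAlg (h : RestrictedSub k p L) : Submodule k (REnv k p L →ₗ[k] k) :=
  Coind h (RestrictedRep.trivial k p h.carrier)

/-- The product `f μ` of `f ∈ 𝒜` and an element `μ` of a coinduced representation. -/
def Coind.smul {h : RestrictedSub k p L} {σ : RestrictedRep k p h.carrier V} (f : FunAlg h)
    (μ : Coind h σ) : Coind h σ :=
  ⟨conv (RestrictedRep.trivial k p h.carrier).grading (LinearMap.lsmul k V) f.1 μ.1,
    conv_mem _ (by intro x _ c v; simp [RestrictedRep.trivial])
      (by
        intro x _ c v
        have : (RestrictedRep.trivial k p h.carrier).grading.flip c = c := by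
          rw [SuperGrading.flip_of_mem (i := 0) _ (by simp [RestrictedRep.trivial,
            SuperGrading.trivial]), sgn_zero, one_smul]
        simp [this]
        simp [RestrictedRep.trivial]) f μ⟩

/-- For `μ ∈ Coind(σ)` and `ω ∈ Coind(Π^q k_χ)`, the product `μ ω ∈ Coind(σ ⊗ Π^q k_χ)`. -/
def Coind.mulLine {h : RestrictedSub k p L} {σ : RestrictedRep k p h.carrier V}
    {χ : RestrictedCharacter k p h.carrier} {q : ZMod 2} (μ : Coind h σ)
    (ω : Coind h ((RestrictedRep.trivial k p h.carrier).twist χ q)) : Coind h (σ.twist χ q) :=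
  ⟨conv σ.grading (LinearMap.lsmul k V).flip μ.1 ω.1, conv_mem _
    (by intro x _ v c; simp [RestrictedRep.twist, RestrictedRep.trivial]; module)
    (by intro x hx v c; simp [RestrictedRep.twist, RestrictedRep.trivial, χ.map_odd hx]) μ ω⟩

end Modules

end Coind

/-! ### The Berezinian -/

section Berezinian

variable {k : Type*} {p : ℕ} {L V : Type*} [Field k] [AddCommGroup L] [Module k L]
  [RestrictedLieSuperalgebra k p L] [AddCommGroup V] [Module k V]

/-- The derivation action of an endomorphism `f` on alternating forms,
`ω ↦ ((v₁, …, vₙ) ↦ ∑ ω (v₁, …, f v_i, …, vₙ))`. -/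
def altDer {n : ℕ} (f : V →ₗ[k] V) : (V [⋀^Fin n]→ₗ[k] k) →ₗ[k] (V [⋀^Fin n]→ₗ[k] k) where
  toFun ω :=
    { toMultilinearMap := ∑ i, ω.toMultilinearMap.compLinearMap
        (fun j => if j = i then f else LinearMap.id)
      map_eq_zero_of_eq' := by
        intro v a b hv hab
        have e : ∀ i, (fun j => (if j = i then f else LinearMap.id) (v j)) =
            Function.update v i (f (v i)) := by
          intro i
          funext j
          rcases eq_or_ne j i with rfl | hj
          · simp
          · simp [hj]
        have key : ∀ i, i ≠ a → i ≠ b → ω (Function.update v i (f (v i))) = 0 := by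
          intro i hia hib
          apply ω.map_eq_zero_of_eq _ _ hab
          rw [Function.update_of_ne hia.symm, Function.update_of_ne hib.symm, hv]
        have hsum : ∑ i, ω (Function.update v i (f (v i))) = 0 := by
          rw [Fintype.sum_eq_add a b hab (fun i hi => key i hi.1 hi.2)]
          have := ω.map_swap (Function.update v a (f (v a))) hab
          have e2 : (Function.update v a (f (v a))) ∘ Equiv.swap a b =
              Function.update v b (f (v b)) := by
            funext j
            simp only [Function.comp_apply]
            rcases eq_or_ne j a with rfl | hja
            · rw [Equiv.swap_apply_left, Function.update_of_ne hab.symm,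
                Function.update_of_ne hab, hv]
            · rcases eq_or_ne j b with rfl | hjb
              · rw [Equiv.swap_apply_right, Function.update_self, Function.update_self, hv]
              · rw [Equiv.swap_apply_of_ne_of_ne hja hjb, Function.update_of_ne hja,
                  Function.update_of_ne hjb]
          rw [e2] at this
          rw [this, add_neg_cancel]
        simpa [_root_.sum_apply, e] using hsum }
  map_add' ω ω' := by
    ext v
    simp [Finset.sum_add_distrib]
  map_smul' c ω := by
    ext v
    simp [Finset.mul_sum]

/-- The formula for the derivation action on alternating forms. -/
theorem altDer_apply {n : ℕ} (f : V →ₗ[k] V) (ω : V [⋀^Fin n]→ₗ[k] k) (v : Fin n → V) :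
    altDer f ω v = ∑ i, ω (Function.update v i (f (v i))) := by
  have e : ∀ i, (fun j => (if j = i then f else LinearMap.id) (v j)) =
      Function.update v i (f (v i)) := by
    intro i
    funext j
    rcases eq_or_ne j i with rfl | hj
    · simp
    · simp [hj]
  have : altDer f ω v = (∑ i, ω.toMultilinearMap.compLinearMap
    (fun j => if j = i then f else LinearMap.id)) v := rfl
  rw [this]
  simp [e]

/-- The Berezinian `Ber(V) = Λ^n V₀ ⊗ (Λ^m V₁)^*` of a superspace of dimension `(n, m)`, written
as `Hom ((Λ^n V₀)^*, (Λ^m V₁)^*)`, the duals being the spaces of alternating forms. -/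
abbrev Ber (S : SuperGrading k V) : Type _ :=
  ((S.gr 0) [⋀^Fin (Module.finrank k (S.gr 0))]→ₗ[k] k) →ₗ[k]
    ((S.gr 1) [⋀^Fin (Module.finrank k (S.gr 1))]→ₗ[k] k)

/-- The Berezinian is even or odd according to the parity of the dimension of `V₁`. -/
def berGr (S : SuperGrading k V) (i : ZMod 2) : Submodule k (Ber S) :=
  if i = ((Module.finrank k (S.gr 1) : ℕ) : ZMod 2) then ⊤ else ⊥

/-- The diagonal block `V_i → V_i` of an endomorphism of `V`. It vanishes if the endomorphism
is odd. -/
def SuperGrading.block (S : SuperGrading k V) (i : ZMod 2) (f : V →ₗ[k] V) :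
    S.gr i →ₗ[k] S.gr i :=
  LinearMap.codRestrict (S.gr i) (S.proj i ∘ₗ f ∘ₗ (S.gr i).subtype) (fun _ => S.proj_mem i _)

/-- The action on the Berezinian that is induced by a representation on `V`; forms carry the
contragredient action `ω ↦ -∑ ω (…, x v_i, …)`. -/
def RestrictedRep.berAct (σ : RestrictedRep k p L V) (x : L) (z : Ber σ.grading) :
    Ber σ.grading :=
  z ∘ₗ altDer (σ.grading.block 0 (σ.ρ x)) - altDer (σ.grading.block 1 (σ.ρ x)) ∘ₗ z

end Berezinian

/-! ### Coordinates -/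

section Coordinates

variable {k : Type*} {p : ℕ} {L V : Type*} [Field k] [AddCommGroup L] [Module k L]
  [RestrictedLieSuperalgebra k p L] [AddCommGroup V] [Module k V]

/-- A homogeneous basis `e₁, …, eₙ` (even), `ε₁, …, εₘ` (odd) of a supplement of `h` in `L`. -/
structure SupplementBasis (h : RestrictedSub k p L) (n m : ℕ) where
  e : Fin n → L
  ε : Fin m → L
  e_even : ∀ i, e i ∈ (LieSuperalgebra.grading (k := k) (L := L)).gr 0
  ε_odd : ∀ s, ε s ∈ (LieSuperalgebra.grading (k := k) (L := L)).gr 1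
  linInd : LinearIndependent k (fun s : Fin n ⊕ Fin m => h.carrier.mkQ (Sum.elim e ε s))
  span : Submodule.span k (Set.range fun s : Fin n ⊕ Fin m => h.carrier.mkQ (Sum.elim e ε s)) = ⊤

/-- The multi-indices `(a, α)` with `a ∈ [0, p-1]^n` and `α ∈ {0,1}^m`. -/
abbrev MIdx (p n m : ℕ) : Type := (Fin n → Fin p) × (Fin m → Fin 2)

/-- The number of inversions: `ζ^α ζ^β = (-1)^Inv(α,β) ζ₁ ⋯ ζₘ` if `α_s + β_s = 1` for all `s`. -/
def inversions {m : ℕ} (α β : Fin m → Fin 2) : ℕ :=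
  (Finset.univ.filter fun st : Fin m × Fin m =>
    st.2 < st.1 ∧ (α st.1 : ℕ) = 1 ∧ (β st.2 : ℕ) = 1).card

/-- The functional `F ↦ (I ↦ F (I + e_i))` on families indexed by multi-indices: the derivation
`∂_i` in coordinates. -/
def dEven {n m : ℕ} (i : Fin n) (F : MIdx p n m → k) : MIdx p n m → k := fun I =>
  if hI : (I.1 i : ℕ) + 1 < p then F (Function.update I.1 i ⟨(I.1 i : ℕ) + 1, hI⟩, I.2) else 0

/-- The odd derivation with respect to the `s`-th odd coordinate. The sign is the one that arises
by moving `ε_s` from the right end of a monomial to its place. -/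
def dOdd {n m : ℕ} (s : Fin m) (F : MIdx p n m → k) : MIdx p n m → k := fun I =>
  if (I.2 s : ℕ) = 0 then
    (-1) ^ (∑ t ∈ Finset.univ.filter (fun t => s < t), (I.2 t : ℕ)) *
      F (I.1, Function.update I.2 s 1)
  else 0

/-- The character `strad_{L/h}`: the supertrace of `ad_{L/h}`. -/
def RestrictedSub.strad [CharP k p] [Fact p.Prime] [Fact (2 < p)] (h : RestrictedSub k p L)
    [FiniteDimensional k (L ⧸ h.carrier)] : RestrictedCharacter k p h.carrier :=
  h.adQuot.str

/-- The dimension modulo `2` of the odd part of `L/h`. -/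
def RestrictedSub.oddDim (h : RestrictedSub k p L) : ZMod 2 :=
  ((Module.finrank k (h.adQuot.grading.gr 1) : ℕ) : ZMod 2)

/-- Superderivations of parity `q` of the superalgebra `𝒜`. -/
structure IsSuperDerivation [CharP k p] [Fact p.Prime] [Fact (2 < p)] {h : RestrictedSub k p L}
    (q : ZMod 2) (D : FunAlg h → FunAlg h) : Prop where
  map_add : ∀ f g, D (f + g) = D f + D g
  map_smul : ∀ (c : k) f, D (c • f) = c • D f
  leibniz : ∀ (j : ZMod 2), ∀ f ∈ Coind.gr h (RestrictedRep.trivial k p h.carrier) j, ∀ g,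
    D (Coind.smul f g) = Coind.smul (D f) g + sgn k (q * j) • Coind.smul f (D g)

namespace SupplementBasis

variable {h : RestrictedSub k p L} {n m : ℕ} (b : SupplementBasis h n m)

/-- The monomial `e₁^a₁ ⋯ eₙ^aₙ ε₁^α₁ ⋯ εₘ^αₘ` in `U'(L)`. -/
def mon (I : MIdx p n m) : REnv k p L :=
  (List.ofFn fun i => REnv.ι k p L (b.e i) ^ (I.1 i : ℕ)).prod *
    (List.ofFn fun s => REnv.ι k p L (b.ε s) ^ (I.2 s : ℕ)).prod

/-- The values of `μ` on the monomials. -/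
def coord (σ : RestrictedRep k p h.carrier V) : Coind h σ →ₗ[k] (MIdx p n m → V) where
  toFun μ I := μ.1 (b.mon I)
  map_add' _ _ := rfl
  map_smul' _ _ := rfl

/-- The element of the coinduced representation with prescribed values on the monomials. -/
def coordInv (σ : RestrictedRep k p h.carrier V) : (MIdx p n m → V) → Coind h σ :=
  Function.invFun (b.coord σ)

/-- The element `v̂`: its value is `v` on the empty monomial and zero on the other ones. -/
def hat (σ : RestrictedRep k p h.carrier V) (v : V) : Coind h σ :=
  b.coordInv σ fun I => if (∀ i, (I.1 i : ℕ) = 0) ∧ ∀ s, (I.2 s : ℕ) = 0 then v else 0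

variable [Fact p.Prime]

/-- The even coordinate `η_i ∈ 𝒜`. -/
def eta (i : Fin n) : Coind h (RestrictedRep.trivial k p h.carrier) :=
  b.coordInv _ fun I =>
    if (∀ j, (I.1 j : ℕ) = if j = i then 1 else 0) ∧ ∀ t, (I.2 t : ℕ) = 0 then 1 else 0

/-- The odd coordinate `ζ_s ∈ 𝒜`. -/
def zeta (s : Fin m) : Coind h (RestrictedRep.trivial k p h.carrier) :=
  b.coordInv _ fun I =>
    if (∀ j, (I.1 j : ℕ) = 0) ∧ ∀ t, (I.2 t : ℕ) = if t = s then 1 else 0 then 1 else 0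

variable [CharP k p] [Fact (2 < p)]

/-- The derivation `∂/∂η_i` of `𝒜`. -/
def partialEven (i : Fin n) (f : FunAlg h) : FunAlg h :=
  b.coordInv _ (dEven i (b.coord _ f))

/-- The odd derivation `∂/∂ζ_s` of `𝒜`. -/
def partialOdd (s : Fin m) (f : FunAlg h) : FunAlg h :=
  b.coordInv _ (dOdd s (b.coord _ f))

/-- The divergence `∑ ∂/∂η_i (δ_X η_i) - (-1)^{|X|} ∑ ∂/∂ζ_s (δ_X ζ_s)` of the derivation `δ_X`
of `𝒜`, where `δ_X` is the action of `X` on `𝒜`. -/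
def divergence (X : L) : FunAlg h :=
  ∑ i, b.partialEven i (Coind.act (REnv.ι k p L X) (b.eta i)) -
    ∑ s, b.partialOdd s (Coind.act
      (REnv.ι k p L ((LieSuperalgebra.grading (k := k) (L := L)).flip X)) (b.zeta s))

/-- The Lie derivative on the free `𝒜`-module `Ω = Ber(Der(𝒜)^*) = 𝒜 ω`, where `f` stands for
`f ω`: `L_X (f ω) = (δ_X f + Div(δ_X) f) ω`. -/
def lieDer (X : L) (f : FunAlg h) : FunAlg h :=
  Coind.act (REnv.ι k p L X) f + Coind.smul (b.divergence X) f

/-- The product `η₁^a₁ ⋯ ηₙ^aₙ ζ₁^α₁ ⋯ ζₘ^αₘ μ`. -/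
def monSmul (I : MIdx p n m) {σ : RestrictedRep k p h.carrier V} (μ : Coind h σ) : Coind h σ :=
  (List.finRange n).foldr (fun i ν => (Coind.smul (b.eta i))^[(I.1 i : ℕ)] ν)
    ((List.finRange m).foldr (fun s ν => (Coind.smul (b.zeta s))^[(I.2 s : ℕ)] ν) μ)

/-- The isomorphism `χ : Ω → Coind(Π^m k_{-strad})`,
`⟨X₁ ⋯ X_t, χ(f ω)⟩ = ⟨1, L_{X₁} ⋯ L_{X_t} f⟩`. -/
def IsChi [FiniteDimensional k (L ⧸ h.carrier)] (χ : FunAlg h ≃ₗ[k]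
    Coind h ((RestrictedRep.trivial k p h.carrier).twist h.strad.neg h.oddDim)) : Prop :=
  ∀ (f : FunAlg h) (l : List L),
    (χ f).1 (l.map (REnv.ι k p L)).prod = (l.foldr b.lieDer f).1 1

/-- The formula that defines the Berezin pairing: `Ψ(η^a ζ^α v̂, η^b ζ^β f̂ ω)` is
`(-1)^Inv(α,β) (-1)^{|v||β|} ⟨v, f⟩` if `a_i + b_i = p - 1` and `α_s + β_s = 1` for all `i` and `s`,
and zero otherwise. Here `⟨v, f⟩ = (-1)^{|v||f|} f(v)`. -/
def IsBerezinPairing [FiniteDimensional k (L ⧸ h.carrier)] (π : RestrictedRep k p h.carrier V)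
    (χ : FunAlg h ≃ₗ[k] Coind h ((RestrictedRep.trivial k p h.carrier).twist h.strad.neg h.oddDim))
    (Ψ : Coind h π →ₗ[k] Coind h (π.dual.twist h.strad.neg h.oddDim) →ₗ[k] k) : Prop :=
  ∀ (I J : MIdx p n m) (i j : ZMod 2), ∀ v ∈ π.grading.gr i, ∀ f ∈ π.dual.grading.gr j,
    Ψ (b.monSmul I (b.hat π v))
        (Coind.mulLine (b.monSmul J (b.hat π.dual f)) (χ (b.hat _ 1))) =
      if (∀ t, (I.1 t : ℕ) + (J.1 t : ℕ) = p - 1) ∧ ∀ s, (I.2 s : ℕ) + (J.2 s : ℕ) = 1 then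
        (-1) ^ inversions I.2 J.2 * sgn k (i * ((∑ s, (J.2 s : ℕ) : ℕ) : ZMod 2)) *
          (sgn k (i * j) * f v)
      else 0

end SupplementBasis

end Coordinates


end SuperDuality

end

open SuperDuality

open scoped TensorProduct DirectSum

set_option linter.unusedSectionVars false

noncomputable section

namespace SuperDuality

/-! ### Linear maps on spaces of finitely supported functions -/

section Finsupp

variable {k α M : Type*} [Field k] [AddCommGroup M] [Module k M]

/-! The pairing is an integral: two sections of dual representations multiply to a volume form, and
the integral of a volume form is the coefficient of its largest monomial. Three facts carry the
proof: the values on monomials are free coordinates, the integral kills Lie derivatives, and the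
volume forms are the coinduced representation of the character `-strad`.

Coordinates. That the values on monomials are arbitrary is the theorem of Poincaré, Birkhoff and
Witt for `U'(L)` relative to `h`. It is proved by rewriting words in a homogeneous basis that lists
`h` before the supplement. Reducing always at the rightmost possible place gives a normal form `nf`
without any confluence argument. The operators "prefix a letter and normalise" are then shown to
satisfy the defining relations by induction on the total degree (`relUpTo`); the ambiguities are
resolved by the Jacobi identity and by `ad x^[p] = (ad x)^p`. Jacobson's formula
(`add_pow_jacobson`) carries the `p`-th power relations from the basis to all even elements. A
functional on words that lets the letters of `h` act on `V` is unchanged by reduction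
(`functional_red`), so it descends to a section with prescribed values; this gives
`SupplementBasis.coord_bijective`.

Calculus. Right translations act on convolutions by the Leibniz rule (`conv_mul_ι`), so identities
between convolutions need only be compared at `1`. Multiplication by a coordinate function lowers a
multi-index and contributes the exponent and a sign (`coord_crd_smul`). Positive exponents are
invertible, hence the coordinate functions generate every coinduced representation over the elements
`v̂`, and the partial derivatives satisfy the canonical supercommutation relations (`pd_crd_smul`).

Integral. The Lie derivative is a total divergence (`lieDer_eq_sum`), and a partial derivative has
no top coefficient, so `topCoeff_lieDer` holds. Since `(f, g) ↦ topCoeff (f g)` is nondegenerate,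
the Lie derivative is, up to sign, the adjoint of the action on functions. It therefore inherits all
relations of `U'(L)`, the `p`-th powers included, with no computation of the divergence of a bracket
or of a power.

Volume forms. The map `χ` evaluates `L_u f` at `1`. For elements of `h` only the divergence at `1`
contributes, and it is `-strad` (`divergence_apply_one`). The kernel of `χ` is an ideal stable under
`L`, hence zero, and bijectivity follows by counting dimensions.

Pairing. `Ψ` is the normalised top coefficient of the volume form that belongs to the product of two
sections. Invariance is the Leibniz rule together with `topCoeff_lieDer`. Multiplying one argument
by the largest monomial reduces `Ψ` to the pairing of values at `1`; as the kernels are stable under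
`L`, they vanish. The statement on the Berezinian holds because a derivation acts on top forms by
its trace. -/

theorem eq_of_mem_supported {s : Set α} {f : α →₀ k} (hf : f ∈ Finsupp.supported k k s)
    {A B : (α →₀ k) →ₗ[k] M} (h : ∀ w ∈ s, A (Finsupp.single w 1) = B (Finsupp.single w 1)) :
    A f = B f := by
  rw [Finsupp.supported_eq_span_single] at hf
  refine LinearMap.eqOn_span (f := A) (g := B) (s := (fun i => Finsupp.single i (1 : k)) '' s) ?_ hf
  rintro _ ⟨w, hw, rfl⟩
  exact h w hw

theorem map_mem_of_mem_supported {s : Set α} {f : α →₀ k} (hf : f ∈ Finsupp.supported k k s)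
    {A : (α →₀ k) →ₗ[k] M} {N : Submodule k M} (h : ∀ w ∈ s, A (Finsupp.single w 1) ∈ N) :
    A f ∈ N := by
  rw [Finsupp.supported_eq_span_single] at hf
  have : Submodule.span k ((fun i => Finsupp.single i (1 : k)) '' s) ≤ N.comap A := by
    rw [Submodule.span_le]
    rintro _ ⟨w, hw, rfl⟩
    exact h w hw
  exact this hf

theorem single_mem_supported {s : Set α} {w : α} (h : w ∈ s) (c : k) :
    Finsupp.single w c ∈ Finsupp.supported k k s :=
  Finsupp.single_mem_supported k c h

end Finsupp

/-! ### Homogeneous bases and words -/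

/-- A homogeneous basis of a Lie superalgebra. -/
structure HomBasis (k L ι : Type*) [Field k] [AddCommGroup L] [Module k L]
    [LieSuperalgebra k L] where
  X : Module.Basis ι k L
  par : ι → ZMod 2
  mem : ∀ i, X i ∈ (LieSuperalgebra.grading (k := k) (L := L)).gr (par i)

section Words

variable {ι : Type*} [LinearOrder ι]

/-- The number of inversions of a word. -/
def inv : List ι → ℕ
  | [] => 0
  | i :: w => w.countP (· < i) + inv w

/-- `V` is shorter than `W`, or a rearrangement of `W` with fewer inversions. -/
def Less (V W : List ι) : Prop := V.length < W.length ∨ (V.Perm W ∧ inv V < inv W)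

theorem Less.wf : WellFounded (Less : List ι → List ι → Prop) := by
  have : WellFounded (InvImage (Prod.Lex (· < ·) (· < ·))
      (fun w : List ι => (w.length, inv w))) :=
    InvImage.wf _ (WellFounded.prod_lex wellFounded_lt wellFounded_lt)
  refine Subrelation.wf ?_ this
  rintro V W (h | ⟨h, h'⟩)
  · exact Prod.Lex.left _ _ h
  · simp only [InvImage, h.length_eq]
    exact Prod.Lex.right _ h'

/-- A prefixed letter adds a number of inversions that depends only on the multiset of the letters
behind it, and this multiset is unchanged by a rearrangement. -/
theorem Less.cons {V W : List ι} (h : Less V W) (i : ι) : Less (i :: V) (i :: W) := by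
  rcases h with h | ⟨h, h'⟩
  · exact Or.inl (by simpa using h)
  · refine Or.inr ⟨h.cons i, ?_⟩
    simp only [inv, h.countP_eq]
    omega

theorem Less.swap {i j : ι} (h : j < i) (w : List ι) : Less (j :: i :: w) (i :: j :: w) := by
  refine Or.inr ⟨List.Perm.swap _ _ _, ?_⟩
  simp only [inv, List.countP_cons, h, not_lt_of_gt h, decide_true, decide_false]
  simp
  omega

/-- The words that are nondecreasing and contain the letter `i` less than `q i` times. -/
def Normal (q : ι → ℕ) (w : List ι) : Prop := w.Pairwise (· ≤ ·) ∧ ∀ i, w.count i < q i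

theorem Normal.sublist {q : ι → ℕ} {v w : List ι} (h : Normal q w) (hv : v.Sublist w) :
    Normal q v :=
  ⟨h.1.sublist hv, fun i => lt_of_le_of_lt (hv.count_le i) (h.2 i)⟩

theorem Normal.of_cons {q : ι → ℕ} {i : ι} {w : List ι} (h : Normal q (i :: w)) : Normal q w :=
  h.sublist (List.sublist_cons_self _ _)

/-- A nondecreasing word whose letters are at least `i` starts with all its letters `i`. -/
theorem eq_replicate_append {i : ι} {w : List ι} (hw : w.Pairwise (· ≤ ·)) (hi : ∀ j ∈ w, i ≤ j) :
    ∃ v, w = List.replicate (w.count i) i ++ v ∧ (∀ j ∈ v, i < j) := by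
  induction w with
  | nil => exact ⟨[], by simp⟩
  | cons j w ih =>
    rw [List.pairwise_cons] at hw
    rcases (hi j (by simp)).eq_or_lt with rfl | hij
    · obtain ⟨v, hv, hv'⟩ := ih hw.2 (fun l hl => hi l (by simp [hl]))
      refine ⟨v, ?_, hv'⟩
      rw [List.count_cons_self, List.replicate_succ, List.cons_append, ← hv]
    · have h : ∀ l ∈ j :: w, i < l := by
        intro l hl
        rcases List.mem_cons.1 hl with rfl | hl
        · exact hij
        · exact lt_of_lt_of_le hij (hw.1 l hl)
      refine ⟨j :: w, ?_, h⟩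
      rw [List.count_eq_zero_of_not_mem (fun hm => lt_irrefl _ (h i hm))]
      rfl

end Words

namespace HomBasis

variable {k : Type*} {p : ℕ} {L ι : Type*} [Field k] [AddCommGroup L] [Module k L]
  [RestrictedLieSuperalgebra k p L] (b : HomBasis k L ι)

theorem span_gr (i : ZMod 2) :
    (LieSuperalgebra.grading (k := k) (L := L)).gr i =
      Submodule.span k (b.X '' {j | b.par j = i}) := by
  set G := LieSuperalgebra.grading (k := k) (L := L)
  apply le_antisymm
  · intro x hx
    have hx' := b.X.linearCombination_repr x
    rw [← G.proj_of_mem hx, ← hx', Finsupp.linearCombination_apply, Finsupp.sum, map_sum]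
    refine Submodule.sum_mem _ fun j _ => ?_
    rw [map_smul]
    refine Submodule.smul_mem _ _ ?_
    by_cases hj : b.par j = i
    · rw [G.proj_of_mem (hj ▸ b.mem j)]
      exact Submodule.subset_span ⟨j, hj, rfl⟩
    · rw [G.proj_of_mem_ne hj (b.mem j)]
      exact Submodule.zero_mem _
  · rw [Submodule.span_le]
    rintro _ ⟨j, rfl, rfl⟩
    exact b.mem j

variable (p) in
/-- The exponent of the power of `x_i` that can be reduced. -/
def q (i : ι) : ℕ := if b.par i = 0 then p else 2

variable (p) in
/-- The element of `L` to which the power `x_i ^ q_i` is reduced. -/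
def P (i : ι) : L :=
  if h : b.par i = 0 then
    (RestrictedLieSuperalgebra.pmap (k := k) (p := p) ⟨b.X i, h ▸ b.mem i⟩ : L)
  else (2 : k)⁻¹ • LieSuperalgebra.br (k := k) (b.X i) (b.X i)

theorem P_mem (i : ι) : b.P p i ∈ (LieSuperalgebra.grading (k := k) (L := L)).gr 0 := by
  unfold P
  split_ifs with h
  · exact Subtype.property _
  · have h1 : b.par i = 1 := (zmod2_cases _).resolve_left h
    have := LieSuperalgebra.br_mem (k := k) (L := L) (b.mem i) (b.mem i)
    rw [h1, one_add_one_zmod2] at this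
    exact Submodule.smul_mem _ _ this

/-- Left multiplication of words by an element of `L`. -/
def consL : L →ₗ[k] Module.End k (List ι →₀ k) :=
  b.X.constr k fun i => Finsupp.lmapDomain k k (List.cons i)

theorem consL_X (i : ι) (w : List ι) :
    b.consL (b.X i) (Finsupp.single w 1) = Finsupp.single (i :: w) 1 := by
  rw [consL, Module.Basis.constr_basis]
  simp

theorem consL_mem (x : L) {s t : Set (List ι)} (h : ∀ i, ∀ w ∈ s, i :: w ∈ t) {f : List ι →₀ k}
    (hf : f ∈ Finsupp.supported k k s) : b.consL x f ∈ Finsupp.supported k k t := by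
  refine map_mem_of_mem_supported hf fun w hw => ?_
  rw [consL, Module.Basis.constr_apply, Finsupp.sum, LinearMap.sum_apply]
  refine Submodule.sum_mem _ fun i _ => ?_
  rw [LinearMap.smul_apply, Finsupp.lmapDomain_apply, Finsupp.mapDomain_single]
  exact Submodule.smul_mem _ _ (single_mem_supported (h i w hw) 1)

variable [LinearOrder ι]

variable (p) in
/-- The reduction of the word `i w` at its head, if `w` is normal and `i w` is not. -/
def headRed (i : ι) : List ι → (List ι →₀ k)
  -- This value is never used: every exponent bound `q i` is at least `2`, so a word with one letter
  -- is normal.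
  | [] => 0
  | j :: v =>
    if j < i then
      sgn k (b.par i * b.par j) • Finsupp.single (j :: i :: v) 1 +
        b.consL (LieSuperalgebra.br (k := k) (b.X i) (b.X j)) (Finsupp.single v 1)
    -- If the tail is normal and no smaller letter follows, the head fails only because `q i - 1`
    -- further copies of `i` follow it; together with the head they form the power that is replaced.
    else b.consL (b.P p i) (Finsupp.single ((j :: v).drop (b.q p i - 1)) 1)

open Classical in
variable (p) in
/-- One step of the reduction of a word, at the rightmost place that can be reduced. -/
def red : List ι → (List ι →₀ k)
  | [] => Finsupp.single [] 1
  | i :: w =>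
    if Normal (b.q p) w then
      if Normal (b.q p) (i :: w) then Finsupp.single (i :: w) 1 else b.headRed p i w
    else b.consL (b.X i) (red w)

variable [Fact (2 < p)]

theorem two_le_q (i : ι) : 2 ≤ b.q p i := by
  have : 2 < p := Fact.out
  unfold q; split_ifs <;> omega

theorem normal_nil : Normal (b.q p) [] :=
  ⟨List.Pairwise.nil, fun i => by have := b.two_le_q (p := p) i; simp; omega⟩

theorem normal_cons {i : ι} {w : List ι} :
    Normal (b.q p) (i :: w) ↔
      Normal (b.q p) w ∧ (∀ j ∈ w, i ≤ j) ∧ w.count i + 1 < b.q p i := by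
  constructor
  · intro h
    refine ⟨h.of_cons, (List.pairwise_cons.1 h.1).1, ?_⟩
    have := h.2 i
    rwa [List.count_cons_self] at this
  · rintro ⟨h, h1, h2⟩
    refine ⟨List.pairwise_cons.2 ⟨h1, h.1⟩, fun j => ?_⟩
    rcases eq_or_ne j i with rfl | hj
    · rwa [List.count_cons_self]
    · rw [List.count_cons_of_ne hj.symm]; exact h.2 j

/-- The reasons for which a word is not normal although its tail is. -/
theorem not_normal_cases {i : ι} {w : List ι} (hw : Normal (b.q p) w)
    (h : ¬Normal (b.q p) (i :: w)) :
    (∃ j v, w = j :: v ∧ j < i) ∨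
      ∃ v, w = List.replicate (b.q p i - 1) i ++ v ∧ ∀ j ∈ v, i < j := by
  by_cases h1 : ∀ j ∈ w, i ≤ j
  · right
    obtain ⟨v, hv, hv'⟩ := eq_replicate_append hw.1 h1
    have h2 : ¬w.count i + 1 < b.q p i := fun h2 => h (b.normal_cons.2 ⟨hw, h1, h2⟩)
    have h3 := hw.2 i
    have : w.count i = b.q p i - 1 := by omega
    exact ⟨v, by rw [← this]; exact hv, hv'⟩
  · left
    push Not at h1
    obtain ⟨l, hl, hli⟩ := h1
    cases w with
    | nil => simp at hl
    | cons j v =>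
      refine ⟨j, v, rfl, ?_⟩
      rcases List.mem_cons.1 hl with rfl | hl
      · exact hli
      · exact lt_of_le_of_lt ((List.pairwise_cons.1 hw.1).1 l hl) hli

theorem red_of_normal {w : List ι} (h : Normal (b.q p) w) :
    b.red p w = Finsupp.single w 1 := by
  cases w with
  | nil => simp [red]
  | cons i w => rw [red, if_pos h.of_cons, if_pos h]

theorem red_of_not_normal {i : ι} {w : List ι} (h : ¬Normal (b.q p) w) :
    b.red p (i :: w) = b.consL (b.X i) (b.red p w) := by
  rw [red, if_neg h]

theorem red_swap {i j : ι} {w : List ι} (h : Normal (b.q p) (j :: w)) (hij : j < i) :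
    b.red p (i :: j :: w) = sgn k (b.par i * b.par j) • Finsupp.single (j :: i :: w) 1 +
      b.consL (LieSuperalgebra.br (k := k) (b.X i) (b.X j)) (Finsupp.single w 1) := by
  have hn : ¬Normal (b.q p) (i :: j :: w) := fun hn =>
    absurd ((b.normal_cons.1 hn).2.1 j (by simp)) (not_le_of_gt hij)
  rw [red, if_pos h, if_neg hn, headRed, if_pos hij]

theorem red_pow {i : ι} {w : List ι}
    (h : Normal (b.q p) (List.replicate (b.q p i - 1) i ++ w)) :
    b.red p (i :: (List.replicate (b.q p i - 1) i ++ w)) =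
      b.consL (b.P p i) (Finsupp.single w 1) := by
  have h2 := b.two_le_q (p := p) i
  have hn : ¬Normal (b.q p) (i :: (List.replicate (b.q p i - 1) i ++ w)) := fun hn => by
    have := (b.normal_cons.1 hn).2.2
    rw [List.count_append, List.count_replicate_self] at this
    omega
  obtain ⟨m, hm⟩ : ∃ m, b.q p i - 1 = m + 1 := ⟨b.q p i - 2, by omega⟩
  have hd : (List.replicate (b.q p i - 1) i ++ w).drop (b.q p i - 1) = w := by
    rw [List.drop_append]; simp
  rw [red, if_pos h, if_neg hn]
  rw [hm] at hd ⊢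
  rw [List.replicate_succ, List.cons_append] at hd ⊢
  rw [headRed, if_neg (lt_irrefl _), hm, hd]

/-- Reduction makes words smaller. -/
theorem red_less {w : List ι} (h : ¬Normal (b.q p) w) :
    b.red p w ∈ Finsupp.supported k k {v | Less v w} := by
  induction w with
  | nil => exact absurd b.normal_nil h
  | cons i w ih =>
    by_cases hw : Normal (b.q p) w
    · rcases b.not_normal_cases hw h with ⟨j, v, rfl, hji⟩ | ⟨v, rfl, hv⟩
      · rw [b.red_swap hw hji]
        refine Submodule.add_mem _ (Submodule.smul_mem _ _ (single_mem_supported ?_ _)) ?_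
        · exact Less.swap hji v
        · refine b.consL_mem _ (s := {v}) ?_ (single_mem_supported (by exact rfl) 1)
          rintro l _ rfl
          exact Or.inl (by simp)
      · rw [b.red_pow hw]
        refine b.consL_mem _ (s := {v}) ?_ (single_mem_supported (by exact rfl) 1)
        rintro l _ rfl
        have := b.two_le_q (p := p) i
        exact Or.inl (by simp; omega)
    · rw [b.red_of_not_normal hw, consL, Module.Basis.constr_basis]
      refine map_mem_of_mem_supported (ih hw) fun v hv => ?_
      rw [Finsupp.lmapDomain_apply, Finsupp.mapDomain_single]
      exact single_mem_supported (by exact hv.cons i) 1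

open Classical in
variable (p) in
/-- The normal form of a word. -/
def nfWord : List ι → (List ι →₀ k) :=
  Less.wf.fix fun w rec => if Normal (b.q p) w then Finsupp.single w 1 else
    -- The test only justifies the recursion: by `red_less` all words in the support of `red` are
    -- smaller, so the value `0` never occurs.
    (b.red p w).sum fun v c => if h : Less v w then c • rec v h else 0

variable (p) in
/-- The linear extension of the normal form of words. -/
def nf : (List ι →₀ k) →ₗ[k] (List ι →₀ k) :=
  Finsupp.linearCombination k (b.nfWord p)

theorem nf_single (w : List ι) : b.nf p (Finsupp.single w 1) = b.nfWord p w := by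
  rw [nf, Finsupp.linearCombination_single, one_smul]

theorem nf_of_normal {w : List ι} (h : Normal (b.q p) w) :
    b.nf p (Finsupp.single w 1) = Finsupp.single w 1 := by
  rw [nf_single, nfWord, WellFounded.fix_eq, if_pos h]

/-- The unfolded recursion: the normal form is invariant under one step of reduction. -/
theorem nf_red (w : List ι) : b.nf p (Finsupp.single w 1) = b.nf p (b.red p w) := by
  by_cases h : Normal (b.q p) w
  · rw [b.red_of_normal h]
  · rw [nf_single, nfWord, WellFounded.fix_eq, if_neg h, nf, Finsupp.linearCombination_apply]
    refine Finsupp.sum_congr fun v hv => ?_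
    have : Less v w := (Finsupp.mem_supported k _).1 (b.red_less h) hv
    rw [dif_pos this]
    rfl

/-- Well-founded induction along reduction. -/
theorem word_induction {Q : List ι → Prop} (hn : ∀ w, Normal (b.q p) w → Q w)
    (hr : ∀ w, ¬Normal (b.q p) w → (∀ v, Less v w → Q v) → Q w) (w : List ι) : Q w := by
  induction w using (Less.wf (ι := ι)).induction with
  | _ w ih =>
    by_cases h : Normal (b.q p) w
    · exact hn w h
    · exact hr w h ih

/-- The normal form of a word involves only normal words, which are shorter than the word or
rearrangements of it. -/
theorem nf_mem (w : List ι) : b.nf p (Finsupp.single w 1) ∈ Finsupp.supported k k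
    {v | Normal (b.q p) v ∧ (v.length < w.length ∨ v.Perm w)} := by
  induction w using b.word_induction (p := p) with
  | hn w h => rw [b.nf_of_normal h]; exact single_mem_supported (by exact ⟨h, Or.inr (List.Perm.refl _)⟩) 1
  | hr w h ih =>
    rw [nf_red]
    refine map_mem_of_mem_supported (b.red_less h) fun v hv => ?_
    refine Finsupp.supported_mono ?_ (ih v hv)
    rintro u ⟨hu, hu'⟩
    refine ⟨hu, ?_⟩
    rcases hv with hv | ⟨hv, -⟩ <;> rcases hu' with hu' | hu'
    · exact Or.inl (hu'.trans hv)
    · exact Or.inl (hu'.length_eq ▸ hv)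
    · exact Or.inl (hv.length_eq ▸ hu')
    · exact Or.inr (hu'.trans hv)

/-- This is where the choice of the rightmost place pays off: as long as the tail is not normal,
reducing `i :: w` means reducing `w`, so a prefixed letter does not interfere with the normalisation
of the tail. Confluence is not needed. -/
theorem nf_consL (i : ι) (f : List ι →₀ k) :
    b.nf p (b.consL (b.X i) f) = b.nf p (b.consL (b.X i) (b.nf p f)) := by
  have : b.nf p ∘ₗ b.consL (b.X i) = b.nf p ∘ₗ b.consL (b.X i) ∘ₗ b.nf p := by
    apply Finsupp.lhom_ext'
    intro w
    apply LinearMap.ext_ring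
    simp only [LinearMap.comp_apply, Finsupp.lsingle_apply]
    induction w using b.word_induction (p := p) with
    | hn w h => rw [b.nf_of_normal h]
    | hr w h ih =>
      rw [consL_X, nf_red, b.red_of_not_normal h, b.nf_red w]
      exact eq_of_mem_supported (A := b.nf p ∘ₗ b.consL (b.X i))
        (B := b.nf p ∘ₗ b.consL (b.X i) ∘ₗ b.nf p) (b.red_less h) ih
  exact LinearMap.congr_fun this f

end HomBasis

namespace HomBasis

variable {k : Type*} {p : ℕ} {L ι : Type*} [Field k] [AddCommGroup L] [Module k L]
  [RestrictedLieSuperalgebra k p L] (b : HomBasis k L ι)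

/-! ### Brackets with the elements `P i` -/

theorem br_skew_even {i : ZMod 2} {x y : L}
    (hx : x ∈ (LieSuperalgebra.grading (k := k) (L := L)).gr 0)
    (hy : y ∈ (LieSuperalgebra.grading (k := k) (L := L)).gr i) :
    LieSuperalgebra.br (k := k) x y = -LieSuperalgebra.br (k := k) y x := by
  rw [LieSuperalgebra.br_skew hx hy, zero_mul, sgn_zero, one_smul]

theorem br_self_even [CharP k p] [Fact (2 < p)] {x : L}
    (hx : x ∈ (LieSuperalgebra.grading (k := k) (L := L)).gr 0) :
    LieSuperalgebra.br (k := k) x x = 0 := by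
  have h := br_skew_even hx hx
  have : (2 : k) • LieSuperalgebra.br (k := k) x x = 0 := by
    rw [two_smul]; nth_rewrite 1 [h]; simp
  exact (smul_eq_zero.1 this).resolve_left (two_ne k p)

variable [CharP k p] [Fact (2 < p)]

/-- For even letters this is the axiom on `ad x^[p]`; for odd letters the Jacobi identity gives
`[x,[x,y]] = ½ [[x,x],y]`. It puts the two kinds of power relations on the same footing. -/
theorem br_P (i : ι) (y : L) :
    LieSuperalgebra.br (k := k) (b.P p i) y =
      (LieSuperalgebra.br (k := k) (b.X i))^[b.q p i] y := by
  unfold P q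
  split_ifs with h
  · exact RestrictedLieSuperalgebra.ad_pmap _ y
  · have h1 : b.par i = 1 := (zmod2_cases _).resolve_left h
    have hm := b.mem i
    rw [h1] at hm
    have hj := LieSuperalgebra.br_jacobi (k := k) y hm hm
    rw [mul_one, sgn_one, neg_one_smul, ← sub_eq_add_neg, eq_sub_iff_add_eq, ← two_smul k] at hj
    rw [map_smul, LinearMap.smul_apply, ← hj, smul_smul, inv_mul_cancel₀ (two_ne k p), one_smul]
    rfl

/-- It resolves the ambiguity of `x_i` against its own power. For odd letters it is the axiom
`[x,[x,x]] = 0`, for even ones `[x,x] = 0`. -/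
theorem br_P_self (i : ι) : LieSuperalgebra.br (k := k) (b.X i) (b.P p i) = 0 := by
  have h : LieSuperalgebra.br (k := k) (b.P p i) (b.X i) = 0 := by
    rw [br_P]
    by_cases h : b.par i = 0
    · have : 2 < p := Fact.out
      obtain ⟨n, hn⟩ : ∃ n, b.q p i = n + 1 := ⟨p - 1, by rw [q, if_pos h]; omega⟩
      rw [hn, Function.iterate_succ_apply, br_self_even (p := p) (h ▸ b.mem i)]
      exact Function.iterate_fixed (map_zero _) n
    · rw [q, if_neg h]
      have h1 : b.par i = 1 := (zmod2_cases _).resolve_left h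
      exact LieSuperalgebra.br_cube (k := k) (h1 ▸ b.mem i)
  have := br_skew_even (b.P_mem (p := p) i) (b.mem i)
  rw [h] at this
  exact neg_eq_zero.1 this.symm

theorem odd_p [Fact p.Prime] : Odd p :=
  (Fact.out : p.Prime).odd_of_ne_two (Fact.out : 2 < p).ne'

variable [Fact p.Prime]

/-- Passing from left to right brackets changes the sign `q i + 1` times up to Koszul signs: for
even letters `(-1)^p = -1` as `p` is odd, for odd letters the Koszul signs of the two brackets
combine to the same sign. -/
theorem br_P_right {c : ZMod 2} (i : ι) {y : L}
    (hy : y ∈ (LieSuperalgebra.grading (k := k) (L := L)).gr c) :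
    LieSuperalgebra.br (k := k) y (b.P p i) =
      (fun z => LieSuperalgebra.br (k := k) z (b.X i))^[b.q p i] y := by
  have h0 := br_skew_even (b.P_mem (p := p) i) hy
  have h0' : LieSuperalgebra.br (k := k) y (b.P p i) =
    -(LieSuperalgebra.br (k := k) (b.X i))^[b.q p i] y := by rw [← br_P, h0, neg_neg]
  rw [h0']
  by_cases h : b.par i = 0
  · rw [q, if_pos h]
    have hm := b.mem i
    rw [h] at hm
    have key : ∀ n, (fun z => LieSuperalgebra.br (k := k) z (b.X i))^[n] y ∈
        (LieSuperalgebra.grading (k := k) (L := L)).gr c ∧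
        (fun z => LieSuperalgebra.br (k := k) z (b.X i))^[n] y =
          (-1 : k) ^ n • (LieSuperalgebra.br (k := k) (b.X i))^[n] y := by
      intro n
      induction n with
      | zero => simpa using hy
      | succ n ih =>
        rw [Function.iterate_succ_apply', Function.iterate_succ_apply']
        refine ⟨by simpa using LieSuperalgebra.br_mem (k := k) ih.1 hm, ?_⟩
        have := br_skew_even hm ih.1
        rw [← neg_eq_iff_eq_neg] at this
        rw [← this, ih.2, map_smul, pow_succ, mul_neg_one, neg_smul]
    rw [(key p).2, odd_p.neg_one_pow, neg_one_smul]
  · rw [q, if_neg h]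
    have h1 : b.par i = 1 := (zmod2_cases _).resolve_left h
    have hm := b.mem i
    rw [h1] at hm
    have e1 := LieSuperalgebra.br_skew (k := k) hm hy
    have e2 := LieSuperalgebra.br_skew (k := k) hm (LieSuperalgebra.br_mem (k := k) hy hm)
    change -(LieSuperalgebra.br (k := k) (b.X i) (LieSuperalgebra.br (k := k) (b.X i) y)) =
      LieSuperalgebra.br (k := k) (LieSuperalgebra.br (k := k) y (b.X i)) (b.X i)
    rw [e1, map_neg, map_smul, e2]
    simp only [one_mul, sgn_add, sgn_one, smul_neg, smul_smul, neg_neg]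
    rw [← mul_assoc, sgn_mul_self]
    simp

variable [LinearOrder ι]

/-! ### The action on normal forms -/

variable (p) in
/-- The action of `L` on the span of the words: multiplication from the left, followed by
reduction. -/
def op : L →ₗ[k] Module.End k (List ι →₀ k) :=
  LinearMap.mulLeft k (b.nf p : Module.End k (List ι →₀ k)) ∘ₗ b.consL

theorem op_X_single (i : ι) (w : List ι) :
    b.op p (b.X i) (Finsupp.single w 1) = b.nf p (Finsupp.single (i :: w) 1) := by
  rw [← b.consL_X]; rfl

/-- The operators see only normal forms. Relations proved on normal words therefore hold on the
whole space of words. -/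
theorem op_nf (x : L) (f : List ι →₀ k) : b.op p x (b.nf p f) = b.op p x f := by
  have : ∀ x : L, (b.op p x) ∘ₗ b.nf p = b.op p x := by
    intro x
    have h : (LinearMap.mulRight k (b.nf p : Module.End k (List ι →₀ k))) ∘ₗ b.op p = b.op p :=
      b.X.ext fun i => LinearMap.ext fun f => (b.nf_consL i f).symm
    exact LinearMap.congr_fun h x
  exact LinearMap.congr_fun (this x) f

variable (k p) in
/-- The span of the normal words of length at most `n`. -/
def Z (n : ℕ) : Submodule k (List ι →₀ k) :=
  Finsupp.supported k k {w | Normal (b.q p) w ∧ w.length ≤ n}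

theorem Z_mono {m n : ℕ} (h : m ≤ n) : b.Z k p m ≤ b.Z k p n :=
  Finsupp.supported_mono fun _ hw => ⟨hw.1, hw.2.trans h⟩

theorem single_mem_Z {w : List ι} (h : Normal (b.q p) w) {n : ℕ} (hn : w.length ≤ n) :
    Finsupp.single w 1 ∈ b.Z k p n := single_mem_supported (by exact ⟨h, hn⟩) 1

theorem op_mem (x : L) {n : ℕ} {f : List ι →₀ k} (hf : f ∈ b.Z k p n) :
    b.op p x f ∈ b.Z k p (n + 1) := by
  have h1 := b.consL_mem x (s := {w | Normal (b.q p) w ∧ w.length ≤ n})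
    (t := {w | w.length ≤ n + 1}) (by rintro i w ⟨-, hw⟩; simpa using hw) hf
  refine map_mem_of_mem_supported (A := b.nf p) h1 fun w hw => ?_
  refine Finsupp.supported_mono ?_ (b.nf_mem w)
  rintro v ⟨hv, hv'⟩
  have hw : w.length ≤ n + 1 := hw
  rcases hv' with h | h
  · exact ⟨hv, by omega⟩
  · exact ⟨hv, h.length_eq ▸ hw⟩

theorem op_pow_mem (x : L) {n : ℕ} {f : List ι →₀ k} (hf : f ∈ b.Z k p n) (s : ℕ) :
    (b.op p x ^ s) f ∈ b.Z k p (n + s) := by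
  induction s with
  | zero => simpa using hf
  | succ s ih => rw [pow_succ', Module.End.mul_apply]; exact b.op_mem x ih

variable (p) in
/-- The operators of two basis vectors satisfy the commutation relation at `f`. -/
def Comm (i j : ι) (f : List ι →₀ k) : Prop :=
  (b.op p (b.X i) * b.op p (b.X j)) f =
    (sgn k (b.par i * b.par j) • (b.op p (b.X j) * b.op p (b.X i)) +
      b.op p (LieSuperalgebra.br (k := k) (b.X i) (b.X j))) f

theorem comm_iff {i j : ι} {f : List ι →₀ k} : b.Comm p i j f ↔
    b.op p (b.X i) (b.op p (b.X j) f) =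
      sgn k (b.par i * b.par j) • b.op p (b.X j) (b.op p (b.X i) f) +
        b.op p (LieSuperalgebra.br (k := k) (b.X i) (b.X j)) f := Iff.rfl

theorem Comm.of_supported {i j : ι} {f : List ι →₀ k} {s : Set (List ι)}
    (hf : f ∈ Finsupp.supported k k s) (h : ∀ w ∈ s, b.Comm p i j (Finsupp.single w 1)) :
    b.Comm p i j f := eq_of_mem_supported hf h

theorem Comm.symm {i j : ι} {f : List ι →₀ k} (h : b.Comm p i j f) : b.Comm p j i f := by
  rw [comm_iff] at h ⊢
  rw [h, LieSuperalgebra.br_skew (b.mem i) (b.mem j), mul_comm (b.par j), smul_add, smul_smul,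
    sgn_mul_self, one_smul, map_neg, map_smul, LinearMap.neg_apply, LinearMap.smul_apply, smul_neg,
    smul_smul, sgn_mul_self, one_smul]
  abel

theorem comm_of_basis_right {i : ι} {f : List ι →₀ k} (h : ∀ j, b.Comm p j i f) {a : ZMod 2}
    {y : L} (hy : y ∈ (LieSuperalgebra.grading (k := k) (L := L)).gr a) :
    b.op p y (b.op p (b.X i) f) = sgn k (a * b.par i) • b.op p (b.X i) (b.op p y f) +
      b.op p (LieSuperalgebra.br (k := k) y (b.X i)) f := by
  rw [b.span_gr] at hy
  induction hy using Submodule.span_induction with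
  | mem y hy => obtain ⟨j, rfl, rfl⟩ := hy; exact b.comm_iff.1 (h j)
  | zero => simp
  | add y z _ _ hy hz =>
    simp only [map_add, LinearMap.add_apply, hy, hz, smul_add]; abel
  | smul c y _ hy =>
    simp only [map_smul, LinearMap.smul_apply, hy, smul_add, smul_comm c]

theorem comm_of_basis {f : List ι →₀ k} (h : ∀ i j, b.Comm p i j f) {a c : ZMod 2}
    {x y : L} (hx : x ∈ (LieSuperalgebra.grading (k := k) (L := L)).gr a)
    (hy : y ∈ (LieSuperalgebra.grading (k := k) (L := L)).gr c) :
    b.op p x (b.op p y f) = sgn k (a * c) • b.op p y (b.op p x f) +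
      b.op p (LieSuperalgebra.br (k := k) x y) f := by
  rw [b.span_gr] at hy
  induction hy using Submodule.span_induction with
  | mem y hy =>
    obtain ⟨j, rfl, rfl⟩ := hy
    exact b.comm_of_basis_right (fun i => h i j) hx
  | zero => simp
  | add y z _ _ hy hz =>
    simp only [map_add, LinearMap.add_apply, hy, hz, smul_add]; abel
  | smul c y _ hy =>
    simp only [map_smul, LinearMap.smul_apply, hy, smul_add, smul_comm c]

/-- The commutation relation holds by definition at words that start after `j`. -/
theorem comm_of_normal {i j : ι} (hji : j < i) {w : List ι} (h : Normal (b.q p) (j :: w)) :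
    b.Comm p i j (Finsupp.single w 1) := by
  rw [comm_iff]
  rw [b.op_X_single j w, b.nf_of_normal h, op_X_single, nf_red, b.red_swap h hji, map_add, map_smul,
    op_X_single, op_nf, op_X_single]
  rfl

theorem op_pow_single {i : ι} {w : List ι} {n : ℕ}
    (h : Normal (b.q p) (List.replicate n i ++ w)) :
    (b.op p (b.X i) ^ n) (Finsupp.single w 1) = Finsupp.single (List.replicate n i ++ w) 1 := by
  induction n with
  | zero => simp
  | succ n ih =>
    rw [List.replicate_succ, List.cons_append] at h ⊢
    rw [pow_succ', Module.End.mul_apply, ih h.of_cons, op_X_single, b.nf_of_normal h]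

theorem normal_replicate_append {i : ι} {w : List ι} (hw : Normal (b.q p) w)
    (hi : ∀ j ∈ w, i < j) {n : ℕ} (hn : n < b.q p i) :
    Normal (b.q p) (List.replicate n i ++ w) := by
  have hc : w.count i = 0 := List.count_eq_zero_of_not_mem fun h => lt_irrefl _ (hi i h)
  induction n with
  | zero => simpa using hw
  | succ n ih =>
    rw [List.replicate_succ, List.cons_append]
    refine b.normal_cons.2 ⟨ih (by omega), ?_, ?_⟩
    · intro j hj
      rcases List.mem_append.1 hj with hj | hj
      · exact (List.eq_of_mem_replicate hj).ge
      · exact (hi j hj).le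
    · rw [List.count_append, List.count_replicate_self, hc]; omega

/-- The power relation holds by definition at words with letters greater than `i`. -/
theorem pow_of_normal {i : ι} {w : List ι} (hw : Normal (b.q p) w) (hi : ∀ j ∈ w, i < j) :
    (b.op p (b.X i) ^ b.q p i) (Finsupp.single w 1) =
      b.op p (b.P p i) (Finsupp.single w 1) := by
  have h2 := b.two_le_q (p := p) i
  have hn := b.normal_replicate_append hw hi (n := b.q p i - 1) (by omega)
  have e : b.q p i = (b.q p i - 1) + 1 := by omega
  rw [e, pow_succ', Module.End.mul_apply, b.op_pow_single hn, op_X_single, nf_red, b.red_pow hn]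
  rfl

/-- The Leibniz rule for moving an element through a power of an even basis vector. -/
theorem op_op_pow {i : ι} (hi : b.par i = 0) {n s : ℕ}
    (H : ∀ g ∈ b.Z k p (n + s), ∀ j, b.Comm p j i g) {f : List ι →₀ k} (hf : f ∈ b.Z k p n)
    {c : ZMod 2} {y : L} (hy : y ∈ (LieSuperalgebra.grading (k := k) (L := L)).gr c) {t : ℕ}
    (ht : t ≤ s + 1) :
    b.op p y ((b.op p (b.X i) ^ t) f) = ∑ u ∈ Finset.range (t + 1),
      t.choose u • (b.op p (b.X i) ^ (t - u))
        (b.op p ((fun z => LieSuperalgebra.br (k := k) z (b.X i))^[u] y) f) := by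
  induction t generalizing y with
  | zero => simp
  | succ t ih =>
    have hm := b.mem i
    rw [hi] at hm
    have hy' : LieSuperalgebra.br (k := k) y (b.X i) ∈
        (LieSuperalgebra.grading (k := k) (L := L)).gr c := by
      simpa using LieSuperalgebra.br_mem (k := k) hy hm
    have hg : (b.op p (b.X i) ^ t) f ∈ b.Z k p (n + s) :=
      b.Z_mono (by omega) (b.op_pow_mem (b.X i) hf t)
    rw [pow_succ' _ t, Module.End.mul_apply, b.comm_of_basis_right (H _ hg) hy, ih hy (by omega),
      ih hy' (by omega), hi, mul_zero, sgn_zero, one_smul, map_sum]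
    rw [Finset.sum_choose_succ_nsmul (fun u v => (b.op p (b.X i) ^ v)
        (b.op p ((fun z => LieSuperalgebra.br (k := k) z (b.X i))^[u] y) f)) t]
    congr 1
    refine Finset.sum_congr rfl fun u hu => ?_
    have hu : u < t + 1 := Finset.mem_range.1 hu
    rw [map_nsmul, ← Module.End.mul_apply, ← pow_succ', Nat.sub_add_comm (by omega)]

/-- In characteristic `p` only the extremal terms of a binomial sum of exponent `p` survive. -/
theorem sum_choose_prime {M : Type*} [AddCommGroup M] [Module k M] (F : ℕ → M) :
    ∑ u ∈ Finset.range (p + 1), p.choose u • F u = F 0 + F p := by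
  have hp : p.Prime := Fact.out
  rw [Finset.sum_range_succ, Finset.sum_eq_single_of_mem 0 (by simp [hp.pos])]
  · simp
  · intro u hu hu0
    rw [← Nat.cast_smul_eq_nsmul k, (CharP.cast_eq_zero_iff k p _).2
      (hp.dvd_choose_self hu0 (Finset.mem_range.1 hu)), zero_smul]

end HomBasis

namespace HomBasis

variable {k : Type*} {p : ℕ} {L ι : Type*} [Field k] [AddCommGroup L] [Module k L]
  [RestrictedLieSuperalgebra k p L] (b : HomBasis k L ι)
  [CharP k p] [Fact (2 < p)] [Fact p.Prime] [LinearOrder ι]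

/-! ### The relations hold for the action -/

variable (k p) in
/-- The relations hold in total degree at most `N`. -/
structure RelUpTo (N : ℕ) : Prop where
  comm : ∀ n, n + 2 ≤ N → ∀ f ∈ b.Z k p n, ∀ i j, b.Comm p i j f
  pow : ∀ i n, n + b.q p i ≤ N → ∀ f ∈ b.Z k p n,
    (b.op p (b.X i) ^ b.q p i) f = b.op p (b.P p i) f

variable {b} {N : ℕ}

/-- The ambiguity `x_i x_j ^ q`, `j < i`. -/
theorem RelUpTo.comm_of_overflow (H : b.RelUpTo k p N) {i j : ι} (hji : j < i) {w : List ι}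
    (hw : Normal (b.q p) w) (hj : ∀ l ∈ w, j < l) (hN : b.q p j + w.length ≤ N) :
    b.Comm p i j (Finsupp.single (List.replicate (b.q p j - 1) j ++ w) 1) := by
  have h2 := b.two_le_q (p := p) j
  have hn := b.normal_replicate_append hw hj (n := b.q p j - 1) (by omega)
  set f : List ι →₀ k := Finsupp.single w 1 with hf
  have hfZ : f ∈ b.Z k p w.length := b.single_mem_Z hw le_rfl
  have hpow : (b.op p (b.X j) ^ b.q p j) f = b.op p (b.P p j) f := b.pow_of_normal hw hj
  -- The normal form of `i :: w` involves shorter words, where the relation is known by induction,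
  -- and rearrangements of `i :: w`, whose letters still exceed `j`, so that the power relation
  -- holds there by definition.
  have hpow' : (b.op p (b.X j) ^ b.q p j) (b.op p (b.X i) f) =
      b.op p (b.P p j) (b.op p (b.X i) f) := by
    rw [hf, op_X_single]
    refine eq_of_mem_supported (b.nf_mem (i :: w)) fun v hv => ?_
    rcases hv with ⟨hv, hv' | hv'⟩
    · refine H.pow j w.length (by omega) _ (b.single_mem_Z hv ?_)
      simp at hv'; omega
    · refine b.pow_of_normal hv fun l hl => ?_
      rcases List.mem_cons.1 (hv'.mem_iff.1 hl) with rfl | hl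
      · exact hji
      · exact hj l hl
  -- All words met below have at least one letter fewer than `j^(q-1) w`, so the known commutation
  -- relations apply to them.
  have hcomm : ∀ g ∈ b.Z k p (w.length + (b.q p j - 2)), ∀ i j, b.Comm p i j g :=
    fun g hg => H.comm _ (by omega) g hg
  have hP := b.comm_of_basis (hcomm f (b.Z_mono (by omega) hfZ)) (b.mem i) (b.P_mem (p := p) j)
  rw [mul_zero, sgn_zero, one_smul] at hP
  -- The left side is now `x_i x_j^q f = x_i P_j f = P_j x_i f + [x_i, P_j] f`, with `P_j x_i f =
  -- x_j^q x_i f`; it remains to expand the right side.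
  rw [← b.op_pow_single hn, comm_iff, ← Module.End.mul_apply (b.op p (b.X j)), ← pow_succ',
    show b.q p j - 1 + 1 = b.q p j by omega, hpow, hP, ← hpow', b.br_P_right j (b.mem i)]
  have hm := b.mem j
  rcases zmod2_cases (b.par j) with h0 | h1
  · have hq : b.q p j = p := by rw [q, if_pos h0]
    have hp2 : 2 < p := Fact.out
    rw [hq] at hcomm ⊢
    rw [h0] at hm
    have hmem' : LieSuperalgebra.br (k := k) (b.X i) (b.X j) ∈
        (LieSuperalgebra.grading (k := k) (L := L)).gr (b.par i) := by
      simpa using LieSuperalgebra.br_mem (k := k) (b.mem i) hm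
    have T1 := b.op_op_pow h0 (s := p - 2) (fun g hg l => hcomm g hg l j) hfZ (b.mem i)
      (t := p - 1) (by omega)
    have T2 := b.op_op_pow h0 (s := p - 2) (fun g hg l => hcomm g hg l j) hfZ hmem'
      (t := p - 1) (by omega)
    -- With `p` in place of `p - 1` the expansion would have only the extremal terms `x_j^p x_i` and
    -- `(ad x_j)^p x_i`; Pascal's rule splits its binomial coefficients into those of the two
    -- expansions of exponent `p - 1`.
    have S := HomBasis.sum_choose_prime (k := k) (p := p) (fun u => (b.op p (b.X j) ^ (p - u))
      (b.op p ((fun z => LieSuperalgebra.br (k := k) z (b.X j))^[u] (b.X i)) f))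
    have S' := Finset.sum_choose_succ_nsmul (fun u v => (b.op p (b.X j) ^ v)
      (b.op p ((fun z => LieSuperalgebra.br (k := k) z (b.X j))^[u] (b.X i)) f)) (p - 1)
    rw [show p - 1 + 2 = p + 1 by omega] at S'
    simp only [show p - 1 + 1 = p by omega] at S' T1 T2
    rw [S'] at S
    simp only [Nat.sub_zero, Nat.sub_self, pow_zero, Module.End.one_apply,
      Function.iterate_zero_apply] at S
    rw [T1, T2, h0, mul_zero, sgn_zero, one_smul, ← S, map_sum]
    congr 1
    refine Finset.sum_congr rfl fun u hu => ?_
    have hu : u < p := Finset.mem_range.1 hu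
    rw [map_nsmul, show p - u = p - 1 - u + 1 by omega, pow_succ', Module.End.mul_apply]
  -- For odd `x_j` two applications of the commutation relation suffice; the two terms `x_j [x_i,
  -- x_j]` have opposite signs.
  · have hq : b.q p j = 2 := by rw [q, if_neg (by rw [h1]; decide)]
    rw [hq] at hcomm ⊢
    rw [h1] at hm
    have hc := hcomm f (b.Z_mono (by omega) hfZ)
    have hmem' := LieSuperalgebra.br_mem (k := k) (b.mem i) hm
    have c1 := b.comm_iff.1 (hc i j)
    have c2 := b.comm_of_basis_right (fun l => hc l j) hmem'
    rw [h1] at c1 c2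
    simp only [show 2 - 1 = 1 from rfl, pow_one, pow_two, Module.End.mul_apply]
    rw [c1, c2, h1, map_add, map_smul, smul_add, smul_smul, sgn_mul_self, one_smul]
    rcases zmod2_cases (b.par i) with hi | hi <;> rw [hi] <;>
      simp [sgn_one, sgn_zero, one_add_one_zmod2]

/-- The commutation relation for `x_i` and `x_j` at words with letters `≥ j`, `j < i`. -/
theorem RelUpTo.comm_of_le (H : b.RelUpTo k p N) {i j : ι} (hji : j < i) {w : List ι}
    (hw : Normal (b.q p) w) (hj : ∀ l ∈ w, j ≤ l) (hN : w.length + 1 ≤ N) :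
    b.Comm p i j (Finsupp.single w 1) := by
  by_cases h : Normal (b.q p) (j :: w)
  · exact b.comm_of_normal hji h
  · rcases b.not_normal_cases hw h with ⟨l, v, rfl, hl⟩ | ⟨v, rfl, hv⟩
    · exact absurd (hj l (by simp)) (not_le_of_gt hl)
    · have h2 := b.two_le_q (p := p) j
      refine H.comm_of_overflow hji (hw.sublist (List.sublist_append_right _ _)) hv ?_
      rw [List.length_append, List.length_replicate] at hN
      omega

/-- The normal form of `l :: w` consists of shorter words, covered by induction, and of
rearrangements, whose letters are still at least `j`. -/
theorem RelUpTo.comm_of_le_perm (H : b.RelUpTo k p N) {i j l : ι} (hji : j < i) {w : List ι}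
    (hjl : j ≤ l) (hj : ∀ l ∈ w, j ≤ l) (hN : w.length + 2 ≤ N) :
    b.Comm p i j (b.op p (b.X l) (Finsupp.single w 1)) := by
  rw [op_X_single]
  refine Comm.of_supported b (b.nf_mem _) fun v hv => ?_
  rcases hv with ⟨hv, hv' | hv'⟩
  · refine H.comm w.length hN _ (b.single_mem_Z hv ?_) i j
    simp at hv'; omega
  · refine H.comm_of_le hji hv (fun u hu => ?_) ?_
    · rcases List.mem_cons.1 (hv'.mem_iff.1 hu) with rfl | hu
      · exact hjl
      · exact hj u hu
    · rw [hv'.length_eq, List.length_cons]; omega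

/-- The ambiguity `x_i x_j x_l`, `l < j < i`. -/
theorem RelUpTo.comm_of_lt (H : b.RelUpTo k p N) {i j l : ι} (hji : j < i) (hlj : l < j)
    {w : List ι} (hw : Normal (b.q p) (l :: w)) (hN : w.length + 2 ≤ N) :
    b.Comm p i j (Finsupp.single (l :: w) 1) := by
  have hl := (List.pairwise_cons.1 hw.1).1
  have hw' := hw.of_cons
  have e : (Finsupp.single (l :: w) 1 : List ι →₀ k) =
      b.op p (b.X l) (Finsupp.single w 1) := by
    rw [op_X_single, b.nf_of_normal hw]
  rw [e]
  set f : List ι →₀ k := Finsupp.single w 1 with hf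
  have hc := H.comm _ hN f (b.single_mem_Z hw' le_rfl)
  -- The smallest letter `l` can be moved to the front across both `x_j w` and `x_i w`; all other
  -- exchanges take place on `w`, where they are known. The difference of the two ways to sort `x_i
  -- x_j x_l` is then the Jacobi identity.
  have A := b.comm_iff.1 (H.comm_of_le_perm (hlj.trans hji) hlj.le hl hN)
  have B := b.comm_iff.1 (H.comm_of_le_perm hlj (hlj.trans hji).le hl hN)
  rw [← hf] at A B
  have ij := b.comm_iff.1 (hc i j)
  have il := b.comm_iff.1 (hc i l)
  have jl := b.comm_iff.1 (hc j l)
  have i_jl := b.comm_of_basis hc (b.mem i) (LieSuperalgebra.br_mem (k := k) (b.mem j) (b.mem l))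
  have j_il := b.comm_of_basis hc (b.mem j) (LieSuperalgebra.br_mem (k := k) (b.mem i) (b.mem l))
  have ij_l := b.comm_of_basis hc (LieSuperalgebra.br_mem (k := k) (b.mem i) (b.mem j)) (b.mem l)
  have J := congrArg (fun x => b.op p x f)
    (LieSuperalgebra.br_jacobi (k := k) (b.X l) (b.mem i) (b.mem j))
  simp only [map_add, map_smul, LinearMap.add_apply, LinearMap.smul_apply] at J
  rw [comm_iff, jl, il, map_add, map_add, map_smul, map_smul, A, B, ij, ij_l, i_jl, j_il, J]
  simp only [map_add, map_smul, smul_add, smul_smul, mul_add, add_mul, sgn_add]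
  rw [mul_comm (b.par j) (b.par i)]
  generalize b.par i = x
  generalize b.par j = y
  generalize b.par l = z
  rcases zmod2_cases x with rfl | rfl <;> rcases zmod2_cases y with rfl | rfl <;>
    rcases zmod2_cases z with rfl | rfl <;>
    simp only [mul_zero, mul_one, sgn_zero, sgn_one] <;> module

/-- The commutation relation in total degree `N + 1`, except for squares of odd elements. -/
theorem RelUpTo.comm_succ (H : b.RelUpTo k p N) {i j : ι} (hij : i ≠ j ∨ b.par i = 0) {n : ℕ}
    (hn : n + 1 ≤ N) {f : List ι →₀ k} (hf : f ∈ b.Z k p n) : b.Comm p i j f := by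
  refine Comm.of_supported b hf ?_
  rintro w ⟨hw, hwn⟩
  have key : ∀ i j, j < i → b.Comm p i j (Finsupp.single w 1) := by
    intro i j hji
    by_cases hj : ∀ l ∈ w, j ≤ l
    · exact H.comm_of_le hji hw hj (by omega)
    · cases w with
      | nil => simp at hj
      | cons l w =>
        have hlj : l < j := by
          push Not at hj
          obtain ⟨u, hu, huj⟩ := hj
          rcases List.mem_cons.1 hu with rfl | hu
          · exact huj
          · exact lt_of_le_of_lt ((List.pairwise_cons.1 hw.1).1 u hu) huj
        refine H.comm_of_lt hji hlj hw ?_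
        simp at hwn; omega
  rcases lt_trichotomy i j with h | rfl | h
  · exact (key j i h).symm
  · have h0 : b.par i = 0 := by tauto
    rw [comm_iff, br_self_even (p := p) (h0 ▸ b.mem i), h0, mul_zero, sgn_zero, one_smul, map_zero,
      LinearMap.zero_apply, add_zero]
  · exact key i j h

/-- The power relation in total degree `N + 1`. -/
theorem RelUpTo.pow_succ (H : b.RelUpTo k p N) (i : ι) {n : ℕ}
    (hn : n + b.q p i ≤ N + 1) {f : List ι →₀ k} (hf : f ∈ b.Z k p n) :
    (b.op p (b.X i) ^ b.q p i) f = b.op p (b.P p i) f := by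
  have h2 := b.two_le_q (p := p) i
  have hPm := b.P_mem (p := p) i
  refine eq_of_mem_supported hf ?_
  rintro w ⟨hw, hwn⟩
  by_cases hi : ∀ j ∈ w, i ≤ j
  -- On `i^a v` with letters of `v` beyond `i`, the power acts directly on `v`, and the resulting
  -- `P_i` commutes with `x_i^a`.
  · obtain ⟨v, hv, hv'⟩ := eq_replicate_append hw.1 hi
    set a := w.count i with ha
    have hlen : a + v.length ≤ n := by
      rw [hv, List.length_append, List.length_replicate] at hwn; exact hwn
    clear_value a
    subst hv
    have hvn : Normal (b.q p) v := hw.sublist (List.sublist_append_right _ _)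
    rw [← b.op_pow_single hw, ← Module.End.mul_apply, ← pow_add, add_comm, pow_add,
      Module.End.mul_apply, b.pow_of_normal hvn hv']
    have key : ∀ s, s ≤ a → (b.op p (b.X i) ^ s) (b.op p (b.P p i) (Finsupp.single v 1)) =
        b.op p (b.P p i) ((b.op p (b.X i) ^ s) (Finsupp.single v 1)) := by
      intro s
      induction s with
      | zero => intro _; simp
      | succ s ih =>
        intro hs
        rw [_root_.pow_succ', Module.End.mul_apply, ih (by omega), Module.End.mul_apply]
        have hg := b.op_pow_mem (b.X i) (b.single_mem_Z hvn (le_refl v.length)) s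
        have := b.comm_of_basis (H.comm _ (by omega) _ hg) (b.mem i) hPm
        rw [this, b.br_P_self, mul_zero, sgn_zero, one_smul, map_zero, LinearMap.zero_apply,
          add_zero]
    exact key a le_rfl
  · cases w with
    | nil => simp at hi
    | cons l w =>
      have hli : l < i := by
        push Not at hi
        obtain ⟨u, hu, hui⟩ := hi
        rcases List.mem_cons.1 hu with rfl | hu
        · exact hui
        · exact lt_of_le_of_lt ((List.pairwise_cons.1 hw.1).1 u hu) hui
      have hwn : w.length + 1 ≤ n := by simpa using hwn
      have hw' := hw.of_cons
      have e : (Finsupp.single (l :: w) 1 : List ι →₀ k) =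
          b.op p (b.X l) (Finsupp.single w 1) := by
        rw [op_X_single, b.nf_of_normal hw]
      rw [e]
      set f : List ι →₀ k := Finsupp.single w 1 with hf
      have hfZ : f ∈ b.Z k p w.length := b.single_mem_Z hw' le_rfl
      have hP := b.comm_of_basis (H.comm _ (by omega) f hfZ) (b.mem l) hPm
      rw [mul_zero, sgn_zero, one_smul] at hP
      have hpow := H.pow i _ (by omega) f hfZ
      -- On `w` the power is already known to act as `P_i`. So it suffices that moving `x_l` through
      -- `x_i^q` produces the same bracket as moving it through `P_i`.
      suffices h : b.op p (b.X l) ((b.op p (b.X i) ^ b.q p i) f) =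
          (b.op p (b.X i) ^ b.q p i) (b.op p (b.X l) f) +
            b.op p (LieSuperalgebra.br (k := k) (b.X l) (b.P p i)) f by
        rw [hpow, hP] at h
        exact (add_right_cancel h).symm
      rw [b.br_P_right i (b.mem l)]
      rcases zmod2_cases (b.par i) with h0 | h1
      · have hq : b.q p i = p := by rw [q, if_pos h0]
        have hp2 : 2 < p := Fact.out
        rw [hq] at hn ⊢
        -- The Leibniz rule is needed up to exponent `p`, where the commutation relations reach
        -- total degree `N + 1`; hence `comm_succ` has to precede.
        have T := b.op_op_pow h0 (s := p - 1) (n := w.length)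
          (fun g hg j => (H.comm_succ (Or.inr h0) (by omega) hg).symm) hfZ (b.mem l)
          (t := p) (by omega)
        rw [T, HomBasis.sum_choose_prime (k := k) (p := p) (fun u => (b.op p (b.X i) ^ (p - u))
          (b.op p ((fun z => LieSuperalgebra.br (k := k) z (b.X i))^[u] (b.X l)) f))]
        simp
      · have hq : b.q p i = 2 := by rw [q, if_neg (by rw [h1]; decide)]
        rw [hq] at hn ⊢
        have hm := b.mem i
        rw [h1] at hm
        have hmem' := LieSuperalgebra.br_mem (k := k) (b.mem l) hm
        have c0 := b.comm_iff.1 (H.comm_succ (i := l) (j := i) (Or.inl hli.ne) (by omega)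
          (b.op_mem (b.X i) hfZ))
        have hc := H.comm _ (by omega) f hfZ
        have c1 := b.comm_iff.1 (hc l i)
        have c2 := b.comm_of_basis_right (fun j => hc j i) hmem'
        rw [h1] at c0 c1 c2
        simp only [pow_two, Module.End.mul_apply]
        rw [c0, c1, c2, map_add, map_smul, smul_add, smul_smul, sgn_mul_self, one_smul]
        rcases zmod2_cases (b.par l) with hl | hl <;> rw [hl] <;>
          simp [sgn_one, sgn_zero, one_add_one_zmod2]

variable (b)

/-- The induction step depends on an order: commutation in degree `N + 1` apart from odd squares,
then the power relations, and the odd squares last. -/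
theorem relUpTo (N : ℕ) : b.RelUpTo k p N := by
  induction N with
  | zero =>
    exact ⟨fun n hn => by omega, fun i n hn => by have := b.two_le_q (p := p) i; omega⟩
  | succ N H =>
    refine ⟨fun n hn f hf i j => ?_, fun i n hn f hf => H.pow_succ i hn hf⟩
    by_cases hij : i ≠ j ∨ b.par i = 0
    · exact H.comm_succ hij (by omega) hf
    · push Not at hij
      obtain ⟨rfl, h0⟩ := hij
      have h1 : b.par i = 1 := (zmod2_cases _).resolve_left h0
      have hq : b.q p i = 2 := by rw [q, if_neg h0]
      -- For an odd letter `q i = 2` and `P i = ½ [x_i, x_i]`, so the power relation is the missing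
      -- commutation relation.
      have := H.pow_succ i (n := n) (by omega) hf
      rw [hq, P, dif_neg h0, pow_two, Module.End.mul_apply, map_smul, LinearMap.smul_apply] at this
      rw [comm_iff, h1, mul_one, sgn_one, neg_one_smul, eq_neg_add_iff_add_eq, this, ← two_smul k,
        smul_smul, mul_inv_cancel₀ (two_ne k p), one_smul]

theorem nf_mem_Z (f : List ι →₀ k) : ∃ n, b.nf p f ∈ b.Z k p n := by
  induction f using Finsupp.induction_linear with
  | zero => exact ⟨0, by simp⟩
  | add f g hf hg =>
    obtain ⟨m, hm⟩ := hf
    obtain ⟨n, hn⟩ := hg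
    refine ⟨max m n, ?_⟩
    rw [map_add]
    exact Submodule.add_mem _ (b.Z_mono (le_max_left _ _) hm) (b.Z_mono (le_max_right _ _) hn)
  | single w c =>
    refine ⟨w.length, ?_⟩
    rw [← mul_one c, ← smul_eq_mul, ← Finsupp.smul_single, map_smul]
    refine Submodule.smul_mem _ _ (Finsupp.supported_mono ?_ (b.nf_mem w))
    rintro v ⟨hv, h | h⟩
    · exact ⟨hv, h.le⟩
    · exact ⟨hv, h.length_eq.le⟩

/-- The operators depend only on the normal form of their argument, and this lies in some `Z n`,
where `relUpTo` applies. -/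
theorem op_comm {a c : ZMod 2} {x y : L}
    (hx : x ∈ (LieSuperalgebra.grading (k := k) (L := L)).gr a)
    (hy : y ∈ (LieSuperalgebra.grading (k := k) (L := L)).gr c) :
    b.op p x * b.op p y = sgn k (a * c) • (b.op p y * b.op p x) +
      b.op p (LieSuperalgebra.br (k := k) x y) := by
  refine LinearMap.ext fun f => ?_
  obtain ⟨n, hn⟩ := b.nf_mem_Z (p := p) f
  have := b.comm_of_basis ((b.relUpTo (n + 2)).comm n le_rfl _ hn) hx hy
  simp only [op_nf] at this
  exact this

theorem op_pow (i : ι) : b.op p (b.X i) ^ b.q p i = b.op p (b.P p i) := by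
  refine LinearMap.ext fun f => ?_
  obtain ⟨n, hn⟩ := b.nf_mem_Z (p := p) f
  have h2 := b.two_le_q (p := p) i
  have := (b.relUpTo (n + b.q p i)).pow i n le_rfl _ hn
  obtain ⟨m, hm⟩ : ∃ m, b.q p i = m + 1 := ⟨b.q p i - 1, by omega⟩
  rw [hm, _root_.pow_succ, Module.End.mul_apply, op_nf, op_nf] at this
  rw [hm, _root_.pow_succ, Module.End.mul_apply]
  exact this

end HomBasis

/-! ### Jacobson's formula -/

section Jacobson

variable {k : Type*} [Field k] (p : ℕ) [CharP k p] [Fact p.Prime] [Fact (2 < p)]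

theorem choose_pred_prime {j : ℕ} (hj : j < p) : ((p - 1).choose j : k) = (-1) ^ j := by
  have hp : p.Prime := Fact.out
  induction j with
  | zero => simp
  | succ j ih =>
    have h1 : p.choose (j + 1) = (p - 1).choose j + (p - 1).choose (j + 1) := by
      obtain ⟨m, rfl⟩ : ∃ m, p = m + 1 := ⟨p - 1, by omega⟩
      exact Nat.choose_succ_succ m j
    have h2 : ((p.choose (j + 1) : ℕ) : k) = 0 :=
      (CharP.cast_eq_zero_iff k p _).2 (hp.dvd_choose_self (by omega) hj)
    rw [h1, Nat.cast_add, ih (by omega)] at h2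
    rw [pow_succ, mul_neg_one]
    exact (neg_eq_of_add_eq_zero_right h2).symm

variable (k) in
/-- The commutator of an associative algebra. -/
def commutator (S : Type*) [Ring S] [Algebra k S] : S →ₗ[k] S →ₗ[k] S :=
  LinearMap.mul k S - (LinearMap.mul k S).flip

@[simp]
theorem commutator_apply {S : Type*} [Ring S] [Algebra k S] (x y : S) :
    commutator k S x y = x * y - y * x := by
  simp [commutator]

/-- Left and right multiplication by `z` commute, so the power of their difference expands by the
binomial theorem; modulo `p` the coefficient `choose (p-1) j` is `(-1)^j` and cancels the sign of
the right multiplications. -/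
theorem commutator_iterate_pred {S : Type*} [Ring S] [Algebra k S] (z c : S) :
    (commutator k S z)^[p - 1] c = ∑ j ∈ Finset.range p, z ^ j * c * z ^ (p - 1 - j) := by
  have hp : p.Prime := Fact.out
  have hodd : Odd p := HomBasis.odd_p
  have e : commutator k S z = LinearMap.mulLeft k z + -LinearMap.mulRight k z := by
    ext y; simp [sub_eq_add_neg]
  have hc : Commute (LinearMap.mulLeft k z) (-LinearMap.mulRight k z) := by
    unfold Commute SemiconjBy
    ext y
    simp [mul_assoc]
  have hneg : ∀ (n : ℕ) (y : S), ((-1 : Module.End k S) ^ n) y = (-1 : k) ^ n • y := by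
    intro n y
    induction n with
    | zero => simp
    | succ n ih =>
      rw [pow_succ', Module.End.mul_apply, ih, pow_succ', neg_one_mul, neg_smul]
      simp
  rw [← Module.End.pow_apply, e, hc.add_pow, show p - 1 + 1 = p from Nat.sub_add_cancel hp.one_le,
    LinearMap.sum_apply]
  refine Finset.sum_congr rfl fun j hj => ?_
  have hj : j < p := Finset.mem_range.1 hj
  rw [← nsmul_eq_mul', LinearMap.smul_apply, ← Nat.cast_smul_eq_nsmul k, choose_pred_prime p hj,
    neg_pow (LinearMap.mulRight k z), Module.End.mul_apply, Module.End.mul_apply,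
    LinearMap.pow_mulLeft,
    LinearMap.pow_mulRight]
  have h2 : (LinearMap.mulRight k (z ^ (p - 1 - j))) c = c * z ^ (p - 1 - j) := rfl
  have h3 : (-1 : k) ^ j * (-1) ^ (p - 1 - j) = 1 := by
    rw [← pow_add, show j + (p - 1 - j) = p - 1 by omega]
    obtain ⟨m, rfl⟩ := hodd
    simp
  rw [h2, hneg, LinearMap.mulLeft_apply, mul_smul_comm, smul_smul, h3, one_smul, mul_assoc]

open Polynomial in
theorem derivative_pow_sum {S : Type*} [Ring S] (z : S[X]) (n : ℕ) :
    derivative (z ^ n) = ∑ j ∈ Finset.range n, z ^ j * derivative z * z ^ (n - 1 - j) := by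
  induction n with
  | zero => simp
  | succ n ih =>
    rw [pow_succ, derivative_mul, ih, Finset.sum_range_succ, Finset.sum_mul]
    simp only [Nat.add_sub_cancel, Nat.sub_self, pow_zero, mul_one, add_left_inj]
    refine Finset.sum_congr rfl fun j hj => ?_
    have hj : j < n := Finset.mem_range.1 hj
    rw [mul_assoc, ← pow_succ, show n - 1 - j + 1 = n - j by omega]

open Polynomial in
-- The variable is central, so taking coefficients turns the commutator with `t x + y` into the
-- recursion of `adCoeff`.
theorem coeff_commutator_iterate {S : Type*} [Ring S] [Algebra k S] (x y : S) (n i : ℕ) :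
    ((commutator k S[X] (X * C x + C y))^[n] (C x)).coeff i =
      adCoeff (commutator k S) x y n i := by
  induction n generalizing i with
  | zero =>
    cases i with
    | zero => simp [adCoeff]
    | succ i => simp [adCoeff]
  | succ n ih =>
    rw [Function.iterate_succ_apply', commutator_apply]
    have hX : ∀ g : S[X], X * C x * g = X * (C x * g) := fun g => mul_assoc _ _ _
    have hX' : ∀ g : S[X], g * (X * C x) = X * (g * C x) := fun g => by
      rw [← mul_assoc, ← X_mul, mul_assoc]
    cases i with
    | zero => simp [adCoeff, add_mul, mul_add, ← ih]
    | succ i =>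
      simp only [adCoeff, add_mul, mul_add, hX, hX', coeff_sub, coeff_add, coeff_X_mul, coeff_C_mul,
        coeff_mul_C, ih, commutator_apply]
      abel

open Polynomial in
/-- Jacobson's formula for the `p`-th power of a sum. -/
theorem add_pow_jacobson {S : Type*} [Ring S] [Algebra k S] (x y : S) :
    (x + y) ^ p = x ^ p + y ^ p +
      ∑ i ∈ Finset.Icc 1 (p - 1), (i : k)⁻¹ • adCoeff (commutator k S) x y (p - 1) (i - 1) := by
  have hp : p.Prime := Fact.out
  set z : S[X] := X * C x + C y with hz
  have hd : derivative z = C x := by simp [hz]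
  have hdeg : (z ^ p).natDegree < p + 1 := by
    refine Nat.lt_succ_of_le (natDegree_pow_le.trans ?_)
    have : z.natDegree ≤ 1 := by
      refine (natDegree_add_le _ _).trans (max_le ?_ (by simp))
      rw [X_mul]
      simpa using natDegree_C_mul_X_pow_le x 1
    simpa using Nat.mul_le_mul_left p this
  have hcoeff : ∀ i, 1 ≤ i → i < p →
      (z ^ p).coeff i = (i : k)⁻¹ • adCoeff (commutator k S) x y (p - 1) (i - 1) := by
    intro i hi hip
    -- The derivative of `z^p` is `∑ z^j x z^(p-1-j) = (ad z)^(p-1)(x)`. Its coefficient at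
    -- `t^(i-1)` is `i` times that of `z^p` at `t^i`, and `i` is invertible for `0 < i < p`.
    have h := derivative_pow_sum z p
    rw [hd, ← commutator_iterate_pred (k := k) p z (C x)] at h
    have h' := congrArg (fun g => g.coeff (i - 1)) h
    simp only [coeff_derivative, hz, coeff_commutator_iterate] at h'
    rw [← h', show i - 1 + 1 = i by omega, ← Nat.cast_succ, Nat.succ_eq_add_one,
      show i - 1 + 1 = i by omega, ← nsmul_eq_mul', ← Nat.cast_smul_eq_nsmul k, smul_smul,
      inv_mul_cancel₀, one_smul]
    intro h0
    exact absurd (Nat.le_of_dvd hi ((CharP.cast_eq_zero_iff k p i).1 h0)) (by omega)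
  have h0 : (z ^ p).coeff 0 = y ^ p := by
    have : ∀ n, (z ^ n).coeff 0 = y ^ n := by
      intro n
      induction n with
      | zero => simp
      | succ n ih => rw [pow_succ, mul_coeff_zero, ih, pow_succ]; simp [hz]
    exact this p
  have hpc : (z ^ p).coeff p = x ^ p := by
    have : ∀ n, (z ^ n).coeff n = x ^ n ∧ (z ^ n).natDegree ≤ n := by
      intro n
      induction n with
      | zero => simp
      | succ n ih =>
        have h1 : z ^ (n + 1) = X * (z ^ n * C x) + z ^ n * C y := by
          rw [pow_succ, hz, mul_add, ← mul_assoc, ← X_mul, mul_assoc]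
        constructor
        · rw [h1, coeff_add, coeff_X_mul, coeff_mul_C, coeff_mul_C, ih.1,
            coeff_eq_zero_of_natDegree_lt (Nat.lt_succ_of_le ih.2), zero_mul, add_zero, pow_succ]
        · refine natDegree_pow_le.trans ?_
          have : z.natDegree ≤ 1 := by
            refine (natDegree_add_le _ _).trans (max_le ?_ (by simp))
            rw [X_mul]
            simpa using natDegree_C_mul_X_pow_le x 1
          simpa using Nat.mul_le_mul_left (n + 1) this
    exact (this p).1
  -- Evaluation at `1` is multiplicative although the coefficients do not commute, because `1` is
  -- central.
  have heval : (z ^ p).eval 1 = (x + y) ^ p := by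
    have := map_pow (eval₂RingHom' (RingHom.id S) 1 (fun a => Commute.one_right _)) z p
    simpa [eval₂RingHom', eval₂_id, hz] using this
  rw [← heval, eval_eq_sum_range' hdeg, Finset.sum_range_succ]
  obtain ⟨m, hm⟩ : ∃ m, p = m + 1 := ⟨p - 1, by have := hp.one_le; omega⟩
  have hsum : ∑ i ∈ Finset.range p, (z ^ p).coeff i * 1 ^ i = y ^ p +
      ∑ i ∈ Finset.Icc 1 (p - 1), (i : k)⁻¹ • adCoeff (commutator k S) x y (p - 1) (i - 1) := by
    rw [Finset.range_eq_Ico, Finset.sum_eq_sum_Ico_succ_bot hp.pos, h0, one_pow, mul_one]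
    congr 1
    have : Finset.Ico (0 + 1) p = Finset.Icc 1 (p - 1) := by
      ext i; simp; omega
    rw [this]
    refine Finset.sum_congr rfl fun i hi => ?_
    have hi := Finset.mem_Icc.1 hi
    rw [one_pow, mul_one, hcoeff i hi.1 (by omega)]
  rw [hsum, hpc, one_pow, mul_one]
  abel

end Jacobson

namespace HomBasis

variable {k : Type*} {p : ℕ} {L ι : Type*} [Field k] [AddCommGroup L] [Module k L]
  [RestrictedLieSuperalgebra k p L] (b : HomBasis k L ι)
  [CharP k p] [Fact (2 < p)] [Fact p.Prime] [LinearOrder ι]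

theorem adCoeff_mem {x y : L} (hx : x ∈ (LieSuperalgebra.grading (k := k) (L := L)).gr 0)
    (hy : y ∈ (LieSuperalgebra.grading (k := k) (L := L)).gr 0) (n i : ℕ) :
    adCoeff (LieSuperalgebra.br (k := k)) x y n i ∈
      (LieSuperalgebra.grading (k := k) (L := L)).gr 0 := by
  induction n generalizing i with
  | zero => cases i <;> simp [adCoeff, hx]
  | succ n ih =>
    have h1 : ∀ i, LieSuperalgebra.br (k := k) y (adCoeff (LieSuperalgebra.br (k := k)) x y n i) ∈
        (LieSuperalgebra.grading (k := k) (L := L)).gr 0 := fun i => by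
      simpa using LieSuperalgebra.br_mem (k := k) hy (ih i)
    have h2 : ∀ i, LieSuperalgebra.br (k := k) x (adCoeff (LieSuperalgebra.br (k := k)) x y n i) ∈
        (LieSuperalgebra.grading (k := k) (L := L)).gr 0 := fun i => by
      simpa using LieSuperalgebra.br_mem (k := k) hx (ih i)
    cases i with
    | zero => exact h1 0
    | succ i => exact Submodule.add_mem _ (h2 i) (h1 (i + 1))

/-- A linear map to an associative algebra that satisfies the commutation relations and the power
relations at an even basis satisfies the power relations at all even elements. -/
theorem pow_of_basis {S : Type*} [Ring S] [Algebra k S] (F : L →ₗ[k] S)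
    (hF : ∀ {x y : L}, x ∈ (LieSuperalgebra.grading (k := k) (L := L)).gr 0 →
      y ∈ (LieSuperalgebra.grading (k := k) (L := L)).gr 0 →
        F (LieSuperalgebra.br (k := k) x y) = F x * F y - F y * F x)
    (h : ∀ i, b.par i = 0 → F (b.X i) ^ p = F (b.P p i))
    (x : (LieSuperalgebra.grading (k := k) (L := L)).gr 0) :
    F (x : L) ^ p = F (RestrictedLieSuperalgebra.pmap (p := p) x : L) := by
  have hp : p.Prime := Fact.out
  obtain ⟨x, hx⟩ := x
  have hx' := hx
  rw [b.span_gr] at hx'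
  induction hx' using Submodule.span_induction with
  | mem x hx' =>
    obtain ⟨j, hj, rfl⟩ := hx'
    have hj : b.par j = 0 := hj
    change F (b.X j) ^ p = _
    rw [h j hj, P, dif_pos hj]
  | zero =>
    have := RestrictedLieSuperalgebra.pmap_smul (k := k) (p := p) (L := L) 0 ⟨0, hx⟩
    rw [zero_pow hp.ne_zero, zero_smul, zero_smul] at this
    have h0 : (⟨0, hx⟩ : (LieSuperalgebra.grading (k := k) (L := L)).gr 0) = 0 := rfl
    rw [h0, this]
    simp [hp.ne_zero]
  | add x y hx1 hy1 ihx ihy =>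
    rw [← b.span_gr] at hx1 hy1
    -- The correction terms on both sides are the same: `F` turns brackets of even elements into
    -- commutators, hence the terms of `pmap` into those of Jacobson's formula.
    have e := RestrictedLieSuperalgebra.pmap_add (k := k) (p := p) (L := L) ⟨x, hx1⟩ ⟨y, hy1⟩
    have e' : (⟨x + y, hx⟩ : (LieSuperalgebra.grading (k := k) (L := L)).gr 0) =
      ⟨x, hx1⟩ + ⟨y, hy1⟩ := rfl
    have key : ∀ n i, F (adCoeff (LieSuperalgebra.br (k := k)) x y n i) =
        adCoeff (commutator k S) (F x) (F y) n i := by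
      intro n
      induction n with
      | zero => intro i; cases i <;> simp [adCoeff]
      | succ n ih =>
        intro i
        cases i with
        | zero =>
          simp only [adCoeff, hF hy1 (adCoeff_mem hx1 hy1 n _), ih, commutator_apply]
        | succ i =>
          simp only [adCoeff, map_add, hF hy1 (adCoeff_mem hx1 hy1 n _),
            hF hx1 (adCoeff_mem hx1 hy1 n _), ih, commutator_apply]
    rw [e', e, map_add, map_add, map_sum, ← ihx hx1, ← ihy hy1]
    change F (x + y) ^ p = _
    rw [map_add, add_pow_jacobson (k := k) p (F x) (F y)]
    simp only [map_smul, key]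
  | smul c x hx1 ih =>
    rw [← b.span_gr] at hx1
    have e := RestrictedLieSuperalgebra.pmap_smul (k := k) (p := p) (L := L) c ⟨x, hx1⟩
    have e' : (⟨c • x, hx⟩ : (LieSuperalgebra.grading (k := k) (L := L)).gr 0) =
      c • ⟨x, hx1⟩ := rfl
    rw [e', e]
    change F (c • x) ^ p = _
    rw [map_smul, smul_pow, ih hx1, Submodule.coe_smul, map_smul]

/-! ### The theorem of Poincaré, Birkhoff and Witt -/

theorem op_pmap (x : (LieSuperalgebra.grading (k := k) (L := L)).gr 0) :
    b.op p (x : L) ^ p = b.op p (RestrictedLieSuperalgebra.pmap (p := p) x : L) := by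
  refine b.pow_of_basis (S := Module.End k (List ι →₀ k)) (b.op p) ?_ ?_ x
  · intro x y hx hy
    rw [b.op_comm hx hy, zero_mul, sgn_zero, one_smul]; abel
  · intro i hi
    have := b.op_pow (p := p) i
    rwa [q, if_pos hi] at this

variable (p) in
/-- The action of `U'(L)` on the span of the words. -/
def rep : REnv k p L →ₐ[k] Module.End k (List ι →₀ k) :=
  REnv.lift (B := Module.End k (List ι →₀ k)) (b.op p) (fun hx hy => b.op_comm hx hy) b.op_pmap

theorem rep_ι (x : L) : b.rep p (REnv.ι k p L x) = b.op p x := REnv.lift_ι _ _ _ x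

variable (p) in
/-- The element of `U'(L)` that is given by a word. -/
def ev (w : List ι) : REnv k p L := (w.map fun i => REnv.ι k p L (b.X i)).prod

theorem ev_cons (i : ι) (w : List ι) :
    b.ev p (i :: w) = REnv.ι k p L (b.X i) * b.ev p w := by simp [ev]

/-- Acting on the empty word computes normal forms. With `evL_rep` it follows that distinct normal
words stay linearly independent in `U'(L)`. -/
theorem rep_ev (w : List ι) :
    b.rep p (b.ev p w) (Finsupp.single [] 1) = b.nf p (Finsupp.single w 1) := by
  induction w with
  | nil => rw [b.nf_of_normal b.normal_nil]; simp [ev]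
  | cons i w ih =>
    rw [ev_cons, map_mul, Module.End.mul_apply, ih, rep_ι, op_nf, op_X_single]

variable (p) in
/-- The linear extension of the evaluation of words. -/
def evL : (List ι →₀ k) →ₗ[k] REnv k p L := Finsupp.linearCombination k (b.ev p)

theorem evL_single (w : List ι) : b.evL p (Finsupp.single w 1) = b.ev p w := by simp [evL]

theorem evL_consL (x : L) (f : List ι →₀ k) :
    b.evL p (b.consL x f) = REnv.ι k p L x * b.evL p f := by
  have h : ∀ x : L, b.evL p ∘ₗ b.consL x = LinearMap.mulLeft k (REnv.ι k p L x) ∘ₗ b.evL p := by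
    intro x
    apply Finsupp.lhom_ext'
    intro w
    apply LinearMap.ext_ring
    simp only [LinearMap.comp_apply, Finsupp.lsingle_apply, LinearMap.mulLeft_apply]
    rw [evL_single]
    have h : (b.evL p) ∘ₗ b.consL.flip (Finsupp.single w 1) =
        LinearMap.mulRight k (b.ev p w) ∘ₗ REnv.ι k p L := by
      refine b.X.ext fun i => ?_
      simp only [LinearMap.comp_apply, LinearMap.flip_apply, consL_X, evL_single,
        LinearMap.mulRight_apply, ev_cons]
    exact LinearMap.congr_fun h x
  exact LinearMap.congr_fun (h x) f

theorem ι_pow_q (i : ι) :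
    REnv.ι k p L (b.X i) ^ b.q p i = REnv.ι k p L (b.P p i) := by
  unfold q P
  split_ifs with h
  · exact REnv.ι_pow k p (L := L) ⟨b.X i, h ▸ b.mem i⟩
  · have h1 : b.par i = 1 := (zmod2_cases _).resolve_left h
    have := REnv.ι_comm k p (b.mem i) (b.mem i)
    rw [h1, mul_one, sgn_one, neg_one_smul, eq_neg_add_iff_add_eq, ← two_smul k] at this
    rw [map_smul, ← this, smul_smul, inv_mul_cancel₀ (two_ne k p), one_smul, pow_two]

/-- Each reduction rule is a relation of `U'(L)`, used inside a word. -/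
theorem evL_red (w : List ι) : b.evL p (b.red p w) = b.ev p w := by
  induction w with
  | nil => rw [b.red_of_normal b.normal_nil, evL_single]
  | cons i w ih =>
    by_cases hw : Normal (b.q p) w
    · by_cases h : Normal (b.q p) (i :: w)
      · rw [b.red_of_normal h, evL_single]
      · rcases b.not_normal_cases hw h with ⟨j, v, rfl, hji⟩ | ⟨v, rfl, hv⟩
        · rw [b.red_swap hw hji, map_add, map_smul, evL_single, evL_consL, evL_single, ev_cons,
            ev_cons, ev_cons, ev_cons, ← mul_assoc, ← mul_assoc, REnv.ι_comm k p (b.mem i) (b.mem j),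
            add_mul, smul_mul_assoc]
        · have h2 := b.two_le_q (p := p) i
          have e : ∀ n, b.ev p (List.replicate n i ++ v) =
              REnv.ι k p L (b.X i) ^ n * b.ev p v := by
            intro n; simp [ev]
          rw [b.red_pow hw, evL_consL, evL_single, ev_cons, e, ← mul_assoc, ← pow_succ',
            show b.q p i - 1 + 1 = b.q p i by omega, ι_pow_q]
    · rw [b.red_of_not_normal hw, evL_consL, ih, ev_cons]

theorem evL_nf (f : List ι →₀ k) : b.evL p (b.nf p f) = b.evL p f := by
  have : b.evL p ∘ₗ b.nf p = b.evL p := by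
    apply Finsupp.lhom_ext'
    intro w
    apply LinearMap.ext_ring
    simp only [LinearMap.comp_apply, Finsupp.lsingle_apply]
    induction w using b.word_induction (p := p) with
    | hn w h => rw [b.nf_of_normal h]
    | hr w h ih =>
      rw [nf_red, evL_single, ← evL_red]
      exact eq_of_mem_supported (A := b.evL p ∘ₗ b.nf p) (b.red_less h) ih
  exact LinearMap.congr_fun this f

/-- `u ↦ u · 1` maps `U'(L)` to the normal forms, and evaluation is its inverse. -/
theorem evL_rep (u : REnv k p L) : b.evL p (b.rep p u (Finsupp.single [] 1)) = u := by
  have key : ∀ (u : REnv k p L) (f : List ι →₀ k), b.evL p (b.rep p u f) = u * b.evL p f := by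
    intro u
    induction u using REnv.induction with
    | hscalar c => intro f; rw [AlgHom.commutes, ← Algebra.smul_def]; simp
    | hadd u w hu hw => intro f; simp [hu, hw, add_mul]
    | hmul u w hu hw => intro f; rw [map_mul, Module.End.mul_apply, hu, hw, mul_assoc]
    | hι x => intro f; rw [rep_ι, ← evL_consL, ← evL_nf _ (b.consL x f)]; rfl
  rw [key, evL_single]; simp [ev]

theorem nf_nf (f : List ι →₀ k) : b.nf p (b.nf p f) = b.nf p f := by
  obtain ⟨n, hn⟩ := b.nf_mem_Z (p := p) f
  exact eq_of_mem_supported (A := b.nf p) (B := LinearMap.id) hn fun w hw => b.nf_of_normal hw.1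

theorem nf_op (x : L) (f : List ι →₀ k) : b.nf p (b.op p x f) = b.op p x f := b.nf_nf _

end HomBasis

/-! ### Bases adapted to a subalgebra -/

section Adapted

variable {k : Type*} {p : ℕ} {L ι V : Type*} [Field k] [AddCommGroup L] [Module k L]
  [RestrictedLieSuperalgebra k p L] [AddCommGroup V] [Module k V] [LinearOrder ι]
  {h : RestrictedSub k p L} {n m : ℕ}

/-- A homogeneous basis of `L` that consists of a basis of `h`, followed by a basis of a
supplement. -/
structure AdaptedBasis (s : SupplementBasis h n m) (ι : Type*) [LinearOrder ι] extends
    HomBasis k L ι where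
  right : Fin n ⊕ Fin m → ι
  X_right : ∀ r, X (right r) = Sum.elim s.e s.ε r
  par_right : ∀ r, par (right r) = Sum.elim (fun _ => 0) (fun _ => 1) r
  left_or_right : ∀ i, X i ∈ h.carrier ∨ ∃ r, i = right r
  right_notMem : ∀ r, X (right r) ∉ h.carrier
  lt_right : ∀ i r, X i ∈ h.carrier → i < right r
  repr_right : ∀ x ∈ h.carrier, ∀ r, X.repr x (right r) = 0
  right_lt : ∀ r t, Sum.Lex (· < ·) (· < ·) r t → right r < right t

namespace AdaptedBasis

variable {s : SupplementBasis h n m} (b : AdaptedBasis s ι)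

theorem right_injective : Function.Injective b.right := by
  have key : ∀ r t : Fin n ⊕ Fin m, r = t ∨ Sum.Lex (· < ·) (· < ·) r t ∨
      Sum.Lex (· < ·) (· < ·) t r := by
    rintro (i | i) (j | j)
    · rcases lt_trichotomy i j with h | rfl | h <;> simp_all
    · simp
    · simp
    · rcases lt_trichotomy i j with h | rfl | h <;> simp_all
  intro r t hrt
  rcases key r t with h | h | h
  · exact h
  · exact absurd hrt (b.right_lt _ _ h).ne
  · exact absurd hrt (b.right_lt _ _ h).ne'

theorem mem_of_lt {i j : ι} (hi : b.X i ∈ h.carrier) (hji : j < i) : b.X j ∈ h.carrier := by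
  rcases b.left_or_right j with hj | ⟨r, rfl⟩
  · exact hj
  · exact absurd hji (not_lt_of_gt (b.lt_right i r hi))

/-- All letters belong to `h`. -/
def IsLeft (w : List ι) : Prop := ∀ i ∈ w, b.X i ∈ h.carrier

/-- No letter belongs to `h`. -/
def IsRight (w : List ι) : Prop := ∀ i ∈ w, ∃ r, i = b.right r

variable (p) in
/-- The words that consist of letters in `h`, followed by a normal word with letters outside. -/
def Split : Set (List ι) :=
  {w | ∃ u v, w = u ++ v ∧ b.IsLeft u ∧ b.IsRight v ∧ Normal (b.q p) v}

/-- Letters of `h` precede all others, so they form an initial segment of a nondecreasing word. -/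
theorem split_of_normal {w : List ι} (hw : Normal (b.q p) w) : w ∈ b.Split p := by
  induction w with
  | nil => exact ⟨[], [], rfl, by simp [IsLeft], by simp [IsRight], hw⟩
  | cons i w ih =>
    obtain ⟨u, v, huv, hu, hv, hn⟩ := ih hw.of_cons
    rcases b.left_or_right i with hi | ⟨r, rfl⟩
    · refine ⟨i :: u, v, by rw [huv]; rfl, ?_, hv, hn⟩
      intro j hj
      rcases List.mem_cons.1 hj with rfl | hj
      · exact hi
      · exact hu j hj
    · refine ⟨[], b.right r :: w, rfl, by simp [IsLeft], ?_, hw⟩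
      intro j hj
      rcases List.mem_cons.1 hj with rfl | hj
      · exact ⟨r, rfl⟩
      · rcases b.left_or_right j with hj' | hj'
        · exact absurd ((List.pairwise_cons.1 hw.1).1 j hj) (not_le_of_gt (b.lt_right j r hj'))
        · exact hj'

theorem cons_mem_split {i : ι} (hi : b.X i ∈ h.carrier) {w : List ι} (hw : w ∈ b.Split p) :
    i :: w ∈ b.Split p := by
  obtain ⟨u, v, rfl, hu, hv, hn⟩ := hw
  refine ⟨i :: u, v, rfl, ?_, hv, hn⟩
  intro j hj
  rcases List.mem_cons.1 hj with rfl | hj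
  · exact hi
  · exact hu j hj

theorem consL_mem_split {x : L} (hx : x ∈ h.carrier) {f : List ι →₀ k}
    (hf : f ∈ Finsupp.supported k k (b.Split p)) :
    b.consL x f ∈ Finsupp.supported k k (b.Split p) := by
  refine map_mem_of_mem_supported hf fun w hw => ?_
  rw [HomBasis.consL, Module.Basis.constr_apply, Finsupp.sum, LinearMap.sum_apply]
  refine Submodule.sum_mem _ fun i hi => ?_
  rcases b.left_or_right i with hi' | ⟨r, rfl⟩
  · rw [LinearMap.smul_apply, Finsupp.lmapDomain_apply, Finsupp.mapDomain_single]
    exact Submodule.smul_mem _ _ (single_mem_supported (b.cons_mem_split hi' hw) 1)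
  · rw [b.repr_right x hx, zero_smul]
    exact Submodule.zero_mem _

variable (σ : RestrictedRep k p h.carrier V)

open Classical in
/-- The action of a letter on `V`, the letters outside `h` acting as the identity. -/
def letter (i : ι) : Module.End k V := if hi : b.X i ∈ h.carrier then σ.ρ ⟨b.X i, hi⟩ else 1

theorem letter_left {i : ι} (hi : b.X i ∈ h.carrier) : b.letter σ i = σ.ρ ⟨b.X i, hi⟩ :=
  dif_pos hi

theorem letter_right (r : Fin n ⊕ Fin m) : b.letter σ (b.right r) = 1 :=
  dif_neg (b.right_notMem r)

variable [Fact p.Prime]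

variable (p) in
/-- The exponents of the letters outside `h`. -/
def exps (w : List ι) : MIdx p n m :=
  (fun i => ⟨w.count (b.right (Sum.inl i)) % p, Nat.mod_lt _ (Fact.out : p.Prime).pos⟩,
    fun t => ⟨w.count (b.right (Sum.inr t)) % 2, Nat.mod_lt _ two_pos⟩)

theorem exps_cons {i : ι} (hi : b.X i ∈ h.carrier) (w : List ι) :
    b.exps p (i :: w) = b.exps p w := by
  have : ∀ r, i ≠ b.right r := fun r => (b.lt_right i r hi).ne
  simp only [exps, List.count_cons_of_ne (this _)]

/-- The functional on words that sends `u v`, where `u` has letters in `h` and `v` has letters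
outside `h`, to `u · F (exponents of v)`. -/
def functional (F : MIdx p n m → V) : (List ι →₀ k) →ₗ[k] V :=
  Finsupp.linearCombination k fun w => (w.map (b.letter σ)).prod (F (b.exps p w))

variable (F : MIdx p n m → V)

theorem functional_single (w : List ι) : b.functional σ F (Finsupp.single w 1) =
    (w.map (b.letter σ)).prod (F (b.exps p w)) := by
  simp [functional]

theorem functional_cons {i : ι} (hi : b.X i ∈ h.carrier) (w : List ι) :
    b.functional σ F (Finsupp.single (i :: w) 1) =
      σ.ρ ⟨b.X i, hi⟩ (b.functional σ F (Finsupp.single w 1)) := by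
  rw [functional_single, functional_single, List.map_cons, List.prod_cons, b.exps_cons hi,
    b.letter_left σ hi]
  rfl

theorem functional_consL (x : h.carrier) (f : List ι →₀ k) :
    b.functional σ F (b.consL (x : L) f) = σ.ρ x (b.functional σ F f) := by
  have key : ∀ x : h.carrier, (x : L) ∈ Submodule.span k (b.X '' {i | b.X i ∈ h.carrier}) := by
    intro x
    have := b.X.linearCombination_repr (x : L)
    rw [← this, Finsupp.linearCombination_apply, Finsupp.sum]
    refine Submodule.sum_mem _ fun i _ => ?_
    rcases b.left_or_right i with hi | ⟨r, rfl⟩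
    · exact Submodule.smul_mem _ _ (Submodule.subset_span ⟨i, hi, rfl⟩)
    · rw [b.repr_right _ x.2, zero_smul]
      exact Submodule.zero_mem _
  have key2 : ∀ y ∈ Submodule.span k (b.X '' {i | b.X i ∈ h.carrier}), ∀ hy : y ∈ h.carrier,
      ∀ f : List ι →₀ k, b.functional σ F (b.consL y f) = σ.ρ ⟨y, hy⟩ (b.functional σ F f) := by
    intro y hy
    induction hy using Submodule.span_induction with
    | mem y hy =>
      obtain ⟨i, hi, rfl⟩ := hy
      intro hy f
      have : b.functional σ F ∘ₗ b.consL (b.X i) = σ.ρ ⟨b.X i, hy⟩ ∘ₗ b.functional σ F := by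
        apply Finsupp.lhom_ext'
        intro w
        apply LinearMap.ext_ring
        simp only [LinearMap.comp_apply, Finsupp.lsingle_apply]
        rw [b.consL_X, b.functional_cons σ F hy]
      exact LinearMap.congr_fun this f
    | zero =>
      intro hy f
      have : (⟨0, hy⟩ : h.carrier) = 0 := rfl
      rw [this]; simp
    | add y z hy1 hz1 ihy ihz =>
      intro hy f
      have hle : Submodule.span k (b.X '' {i | b.X i ∈ h.carrier}) ≤ h.carrier := by
        rw [Submodule.span_le]; rintro _ ⟨i, hi, rfl⟩; exact hi
      have : (⟨y + z, hy⟩ : h.carrier) = ⟨y, hle hy1⟩ + ⟨z, hle hz1⟩ := rfl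
      rw [this, map_add, map_add, LinearMap.add_apply, LinearMap.add_apply, map_add,
        ihy (hle hy1), ihz (hle hz1)]
    | smul c y hy1 ihy =>
      intro hy f
      have hle : Submodule.span k (b.X '' {i | b.X i ∈ h.carrier}) ≤ h.carrier := by
        rw [Submodule.span_le]; rintro _ ⟨i, hi, rfl⟩; exact hi
      have : (⟨c • y, hy⟩ : h.carrier) = c • ⟨y, hle hy1⟩ := rfl
      rw [this, map_smul, map_smul, LinearMap.smul_apply, LinearMap.smul_apply, map_smul,
        ihy (hle hy1)]
  exact key2 _ (key x) x.2 f

variable [CharP k p] [Fact (2 < p)]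

theorem P_mem_left {i : ι} (hi : b.X i ∈ h.carrier) : b.P p i ∈ h.carrier := by
  unfold HomBasis.P
  split_ifs with h0
  · exact h.pmap_mem _ hi
  · exact Submodule.smul_mem _ _ (h.br_mem hi hi)

theorem ρ_P {i : ι} (hi : b.X i ∈ h.carrier) :
    σ.ρ ⟨b.P p i, b.P_mem_left hi⟩ = σ.ρ ⟨b.X i, hi⟩ ^ b.q p i := by
  have hm := b.mem i
  rcases zmod2_cases (b.par i) with h0 | h1
  · have e := σ.map_pmap ⟨⟨b.X i, hi⟩, (h0 ▸ hm : _ ∈ _)⟩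
    rw [HomBasis.q, if_pos h0, ← e]
    congr 1
    apply Subtype.ext
    simp only [HomBasis.P, dif_pos h0]
    rfl
  · have h0 : ¬b.par i = 0 := by rw [h1]; decide
    have hx : (⟨b.X i, hi⟩ : h.carrier) ∈ (LieSuperalgebra.grading (k := k) (L := h.carrier)).gr 1 :=
      (h1 ▸ hm : b.X i ∈ _)
    have e := σ.map_br hx hx
    rw [mul_one, sgn_one, neg_one_smul, sub_neg_eq_add, ← two_smul k] at e
    rw [HomBasis.q, if_neg h0, pow_two]
    have e2 : (⟨b.P p i, b.P_mem_left hi⟩ : h.carrier) =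
        (2 : k)⁻¹ • LieSuperalgebra.br (k := k) (⟨b.X i, hi⟩ : h.carrier) ⟨b.X i, hi⟩ := by
      apply Subtype.ext
      simp only [HomBasis.P, dif_neg h0]
      rfl
    rw [e2, map_smul, e, smul_smul, inv_mul_cancel₀ (two_ne k p), one_smul]

/-- Reduction of words does not change the functional. -/
theorem functional_red {w : List ι} (hw : w ∈ b.Split p) :
    b.red p w ∈ Finsupp.supported k k (b.Split p) ∧
      b.functional σ F (b.red p w) = b.functional σ F (Finsupp.single w 1) := by
  induction w with
  | nil => rw [b.red_of_normal b.normal_nil]; exact ⟨single_mem_supported hw 1, rfl⟩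
  | cons i w ih =>
    by_cases hn : Normal (b.q p) (i :: w)
    · rw [b.red_of_normal hn]; exact ⟨single_mem_supported hw 1, rfl⟩
    obtain ⟨u, v, huv, hu, hv, hvn⟩ := hw
    cases u with
    | nil =>
      rw [List.nil_append] at huv
      exact absurd (huv ▸ hvn) hn
    | cons i' u =>
      rw [List.cons_append, List.cons.injEq] at huv
      obtain ⟨rfl, rfl⟩ := huv
      have hi : b.X i ∈ h.carrier := hu i (by simp)
      have hu' : b.IsLeft u := fun j hj => hu j (by simp [hj])
      have hw' : u ++ v ∈ b.Split p := ⟨u, v, rfl, hu', hv, hvn⟩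
      by_cases hwn : Normal (b.q p) (u ++ v)
      -- The tail is normal, so the reduction takes place at the head `i`, a letter of `h`. It
      -- involves only letters up to `i`, which all belong to `h`: it becomes a relation of the
      -- representation on `V` and leaves the exponents outside `h` untouched.
      · rcases b.not_normal_cases hwn hn with ⟨j, w, hjw, hji⟩ | ⟨w, hjw, hjv⟩
        · have hj := b.mem_of_lt hi hji
          have hws : w ∈ b.Split p := by
            cases u with
            | nil =>
              rw [List.nil_append] at hjw
              obtain ⟨r, hr⟩ := hv j (by rw [hjw]; simp)
              exact absurd (hr ▸ hj) (b.right_notMem r)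
            | cons j' u =>
              rw [List.cons_append, List.cons.injEq] at hjw
              exact ⟨u, v, hjw.2.symm, fun l hl => hu' l (by simp [hl]), hv, hvn⟩
          have hbr := h.br_mem hi hj
          rw [hjw] at hwn ⊢
          rw [b.red_swap hwn hji]
          refine ⟨Submodule.add_mem _ (Submodule.smul_mem _ _ (single_mem_supported
            (b.cons_mem_split hj (b.cons_mem_split hi hws)) 1)) (b.consL_mem_split hbr
              (single_mem_supported hws 1)), ?_⟩
          have e := σ.map_br (x := ⟨b.X i, hi⟩) (y := ⟨b.X j, hj⟩) (b.mem i) (b.mem j)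
          have e' := LinearMap.congr_fun e (b.functional σ F (Finsupp.single w 1))
          rw [map_add, map_smul, b.functional_cons σ F hj, b.functional_cons σ F hi,
            b.functional_cons σ F hi, b.functional_cons σ F hj]
          rw [show LieSuperalgebra.br (k := k) (b.X i) (b.X j) =
              ((LieSuperalgebra.br (k := k) (⟨b.X i, hi⟩ : h.carrier) ⟨b.X j, hj⟩ : h.carrier) : L)
            from rfl, functional_consL, e']
          simp
        · have hq := b.two_le_q (p := p) i
          have hws : w ∈ b.Split p := by
            rcases List.append_eq_append_iff.1 hjw with ⟨c, hc, hc'⟩ | ⟨c, hc, hc'⟩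
            · have : c = [] := by
                cases c with
                | nil => rfl
                | cons l c =>
                  have hl : l = i := by
                    refine List.eq_of_mem_replicate (n := b.q p i - 1) ?_
                    rw [hc]; simp
                  obtain ⟨r, hr⟩ := hv l (by rw [hc']; simp)
                  rw [hl] at hr
                  exact absurd (hr ▸ hi) (b.right_notMem r)
              subst this
              rw [List.nil_append] at hc'
              exact ⟨[], w, rfl, by simp [IsLeft], hc' ▸ hv, hc' ▸ hvn⟩
            · exact ⟨c, v, hc', fun l hl => hu' l (by rw [hc]; simp [hl]), hv, hvn⟩
          rw [hjw] at hwn ⊢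
          rw [b.red_pow hwn]
          refine ⟨b.consL_mem_split (b.P_mem_left hi) (single_mem_supported hws 1), ?_⟩
          have hpow : ∀ a, b.functional σ F (Finsupp.single (List.replicate a i ++ w) 1) =
              (σ.ρ ⟨b.X i, hi⟩ ^ a) (b.functional σ F (Finsupp.single w 1)) := by
            intro a
            induction a with
            | zero => simp
            | succ a ih =>
              rw [List.replicate_succ, List.cons_append, b.functional_cons σ F hi, ih, pow_succ',
                Module.End.mul_apply]
          rw [b.functional_cons σ F hi, hpow, ← Module.End.mul_apply, ← pow_succ',
            show b.q p i - 1 + 1 = b.q p i by omega, ← b.ρ_P σ hi]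
          exact b.functional_consL σ F ⟨b.P p i, b.P_mem_left hi⟩ _
      · obtain ⟨h1, h2⟩ := ih hw'
        rw [b.red_of_not_normal hwn]
        refine ⟨b.consL_mem_split hi h1, ?_⟩
        rw [b.functional_cons σ F hi, ← h2]
        exact b.functional_consL σ F ⟨b.X i, hi⟩ _

/-- Reduction preserves both the set `Split` and the functional, so induction along reduction
applies. -/
theorem functional_nf {f : List ι →₀ k} (hf : f ∈ Finsupp.supported k k (b.Split p)) :
    b.functional σ F (b.nf p f) = b.functional σ F f := by
  refine eq_of_mem_supported (A := b.functional σ F ∘ₗ b.nf p) hf fun w hw => ?_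
  rw [LinearMap.comp_apply]
  induction w using b.word_induction (p := p) with
  | hn w hn => rw [b.nf_of_normal hn]
  | hr w hn ih =>
    obtain ⟨h1, h2⟩ := b.functional_red σ F hw
    rw [b.nf_red, ← h2]
    refine eq_of_mem_supported (A := b.functional σ F ∘ₗ b.nf p)
      (s := b.Split p ∩ {v | Less v w}) ?_ (fun v hv => ih v hv.2 hv.1)
    rw [Finsupp.mem_supported]
    exact Set.subset_inter ((Finsupp.mem_supported k _).1 h1)
      ((Finsupp.mem_supported k _).1 (b.red_less hn))

/-- The element of the coinduced representation with prescribed values on monomials. -/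
def extend : Coind h σ :=
  ⟨b.functional σ F ∘ₗ b.nf p ∘ₗ LinearMap.applyₗ (Finsupp.single [] 1) ∘ₗ (b.rep p).toLinearMap,
    mem_coind (by
      intro i x hx u
      change b.functional σ F (b.nf p (b.rep p (REnv.ι k p L (x : L) * u) (Finsupp.single [] 1))) =
        σ.ρ x (b.functional σ F (b.nf p (b.rep p u (Finsupp.single [] 1))))
      set g := b.rep p u (Finsupp.single [] 1)
      obtain ⟨N, hN⟩ := b.nf_mem_Z (p := p) g
      -- Equivariance is only available on `Split`, which contains the normal words; hence `nf` is
      -- part of the definition.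
      have hs : b.nf p g ∈ Finsupp.supported k k (b.Split p) :=
        Finsupp.supported_mono (fun w hw => b.split_of_normal hw.1) hN
      rw [map_mul, Module.End.mul_apply, b.rep_ι, b.nf_op, ← b.op_nf]
      change b.functional σ F (b.nf p (b.consL (x : L) (b.nf p g))) = _
      rw [b.functional_nf σ F (b.consL_mem_split x.2 hs), functional_consL])⟩

theorem extend_ev {w : List ι} (hw : Normal (b.q p) w) (hr : b.IsRight w) :
    (b.extend σ F).1 (b.ev p w) = F (b.exps p w) := by
  change b.functional σ F (b.nf p (b.rep p (b.ev p w) (Finsupp.single [] 1))) = _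
  rw [b.rep_ev, b.nf_nf, b.nf_of_normal hw, functional_single]
  have : (w.map (b.letter σ)).prod = 1 := by
    apply List.prod_eq_one
    intro x hx
    obtain ⟨i, hi, rfl⟩ := List.mem_map.1 hx
    obtain ⟨r, rfl⟩ := hr i hi
    exact b.letter_right σ r
  rw [this, Module.End.one_apply]

end AdaptedBasis

end Adapted

/-! ### Monomials as words -/

section Monomials

/-- Multiplicities of letters in words over `Fin n ⊕ Fin m` are counted by Boolean equality, which
must agree with equality. -/
instance {α β : Type*} [BEq α] [BEq β] [LawfulBEq α] [LawfulBEq β] : LawfulBEq (α ⊕ β) where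
  eq_of_beq {x y} h := by
    rcases x with a | a <;> rcases y with b | b
    · exact congrArg Sum.inl (eq_of_beq (show (a == b) = true from h))
    · cases h
    · cases h
    · exact congrArg Sum.inr (eq_of_beq (show (a == b) = true from h))
  rfl {x} := by
    rcases x with a | a
    · exact (beq_self_eq_true a : (a == a) = true)
    · exact (beq_self_eq_true a : (a == a) = true)

variable {n m : ℕ}

/-- The order of the letters in a monomial. -/
abbrev letterLE : Fin n ⊕ Fin m → Fin n ⊕ Fin m → Prop := Sum.Lex (· ≤ ·) (· ≤ ·)

/-- The number of times a letter may occur in a monomial, plus one. -/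
def letterBound (p : ℕ) : Fin n ⊕ Fin m → ℕ := Sum.elim (fun _ => p) (fun _ => 2)

/-- The words that are monomials. -/
def IsMon (p : ℕ) (w : List (Fin n ⊕ Fin m)) : Prop :=
  w.Pairwise letterLE ∧ ∀ r, w.count r < letterBound p r

theorem IsMon.sublist {p : ℕ} {v w : List (Fin n ⊕ Fin m)} (h : IsMon p w) (hv : v.Sublist w) :
    IsMon p v :=
  ⟨h.1.sublist hv, fun r => lt_of_le_of_lt (hv.count_le r) (h.2 r)⟩

theorem IsMon.eq_of_count {p : ℕ} {v w : List (Fin n ⊕ Fin m)} (hv : IsMon p v) (hw : IsMon p w)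
    (h : ∀ r, v.count r = w.count r) : v = w :=
  List.Perm.eq_of_pairwise' hv.1 hw.1 (List.perm_iff_count.2 h)

/-- The exponent of a letter in a monomial. -/
def MIdx.exp {p : ℕ} (I : MIdx p n m) : Fin n ⊕ Fin m → ℕ :=
  Sum.elim (fun i => (I.1 i : ℕ)) (fun t => (I.2 t : ℕ))

theorem MIdx.ext_exp {p : ℕ} {I J : MIdx p n m} (h : ∀ r, I.exp r = J.exp r) : I = J :=
  Prod.ext (funext fun i => Fin.ext (h (Sum.inl i))) (funext fun t => Fin.ext (h (Sum.inr t)))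

theorem MIdx.exp_lt {p : ℕ} (I : MIdx p n m) (r : Fin n ⊕ Fin m) : I.exp r < letterBound p r := by
  rcases r with i | t
  · exact (I.1 i).2
  · exact (I.2 t).2

/-- The word of a monomial. -/
def MIdx.word {p : ℕ} (I : MIdx p n m) : List (Fin n ⊕ Fin m) :=
  (List.ofFn fun i => List.replicate (I.1 i : ℕ) (Sum.inl i)).flatten ++
    (List.ofFn fun t => List.replicate (I.2 t : ℕ) (Sum.inr t)).flatten

theorem MIdx.count_word {p : ℕ} (I : MIdx p n m) (r : Fin n ⊕ Fin m) :
    I.word.count r = I.exp r := by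
  rw [word, List.count_append, List.count_flatten, List.count_flatten, List.map_ofFn, List.map_ofFn,
    List.sum_ofFn, List.sum_ofFn]
  rcases r with i | t
  · rw [Finset.sum_eq_single i, Finset.sum_eq_zero]
    · simp [exp]
    · intro t _; simp [List.count_replicate]
    · intro j _ hj; simp [List.count_replicate, hj]
    · simp
  · rw [Finset.sum_eq_zero, Finset.sum_eq_single t]
    · simp [exp]
    · intro j _ hj; simp [List.count_replicate, hj]
    · simp
    · intro t _; simp [List.count_replicate]

theorem MIdx.isMon_word {p : ℕ} (I : MIdx p n m) : IsMon p I.word := by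
  refine ⟨?_, fun r => I.count_word r ▸ I.exp_lt r⟩
  rw [word, List.pairwise_append]
  refine ⟨?_, ?_, ?_⟩
  · rw [List.pairwise_flatten]
    constructor
    · intro l hl
      obtain ⟨i, rfl⟩ := List.mem_ofFn.1 hl
      exact List.pairwise_replicate_of_refl
    · rw [List.pairwise_ofFn]
      intro i j hij x hx y hy
      rw [List.eq_of_mem_replicate hx, List.eq_of_mem_replicate hy]
      exact Sum.Lex.inl hij.le
  · rw [List.pairwise_flatten]
    constructor
    · intro l hl
      obtain ⟨i, rfl⟩ := List.mem_ofFn.1 hl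
      exact List.pairwise_replicate_of_refl
    · rw [List.pairwise_ofFn]
      intro i j hij x hx y hy
      rw [List.eq_of_mem_replicate hx, List.eq_of_mem_replicate hy]
      exact Sum.Lex.inr hij.le
  · intro x hx y hy
    obtain ⟨l, hl, hx⟩ := List.mem_flatten.1 hx
    obtain ⟨i, rfl⟩ := List.mem_ofFn.1 hl
    obtain ⟨l, hl, hy⟩ := List.mem_flatten.1 hy
    obtain ⟨j, rfl⟩ := List.mem_ofFn.1 hl
    rw [List.eq_of_mem_replicate hx, List.eq_of_mem_replicate hy]
    exact Sum.Lex.sep _ _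

variable {p : ℕ}

/-- The exponents of a word that is a monomial. -/
def IsMon.idx {w : List (Fin n ⊕ Fin m)} (h : IsMon p w) : MIdx p n m :=
  (fun i => ⟨w.count (Sum.inl i), h.2 (Sum.inl i)⟩, fun t => ⟨w.count (Sum.inr t), h.2 (Sum.inr t)⟩)

theorem IsMon.exp_idx {w : List (Fin n ⊕ Fin m)} (h : IsMon p w) (r : Fin n ⊕ Fin m) :
    h.idx.exp r = w.count r := by
  rcases r with i | t <;> rfl

theorem IsMon.word_idx {w : List (Fin n ⊕ Fin m)} (h : IsMon p w) : h.idx.word = w :=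
  h.idx.isMon_word.eq_of_count h fun r => by rw [MIdx.count_word, h.exp_idx]

end Monomials

/-! ### Values on monomials as free coordinates of coinduced representations -/

section Bijective

variable {k : Type*} {p : ℕ} {L V : Type*} [Field k] [AddCommGroup L] [Module k L]
  [RestrictedLieSuperalgebra k p L] [AddCommGroup V] [Module k V]
  {h : RestrictedSub k p L} {n m : ℕ}

namespace SupplementBasis

variable (s : SupplementBasis h n m)

/-- The vector of the basis of the supplement that belongs to a letter. -/
def gen : Fin n ⊕ Fin m → L := Sum.elim s.e s.ε

/-- The parity of a letter. -/
def _root_.SuperDuality.letterPar : Fin n ⊕ Fin m → ZMod 2 := Sum.elim (fun _ => 0) (fun _ => 1)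

theorem gen_mem (r : Fin n ⊕ Fin m) :
    s.gen r ∈ (LieSuperalgebra.grading (k := k) (L := L)).gr (letterPar r) := by
  rcases r with i | t
  · exact s.e_even i
  · exact s.ε_odd t

/-- The element of `U'(L)` that is given by a word. -/
def wordProd (w : List (Fin n ⊕ Fin m)) : REnv k p L :=
  (w.map fun r => REnv.ι k p L (s.gen r)).prod

theorem mon_eq_wordProd (I : MIdx p n m) : s.mon I = s.wordProd I.word := by
  rw [mon, wordProd, MIdx.word, List.map_append, List.prod_append, List.map_flatten,
    List.map_flatten, List.prod_flatten, List.prod_flatten, List.map_ofFn, List.map_ofFn,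
    List.map_ofFn, List.map_ofFn]
  simp [Function.comp_def, gen]

end SupplementBasis

namespace AdaptedBasis

variable {ι : Type*} [LinearOrder ι] {s : SupplementBasis h n m} (b : AdaptedBasis s ι)

theorem bound_right (r : Fin n ⊕ Fin m) : b.q p (b.right r) = letterBound p r := by
  rw [HomBasis.q, b.par_right]
  rcases r with i | t <;> simp [letterBound]

theorem right_le {r t : Fin n ⊕ Fin m} (h : letterLE r t) : b.right r ≤ b.right t := by
  rcases h with h | h | h
  · rename_i i j
    rcases h.eq_or_lt with rfl | h
    · exact le_rfl
    · exact (b.right_lt _ _ (Sum.Lex.inl h)).le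
  · rename_i i j
    rcases h.eq_or_lt with rfl | h
    · exact le_rfl
    · exact (b.right_lt _ _ (Sum.Lex.inr h)).le
  · exact (b.right_lt _ _ (Sum.Lex.sep _ _)).le

theorem letterLE_of_le {r t : Fin n ⊕ Fin m} (h : b.right r ≤ b.right t) : letterLE r t := by
  rcases r with i | i <;> rcases t with j | j
  · refine Sum.Lex.inl (le_of_not_gt fun hji => ?_)
    exact absurd h (not_le_of_gt (b.right_lt _ _ (Sum.Lex.inl hji)))
  · exact Sum.Lex.sep _ _
  · exact absurd h (not_le_of_gt (b.right_lt _ _ (Sum.Lex.sep _ _)))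
  · refine Sum.Lex.inr (le_of_not_gt fun hji => ?_)
    exact absurd h (not_le_of_gt (b.right_lt _ _ (Sum.Lex.inr hji)))

variable [CharP k p] [Fact (2 < p)] [Fact p.Prime]

/-- Monomials are exactly the normal words with letters outside `h`, because the order and the
exponent bounds agree on these letters. -/
theorem normal_map_right {w : List (Fin n ⊕ Fin m)} :
    Normal (b.q p) (w.map b.right) ↔ IsMon p w := by
  constructor
  · rintro ⟨h1, h2⟩
    refine ⟨(List.pairwise_map.1 h1).imp fun h => b.letterLE_of_le h, fun r => ?_⟩
    have := h2 (b.right r)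
    rwa [List.count_map_of_injective _ _ b.right_injective, bound_right] at this
  · rintro ⟨h1, h2⟩
    refine ⟨List.pairwise_map.2 (h1.imp fun h => b.right_le h), fun i => ?_⟩
    by_cases hi : i ∈ w.map b.right
    · obtain ⟨r, -, rfl⟩ := List.mem_map.1 hi
      rw [List.count_map_of_injective _ _ b.right_injective, bound_right]
      exact h2 r
    · rw [List.count_eq_zero_of_not_mem hi]
      have := b.two_le_q (p := p) i
      omega

theorem exists_map_right {w : List ι} (hw : b.IsRight w) : ∃ v : List (Fin n ⊕ Fin m), w = v.map b.right := by
  induction w with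
  | nil => exact ⟨[], rfl⟩
  | cons i w ih =>
    obtain ⟨v, rfl⟩ := ih fun j hj => hw j (by simp [hj])
    obtain ⟨r, rfl⟩ := hw i (by simp)
    exact ⟨r :: v, rfl⟩

theorem ev_map_right (w : List (Fin n ⊕ Fin m)) : b.ev p (w.map b.right) = s.wordProd w := by
  simp [HomBasis.ev, SupplementBasis.wordProd, b.X_right, Function.comp_def, SupplementBasis.gen]

theorem exps_map_right (I : MIdx p n m) : b.exps p (I.word.map b.right) = I := by
  apply MIdx.ext_exp
  intro r
  rcases r with i | t
  · change List.count _ _ % p = _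
    rw [List.count_map_of_injective _ _ b.right_injective, MIdx.count_word]
    exact Nat.mod_eq_of_lt (I.exp_lt (Sum.inl i))
  · change List.count _ _ % 2 = _
    rw [List.count_map_of_injective _ _ b.right_injective, MIdx.count_word]
    exact Nat.mod_eq_of_lt (I.exp_lt (Sum.inr t))

theorem coord_extend (σ : RestrictedRep k p h.carrier V) (F : MIdx p n m → V) :
    s.coord σ (b.extend σ F) = F := by
  funext I
  change (b.extend σ F).1 (s.mon I) = F I
  rw [s.mon_eq_wordProd, ← b.ev_map_right, b.extend_ev σ F (b.normal_map_right.2 I.isMon_word),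
    b.exps_map_right]
  intro i hi
  obtain ⟨r, -, rfl⟩ := List.mem_map.1 hi
  exact ⟨r, rfl⟩

/-- The normal words span `U'(L)`, and each is a product of letters of `h` and a monomial. By
equivariance a section that vanishes on the monomials vanishes on all of them. -/
theorem coord_injective (b : AdaptedBasis s ι) (σ : RestrictedRep k p h.carrier V) :
    Function.Injective (s.coord (p := p) σ) := by
  rw [← LinearMap.ker_eq_bot, LinearMap.ker_eq_bot']
  intro μ hμ
  have hmon : ∀ I : MIdx p n m, μ.1 (s.mon I) = 0 := fun I => congrFun hμ I
  have hleft : ∀ u : List ι, b.IsLeft u → ∀ x : REnv k p L, μ.1 x = 0 →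
      μ.1 (b.ev p u * x) = 0 := by
    intro u
    induction u with
    | nil => intro _ x hx; simpa [HomBasis.ev] using hx
    | cons i u ih =>
      intro hu x hx
      have hi := hu i (by simp)
      rw [b.ev_cons, mul_assoc]
      have := coind_apply μ ⟨b.X i, hi⟩ (b.ev p u * x)
      rw [ih (fun j hj => hu j (by simp [hj])) x hx, map_zero] at this
      exact this
  apply Subtype.ext
  refine LinearMap.ext fun u => ?_
  rw [← b.evL_rep u, ← b.evL_nf]
  obtain ⟨N, hN⟩ := b.nf_mem_Z (p := p) (b.rep p u (Finsupp.single [] 1))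
  refine eq_of_mem_supported (A := μ.1 ∘ₗ b.evL p) (B := 0) hN fun w hw => ?_
  obtain ⟨u, v, rfl, hu, hv, hvn⟩ := b.split_of_normal hw.1
  obtain ⟨v, rfl⟩ := b.exists_map_right hv
  rw [LinearMap.comp_apply, b.evL_single, LinearMap.zero_apply]
  have e : b.ev p (u ++ v.map b.right) = b.ev p u * b.ev p (v.map b.right) := by
    simp [HomBasis.ev]
  have hv' := b.normal_map_right.1 hvn
  rw [e]
  refine hleft u hu _ ?_
  rw [b.ev_map_right, ← hv'.word_idx, ← s.mon_eq_wordProd]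
  exact hmon _

theorem coord_bijective (b : AdaptedBasis s ι) (σ : RestrictedRep k p h.carrier V) :
    Function.Bijective (s.coord (p := p) σ) :=
  ⟨b.coord_injective σ, fun F => ⟨_, b.coord_extend σ F⟩⟩

end AdaptedBasis

/-- A graded subspace has a homogeneous basis. -/
theorem exists_homBasis.{u, v} (k : Type u) (L : Type v) [Field k] [AddCommGroup L] [Module k L]
    [LieSuperalgebra k L] : ∃ κ : Type v, Nonempty (HomBasis k L κ) := by
  let G := LieSuperalgebra.grading (k := k) (L := L)
  let b0 := Module.Basis.ofVectorSpace k (G.gr 0)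
  let b1 := Module.Basis.ofVectorSpace k (G.gr 1)
  let B := (b0.prod b1).map (Submodule.prodEquivOfIsCompl _ _ G.isCompl)
  refine ⟨_, ⟨B, Sum.elim (fun _ => 0) (fun _ => 1), ?_⟩⟩
  rintro (i | i)
  · simp only [Sum.elim_inl, B, Module.Basis.map_apply, Module.Basis.prod_apply,
      LinearMap.coe_inl, Function.comp_apply, Submodule.coe_prodEquivOfIsCompl',
      ZeroMemClass.coe_zero, add_zero]
    exact (b0 i).2
  · simp only [Sum.elim_inr, B, Module.Basis.map_apply, Module.Basis.prod_apply,
      LinearMap.coe_inr, Function.comp_apply, Submodule.coe_prodEquivOfIsCompl',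
      ZeroMemClass.coe_zero, zero_add]
    exact (b1 i).2

/-- Every homogeneous basis of a supplement can be completed to an adapted basis. -/
theorem SupplementBasis.exists_adaptedBasis.{u, v} {k : Type u} {p : ℕ} {L : Type v} [Field k]
    [AddCommGroup L] [Module k L] [RestrictedLieSuperalgebra k p L] {h : RestrictedSub k p L}
    {n m : ℕ} (s : SupplementBasis h n m) :
    ∃ (ι : Type v) (_ : LinearOrder ι), Nonempty (AdaptedBasis s ι) := by
  classical
  obtain ⟨κ, ⟨c⟩⟩ := exists_homBasis k h.carrier
  -- Any linear order on the basis of `h` will do; the lexicographic sum puts it before the even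
  -- letters of the supplement, and these before the odd ones.
  let _ : LinearOrder κ := linearOrderOfSTO WellOrderingRel
  let ι := Lex (κ ⊕ Lex (Fin n ⊕ Fin m))
  let v : κ ⊕ (Fin n ⊕ Fin m) → L := Sum.elim (fun i => (c.X i : L)) (Sum.elim s.e s.ε)
  have hli : LinearIndependent k v :=
    LinearIndependent.sumElim_of_quotient c.X.linearIndependent _ s.linInd
  have hsp : ⊤ ≤ Submodule.span k (Set.range v) := by
    have h1 : Submodule.span k (Set.range fun i => (c.X i : L)) = h.carrier := by
      rw [show Set.range (fun i => (c.X i : L)) = h.carrier.subtype '' Set.range c.X by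
        rw [← Set.range_comp]; rfl, ← Submodule.map_span, c.X.span_eq, Submodule.map_top,
        Submodule.range_subtype]
    rw [Set.Sum.elim_range, Submodule.span_union, h1, top_le_iff,
      ← Submodule.map_mkQ_eq_top, Submodule.map_span, ← Set.range_comp]
    exact s.span
  let B0 : Module.Basis (κ ⊕ (Fin n ⊕ Fin m)) k L := Module.Basis.mk hli hsp
  let E : κ ⊕ (Fin n ⊕ Fin m) ≃ ι := (Equiv.sumCongr (Equiv.refl κ) toLex).trans toLex
  have hB0 : ∀ x, B0 x = v x := fun x => by simp [B0]
  have hleft : ∀ i : κ, v (Sum.inl i) ∈ h.carrier := fun i => (c.X i).2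
  have hrepr : ∀ x ∈ h.carrier, ∀ r, B0.repr x (Sum.inr r) = 0 := by
    intro x hx r
    have : B0.coord (Sum.inr r) ∘ₗ h.carrier.subtype = 0 := by
      refine c.X.ext fun i => ?_
      have : (c.X i : L) = B0 (Sum.inl i) := (hB0 (Sum.inl i)).symm
      simp [this]
    exact LinearMap.congr_fun this ⟨x, hx⟩
  have hB : ∀ x, B0.reindex E (E x) = v x := fun x => by simp [hB0]
  have hright : ∀ r, v (Sum.inr r) ∉ h.carrier := by
    intro r hr
    have := hrepr _ hr r
    rw [← hB0, Module.Basis.repr_self, Finsupp.single_eq_same] at this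
    exact one_ne_zero this
  have hcases : ∀ i : ι, (∃ a, i = E (Sum.inl a)) ∨ ∃ r, i = E (Sum.inr r) := by
    intro i
    obtain ⟨x, rfl⟩ := E.surjective i
    rcases x with a | r
    · exact Or.inl ⟨a, rfl⟩
    · exact Or.inr ⟨r, rfl⟩
  refine ⟨ι, inferInstance, ⟨{
    X := B0.reindex E
    par := fun i => Sum.elim c.par (Sum.elim (fun _ => 0) (fun _ => 1)) (E.symm i)
    mem := ?_
    right := fun r => E (Sum.inr r)
    X_right := fun r => hB _
    par_right := fun r => by simp
    left_or_right := ?_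
    right_notMem := fun r => by rw [hB]; exact hright r
    lt_right := ?_
    repr_right := fun x hx r => by simpa using hrepr x hx r
    right_lt := ?_ }⟩⟩
  · intro i
    rcases hcases i with ⟨a, rfl⟩ | ⟨r, rfl⟩
    · rw [hB, Equiv.symm_apply_apply]
      exact c.mem a
    · rw [hB, Equiv.symm_apply_apply]
      rcases r with i | t
      · exact s.e_even i
      · exact s.ε_odd t
  · intro i
    rcases hcases i with ⟨a, rfl⟩ | ⟨r, rfl⟩
    · left; rw [hB]; exact hleft a
    · right; exact ⟨r, rfl⟩
  · intro i r hi
    rcases hcases i with ⟨a, rfl⟩ | ⟨t, rfl⟩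
    · exact Sum.Lex.inl_lt_inr _ _
    · rw [hB] at hi; exact absurd hi (hright t)
  · intro r t hrt
    exact Sum.Lex.toLex_lt_toLex.2 (Sum.Lex.inr (Sum.Lex.toLex_lt_toLex.2 hrt))

variable [CharP k p] [Fact (2 < p)] [Fact p.Prime]

/-- The values on the monomials determine the elements of the coinduced representation, and are
arbitrary. -/
theorem SupplementBasis.coord_bijective (s : SupplementBasis h n m)
    (σ : RestrictedRep k p h.carrier V) : Function.Bijective (s.coord (p := p) σ) := by
  obtain ⟨ι, _, ⟨b⟩⟩ := s.exists_adaptedBasis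
  exact b.coord_bijective σ

end Bijective

/-! ### Convolution -/

section Convolution

open GradedTensorProduct

variable {k : Type*} {p : ℕ} {L : Type*} [Field k] [AddCommGroup L] [Module k L]
  [RestrictedLieSuperalgebra k p L]

/-- Induction on elements of `U'(L)` by multiplication with elements of `L` on the right. -/
theorem REnv.induction_right {P : REnv k p L → Prop} (hone : P 1)
    (hadd : ∀ u w, P u → P w → P (u + w)) (hsmul : ∀ (c : k) u, P u → P (c • u))
    (hmul : ∀ (i : ZMod 2), ∀ x ∈ (LieSuperalgebra.grading (k := k) (L := L)).gr i, ∀ u, P u →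
      P (u * REnv.ι k p L x)) (u : REnv k p L) : P u := by
  have key : ∀ w v : REnv k p L, P v → P (v * w) := by
    intro w
    induction w using REnv.induction with
    | hscalar c => intro v hv; rw [← Algebra.commutes, ← Algebra.smul_def]; exact hsmul c v hv
    | hadd u w hu hw => intro v hv; rw [mul_add]; exact hadd _ _ (hu v hv) (hw v hv)
    | hmul u w hu hw => intro v hv; rw [← mul_assoc]; exact hw _ (hu v hv)
    | hι x =>
      induction x using (LieSuperalgebra.grading (k := k) (L := L)).induction with
      | hadd x y hx hy =>
        intro v hv
        rw [map_add, mul_add]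
        exact hadd _ _ (hx v hv) (hy v hv)
      | hom i x hx => intro v hv; exact hmul i x hx v hv
  simpa using key u 1 hone

variable {V W Y Z V' : Type*} [AddCommGroup V] [Module k V] [AddCommGroup W] [Module k W]
  [AddCommGroup Y] [Module k Y] [AddCommGroup Z] [Module k Z] [AddCommGroup V'] [Module k V']

/-- Right translation by an element of `L`. -/
def rtrans (x : L) (μ : REnv k p L →ₗ[k] V) : REnv k p L →ₗ[k] V :=
  μ ∘ₗ LinearMap.mulRight k (REnv.ι k p L x)

theorem rtrans_apply (x : L) (μ : REnv k p L →ₗ[k] V) (u : REnv k p L) :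
    rtrans x μ u = μ (u * REnv.ι k p L x) := rfl

variable [CharP k p] [Fact (2 < p)]

theorem homFlip_apply (S : SuperGrading k V) (μ : REnv k p L →ₗ[k] V) (u : REnv k p L) :
    homFlip S μ u = S.flip (μ (REnv.parity u)) := rfl

theorem homFlip_homFlip (S : SuperGrading k V) (μ : REnv k p L →ₗ[k] V) :
    homFlip S (homFlip S μ) = μ := by
  ext u; simp only [homFlip_apply, S.flip_flip, REnv.parity_parity]

/-- The `i`-th power of the parity automorphism of `Hom(U'(L), V)`. -/
def tw (S : SuperGrading k V) (i : ZMod 2) (μ : REnv k p L →ₗ[k] V) : REnv k p L →ₗ[k] V :=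
  if i = 0 then μ else homFlip S μ

@[simp] theorem tw_zero (S : SuperGrading k V) (μ : REnv k p L →ₗ[k] V) : tw S 0 μ = μ := by
  simp [tw]

@[simp] theorem tw_one (S : SuperGrading k V) (μ : REnv k p L →ₗ[k] V) :
    tw S 1 μ = homFlip S μ := by
  simp [tw]

theorem tw_tw (S : SuperGrading k V) (i j : ZMod 2) (μ : REnv k p L →ₗ[k] V) :
    tw S i (tw S j μ) = tw S (i + j) μ := by
  rcases zmod2_cases i with rfl | rfl <;> rcases zmod2_cases j with rfl | rfl <;>
    simp [one_add_one_zmod2, homFlip_homFlip]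

theorem rtrans_homFlip (S : SuperGrading k V) {i : ZMod 2} {x : L}
    (hx : x ∈ (LieSuperalgebra.grading (k := k) (L := L)).gr i) (μ : REnv k p L →ₗ[k] V) :
    rtrans x (homFlip S μ) = sgn k i • homFlip S (rtrans x μ) := by
  ext u
  simp only [rtrans_apply, homFlip_apply, map_mul, REnv.parity_ι hx, mul_smul_comm, map_smul,
    LinearMap.smul_apply]

theorem rtrans_tw (S : SuperGrading k V) {i : ZMod 2} (j : ZMod 2) {x : L}
    (hx : x ∈ (LieSuperalgebra.grading (k := k) (L := L)).gr i) (μ : REnv k p L →ₗ[k] V) :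
    rtrans x (tw S j μ) = sgn k (i * j) • tw S j (rtrans x μ) := by
  rcases zmod2_cases j with rfl | rfl
  · simp [sgn_zero]
  · simp [rtrans_homFlip S hx]

theorem homFlip_add (S : SuperGrading k V) (μ ν : REnv k p L →ₗ[k] V) :
    homFlip S (μ + ν) = homFlip S μ + homFlip S ν := by
  ext u; simp [homFlip_apply]

theorem homFlip_smul (S : SuperGrading k V) (c : k) (μ : REnv k p L →ₗ[k] V) :
    homFlip S (c • μ) = c • homFlip S μ := by
  ext u; simp [homFlip_apply]

theorem tw_add (S : SuperGrading k V) (i : ZMod 2) (μ ν : REnv k p L →ₗ[k] V) :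
    tw S i (μ + ν) = tw S i μ + tw S i ν := by
  rcases zmod2_cases i with rfl | rfl <;> simp [homFlip_add]

theorem tw_smul (S : SuperGrading k V) (i : ZMod 2) (c : k) (μ : REnv k p L →ₗ[k] V) :
    tw S i (c • μ) = c • tw S i μ := by
  rcases zmod2_cases i with rfl | rfl <;> simp [homFlip_smul]

/-- Linear maps on the graded tensor product that agree on tensors of homogeneous elements. -/
theorem gradedTensor_ext {T T' : (REnv.gr k p L ᵍ⊗[k] REnv.gr k p L) →ₗ[k] Y}
    (H : ∀ (l j : ZMod 2), ∀ a ∈ REnv.gr k p L l, ∀ b ∈ REnv.gr k p L j,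
      T (a ᵍ⊗ₜ[k] b) = T' (a ᵍ⊗ₜ[k] b)) (t : REnv.gr k p L ᵍ⊗[k] REnv.gr k p L) :
    T t = T' t := by
  obtain ⟨s, rfl⟩ : ∃ s : REnv k p L ⊗[k] REnv k p L,
      GradedTensorProduct.of k (REnv.gr k p L) (REnv.gr k p L) s = t := ⟨_, rfl⟩
  induction s using TensorProduct.induction_on with
  | zero => simp
  | add s t hs ht => simp only [map_add, hs, ht]
  | tmul a b =>
    induction a using (REnv.grading (k := k) (p := p) (L := L)).induction with
    | hadd a a' ha ha' => rw [TensorProduct.add_tmul]; simp only [map_add, ha, ha']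
    | hom l a ha =>
      induction b using (REnv.grading (k := k) (p := p) (L := L)).induction with
      | hadd b b' hb hb' => rw [TensorProduct.tmul_add]; simp only [map_add, hb, hb']
      | hom j b hb => exact H l j a ha b hb

/-- The Koszul sign `(-1)^{|μ||u₂|}` is expressed by a power of the parity automorphism, so `μ` need
not be homogeneous and the two parities are treated alike. -/
theorem convTensor_tmul (S : SuperGrading k V) (B : V →ₗ[k] W →ₗ[k] Y)
    (μ : REnv k p L →ₗ[k] V) (ν : REnv k p L →ₗ[k] W) (a : REnv k p L) {j : ZMod 2}
    {b : REnv k p L} (hb : b ∈ REnv.gr k p L j) :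
    convTensor S B μ ν (a ᵍ⊗ₜ[k] b) = B (tw S j μ a) (ν b) := by
  rcases zmod2_cases j with rfl | rfl
  · rw [convTensor_even _ _ _ _ _ hb, tw_zero]
  · rw [convTensor_odd _ _ _ _ _ hb, tw_one, homFlip_apply]

variable [Fact p.Prime]

theorem conv_apply (S : SuperGrading k V) (B : V →ₗ[k] W →ₗ[k] Y)
    (μ : REnv k p L →ₗ[k] V) (ν : REnv k p L →ₗ[k] W) (u : REnv k p L) :
    conv S B μ ν u = convTensor S B μ ν (coproduct k p L u) := rfl

theorem conv_add_left (S : SuperGrading k V) (B : V →ₗ[k] W →ₗ[k] Y)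
    (μ μ' : REnv k p L →ₗ[k] V) (ν : REnv k p L →ₗ[k] W) :
    conv S B (μ + μ') ν = conv S B μ ν + conv S B μ' ν := by
  ext u
  refine gradedTensor_ext (T := convTensor S B (μ + μ') ν)
    (T' := convTensor S B μ ν + convTensor S B μ' ν) (fun l j a _ b hb => ?_) _
  simp only [LinearMap.add_apply, convTensor_tmul _ _ _ _ _ hb, tw_add, map_add]

theorem conv_smul_left (S : SuperGrading k V) (B : V →ₗ[k] W →ₗ[k] Y) (c : k)
    (μ : REnv k p L →ₗ[k] V) (ν : REnv k p L →ₗ[k] W) :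
    conv S B (c • μ) ν = c • conv S B μ ν := by
  ext u
  refine gradedTensor_ext (T := convTensor S B (c • μ) ν)
    (T' := c • convTensor S B μ ν) (fun l j a _ b hb => ?_) _
  simp only [LinearMap.smul_apply, convTensor_tmul _ _ _ _ _ hb, tw_smul, map_smul]

theorem conv_add_right (S : SuperGrading k V) (B : V →ₗ[k] W →ₗ[k] Y)
    (μ : REnv k p L →ₗ[k] V) (ν ν' : REnv k p L →ₗ[k] W) :
    conv S B μ (ν + ν') = conv S B μ ν + conv S B μ ν' := by
  ext u
  refine gradedTensor_ext (T := convTensor S B μ (ν + ν'))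
    (T' := convTensor S B μ ν + convTensor S B μ ν') (fun l j a _ b hb => ?_) _
  simp only [LinearMap.add_apply, convTensor_tmul _ _ _ _ _ hb, map_add]

theorem conv_smul_right (S : SuperGrading k V) (B : V →ₗ[k] W →ₗ[k] Y) (c : k)
    (μ : REnv k p L →ₗ[k] V) (ν : REnv k p L →ₗ[k] W) :
    conv S B μ (c • ν) = c • conv S B μ ν := by
  ext u
  refine gradedTensor_ext (T := convTensor S B μ (c • ν))
    (T' := c • convTensor S B μ ν) (fun l j a _ b hb => ?_) _
  simp only [LinearMap.smul_apply, convTensor_tmul _ _ _ _ _ hb, map_smul]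

theorem conv_one (S : SuperGrading k V) (B : V →ₗ[k] W →ₗ[k] Y)
    (μ : REnv k p L →ₗ[k] V) (ν : REnv k p L →ₗ[k] W) :
    conv S B μ ν 1 = B (μ 1) (ν 1) := by
  rw [conv_apply, map_one]
  exact convTensor_even S B μ ν 1 (SetLike.GradedOne.one_mem (A := REnv.gr k p L))

/-- The elements of `L` act on convolutions as superderivations. -/
theorem conv_mul_ι (S : SuperGrading k V) (B : V →ₗ[k] W →ₗ[k] Y)
    (μ : REnv k p L →ₗ[k] V) (ν : REnv k p L →ₗ[k] W) {i : ZMod 2} {x : L}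
    (hx : x ∈ (LieSuperalgebra.grading (k := k) (L := L)).gr i) (u : REnv k p L) :
    conv S B μ ν (u * REnv.ι k p L x) =
      conv S B (rtrans x μ) ν u + conv S B (tw S i μ) (rtrans x ν) u := by
  rw [conv_apply, map_mul, coproduct_ι]
  refine gradedTensor_ext
    (T := convTensor S B μ ν ∘ₗ LinearMap.mulRight k (primitive k p L x))
    (T' := convTensor S B (rtrans x μ) ν + convTensor S B (tw S i μ) (rtrans x ν))
    (fun l j a ha b hb => ?_) _
  -- Moving `x` past `b` costs a sign, which cancels the one between right translation and the
  -- parity automorphism in `rtrans_tw`.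
  have e1 : (a ᵍ⊗ₜ[k] b) * includeLeft (REnv.gr k p L) (REnv.gr k p L) (REnv.ι k p L x) =
      sgn k (j * i) • ((a * REnv.ι k p L x) ᵍ⊗ₜ[k] b) := by
    have := tmul_mul_tmul a hb (REnv.ι_mem_gr (p := p) hx) 1
    rw [mul_one] at this
    exact this
  have e2 : (a ᵍ⊗ₜ[k] b) * includeRight (REnv.gr k p L) (REnv.gr k p L) (REnv.ι k p L x) =
      a ᵍ⊗ₜ[k] (b * REnv.ι k p L x) := by
    have := tmul_mul_tmul a hb (SetLike.GradedOne.one_mem (A := REnv.gr k p L))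
      (REnv.ι k p L x)
    rw [mul_one, mul_zero, sgn_zero, one_smul] at this
    exact this
  have hbx : b * REnv.ι k p L x ∈ REnv.gr k p L (j + i) :=
    SetLike.mul_mem_graded hb (REnv.ι_mem_gr hx)
  rw [LinearMap.comp_apply, LinearMap.mulRight_apply, primitive_apply, mul_add, e1, e2, map_add,
    map_smul, LinearMap.add_apply, convTensor_tmul _ _ _ _ _ hb, convTensor_tmul _ _ _ _ _ hb,
    convTensor_tmul _ _ _ _ _ hb, convTensor_tmul _ _ _ _ _ hbx, tw_tw, rtrans_apply,
    ← rtrans_apply x (tw S j μ), rtrans_tw S j hx, LinearMap.smul_apply, map_smul,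
    LinearMap.smul_apply, smul_smul, mul_comm j i, sgn_mul_self, one_smul]

theorem rtrans_conv (S : SuperGrading k V) (B : V →ₗ[k] W →ₗ[k] Y)
    (μ : REnv k p L →ₗ[k] V) (ν : REnv k p L →ₗ[k] W) {i : ZMod 2} {x : L}
    (hx : x ∈ (LieSuperalgebra.grading (k := k) (L := L)).gr i) :
    rtrans x (conv S B μ ν) =
      conv S B (rtrans x μ) ν + conv S B (tw S i μ) (rtrans x ν) := by
  ext u; exact conv_mul_ι S B μ ν hx u

/-- The parity automorphism is multiplicative. -/
theorem homFlip_conv {S : SuperGrading k V} {T : SuperGrading k W} {R : SuperGrading k Y}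
    {B : V →ₗ[k] W →ₗ[k] Y} (hB : ∀ v w, R.flip (B v w) = B (S.flip v) (T.flip w))
    (μ : REnv k p L →ₗ[k] V) (ν : REnv k p L →ₗ[k] W) :
    homFlip R (conv S B μ ν) = conv S B (homFlip S μ) (homFlip T ν) := by
  ext u
  induction u using REnv.induction_right generalizing μ ν with
  | hone => rw [homFlip_apply, map_one, conv_one, conv_one, hB]; simp [homFlip_apply]
  | hadd u w hu hw => rw [map_add, map_add, hu, hw]
  | hsmul c u hu => rw [map_smul, map_smul, hu]
  | hmul i x hx u hu =>
    rw [← rtrans_apply x (homFlip R _), rtrans_homFlip R hx, rtrans_conv _ _ _ _ hx, homFlip_add,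
      conv_mul_ι _ _ _ _ hx, rtrans_homFlip S hx, rtrans_homFlip T hx, conv_smul_left,
      conv_smul_right, LinearMap.smul_apply, LinearMap.smul_apply, LinearMap.smul_apply,
      LinearMap.add_apply, hu, hu, smul_add, ← tw_one S (tw S i μ), tw_tw, ← tw_one S μ, tw_tw,
      add_comm i]

theorem tw_conv {S : SuperGrading k V} {T : SuperGrading k W} {R : SuperGrading k Y}
    {B : V →ₗ[k] W →ₗ[k] Y} (hB : ∀ v w, R.flip (B v w) = B (S.flip v) (T.flip w)) (i : ZMod 2)
    (μ : REnv k p L →ₗ[k] V) (ν : REnv k p L →ₗ[k] W) :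
    tw R i (conv S B μ ν) = conv S B (tw S i μ) (tw T i ν) := by
  rcases zmod2_cases i with rfl | rfl
  · simp
  · simpa using homFlip_conv hB μ ν

/-- Associativity of convolutions. -/
theorem conv_assoc {S : SuperGrading k V} {T : SuperGrading k W} {R : SuperGrading k Y}
    {B : V →ₗ[k] W →ₗ[k] Y} (hB : ∀ v w, R.flip (B v w) = B (S.flip v) (T.flip w))
    {B' : Y →ₗ[k] Z →ₗ[k] V'} {Y' : Type*} [AddCommGroup Y'] [Module k Y']
    {C : W →ₗ[k] Z →ₗ[k] Y'} {C' : V →ₗ[k] Y' →ₗ[k] V'}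
    (hassoc : ∀ v w z, B' (B v w) z = C' v (C w z))
    (μ : REnv k p L →ₗ[k] V) (ν : REnv k p L →ₗ[k] W) (ξ : REnv k p L →ₗ[k] Z) :
    conv R B' (conv S B μ ν) ξ = conv S C' μ (conv T C ν ξ) := by
  ext u
  -- Both sides agree at `1` and obey the same Leibniz rule under right translation; the three
  -- arguments change along the induction and must be arbitrary.
  induction u using REnv.induction_right generalizing μ ν ξ with
  | hone => simp only [conv_one, hassoc]
  | hadd u w hu hw => rw [map_add, map_add, hu, hw]
  | hsmul c u hu => rw [map_smul, map_smul, hu]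
  | hmul i x hx u hu =>
    rw [conv_mul_ι _ _ _ _ hx, conv_mul_ι _ _ _ _ hx, rtrans_conv _ _ _ _ hx,
      rtrans_conv _ _ _ _ hx, conv_add_left, conv_add_right, tw_conv hB, LinearMap.add_apply,
      LinearMap.add_apply, hu, hu, hu, add_assoc]

/-- Commutativity of convolutions with homogeneous functions. -/
theorem conv_comm {S : SuperGrading k V} {B : k →ₗ[k] V →ₗ[k] Y} {j : ZMod 2}
    {f : REnv k p L →ₗ[k] k} (hf : homFlip (SuperGrading.trivial k) f = sgn k j • f)
    (μ : REnv k p L →ₗ[k] V) :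
    conv (SuperGrading.trivial k) B f μ = conv S B.flip (tw S j μ) f := by
  ext u
  induction u using REnv.induction_right generalizing f μ j with
  | hone =>
    rw [conv_one, conv_one, LinearMap.flip_apply]
    rcases zmod2_cases j with rfl | rfl
    · simp
    -- An odd function vanishes at `1`, since `2` is invertible; so the twist of `μ` does no harm
    -- there.
    · have h1 := LinearMap.congr_fun hf 1
      rw [homFlip_apply, map_one, SuperGrading.flip_of_mem (i := 0) _
        (by simp [SuperGrading.trivial]), sgn_zero, sgn_one, one_smul,
        LinearMap.smul_apply, smul_eq_mul] at h1
      have h2 : (2 : k) * f 1 = 0 := by linear_combination h1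
      rw [(mul_eq_zero.1 h2).resolve_left (two_ne k p)]
      simp
  | hadd u w hu hw => rw [map_add, map_add, hu hf, hw hf]
  | hsmul c u hu => rw [map_smul, map_smul, hu hf]
  | hmul i x hx u hu =>
    have hxf : homFlip (SuperGrading.trivial k) (rtrans x f) = sgn k (i + j) • rtrans x f := by
      have := rtrans_homFlip (SuperGrading.trivial k) hx f
      rw [hf] at this
      have h2 := congrArg (fun g => sgn k i • g) this
      simp only [smul_smul, sgn_mul_self, one_smul] at h2
      rw [← h2, sgn_add]
      ext v
      simp [rtrans_apply, mul_assoc]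
    have htf : tw (SuperGrading.trivial k) i f = sgn k (i * j) • f := by
      rcases zmod2_cases i with rfl | rfl
      · simp [sgn_zero]
      · simpa using hf
    rw [conv_mul_ι _ _ _ _ hx, conv_mul_ι _ _ _ _ hx, hu hxf, htf, conv_smul_left,
      LinearMap.smul_apply, hu hf, rtrans_tw S j hx, conv_smul_left, LinearMap.smul_apply, tw_tw,
      add_comm]

variable (k p L) in
/-- The counit of `U'(L)`. -/
def counit : REnv k p L →ₗ[k] k :=
  (REnv.lift (B := k) (0 : L →ₗ[k] k) (by simp) (by simp [(Fact.out : p.Prime).ne_zero])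
    : REnv k p L →ₐ[k] k).toLinearMap

theorem counit_one : counit k p L 1 = 1 := by simp [counit]

theorem rtrans_counit (x : L) : rtrans x (counit k p L) = 0 := by
  ext u; simp [counit, rtrans_apply]

theorem trivial_flip (c : k) : (SuperGrading.trivial k).flip c = c := by
  rw [SuperGrading.flip_of_mem (i := 0) _ (by simp [SuperGrading.trivial]), sgn_zero, one_smul]

theorem homFlip_counit : homFlip (SuperGrading.trivial k) (counit k p L) = counit k p L := by
  ext u
  induction u using REnv.induction_right with
  | hone => simp [homFlip_apply, trivial_flip]
  | hadd u w hu hw => rw [map_add, map_add, hu, hw]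
  | hsmul c u hu => rw [map_smul, map_smul, hu]
  | hmul i x hx u hu =>
    rw [← rtrans_apply, ← rtrans_apply, rtrans_homFlip _ hx, rtrans_counit]
    simp [homFlip_apply]

theorem tw_counit (i : ZMod 2) :
    tw (SuperGrading.trivial k) i (counit k p L) = counit k p L := by
  rcases zmod2_cases i with rfl | rfl <;> simp [homFlip_counit]

/-- All right translates of the counit by elements of `L` vanish, so only the translations of the
other factor remain. The counit is thus the unit of `𝒜`. -/
theorem conv_counit_left (B : k →ₗ[k] V →ₗ[k] Y) (μ : REnv k p L →ₗ[k] V) :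
    conv (SuperGrading.trivial k) B (counit k p L) μ = B 1 ∘ₗ μ := by
  ext u
  induction u using REnv.induction_right generalizing μ with
  | hone => simp [conv_one, counit_one]
  | hadd u w hu hw => rw [map_add, map_add, hu, hw]
  | hsmul c u hu => rw [map_smul, map_smul, hu]
  | hmul i x hx u hu =>
    have e : (0 : REnv k p L →ₗ[k] k) = (0 : k) • (0 : REnv k p L →ₗ[k] k) := by simp
    rw [conv_mul_ι _ _ _ _ hx, rtrans_counit, tw_counit, hu, e, conv_smul_left]
    simp [rtrans_apply]

theorem conv_counit_right (S : SuperGrading k V) (B : V →ₗ[k] k →ₗ[k] Y)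
    (μ : REnv k p L →ₗ[k] V) : conv S B μ (counit k p L) = B.flip 1 ∘ₗ μ := by
  ext u
  induction u using REnv.induction_right generalizing μ with
  | hone => simp [conv_one, counit_one]
  | hadd u w hu hw => rw [map_add, map_add, hu, hw]
  | hsmul c u hu => rw [map_smul, map_smul, hu]
  | hmul i x hx u hu =>
    have e : (0 : REnv k p L →ₗ[k] k) = (0 : k) • (0 : REnv k p L →ₗ[k] k) := by simp
    rw [conv_mul_ι _ _ _ _ hx, rtrans_counit, hu, e, conv_smul_right]
    simp [rtrans_apply]

end Convolution

/-! ### Coordinate functions -/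

section Exponents

variable {n m p : ℕ}

/-- The multi-index with given exponents. -/
def MIdx.ofExp (d : Fin n ⊕ Fin m → ℕ) (hd : ∀ r, d r < letterBound p r) : MIdx p n m :=
  (fun i => ⟨d (Sum.inl i), hd (Sum.inl i)⟩, fun t => ⟨d (Sum.inr t), hd (Sum.inr t)⟩)

@[simp] theorem MIdx.exp_ofExp (d : Fin n ⊕ Fin m → ℕ) (hd : ∀ r, d r < letterBound p r)
    (r : Fin n ⊕ Fin m) : (MIdx.ofExp d hd).exp r = d r := by
  rcases r with i | t <;> rfl

/-- Lower an exponent by one. -/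
def MIdx.dec (r : Fin n ⊕ Fin m) (I : MIdx p n m) : MIdx p n m :=
  MIdx.ofExp (fun t => if t = r then I.exp r - 1 else I.exp t) (fun t => by
    split_ifs with h
    · subst h; exact lt_of_le_of_lt (Nat.sub_le _ _) (I.exp_lt _)
    · exact I.exp_lt t)

theorem MIdx.exp_dec (r t : Fin n ⊕ Fin m) (I : MIdx p n m) :
    (I.dec r).exp t = if t = r then I.exp r - 1 else I.exp t := by simp [dec]

/-- The parity of the part of a word beyond a letter. -/
def rightPar (r : Fin n ⊕ Fin m) (w : List (Fin n ⊕ Fin m)) : ZMod 2 :=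
  open Classical in (w.map fun t => if letterLE t r then 0 else letterPar t).sum

/-- The parity of a word. -/
def wordPar (w : List (Fin n ⊕ Fin m)) : ZMod 2 := (w.map letterPar).sum

theorem letterLE_antisymm {r t : Fin n ⊕ Fin m} (h : letterLE r t) (h' : letterLE t r) :
    r = t := by
  cases h with
  | inl h => cases h' with | inl h' => rw [le_antisymm h h']
  | inr h => cases h' with | inr h' => rw [le_antisymm h h']
  | sep => cases h'

theorem sum_map_eq_count {R : Type*} [AddCommMonoid R] (w : List (Fin n ⊕ Fin m))
    (g : Fin n ⊕ Fin m → R) : (w.map g).sum = ∑ r, w.count r • g r := by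
  induction w with
  | nil => simp
  | cons t w ih =>
    simp only [List.map_cons, List.sum_cons, ih, List.count_cons, add_smul, ite_smul,
      one_smul, zero_smul, Finset.sum_add_distrib, beq_iff_eq]
    rw [Finset.sum_ite_eq Finset.univ t g, if_pos (Finset.mem_univ _), add_comm]

theorem sgn_natCast (k : Type*) [Ring k] (N : ℕ) : sgn k (N : ZMod 2) = (-1) ^ N := by
  rcases Nat.even_or_odd N with h | h
  · rw [h.neg_one_pow, (ZMod.natCast_eq_zero_iff_even).2 h]; simp [sgn]
  · rw [h.neg_one_pow, (ZMod.natCast_eq_one_iff_odd).2 h]; simp [sgn]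

/-- The sum of the exponents beyond a letter. -/
def MIdx.beyond (I : MIdx p n m) (s : Fin m) : ℕ :=
  ∑ t ∈ Finset.univ.filter (fun t => s < t), (I.2 t : ℕ)

theorem MIdx.rightPar_word (I : MIdx p n m) (s : Fin m) :
    rightPar (Sum.inr s) I.word = (I.beyond s : ZMod 2) := by
  classical
  rw [rightPar, sum_map_eq_count, Fintype.sum_sum_type, Finset.sum_eq_zero, zero_add, beyond,
    Nat.cast_sum, Finset.sum_filter]
  · refine Finset.sum_congr rfl fun t _ => ?_
    have hle : letterLE (n := n) (Sum.inr t) (Sum.inr s) ↔ t ≤ s := Sum.lex_inr_inr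
    rw [MIdx.count_word]
    by_cases hst : s < t
    · rw [if_neg (hle.not.2 (not_le.2 hst)), if_pos hst]; simp [letterPar, exp]
    · rw [if_pos (hle.2 (not_lt.1 hst)), if_neg hst, smul_zero]
  · intro i _
    rw [if_pos (Sum.Lex.sep _ _), smul_zero]

/-- The coefficient in the product with a coordinate function. -/
def MIdx.coef (k : Type*) [Ring k] (r : Fin n ⊕ Fin m) (I : MIdx p n m) : k :=
  (I.exp r : k) * sgn k (letterPar r * rightPar r I.word)

theorem sgn_ne_zero (k : Type*) [Field k] (i : ZMod 2) : sgn k i ≠ 0 := fun h => by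
  have := sgn_mul_self (k := k) i
  rw [h, zero_mul] at this
  exact zero_ne_one this

/-- Exponents are smaller than `p`. This is why the coordinate functions generate: their powers are
factorials times dual basis elements, and these factorials are invertible. -/
theorem MIdx.coef_ne_zero {k : Type*} [Field k] [CharP k p] [Fact (2 < p)]
    {r : Fin n ⊕ Fin m} {I : MIdx p n m} (h : 0 < I.exp r) : I.coef k r ≠ 0 := by
  refine mul_ne_zero ?_ (sgn_ne_zero k _)
  have hp : 2 < p := Fact.out
  have h1 := I.exp_lt r
  have h2 : letterBound p r ≤ p := by
    rcases r with i | t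
    · exact le_rfl
    · exact hp.le
  rw [Ne, CharP.cast_eq_zero_iff k p]
  exact fun hd => absurd (Nat.le_of_dvd h hd) (by omega)

theorem MIdx.coef_eq_zero {k : Type*} [Ring k] {r : Fin n ⊕ Fin m} {I : MIdx p n m}
    (h : I.exp r = 0) : I.coef k r = 0 := by
  simp [coef, h]

theorem IsMon.letterLE_of_mem {w : List (Fin n ⊕ Fin m)} {r t : Fin n ⊕ Fin m}
    (h : IsMon p (w ++ [r])) (ht : t ∈ w) : letterLE t r := by
  have := List.pairwise_append.1 h.1
  exact this.2.2 t ht r (by simp)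

end Exponents

section CoordinateFunctions

variable {k : Type*} {p : ℕ} {L V W Y : Type*} [Field k] [AddCommGroup L] [Module k L]
  [RestrictedLieSuperalgebra k p L] [AddCommGroup V] [Module k V] [AddCommGroup W] [Module k W]
  [AddCommGroup Y] [Module k Y] {h : RestrictedSub k p L} {n m : ℕ}

namespace SupplementBasis

variable (s : SupplementBasis h n m)

theorem wordProd_nil : s.wordProd [] = 1 := by simp [wordProd]

theorem wordProd_concat (w : List (Fin n ⊕ Fin m)) (r : Fin n ⊕ Fin m) :
    s.wordProd (w ++ [r]) = s.wordProd w * REnv.ι k p L (s.gen r) := by simp [wordProd]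

theorem parity_wordProd (w : List (Fin n ⊕ Fin m)) :
    REnv.parity (s.wordProd w) = sgn k (wordPar w) • s.wordProd w := by
  induction w with
  | nil => simp [wordProd, wordPar, sgn_zero]
  | cons r w ih =>
    have e : s.wordProd (r :: w) = REnv.ι k p L (s.gen r) * s.wordProd w := by simp [wordProd]
    have e2 : wordPar (r :: w) = letterPar r + wordPar w := by simp [wordPar]
    rw [e, map_mul, ih, REnv.parity_ι (s.gen_mem r), smul_mul_smul_comm, e2, sgn_add]

variable [CharP k p] [Fact (2 < p)]

theorem tw_wordProd_eq_zero (S : SuperGrading k V) (i : ZMod 2) {f : REnv k p L →ₗ[k] V}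
    {w : List (Fin n ⊕ Fin m)} (hf : f (s.wordProd w) = 0) : tw S i f (s.wordProd w) = 0 := by
  rcases zmod2_cases i with rfl | rfl
  · simpa using hf
  · rw [tw_one, homFlip_apply, parity_wordProd, map_smul, hf, smul_zero, map_zero]

variable [Fact p.Prime]

/-- The convolution with a map that vanishes on all nonempty partial words. -/
theorem conv_wordProd_of_vanish (S : SuperGrading k V) (B : V →ₗ[k] W →ₗ[k] Y)
    {w : List (Fin n ⊕ Fin m)} {f : REnv k p L →ₗ[k] V}
    (hf : ∀ v, v.Sublist w → v ≠ [] → f (s.wordProd v) = 0) (μ : REnv k p L →ₗ[k] W) :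
    conv S B f μ (s.wordProd w) = B (tw S (wordPar w) f 1) (μ (s.wordProd w)) := by
  induction w using List.reverseRecOn generalizing f μ with
  | nil => simp [wordProd_nil, conv_one, wordPar]
  | append_singleton w r ih =>
    have h1 : rtrans (s.gen r) f 1 = 0 := by
      rw [rtrans_apply]
      have := hf [r] (List.sublist_append_right w [r]) (by simp)
      simpa [wordProd] using this
    have h2 : ∀ i, tw S i (rtrans (s.gen r) f) 1 = 0 := fun i => by
      have := s.tw_wordProd_eq_zero S i (f := rtrans (s.gen r) f) (w := []) (by
        rw [s.wordProd_nil, h1])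
      rwa [s.wordProd_nil] at this
    have e : wordPar (w ++ [r]) = wordPar w + letterPar r := by simp [wordPar]
    rw [s.wordProd_concat, conv_mul_ι _ _ _ _ (s.gen_mem r), ih, ih, h2, map_zero,
      LinearMap.zero_apply, zero_add, tw_tw, e, rtrans_apply]
    · intro v hv hv0
      exact s.tw_wordProd_eq_zero S _ (hf v (hv.trans (List.sublist_append_left w [r])) hv0)
    · intro v hv _
      rw [rtrans_apply, ← s.wordProd_concat]
      exact hf _ (hv.append (List.Sublist.refl _)) (by simp)

/-- The convolution with a function that takes the value `c` on one letter and vanishes on the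
other partial words. -/
theorem conv_wordProd_of_letter (B : k →ₗ[k] W →ₗ[k] Y) {w : List (Fin n ⊕ Fin m)}
    (hw : IsMon p w) {f : REnv k p L →ₗ[k] k} {r : Fin n ⊕ Fin m} {c : k}
    (hf : ∀ v, v.Sublist w → f (s.wordProd v) = if v = [r] then c else 0)
    (μ : REnv k p L →ₗ[k] W) :
    conv (SuperGrading.trivial k) B f μ (s.wordProd w) =
      ((w.count r : k) * sgn k (letterPar r * rightPar r w)) •
        B c (μ (s.wordProd (w.erase r))) := by
  induction w using List.reverseRecOn generalizing f c μ with
  | nil =>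
    have := hf [] (List.Sublist.refl _)
    rw [s.wordProd_nil] at this
    simp [wordProd_nil, conv_one, this]
  | append_singleton w t ih =>
    have hw' : IsMon p w := hw.sublist (List.sublist_append_left w [t])
    -- Passing the last letter twists `f`, which rescales its value at `r` by a sign; hence the
    -- arbitrary value `c` in the induction.
    have htw : ∀ v, v.Sublist w → tw (SuperGrading.trivial k) (letterPar t) f (s.wordProd v) =
        if v = [r] then sgn k (letterPar t * letterPar r) * c else 0 := by
      intro v hv
      have h0 := hf v (hv.trans (List.sublist_append_left w [t]))
      split_ifs at h0 ⊢ with hvr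
      · rcases zmod2_cases (letterPar t) with ht | ht
        · rw [ht, tw_zero, h0, zero_mul, sgn_zero, one_mul]
        · rw [ht, tw_one, homFlip_apply, s.parity_wordProd, map_smul, h0, trivial_flip, hvr]
          simp [wordPar]
      · exact s.tw_wordProd_eq_zero _ _ h0
    rw [s.wordProd_concat, conv_mul_ι _ _ _ _ (s.gen_mem t), ih hw' htw, rtrans_apply,
      ← s.wordProd_concat]
    -- A nonempty partial word followed by `t` has at least two letters, so it is not `[r]`.
    have hrt : ∀ v, v.Sublist w → v ≠ [] → rtrans (s.gen t) f (s.wordProd v) = 0 := by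
      intro v hv hv0
      rw [rtrans_apply, ← s.wordProd_concat, hf _ (hv.append (List.Sublist.refl _)), if_neg]
      intro h
      have := congrArg List.length h
      rw [List.length_append, List.length_singleton, List.length_singleton] at this
      exact hv0 (List.length_eq_zero_iff.1 (by omega))
    rw [s.conv_wordProd_of_vanish _ _ hrt]
    have h1 : rtrans (s.gen t) f 1 = if t = r then c else 0 := by
      have := hf [t] (List.sublist_append_right w [t])
      rw [rtrans_apply, one_mul]
      simpa [wordProd] using this
    have h2 : tw (SuperGrading.trivial k) (wordPar w) (rtrans (s.gen t) f) 1 =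
        if t = r then c else 0 := by
      rw [← h1]
      rcases zmod2_cases (wordPar w) with h | h
      · rw [h, tw_zero]
      · rw [h, tw_one, homFlip_apply, map_one, trivial_flip]
    rw [h2]
    -- If the last letter is `r` itself, it adds one to the multiplicity and no letter lies beyond
    -- it. Otherwise it lies beyond every occurrence of `r` and contributes its parity to the sign.
    by_cases htr : t = r
    · subst htr
      have hr0 : rightPar t (w ++ [t]) = 0 := by
        rw [rightPar]
        refine List.sum_eq_zero fun x hx => ?_
        obtain ⟨y, hy, rfl⟩ := List.mem_map.1 hx
        rw [if_pos]
        rcases List.mem_append.1 hy with hy | hy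
        · exact hw.letterLE_of_mem hy
        · rw [List.mem_singleton.1 hy]; exact refl_of (Sum.Lex (· ≤ ·) (· ≤ ·)) t
      have he : (w ++ [t]).erase t = w := by
        refine (hw.sublist List.erase_sublist).eq_of_count hw' fun x => ?_
        rw [List.count_erase, List.count_append]
        by_cases hx : t = x
        · subst hx; simp
        · simp [hx]
      rw [if_pos rfl, hr0, he, mul_zero, sgn_zero, mul_one, List.count_append,
        List.count_singleton_self, Nat.cast_add, Nat.cast_one, add_smul, one_smul, add_comm]
      congr 1
      by_cases hmem : t ∈ w
      · have he2 : w.erase t ++ [t] = w := by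
          have hs : IsMon p ((w ++ [t]).erase t) := hw.sublist List.erase_sublist
          rw [List.erase_append_left _ hmem] at hs
          refine hs.eq_of_count hw' fun x => ?_
          rw [List.count_append, List.count_erase]
          by_cases hx : t = x
          · subst hx
            have := List.count_pos_iff.2 hmem
            simp; omega
          · simp [hx]
        -- An odd letter occurs at most once in a monomial, so a repeated letter is even and the
        -- sign is trivial.
        have hpar : letterPar t = 0 := by
          rcases t with i | i
          · rfl
          · have h3 := hw.2 (Sum.inr i)
            have := List.count_pos_iff.2 hmem
            rw [List.count_append, List.count_singleton_self] at h3
            simp only [letterBound, Sum.elim_inr] at h3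
            omega
        rw [he2, hpar]
        simp [sgn_zero]
      · rw [List.count_eq_zero_of_not_mem hmem]
        simp
    · rw [if_neg htr, map_zero, LinearMap.zero_apply, zero_add, List.count_append,
        List.count_singleton, if_neg (by simpa using fun h => htr h), add_zero]
      by_cases hmem : r ∈ w
      · have hnle : ¬ letterLE t r := fun hle => htr (letterLE_antisymm hle (hw.letterLE_of_mem hmem))
        have hrp : rightPar r (w ++ [t]) = rightPar r w + letterPar t := by
          simp [rightPar, hnle]
        rw [List.erase_append_left _ hmem, hrp, ← smul_eq_mul (sgn k _) c, map_smul,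
          LinearMap.smul_apply, smul_smul, mul_add, sgn_add, mul_comm (letterPar t), mul_assoc]
      · rw [List.count_eq_zero_of_not_mem hmem]
        simp

/-- The coordinates as a linear equivalence. -/
def coordEquiv (σ : RestrictedRep k p h.carrier V) : Coind h σ ≃ₗ[k] (MIdx p n m → V) :=
  LinearEquiv.ofBijective (s.coord σ) (s.coord_bijective σ)

theorem coord_coordInv (σ : RestrictedRep k p h.carrier V) (F : MIdx p n m → V) :
    s.coord σ (s.coordInv σ F) = F :=
  Function.invFun_eq ((s.coord_bijective σ).2 F)

theorem coord_ext {σ : RestrictedRep k p h.carrier V} {μ ν : Coind h σ}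
    (H : ∀ I, s.coord σ μ I = s.coord σ ν I) : μ = ν :=
  (s.coord_bijective σ).1 (funext H)

theorem coord_apply (σ : RestrictedRep k p h.carrier V) (μ : Coind h σ) (I : MIdx p n m) :
    s.coord σ μ I = μ.1 (s.wordProd I.word) := by
  rw [← s.mon_eq_wordProd]; rfl

theorem apply_of_isMon {σ : RestrictedRep k p h.carrier V} (μ : Coind h σ)
    {w : List (Fin n ⊕ Fin m)} (hw : IsMon p w) :
    μ.1 (s.wordProd w) = s.coord σ μ hw.idx := by
  rw [s.coord_apply, hw.word_idx]

/-- The coordinate function of a letter. -/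
def crd : Fin n ⊕ Fin m → FunAlg h := Sum.elim s.eta s.zeta

theorem coord_crd (r : Fin n ⊕ Fin m) (I : MIdx p n m) :
    s.coord _ (s.crd r) I = if ∀ t, I.exp t = if t = r then 1 else 0 then 1 else 0 := by
  rcases r with i | i
  · rw [crd, Sum.elim_inl, eta, s.coord_coordInv]
    simp [Sum.forall, MIdx.exp]
  · rw [crd, Sum.elim_inr, zeta, s.coord_coordInv]
    simp [Sum.forall, MIdx.exp]

theorem coord_hat (σ : RestrictedRep k p h.carrier V) (v : V) (I : MIdx p n m) :
    s.coord σ (s.hat σ v) I = if ∀ t, I.exp t = 0 then v else 0 := by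
  rw [hat, s.coord_coordInv]
  simp [Sum.forall, MIdx.exp]

theorem crd_wordProd (r : Fin n ⊕ Fin m) {w : List (Fin n ⊕ Fin m)} (hw : IsMon p w) :
    (s.crd r).1 (s.wordProd w) = if w = [r] then 1 else 0 := by
  rw [s.apply_of_isMon _ hw, s.coord_crd]
  have hr : IsMon p [r] := by
    refine ⟨by simp, fun t => ?_⟩
    have hp : 2 < p := Fact.out
    have h1 : 2 ≤ letterBound p t := by
      rcases t with i | i
      · exact hp.le
      · exact le_rfl
    exact lt_of_le_of_lt (List.count_le_length) h1
  congr 1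
  apply propext
  constructor
  · intro H
    refine hw.eq_of_count hr fun t => ?_
    rw [← hw.exp_idx, H, List.count_singleton]
    by_cases htr : t = r
    · subst htr; simp
    · simp [htr, Ne.symm htr]
  · rintro rfl t
    rw [hw.exp_idx, List.count_singleton]
    by_cases htr : t = r
    · subst htr; simp
    · simp [htr, Ne.symm htr]

theorem hat_wordProd (σ : RestrictedRep k p h.carrier V) (v : V) {w : List (Fin n ⊕ Fin m)}
    (hw : IsMon p w) : (s.hat σ v).1 (s.wordProd w) = if w = [] then v else 0 := by
  rw [s.apply_of_isMon _ hw, s.coord_hat]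
  congr 1
  apply propext
  constructor
  · intro H
    refine List.eq_nil_iff_forall_not_mem.2 fun t ht => ?_
    have h1 := List.count_pos_iff.2 ht
    have := H t
    rw [hw.exp_idx] at this
    omega
  · rintro rfl t
    rw [hw.exp_idx, List.count_nil]

theorem hat_one_apply (σ : RestrictedRep k p h.carrier V) (v : V) : (s.hat σ v).1 1 = v := by
  have := s.hat_wordProd σ v (w := []) ⟨List.Pairwise.nil, fun r => by
    have := (Fact.out : 2 < p)
    rcases r with i | i
    · simp only [List.count_nil, letterBound, Sum.elim_inl]; omega
    · simp [letterBound]⟩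
  rwa [s.wordProd_nil, if_pos rfl] at this

/-- The product with a coordinate function in coordinates. -/
theorem coord_crd_smul {σ : RestrictedRep k p h.carrier V} (r : Fin n ⊕ Fin m) (μ : Coind h σ)
    (I : MIdx p n m) :
    s.coord σ (Coind.smul (s.crd r) μ) I = I.coef k r • s.coord σ μ (I.dec r) := by
  have hI := I.isMon_word
  rw [s.coord_apply, s.coord_apply]
  have := s.conv_wordProd_of_letter (LinearMap.lsmul k V) hI (f := (s.crd r).1) (r := r) (c := 1)
    (fun v hv => s.crd_wordProd r (hI.sublist hv)) μ.1
  refine this.trans ?_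
  have e : I.word.erase r = (I.dec r).word := by
    refine (hI.sublist List.erase_sublist).eq_of_count (I.dec r).isMon_word fun t => ?_
    rw [List.count_erase, MIdx.count_word, MIdx.count_word, MIdx.exp_dec]
    by_cases htr : t = r
    · subst htr; simp
    · simp [htr, Ne.symm htr]
  rw [e, MIdx.coef, MIdx.count_word, LinearMap.lsmul_apply, one_smul]

/-- The coinduced representation is generated by the elements `v̂` as a module over the coordinate
functions. -/
theorem coind_induction {σ : RestrictedRep k p h.carrier V} {P : Coind h σ → Prop}
    (hadd : ∀ μ ν, P μ → P ν → P (μ + ν)) (hsmul : ∀ (c : k) μ, P μ → P (c • μ))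
    (hhat : ∀ v, P (s.hat σ v)) (hcrd : ∀ r μ, P μ → P (Coind.smul (s.crd r) μ))
    (μ : Coind h σ) : P μ := by
  classical
  -- By induction on the degree, the element concentrated at `J` is obtained from one at a lower
  -- index by multiplication with a coordinate function, up to the invertible coefficient.
  have hdelta : ∀ (N : ℕ) (J : MIdx p n m) (v : V), ∑ r, J.exp r = N →
      P ((s.coordEquiv σ).symm (Pi.single J v)) := by
    intro N
    induction N with
    | zero =>
      intro J v hJ
      have h0 : ∀ r, J.exp r = 0 := fun r =>
        (Finset.sum_eq_zero_iff.1 hJ) r (Finset.mem_univ r)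
      have : (s.coordEquiv σ).symm (Pi.single J v) = s.hat σ v := by
        refine s.coord_ext fun I => ?_
        rw [s.coord_hat]
        refine (congrFun ((s.coordEquiv σ).apply_symm_apply (Pi.single J v)) I).trans ?_
        by_cases hI : I = J
        · subst hI; rw [Pi.single_eq_same, if_pos h0]
        · rw [Pi.single_eq_of_ne hI, if_neg]
          exact fun h1 => hI (MIdx.ext_exp fun r => by rw [h0, h1])
      rw [this]; exact hhat v
    | succ N ih =>
      intro J v hJ
      obtain ⟨r, hr⟩ : ∃ r, 0 < J.exp r := by
        by_contra! hcon
        have : ∑ r, J.exp r = 0 := Finset.sum_eq_zero fun r _ => Nat.le_zero.1 (hcon r)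
        omega
      have hsum : ∑ t, (J.dec r).exp t = N := by
        have h1 := Finset.add_sum_erase Finset.univ J.exp (Finset.mem_univ r)
        have h2 := Finset.add_sum_erase Finset.univ (J.dec r).exp (Finset.mem_univ r)
        have h3 : ∑ t ∈ Finset.univ.erase r, (J.dec r).exp t = ∑ t ∈ Finset.univ.erase r, J.exp t :=
          Finset.sum_congr rfl fun t ht => by rw [MIdx.exp_dec, if_neg (Finset.ne_of_mem_erase ht)]
        rw [h3, MIdx.exp_dec, if_pos rfl] at h2
        omega
      have : (s.coordEquiv σ).symm (Pi.single J v) = (J.coef k r)⁻¹ •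
          Coind.smul (s.crd r) ((s.coordEquiv σ).symm (Pi.single (J.dec r) v)) := by
        refine s.coord_ext fun I => ?_
        refine (congrFun ((s.coordEquiv σ).apply_symm_apply (Pi.single J v)) I).trans ?_
        rw [map_smul, Pi.smul_apply, s.coord_crd_smul]
        have e := congrFun ((s.coordEquiv σ).apply_symm_apply (Pi.single (J.dec r) v)) (I.dec r)
        rw [show s.coord σ ((s.coordEquiv σ).symm (Pi.single (J.dec r) v)) (I.dec r) = _ from e]
        by_cases hI : I = J
        · subst hI
          rw [Pi.single_eq_same, Pi.single_eq_same, smul_smul,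
            inv_mul_cancel₀ (MIdx.coef_ne_zero hr), one_smul]
        · rw [Pi.single_eq_of_ne hI]
          -- Lowering truncates at zero, so another index may have the same image; there the
          -- exponent of `r` is zero and the coefficient vanishes.
          by_cases hdec : I.dec r = J.dec r
          · have h0 : I.exp r = 0 := by
              by_contra hne
              apply hI
              refine MIdx.ext_exp fun t => ?_
              have := congrArg (fun K => MIdx.exp K t) hdec
              simp only [MIdx.exp_dec] at this
              split_ifs at this with htr
              · subst htr; omega
              · exact this
            rw [MIdx.coef_eq_zero h0, zero_smul, smul_zero]
          · rw [Pi.single_eq_of_ne hdec, smul_zero, smul_zero]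
      rw [this]
      exact hsmul _ _ (hcrd r _ (ih _ _ hsum))
  have hsum : μ = ∑ J, (s.coordEquiv σ).symm (Pi.single J (s.coord σ μ J)) := by
    rw [← map_sum, Finset.univ_sum_single]
    exact ((s.coordEquiv σ).symm_apply_apply μ).symm
  rw [hsum]
  refine Finset.sum_induction _ P hadd ?_ fun J _ => hdelta _ J _ rfl
  have := hsmul 0 0
  simpa using hsmul 0 _ (hhat 0)

end SupplementBasis

end CoordinateFunctions

/-! ### The algebra of functions -/

section CoindAlgebra

variable {k : Type*} {p : ℕ} {L V W Y : Type*} [Field k] [AddCommGroup L] [Module k L]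
  [RestrictedLieSuperalgebra k p L] [AddCommGroup V] [Module k V] [AddCommGroup W] [Module k W]
  [AddCommGroup Y] [Module k Y] {h : RestrictedSub k p L} {n m : ℕ}
  [CharP k p] [Fact (2 < p)]

theorem SuperGrading.mem_gr_of_flip (k : Type*) {V : Type*} [Field k] [AddCommGroup V] [Module k V]
    (p : ℕ) [CharP k p] [Fact (2 < p)] (S : SuperGrading k V) {i : ZMod 2} {v : V}
    (hv : S.flip v = sgn k i • v) : v ∈ S.gr i := by
  have h2 := two_ne k p
  have e : S.proj 0 v + S.proj 1 v = v := S.proj_add v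
  have e2 : S.proj 0 v - S.proj 1 v = sgn k i • v := hv
  rcases zmod2_cases i with rfl | rfl
  · rw [sgn_zero, one_smul] at e2
    have : (2 : k) • S.proj 1 v = 0 := by
      rw [two_smul, ← sub_eq_zero.2 (e.trans e2.symm)]; abel
    rw [← e, (smul_eq_zero.1 this).resolve_left h2, add_zero]
    exact S.proj_mem 0 v
  · rw [sgn_one, neg_one_smul] at e2
    have : (2 : k) • S.proj 0 v = 0 := by
      have h3 := congrArg₂ (· + ·) e e2
      simp only [add_neg_cancel] at h3
      rw [two_smul, ← h3]; abel
    rw [← e, (smul_eq_zero.1 this).resolve_left h2, zero_add]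
    exact S.proj_mem 1 v

namespace Coind

/-- Homogeneity becomes an eigenvalue condition for the parity automorphism, which turns parity
arguments into computations with signs. -/
theorem mem_gr_iff {σ : RestrictedRep k p h.carrier V} {j : ZMod 2} {μ : Coind h σ} :
    μ ∈ Coind.gr h σ j ↔ homFlip σ.grading μ.1 = sgn k j • μ.1 := by
  constructor
  · intro hμ
    ext u
    induction u using (REnv.grading (k := k) (p := p) (L := L)).induction with
    | hadd u w hu hw => rw [map_add, map_add, hu, hw]
    | hom l u hu =>
      have hu' : REnv.parity u = sgn k l • u := hu
      rw [homFlip_apply, hu', map_smul, map_smul, SuperGrading.flip_of_mem _ (hμ l u hu),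
        smul_smul, sgn_add, mul_left_comm, sgn_mul_self, mul_one, LinearMap.smul_apply]
  · intro hμ l u hu
    have hu' : REnv.parity u = sgn k l • u := hu
    have := LinearMap.congr_fun hμ u
    rw [homFlip_apply, hu', map_smul, map_smul, LinearMap.smul_apply] at this
    refine SuperGrading.mem_gr_of_flip k p _ ?_
    have h2 := congrArg (fun v => sgn k l • v) this
    simp only [smul_smul, sgn_mul_self, one_smul] at h2
    rw [h2, sgn_add, mul_comm]

theorem tw_mem {σ : RestrictedRep k p h.carrier V} (i : ZMod 2) (μ : Coind h σ) :
    SuperDuality.tw σ.grading i μ.1 ∈ Coind h σ := by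
  rcases zmod2_cases i with rfl | rfl
  · rw [tw_zero]; exact μ.2
  · rw [tw_one]
    apply mem_coind
    intro i x hx u
    have hxL : (x : L) ∈ (LieSuperalgebra.grading (k := k) (L := L)).gr i := hx
    rw [homFlip_apply, map_mul, REnv.parity_ι hxL, smul_mul_assoc, map_smul, coind_apply,
      map_smul, σ.flip_ρ hx, smul_smul, sgn_mul_self, one_smul, homFlip_apply]

/-- The `i`-th power of the parity automorphism of a coinduced representation. -/
def tw {σ : RestrictedRep k p h.carrier V} (i : ZMod 2) (μ : Coind h σ) : Coind h σ :=
  ⟨SuperDuality.tw σ.grading i μ.1, tw_mem i μ⟩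

variable {σ : RestrictedRep k p h.carrier V}

@[simp] theorem coe_tw (i : ZMod 2) (μ : Coind h σ) :
    (tw i μ).1 = SuperDuality.tw σ.grading i μ.1 := rfl

@[simp] theorem zero_tw (μ : Coind h σ) : tw 0 μ = μ := Subtype.ext (by simp)

theorem tw_tw (i j : ZMod 2) (μ : Coind h σ) : tw i (tw j μ) = tw (i + j) μ :=
  Subtype.ext (SuperDuality.tw_tw _ _ _ _)

theorem tw_tw_self (i : ZMod 2) (μ : Coind h σ) : tw i (tw i μ) = μ := by
  rw [tw_tw]
  rcases zmod2_cases i with rfl | rfl <;> simp [one_add_one_zmod2]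

theorem tw_add (i : ZMod 2) (μ ν : Coind h σ) : tw i (μ + ν) = tw i μ + tw i ν :=
  Subtype.ext (SuperDuality.tw_add _ _ _ _)

theorem tw_scalar (i : ZMod 2) (c : k) (μ : Coind h σ) : tw i (c • μ) = c • tw i μ :=
  Subtype.ext (SuperDuality.tw_smul _ _ _ _)

theorem tw_of_mem {j : ZMod 2} {μ : Coind h σ} (hμ : μ ∈ Coind.gr h σ j) (i : ZMod 2) :
    tw i μ = sgn k (i * j) • μ := by
  rcases zmod2_cases i with rfl | rfl
  · simp [sgn_zero]
  · apply Subtype.ext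
    rw [coe_tw, tw_one, mem_gr_iff.1 hμ, one_mul]; rfl

theorem mem_gr_of_tw {j : ZMod 2} {μ : Coind h σ} (hμ : tw 1 μ = sgn k j • μ) :
    μ ∈ Coind.gr h σ j := by
  rw [mem_gr_iff, ← tw_one]
  exact congrArg Subtype.val hμ

theorem act_tw {i : ZMod 2} (j : ZMod 2) {x : L}
    (hx : x ∈ (LieSuperalgebra.grading (k := k) (L := L)).gr i) (μ : Coind h σ) :
    act (REnv.ι k p L x) (tw j μ) = sgn k (i * j) • tw j (act (REnv.ι k p L x) μ) :=
  Subtype.ext (rtrans_tw σ.grading j hx μ.1)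

theorem act_mul (u w : REnv k p L) (μ : Coind h σ) : act (u * w) μ = act u (act w μ) := by
  apply Subtype.ext
  ext v
  change μ.1 (v * (u * w)) = μ.1 (v * u * w)
  rw [mul_assoc]

theorem act_add (u w : REnv k p L) (μ : Coind h σ) : act (u + w) μ = act u μ + act w μ := by
  apply Subtype.ext
  ext v
  change μ.1 (v * (u + w)) = μ.1 (v * u) + μ.1 (v * w)
  rw [mul_add, map_add]

theorem act_scalar (c : k) (u : REnv k p L) (μ : Coind h σ) : act (c • u) μ = c • act u μ := by
  apply Subtype.ext
  ext v
  change μ.1 (v * (c • u)) = c • μ.1 (v * u)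
  rw [mul_smul_comm, map_smul]

theorem act_apply_one (u : REnv k p L) (μ : Coind h σ) : (act u μ).1 1 = μ.1 u := by
  change μ.1 (1 * u) = μ.1 u
  rw [one_mul]

variable [Fact p.Prime]

theorem coe_smul (f : FunAlg h) (μ : Coind h σ) :
    (Coind.smul f μ).1 = conv (SuperGrading.trivial k) (LinearMap.lsmul k V) f.1 μ.1 := rfl

theorem smul_apply_one (f : FunAlg h) (μ : Coind h σ) :
    (Coind.smul f μ).1 1 = f.1 1 • μ.1 1 := by
  rw [coe_smul, conv_one, LinearMap.lsmul_apply]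

/-- The product with elements of `𝒜` as a bilinear map. -/
def smulₗ (h : RestrictedSub k p L) (σ : RestrictedRep k p h.carrier V) :
    FunAlg h →ₗ[k] Coind h σ →ₗ[k] Coind h σ :=
  LinearMap.mk₂ k Coind.smul
    (fun f g μ => Subtype.ext (conv_add_left _ _ f.1 g.1 μ.1))
    (fun c f μ => Subtype.ext (conv_smul_left _ _ c f.1 μ.1))
    (fun f μ ν => Subtype.ext (conv_add_right _ _ f.1 μ.1 ν.1))
    (fun c f μ => Subtype.ext (conv_smul_right _ _ c f.1 μ.1))

theorem add_smul (f g : FunAlg h) (μ : Coind h σ) :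
    Coind.smul (f + g) μ = Coind.smul f μ + Coind.smul g μ := (smulₗ h σ).map_add₂ f g μ

theorem scalar_smul (c : k) (f : FunAlg h) (μ : Coind h σ) :
    Coind.smul (c • f) μ = c • Coind.smul f μ := (smulₗ h σ).map_smul₂ c f μ

theorem smul_add (f : FunAlg h) (μ ν : Coind h σ) :
    Coind.smul f (μ + ν) = Coind.smul f μ + Coind.smul f ν := (smulₗ h σ f).map_add μ ν

theorem smul_scalar (c : k) (f : FunAlg h) (μ : Coind h σ) :
    Coind.smul f (c • μ) = c • Coind.smul f μ := (smulₗ h σ f).map_smul c μ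

theorem smul_zero (f : FunAlg h) : Coind.smul f (0 : Coind h σ) = 0 := (smulₗ h σ f).map_zero

theorem zero_smul (μ : Coind h σ) : Coind.smul (0 : FunAlg h) μ = 0 :=
  (smulₗ h σ).map_zero₂ μ

theorem trivial_lsmul_flip (S : SuperGrading k V) (c : k) (v : V) :
    S.flip (LinearMap.lsmul k V c v) =
      LinearMap.lsmul k V ((SuperGrading.trivial k).flip c) (S.flip v) := by
  rw [trivial_flip, LinearMap.lsmul_apply, map_smul, LinearMap.lsmul_apply]

theorem conv_lsmul_assoc (f g : REnv k p L →ₗ[k] k) (μ : REnv k p L →ₗ[k] V) :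
    conv (SuperGrading.trivial k) (LinearMap.lsmul k V)
        (conv (SuperGrading.trivial k) (LinearMap.lsmul k k) f g) μ =
      conv (SuperGrading.trivial k) (LinearMap.lsmul k V) f
        (conv (SuperGrading.trivial k) (LinearMap.lsmul k V) g μ) :=
  conv_assoc (S := SuperGrading.trivial k) (T := SuperGrading.trivial k)
    (R := SuperGrading.trivial k) (B := LinearMap.lsmul k k) (B' := LinearMap.lsmul k V)
    (C := LinearMap.lsmul k V) (C' := LinearMap.lsmul k V)
    (trivial_lsmul_flip _) (fun c d v => by
      simp only [LinearMap.lsmul_apply, smul_eq_mul, mul_smul]) f g μ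

theorem conv_lsmul_tw (S : SuperGrading k V) (i : ZMod 2) (f : REnv k p L →ₗ[k] k)
    (μ : REnv k p L →ₗ[k] V) :
    SuperDuality.tw S i (conv (SuperGrading.trivial k) (LinearMap.lsmul k V) f μ) =
      conv (SuperGrading.trivial k) (LinearMap.lsmul k V)
        (SuperDuality.tw (SuperGrading.trivial k) i f) (SuperDuality.tw S i μ) :=
  tw_conv (S := SuperGrading.trivial k) (T := S) (R := S) (trivial_lsmul_flip S) i f μ

theorem smul_assoc (f g : FunAlg h) (μ : Coind h σ) :
    Coind.smul (Coind.smul f g) μ = Coind.smul f (Coind.smul g μ) := by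
  apply Subtype.ext
  rw [coe_smul, coe_smul, coe_smul, coe_smul]
  exact conv_lsmul_assoc f.1 g.1 μ.1

theorem tw_smul (i : ZMod 2) (f : FunAlg h) (μ : Coind h σ) :
    tw i (Coind.smul f μ) = Coind.smul (tw i f) (tw i μ) := by
  apply Subtype.ext
  rw [coe_tw, coe_smul, coe_smul, coe_tw, coe_tw]
  exact conv_lsmul_tw σ.grading i f.1 μ.1

theorem conv_lsmul_comm {j : ZMod 2} {f : REnv k p L →ₗ[k] k}
    (hf : homFlip (SuperGrading.trivial k) f = sgn k j • f) (g : REnv k p L →ₗ[k] k) :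
    conv (SuperGrading.trivial k) (LinearMap.lsmul k k) f g =
      conv (SuperGrading.trivial k) (LinearMap.lsmul k k)
        (SuperDuality.tw (SuperGrading.trivial k) j g) f := by
  have e : (LinearMap.lsmul k k).flip = LinearMap.lsmul k k := by
    ext; simp
  have := conv_comm (S := SuperGrading.trivial k) (B := LinearMap.lsmul k k) hf g
  rwa [e] at this

/-- The algebra of functions is supercommutative. -/
theorem smul_comm_fun {j : ZMod 2} {f : FunAlg h}
    (hf : f ∈ Coind.gr h (RestrictedRep.trivial k p h.carrier) j) (g : FunAlg h) :
    Coind.smul f g = Coind.smul (tw j g) f := by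
  apply Subtype.ext
  rw [coe_smul, coe_smul, coe_tw]
  exact conv_lsmul_comm (mem_gr_iff.1 hf) g.1

theorem smul_left_comm {j : ZMod 2} {f : FunAlg h}
    (hf : f ∈ Coind.gr h (RestrictedRep.trivial k p h.carrier) j) (g : FunAlg h) (μ : Coind h σ) :
    Coind.smul f (Coind.smul g μ) = Coind.smul (tw j g) (Coind.smul f μ) := by
  rw [← smul_assoc, smul_comm_fun hf, smul_assoc]

/-- `L` acts by superderivations. -/
theorem act_smul {i : ZMod 2} {x : L}
    (hx : x ∈ (LieSuperalgebra.grading (k := k) (L := L)).gr i) (f : FunAlg h) (μ : Coind h σ) :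
    act (REnv.ι k p L x) (Coind.smul f μ) =
      Coind.smul (act (REnv.ι k p L x) f) μ + Coind.smul (tw i f) (act (REnv.ι k p L x) μ) :=
  Subtype.ext (rtrans_conv _ _ f.1 μ.1 hx)

theorem act_mem_gr {i j : ZMod 2} {x : L}
    (hx : x ∈ (LieSuperalgebra.grading (k := k) (L := L)).gr i) {μ : Coind h σ}
    (hμ : μ ∈ Coind.gr h σ j) : act (REnv.ι k p L x) μ ∈ Coind.gr h σ (i + j) := by
  apply mem_gr_of_tw
  have := act_tw 1 hx μ
  rw [tw_of_mem hμ, map_smul, mul_one, one_mul] at this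
  have h2 := congrArg (fun ν => sgn k i • ν) this
  simp only [smul_smul, sgn_mul_self, one_smul] at h2
  rw [← h2, sgn_add]

variable (h) in
/-- The unit of the algebra of functions. -/
def one : FunAlg h := ⟨counit k p L, by
  apply mem_coind
  intro i x hx u
  simp [counit, RestrictedRep.trivial]⟩

theorem coe_one : (one h).1 = counit k p L := rfl

theorem one_smul' (μ : Coind h σ) : Coind.smul (one h) μ = μ := by
  apply Subtype.ext
  rw [coe_smul, coe_one, conv_counit_left]
  ext u
  simp

theorem smul_one' (f : FunAlg h) : Coind.smul f (one h) = f := by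
  apply Subtype.ext
  rw [coe_smul, coe_one, conv_counit_right]
  ext u
  simp

theorem act_one {x : L} : act (REnv.ι k p L x) (one h) = 0 := Subtype.ext (rtrans_counit x)

theorem tw_one' (i : ZMod 2) : tw i (one h) = one h := Subtype.ext (tw_counit i)

end Coind

namespace SupplementBasis

variable (s : SupplementBasis h n m) [Fact p.Prime]

/-- The counit vanishes on all nonempty monomials, so it is the function with these values. -/
theorem hat_scalar (c : k) : s.hat (RestrictedRep.trivial k p h.carrier) c = c • Coind.one h := by
  refine s.coord_ext fun I => ?_
  rw [s.coord_hat, map_smul, Pi.smul_apply, s.coord_apply]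
  rcases List.eq_nil_or_concat I.word with hw | ⟨w, r, hw⟩
  · rw [if_pos fun t => by rw [← MIdx.count_word, hw, List.count_nil], hw, s.wordProd_nil,
      Coind.coe_one, counit_one, smul_eq_mul, mul_one]
  · rw [List.concat_eq_append] at hw
    rw [if_neg, hw, s.wordProd_concat, Coind.coe_one, ← rtrans_apply, rtrans_counit]
    · simp
    · intro h0
      have := h0 r
      rw [← MIdx.count_word, hw, List.count_append, List.count_singleton_self] at this
      omega

theorem coord_tw {σ : RestrictedRep k p h.carrier V} (μ : Coind h σ) (I : MIdx p n m) :
    s.coord σ (Coind.tw 1 μ) I = sgn k (wordPar I.word) • σ.grading.flip (s.coord σ μ I) := by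
  rw [s.coord_apply, s.coord_apply, Coind.coe_tw, tw_one, homFlip_apply, s.parity_wordProd,
    map_smul, map_smul]

theorem wordPar_word (I : MIdx p n m) : wordPar I.word = ∑ r, I.exp r • letterPar r := by
  rw [wordPar, sum_map_eq_count]
  exact Finset.sum_congr rfl fun r _ => by rw [MIdx.count_word]

theorem crd_mem_gr (r : Fin n ⊕ Fin m) :
    s.crd r ∈ Coind.gr h (RestrictedRep.trivial k p h.carrier) (letterPar r) := by
  apply Coind.mem_gr_of_tw
  refine s.coord_ext fun I => ?_
  rw [s.coord_tw, map_smul, Pi.smul_apply, s.coord_crd]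
  split_ifs with hI
  · rw [wordPar_word, Finset.sum_eq_single r (fun t _ htr => by rw [hI, if_neg htr, zero_smul])
      (by simp), hI, if_pos rfl, one_smul]
    congr 1
    exact trivial_flip 1
  · simp

theorem hat_mem_gr {σ : RestrictedRep k p h.carrier V} {i : ZMod 2} {v : V}
    (hv : v ∈ σ.grading.gr i) : s.hat σ v ∈ Coind.gr h σ i := by
  apply Coind.mem_gr_of_tw
  refine s.coord_ext fun I => ?_
  rw [s.coord_tw, map_smul, Pi.smul_apply, s.coord_hat]
  split_ifs with hI
  · rw [wordPar_word, Finset.sum_eq_zero (fun t _ => by rw [hI, zero_smul]), sgn_zero, one_smul,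
      SuperGrading.flip_of_mem _ hv]
  · simp

end SupplementBasis

end CoindAlgebra

/-! ### Partial derivatives -/

section Increment

variable {n m p : ℕ}

open Classical in
/-- Raise an exponent by one, if possible. -/
def MIdx.inc (r : Fin n ⊕ Fin m) (I : MIdx p n m) : MIdx p n m :=
  MIdx.ofExp (fun t => if t = r ∧ I.exp r + 1 < letterBound p r then I.exp t + 1 else I.exp t)
    (fun t => by
      split_ifs with h
      · rw [h.1]; exact h.2
      · exact I.exp_lt t)

theorem MIdx.exp_inc {r : Fin n ⊕ Fin m} {I : MIdx p n m} (hI : I.exp r + 1 < letterBound p r)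
    (t : Fin n ⊕ Fin m) : (I.inc r).exp t = if t = r then I.exp t + 1 else I.exp t := by
  simp [inc, hI]

theorem MIdx.inc_dec {r : Fin n ⊕ Fin m} {I : MIdx p n m} (hI : 0 < I.exp r) :
    (I.dec r).inc r = I := by
  have h1 : (I.dec r).exp r + 1 < letterBound p r := by
    rw [exp_dec, if_pos rfl, Nat.sub_add_cancel hI]; exact I.exp_lt r
  refine ext_exp fun t => ?_
  rw [exp_inc h1, exp_dec]
  split_ifs with htr
  · subst htr; omega
  · rfl

theorem MIdx.dec_inc {r : Fin n ⊕ Fin m} {I : MIdx p n m} (hI : I.exp r + 1 < letterBound p r) :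
    (I.inc r).dec r = I := by
  refine ext_exp fun t => ?_
  rw [exp_dec, exp_inc hI, exp_inc hI]
  by_cases htr : t = r
  · subst htr; simp
  · simp [htr]

theorem MIdx.dec_inc_comm {r t : Fin n ⊕ Fin m} (hrt : t ≠ r) {I : MIdx p n m}
    (hI : I.exp r + 1 < letterBound p r) : (I.inc r).dec t = (I.dec t).inc r := by
  have h1 : (I.dec t).exp r + 1 < letterBound p r := by
    rw [exp_dec, if_neg hrt.symm]; exact hI
  refine ext_exp fun x => ?_
  rw [exp_dec, exp_inc hI, exp_inc hI, exp_inc h1, exp_dec]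
  by_cases hxt : x = t
  · subst hxt; simp [hrt]
  · by_cases hxr : x = r
    · subst hxr; simp [hxt]
    · simp [hxt, hxr]

open Classical in
theorem MIdx.rightPar_inc {t : Fin n ⊕ Fin m} {I : MIdx p n m}
    (hI : I.exp t + 1 < letterBound p t) (r : Fin n ⊕ Fin m) :
    rightPar r (I.inc t).word = rightPar r I.word + if letterLE t r then 0 else letterPar t := by
  rw [rightPar, rightPar, sum_map_eq_count, sum_map_eq_count]
  simp only [count_word]
  rw [← Finset.add_sum_erase _ _ (Finset.mem_univ t),
    ← Finset.add_sum_erase (a := t) _ (fun r_1 => I.exp r_1 • _) (Finset.mem_univ t),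
    exp_inc hI, if_pos rfl, add_smul, one_smul]
  have : ∀ x ∈ Finset.univ.erase t, (I.inc t).exp x = I.exp x := fun x hx => by
    rw [exp_inc hI, if_neg (Finset.ne_of_mem_erase hx)]
  rw [Finset.sum_congr rfl fun x hx => by rw [this x hx]]
  abel

open Classical in
theorem MIdx.rightPar_dec {t : Fin n ⊕ Fin m} {I : MIdx p n m} (hI : 0 < I.exp t)
    (r : Fin n ⊕ Fin m) :
    rightPar r (I.dec t).word = rightPar r I.word + if letterLE t r then 0 else letterPar t := by
  have h1 : (I.dec t).exp t + 1 < letterBound p t := by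
    rw [exp_dec, if_pos rfl, Nat.sub_add_cancel hI]; exact I.exp_lt t
  have := rightPar_inc h1 r
  rw [inc_dec hI] at this
  have e : ∀ a b c : ZMod 2, a = b + c → b = a + c := by decide
  exact e _ _ _ this

theorem letterLE_total (r t : Fin n ⊕ Fin m) : letterLE r t ∨ letterLE t r := by
  rcases r with i | i <;> rcases t with j | j
  · exact (le_total i j).imp Sum.Lex.inl Sum.Lex.inl
  · exact Or.inl (Sum.Lex.sep _ _)
  · exact Or.inr (Sum.Lex.sep _ _)
  · exact (le_total i j).imp Sum.Lex.inr Sum.Lex.inr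

theorem letterLE_refl (r : Fin n ⊕ Fin m) : letterLE r r := (letterLE_total r r).elim id id

/-- The sign that arises by moving a letter to its place from the right end of a monomial. -/
def MIdx.rsgn (k : Type*) [Ring k] (r : Fin n ⊕ Fin m) (I : MIdx p n m) : k :=
  sgn k (letterPar r * rightPar r I.word)

theorem MIdx.coef_eq (k : Type*) [Ring k] (r : Fin n ⊕ Fin m) (I : MIdx p n m) :
    I.coef k r = (I.exp r : k) * I.rsgn k r := rfl

theorem MIdx.rsgn_inc_self (k : Type*) [Ring k] {r : Fin n ⊕ Fin m} {I : MIdx p n m}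
    (hI : I.exp r + 1 < letterBound p r) : (I.inc r).rsgn k r = I.rsgn k r := by
  rw [rsgn, rightPar_inc hI, if_pos (letterLE_refl r), add_zero, rsgn]

theorem MIdx.rsgn_dec_self (k : Type*) [Ring k] {r : Fin n ⊕ Fin m} {I : MIdx p n m}
    (hI : 0 < I.exp r) : (I.dec r).rsgn k r = I.rsgn k r := by
  rw [rsgn, rightPar_dec hI, if_pos (letterLE_refl r), add_zero, rsgn]

theorem MIdx.rsgn_mul_self (k : Type*) [Field k] (r : Fin n ⊕ Fin m) (I : MIdx p n m) :
    I.rsgn k r * I.rsgn k r = 1 := sgn_mul_self _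

/-- Of two different letters exactly one lies beyond the other, so exactly one of the two signs is
affected by changing the other exponent; this yields the Koszul sign. -/
theorem MIdx.rsgn_inc_dec (k : Type*) [Field k] {r t : Fin n ⊕ Fin m} (hrt : t ≠ r)
    {I : MIdx p n m} (hI : I.exp r + 1 < letterBound p r) (ht : 0 < I.exp t) :
    I.rsgn k r * (I.inc r).rsgn k t =
      sgn k (letterPar r * letterPar t) * (I.rsgn k t * (I.dec t).rsgn k r) := by
  rw [rsgn, rsgn, rsgn, rsgn, rightPar_inc hI, rightPar_dec ht, ← sgn_add, ← sgn_add, ← sgn_add]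
  congr 1
  have key : ∀ a b x y : ZMod 2, (a * x + b * (y + a) = a * b + (b * y + a * (x + 0))) ∧
      (a * x + b * (y + 0) = a * b + (b * y + a * (x + b))) := by decide
  rcases letterLE_total r t with hle | hle
  · rw [if_pos hle, if_neg fun h' => hrt (letterLE_antisymm h' hle)]
    exact (key _ _ _ _).2
  · rw [if_pos hle, if_neg fun h' => hrt (letterLE_antisymm hle h')]
    exact (key _ _ _ _).1

end Increment

section PartialDerivatives

variable {k : Type*} {p : ℕ} {L V W Y : Type*} [Field k] [AddCommGroup L] [Module k L]
  [RestrictedLieSuperalgebra k p L] [AddCommGroup V] [Module k V] [AddCommGroup W] [Module k W]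
  [AddCommGroup Y] [Module k Y] {h : RestrictedSub k p L} {n m : ℕ}
  [CharP k p] [Fact (2 < p)] [Fact p.Prime]

namespace SupplementBasis

variable (s : SupplementBasis h n m)

open Classical in
/-- The partial derivative with respect to a letter. -/
def pd (r : Fin n ⊕ Fin m) : FunAlg h →ₗ[k] FunAlg h :=
  (s.coordEquiv _).symm.toLinearMap ∘ₗ
    LinearMap.pi (fun I => if I.exp r + 1 < letterBound p r then
      I.rsgn k r • LinearMap.proj (I.inc r) else 0) ∘ₗ s.coord _

open Classical in
theorem coord_pd (r : Fin n ⊕ Fin m) (f : FunAlg h) (I : MIdx p n m) :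
    s.coord _ (s.pd r f) I =
      if I.exp r + 1 < letterBound p r then I.rsgn k r * s.coord _ f (I.inc r) else 0 := by
  refine (congrFun ((s.coordEquiv _).apply_symm_apply _) I).trans ?_
  rw [LinearMap.comp_apply, LinearMap.pi_apply]
  split_ifs <;> rfl

theorem partialEven_eq (i : Fin n) : s.partialEven i = s.pd (Sum.inl i) := by
  funext f
  refine s.coord_ext fun I => ?_
  rw [partialEven, s.coord_coordInv, s.coord_pd, dEven]
  change (if hI : I.exp (Sum.inl i) + 1 < letterBound (n := n) (m := m) p (Sum.inl i) then _ else _) = _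
  split_ifs with hI
  · have e : I.rsgn k (Sum.inl i) = 1 := by simp [MIdx.rsgn, letterPar, sgn]
    rw [e, one_mul]
    refine congrArg (s.coord _ f) (MIdx.ext_exp fun t => ?_)
    rw [MIdx.exp_inc hI]
    rcases t with j | j
    · by_cases hj : j = i
      · subst hj; simp [MIdx.exp]
      · simp [MIdx.exp, hj]
    · simp [MIdx.exp]
  · rfl

theorem partialOdd_eq (i : Fin m) : s.partialOdd i = s.pd (Sum.inr i) := by
  funext f
  refine s.coord_ext fun I => ?_
  rw [partialOdd, s.coord_coordInv, s.coord_pd, dOdd]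
  have hiff : (I.2 i : ℕ) = 0 ↔ I.exp (Sum.inr i) + 1 < letterBound (n := n) (m := m) p (Sum.inr i) := by
    simp [MIdx.exp, letterBound]
  by_cases h0 : (I.2 i : ℕ) = 0
  · have hI := hiff.1 h0
    rw [if_pos h0, if_pos hI]
    have e : I.rsgn k (Sum.inr i) = (-1) ^ I.beyond i := by
      rw [MIdx.rsgn, I.rightPar_word]
      simp [letterPar, sgn_natCast]
    rw [e, MIdx.beyond]
    refine congrArg (_ * ·) (congrArg (s.coord _ f) (MIdx.ext_exp fun t => ?_))
    rw [MIdx.exp_inc hI]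
    rcases t with j | j
    · simp [MIdx.exp]
    · by_cases hj : j = i
      · subst hj; simp [MIdx.exp, h0]
      · simp [MIdx.exp, hj]
  · rw [if_neg h0, if_neg (hiff.not.1 h0)]

/-- The commutation of partial derivatives and multiplications with coordinate functions. -/
theorem pd_crd_smul (r t : Fin n ⊕ Fin m) (g : FunAlg h) :
    s.pd r (Coind.smul (s.crd t) g) = (if r = t then g else 0) +
      sgn k (letterPar r * letterPar t) • Coind.smul (s.crd t) (s.pd r g) := by
  classical
  refine s.coord_ext fun I => ?_
  rw [s.coord_pd, map_add, Pi.add_apply, map_smul, Pi.smul_apply, s.coord_crd_smul,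
    s.coord_crd_smul, s.coord_pd, smul_eq_mul, smul_eq_mul, smul_eq_mul]
  by_cases hrt : r = t
  · subst hrt
    rw [if_pos rfl]
    by_cases h0 : 0 < I.exp r
    · have h1 : (I.dec r).exp r + 1 < letterBound p r := by
        rw [MIdx.exp_dec, if_pos rfl, Nat.sub_add_cancel h0]; exact I.exp_lt r
      rw [if_pos h1, MIdx.inc_dec h0, MIdx.rsgn_dec_self k h0, MIdx.coef_eq k r I]
      have e2 : sgn k (letterPar r * letterPar r) *
          ((I.exp r : k) * I.rsgn k r * (I.rsgn k r * s.coord _ g I)) =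
          sgn k (letterPar r * letterPar r) * (I.exp r : k) * s.coord _ g I := by
        linear_combination (sgn k (letterPar r * letterPar r) * (I.exp r : k) * s.coord _ g I) *
          MIdx.rsgn_mul_self k r I
      rw [e2]
      split_ifs with hI
      · rw [MIdx.dec_inc hI, MIdx.coef_eq, MIdx.rsgn_inc_self k hI, MIdx.exp_inc hI, if_pos rfl]
        have hs : sgn k (letterPar r * letterPar r) = 1 := by
          rcases r with i | i
          · simp [letterPar, sgn]
          · simp only [letterBound, Sum.elim_inr] at hI; omega
        rw [hs]
        push_cast
        linear_combination ((I.exp r : k) + 1) * s.coord _ g I * MIdx.rsgn_mul_self k r I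
      -- At the largest exponent the derivative of the product vanishes, and the other side does
      -- too: it is `1 + (p - 1) = 0` for an even letter and `1 - 1 = 0` for an odd one.
      · have hs : sgn k (letterPar r * letterPar r) * (I.exp r : k) = -1 := by
          have := I.exp_lt r
          rcases r with i | i
          · have e : I.exp (Sum.inl i) + 1 = p := by
              simp only [letterBound, Sum.elim_inl] at hI this; omega
            have e' : ((I.exp (Sum.inl i) + 1 : ℕ) : k) = 0 := by
              rw [e]; exact CharP.cast_eq_zero k p
            rw [Nat.cast_add, Nat.cast_one] at e'
            simp only [letterPar, Sum.elim_inl, mul_zero, sgn_zero, one_mul]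
            linear_combination e'
          · have e : I.exp (Sum.inr i) = 1 := by
              simp only [letterBound, Sum.elim_inr] at hI this; omega
            simp [e, letterPar, sgn_one]
        rw [hs]; ring
    · have h0' : I.exp r = 0 := by omega
      have hI : I.exp r + 1 < letterBound p r := by
        have := (Fact.out : 2 < p)
        rw [h0']
        rcases r with i | i
        · simp only [letterBound, Sum.elim_inl]; omega
        · simp [letterBound]
      rw [if_pos hI, MIdx.dec_inc hI, MIdx.coef_eq, MIdx.rsgn_inc_self k hI, MIdx.exp_inc hI,
        if_pos rfl, h0', MIdx.coef_eq_zero h0']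
      push_cast
      linear_combination s.coord _ g I * MIdx.rsgn_mul_self k r I
  · have htr : t ≠ r := fun h => hrt h.symm
    rw [if_neg hrt, map_zero, Pi.zero_apply, zero_add]
    have hexp : (I.dec t).exp r = I.exp r := by rw [MIdx.exp_dec, if_neg hrt]
    rw [hexp]
    split_ifs with hI
    · rw [MIdx.dec_inc_comm htr hI, MIdx.coef_eq, MIdx.coef_eq, MIdx.exp_inc hI, if_neg htr]
      by_cases h0 : 0 < I.exp t
      · linear_combination (I.exp t : k) * s.coord _ g ((I.dec t).inc r) *
          MIdx.rsgn_inc_dec k htr hI h0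
      · have h0' : I.exp t = 0 := by omega
        rw [h0']; simp
    · simp

theorem pd_one (r : Fin n ⊕ Fin m) : s.pd r (Coind.one h) = 0 := by
  have e : Coind.one h = s.hat (RestrictedRep.trivial k p h.carrier) 1 := by
    rw [s.hat_scalar, one_smul]
  refine s.coord_ext fun I => ?_
  rw [s.coord_pd, e]
  split_ifs with hI
  · rw [s.coord_hat, if_neg, mul_zero]
    · simp
    · intro h0
      have := h0 r
      rw [MIdx.exp_inc hI, if_pos rfl] at this
      omega
  · simp

theorem pd_crd (r t : Fin n ⊕ Fin m) :
    s.pd r (s.crd t) = if r = t then Coind.one h else 0 := by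
  have := s.pd_crd_smul r t (Coind.one h)
  rwa [Coind.smul_one', s.pd_one, Coind.smul_zero, smul_zero, add_zero] at this

theorem fun_induction {P : FunAlg h → Prop} (hadd : ∀ f g, P f → P g → P (f + g))
    (hsmul : ∀ (c : k) f, P f → P (c • f)) (hone : P (Coind.one h))
    (hcrd : ∀ r f, P f → P (Coind.smul (s.crd r) f)) (f : FunAlg h) : P f :=
  s.coind_induction hadd hsmul (fun c => by rw [s.hat_scalar]; exact hsmul c _ hone) hcrd f

theorem tw_crd (i : ZMod 2) (r : Fin n ⊕ Fin m) :
    Coind.tw i (s.crd r) = sgn k (i * letterPar r) • s.crd r :=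
  Coind.tw_of_mem (s.crd_mem_gr r) i

/-- The partial derivatives are superderivations. -/
theorem pd_smul (r : Fin n ⊕ Fin m) (f g : FunAlg h) :
    s.pd r (Coind.smul f g) =
      Coind.smul (s.pd r f) g + Coind.smul (Coind.tw (letterPar r) f) (s.pd r g) := by
  -- The canonical supercommutation relations are the Leibniz rule for one coordinate function, and
  -- these generate `𝒜`.
  induction f using s.fun_induction with
  | hadd f f' hf hf' =>
    rw [Coind.add_smul, map_add, map_add, hf, hf', Coind.tw_add, Coind.add_smul, Coind.add_smul]
    abel
  | hsmul c f hf =>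
    rw [Coind.scalar_smul, map_smul, map_smul, hf, Coind.tw_scalar, Coind.scalar_smul,
      Coind.scalar_smul, smul_add]
  | hone => rw [s.pd_one, Coind.zero_smul, Coind.tw_one', Coind.one_smul', Coind.one_smul', zero_add]
  | hcrd t f hf =>
    rw [Coind.smul_assoc, s.pd_crd_smul, hf, s.pd_crd_smul, Coind.tw_smul, s.tw_crd,
      Coind.add_smul]
    simp only [Coind.scalar_smul, Coind.smul_assoc, Coind.smul_add, smul_add]
    split_ifs
    · abel
    · rw [Coind.zero_smul]; abel

theorem isSuperDerivation_pd (r : Fin n ⊕ Fin m) : IsSuperDerivation (letterPar r) (s.pd r) where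
  map_add := (s.pd r).map_add
  map_smul := (s.pd r).map_smul
  leibniz j f hf g := by rw [s.pd_smul, Coind.tw_of_mem hf, Coind.scalar_smul]

/-- The partial derivatives are homogeneous. -/
theorem pd_tw (r : Fin n ⊕ Fin m) (i : ZMod 2) (f : FunAlg h) :
    s.pd r (Coind.tw i f) = sgn k (letterPar r * i) • Coind.tw i (s.pd r f) := by
  have hz : Coind.tw i (0 : FunAlg h) = 0 := by
    simpa using Coind.tw_scalar i (0 : k) (0 : FunAlg h)
  induction f using s.fun_induction with
  | hadd f f' hf hf' => rw [Coind.tw_add, map_add, map_add, hf, hf', Coind.tw_add, smul_add]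
  | hsmul c f hf =>
    rw [Coind.tw_scalar, map_smul, map_smul, hf, Coind.tw_scalar, smul_comm]
  | hone => rw [Coind.tw_one', s.pd_one, hz, smul_zero]
  | hcrd t f hf =>
    rw [Coind.tw_smul, s.tw_crd, Coind.scalar_smul, map_smul, s.pd_crd_smul, hf, s.pd_crd_smul,
      Coind.tw_add, Coind.tw_scalar, Coind.tw_smul, s.tw_crd, Coind.scalar_smul,
      Coind.smul_scalar, smul_add, smul_add, smul_smul, smul_smul, smul_smul, smul_smul]
    congr 1
    · split_ifs with hrt
      · subst hrt; rw [mul_comm]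
      · rw [hz, smul_zero, smul_zero]
    · congr 1
      ring

theorem pd_mem_gr (r : Fin n ⊕ Fin m) {j : ZMod 2} {f : FunAlg h}
    (hf : f ∈ Coind.gr h (RestrictedRep.trivial k p h.carrier) j) :
    s.pd r f ∈ Coind.gr h (RestrictedRep.trivial k p h.carrier) (letterPar r + j) := by
  apply Coind.mem_gr_of_tw
  have := s.pd_tw r 1 f
  rw [Coind.tw_of_mem hf, map_smul, mul_one, one_mul] at this
  have h2 := congrArg (fun ν => sgn k (letterPar r) • ν) this
  simp only [smul_smul, sgn_mul_self, one_smul] at h2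
  rw [← h2, sgn_add]

end SupplementBasis

end PartialDerivatives

/-! ### Products of coordinate functions -/

section Decrement

variable {n m p : ℕ}

/-- Lower the exponents by the letters of a word. -/
def MIdx.decs (w : List (Fin n ⊕ Fin m)) (K : MIdx p n m) : MIdx p n m :=
  w.foldl (fun K r => K.dec r) K

theorem MIdx.exp_decs (w : List (Fin n ⊕ Fin m)) (K : MIdx p n m) (t : Fin n ⊕ Fin m) :
    (K.decs w).exp t = K.exp t - w.count t := by
  induction w generalizing K with
  | nil => simp [decs]
  | cons r w ih =>
    have e : K.decs (r :: w) = (K.dec r).decs w := rfl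
    rw [e, ih, exp_dec, List.count_cons]
    by_cases hrt : t = r
    · subst hrt; simp; omega
    · simp [hrt, Ne.symm hrt]

/-- The coefficient in the product with the coordinate functions of the letters of a word. -/
def MIdx.wcoef (k : Type*) [Ring k] : List (Fin n ⊕ Fin m) → MIdx p n m → k
  | [], _ => 1
  | r :: w, K => K.coef k r * MIdx.wcoef k w (K.dec r)

/-- The coefficient is a product of signs and of falling exponents, each of them below `p`; it
vanishes only if some exponent has been used up. -/
theorem MIdx.wcoef_ne_zero_iff {k : Type*} [Field k] [CharP k p] [Fact (2 < p)]
    {w : List (Fin n ⊕ Fin m)} {K : MIdx p n m} :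
    K.wcoef k w ≠ 0 ↔ ∀ t, w.count t ≤ K.exp t := by
  induction w generalizing K with
  | nil => simp [wcoef]
  | cons r w ih =>
    rw [wcoef, mul_ne_zero_iff, ih]
    constructor
    · rintro ⟨h1, h2⟩ t
      have h0 : 0 < K.exp r := by
        by_contra h0
        exact h1 (coef_eq_zero (by omega))
      have := h2 t
      rw [exp_dec] at this
      rw [List.count_cons]
      by_cases hrt : t = r
      · subst hrt; simp at this ⊢; omega
      · simpa [hrt, Ne.symm hrt] using this
    · intro H
      have h0 : 0 < K.exp r := by
        have := H r
        rw [List.count_cons_self] at this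
        omega
      refine ⟨coef_ne_zero h0, fun t => ?_⟩
      have := H t
      rw [List.count_cons] at this
      rw [exp_dec]
      by_cases hrt : t = r
      · subst hrt; simp at this ⊢; omega
      · simpa [hrt, Ne.symm hrt] using this

/-- The largest multi-index. -/
def MIdx.top [Fact (2 < p)] : MIdx p n m :=
  MIdx.ofExp (fun r => letterBound p r - 1) (fun r => by
    have := (Fact.out : 2 < p)
    rcases r with i | i <;> simp [letterBound]
    omega)

theorem MIdx.exp_top [Fact (2 < p)] (r : Fin n ⊕ Fin m) :
    (MIdx.top : MIdx p n m).exp r + 1 = letterBound p r := by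
  have := (Fact.out : 2 < p)
  rw [top, exp_ofExp]
  rcases r with i | i <;> simp [letterBound]
  omega

/-- The complementary multi-index. -/
def MIdx.compl [Fact (2 < p)] (K : MIdx p n m) : MIdx p n m :=
  MIdx.ofExp (fun r => (MIdx.top : MIdx p n m).exp r - K.exp r) (fun r => by
    have := (MIdx.top : MIdx p n m).exp_lt r
    omega)

theorem MIdx.exp_le_top [Fact (2 < p)] (K : MIdx p n m) (r : Fin n ⊕ Fin m) :
    K.exp r ≤ (MIdx.top : MIdx p n m).exp r := by
  have := exp_top (p := p) r
  have := K.exp_lt r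
  omega

end Decrement

section LieDerivative

variable {k : Type*} {p : ℕ} {L V W Y : Type*} [Field k] [AddCommGroup L] [Module k L]
  [RestrictedLieSuperalgebra k p L] [AddCommGroup V] [Module k V] [AddCommGroup W] [Module k W]
  [AddCommGroup Y] [Module k Y] {h : RestrictedSub k p L} {n m : ℕ}
  [CharP k p] [Fact (2 < p)] [Fact p.Prime]

theorem FunAlg.sub_eq (f g : FunAlg h) : f - g = f + (-1 : k) • g := by
  apply Subtype.ext
  ext u
  change f.1 u - g.1 u = f.1 u + (-1 : k) * g.1 u
  ring

namespace SupplementBasis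

variable (s : SupplementBasis h n m)

/-- The product with the coordinate functions of the letters of a word. -/
def crdWord {σ : RestrictedRep k p h.carrier V} (w : List (Fin n ⊕ Fin m)) (μ : Coind h σ) :
    Coind h σ :=
  w.foldr (fun r ν => Coind.smul (s.crd r) ν) μ

variable {σ : RestrictedRep k p h.carrier V}

theorem crdWord_cons (r : Fin n ⊕ Fin m) (w : List (Fin n ⊕ Fin m)) (μ : Coind h σ) :
    s.crdWord (r :: w) μ = Coind.smul (s.crd r) (s.crdWord w μ) := rfl

theorem crdWord_append (w w' : List (Fin n ⊕ Fin m)) (μ : Coind h σ) :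
    s.crdWord (w ++ w') μ = s.crdWord w (s.crdWord w' μ) := by
  simp [crdWord]

theorem coord_crdWord (w : List (Fin n ⊕ Fin m)) (μ : Coind h σ) (K : MIdx p n m) :
    s.coord σ (s.crdWord w μ) K = K.wcoef k w • s.coord σ μ (K.decs w) := by
  induction w generalizing K with
  | nil => simp [crdWord, MIdx.wcoef, MIdx.decs]
  | cons r w ih =>
    rw [crdWord_cons, s.coord_crd_smul, ih, smul_smul]
    rfl

theorem crdWord_replicate (a : ℕ) (r : Fin n ⊕ Fin m) (μ : Coind h σ) :
    s.crdWord (List.replicate a r) μ = (Coind.smul (s.crd r))^[a] μ := by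
  induction a with
  | zero => rfl
  | succ a ih => rw [List.replicate_succ, crdWord_cons, ih, Function.iterate_succ_apply']

theorem crdWord_flatten (l : List (List (Fin n ⊕ Fin m))) (μ : Coind h σ) :
    s.crdWord l.flatten μ = l.foldr s.crdWord μ := by
  induction l with
  | nil => rfl
  | cons w l ih => rw [List.flatten_cons, crdWord_append, ih, List.foldr_cons]

theorem monSmul_eq (I : MIdx p n m) (μ : Coind h σ) : s.monSmul I μ = s.crdWord I.word μ := by
  rw [MIdx.word, crdWord_append, crdWord_flatten, crdWord_flatten, List.ofFn_eq_map,
    List.ofFn_eq_map, List.foldr_map, List.foldr_map, monSmul]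
  simp only [crdWord_replicate]
  rfl

theorem smul_crdWord (w : List (Fin n ⊕ Fin m)) (f : FunAlg h) (μ : Coind h σ) :
    Coind.smul (s.crdWord w f) μ = s.crdWord w (Coind.smul f μ) := by
  induction w with
  | nil => rfl
  | cons r w ih => rw [crdWord_cons, Coind.smul_assoc, ih, crdWord_cons]

/-- The coefficient at the largest monomial. -/
def topCoeff : FunAlg h →ₗ[k] k := LinearMap.proj MIdx.top ∘ₗ s.coord _

theorem topCoeff_apply (f : FunAlg h) : s.topCoeff f = s.coord _ f MIdx.top := rfl

/-- The integral of a derivative vanishes: the largest index cannot be raised. -/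
theorem topCoeff_pd (r : Fin n ⊕ Fin m) (f : FunAlg h) : s.topCoeff (s.pd r f) = 0 := by
  rw [topCoeff_apply, s.coord_pd, if_neg]
  rw [MIdx.exp_top]
  exact lt_irrefl _

/-- The pairing of functions is nondegenerate. -/
theorem eq_zero_of_topCoeff {g : FunAlg h} (H : ∀ f, s.topCoeff (Coind.smul f g) = 0) : g = 0 := by
  refine s.coord_ext fun K => ?_
  rw [map_zero, Pi.zero_apply]
  -- Multiplication by the complementary monomial moves the value at `K` to the largest index, with
  -- a nonzero coefficient.
  have := H (s.crdWord K.compl.word (Coind.one h))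
  rw [smul_crdWord, Coind.one_smul', topCoeff_apply, coord_crdWord, smul_eq_zero] at this
  have hK : (MIdx.top : MIdx p n m).decs K.compl.word = K := by
    refine MIdx.ext_exp fun t => ?_
    rw [MIdx.exp_decs, MIdx.count_word, MIdx.compl, MIdx.exp_ofExp]
    have := K.exp_le_top t
    omega
  rw [hK] at this
  refine this.resolve_left (MIdx.wcoef_ne_zero_iff.2 fun t => ?_)
  rw [MIdx.count_word, MIdx.compl, MIdx.exp_ofExp]
  exact Nat.sub_le _ _

theorem eq_of_topCoeff {g g' : FunAlg h}
    (H : ∀ f, s.topCoeff (Coind.smul f g) = s.topCoeff (Coind.smul f g')) : g = g' := by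
  have : g + (-1 : k) • g' = 0 := s.eq_zero_of_topCoeff fun f => by
    rw [Coind.smul_add, Coind.smul_scalar, map_add, map_smul, H, neg_one_smul, add_neg_cancel]
  refine s.coord_ext fun I => ?_
  have := congrArg (fun f => s.coord _ f I) this
  simp only [map_add, map_smul, map_zero, Pi.add_apply, Pi.smul_apply, Pi.zero_apply,
    smul_eq_mul] at this
  linear_combination this

/-! ### The Lie derivative -/

/-- The sign `sgn (letterPar r * (i + 1))` is `1` for even letters and `-(-1)^{|x|}` for odd ones,
so both sums of the divergence have one formula. -/
theorem divergence_eq {i : ZMod 2} {x : L}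
    (hx : x ∈ (LieSuperalgebra.grading (k := k) (L := L)).gr i) :
    s.divergence x = ∑ r, sgn k (letterPar r * (i + 1)) •
      s.pd r (Coind.act (REnv.ι k p L x) (s.crd r)) := by
  rw [divergence, Fintype.sum_sum_type, SuperGrading.flip_of_mem _ hx, FunAlg.sub_eq,
    Finset.smul_sum]
  congr 1
  · refine Finset.sum_congr rfl fun j _ => ?_
    rw [s.partialEven_eq]
    simp [letterPar, sgn_zero, crd]
  · refine Finset.sum_congr rfl fun j _ => ?_
    rw [s.partialOdd_eq, map_smul, Coind.act_scalar, map_smul, smul_smul]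
    simp [letterPar, sgn_add, sgn_one, crd]

/-- A superderivation is determined by its values on the coordinate functions, so it is the vector
field with these coefficients. -/
theorem act_eq_sum {i : ZMod 2} {x : L}
    (hx : x ∈ (LieSuperalgebra.grading (k := k) (L := L)).gr i) (f : FunAlg h) :
    Coind.act (REnv.ι k p L x) f =
      ∑ r, Coind.smul (Coind.act (REnv.ι k p L x) (s.crd r)) (s.pd r f) := by
  induction f using s.fun_induction with
  | hadd f g hf hg =>
    rw [map_add, hf, hg, ← Finset.sum_add_distrib]
    exact Finset.sum_congr rfl fun r _ => by rw [map_add, Coind.smul_add]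
  | hsmul c f hf =>
    rw [map_smul, hf, Finset.smul_sum]
    exact Finset.sum_congr rfl fun r _ => by rw [map_smul, Coind.smul_scalar]
  | hone =>
    rw [Coind.act_one, Finset.sum_eq_zero]
    intro r _
    rw [s.pd_one, Coind.smul_zero]
  | hcrd t f hf =>
    have hr : ∀ r, Coind.smul (Coind.act (REnv.ι k p L x) (s.crd r))
        (s.pd r (Coind.smul (s.crd t) f)) =
        (if r = t then Coind.smul (Coind.act (REnv.ι k p L x) (s.crd r)) f else 0) +
        sgn k (i * letterPar t) • Coind.smul (s.crd t)
          (Coind.smul (Coind.act (REnv.ι k p L x) (s.crd r)) (s.pd r f)) := by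
      intro r
      rw [s.pd_crd_smul, Coind.smul_add, Coind.smul_scalar,
        Coind.smul_left_comm (Coind.act_mem_gr hx (s.crd_mem_gr r)) (s.crd t), s.tw_crd,
        Coind.scalar_smul, smul_smul, ← sgn_add]
      congr 1
      · split_ifs
        · rfl
        · rw [Coind.smul_zero]
      · congr 2
        have key : ∀ a b c : ZMod 2, a * b + (c + a) * b = c * b := by decide
        exact key _ _ _
    have hsum : Coind.smul (s.crd t)
        (∑ r, Coind.smul (Coind.act (REnv.ι k p L x) (s.crd r)) (s.pd r f)) =
        ∑ r, Coind.smul (s.crd t)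
          (Coind.smul (Coind.act (REnv.ι k p L x) (s.crd r)) (s.pd r f)) :=
      map_sum (Coind.smulₗ h _ (s.crd t)) _ _
    rw [Coind.act_smul hx, s.tw_crd, Coind.scalar_smul, hf, hsum,
      Finset.sum_congr rfl fun r _ => hr r, Finset.sum_add_distrib, Finset.smul_sum,
      Finset.sum_ite_eq' Finset.univ t, if_pos (Finset.mem_univ _)]

/-- The Lie derivative is a total divergence. Where the partial derivative falls on the coefficient
of the vector field it contributes to the divergence, and where it falls on `f` to the action; the
signs of the second kind cancel. -/
theorem lieDer_eq_sum {i : ZMod 2} {x : L}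
    (hx : x ∈ (LieSuperalgebra.grading (k := k) (L := L)).gr i) (f : FunAlg h) :
    s.lieDer x f = ∑ r, sgn k (letterPar r * (i + 1)) •
      s.pd r (Coind.smul (Coind.act (REnv.ι k p L x) (s.crd r)) f) := by
  have hsum : Coind.smul (∑ r, sgn k (letterPar r * (i + 1)) •
      s.pd r (Coind.act (REnv.ι k p L x) (s.crd r))) f =
      ∑ r, Coind.smul (sgn k (letterPar r * (i + 1)) •
        s.pd r (Coind.act (REnv.ι k p L x) (s.crd r))) f :=
    map_sum ((Coind.smulₗ h (RestrictedRep.trivial k p h.carrier)).flip f) _ _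
  rw [lieDer, s.act_eq_sum hx, s.divergence_eq hx, hsum, ← Finset.sum_add_distrib]
  refine Finset.sum_congr rfl fun r _ => ?_
  have key : ∀ a b : ZMod 2, a * (b + 1) + a * (b + a) = 0 := by decide
  rw [s.pd_smul, Coind.tw_of_mem (Coind.act_mem_gr hx (s.crd_mem_gr r)), Coind.scalar_smul,
    Coind.scalar_smul, smul_add, smul_smul, ← sgn_add, key, sgn_zero, one_smul, add_comm]

/-- The integral is invariant, as a form of Stokes' theorem. The invariance of the pairing and the
relations for Lie derivatives come from this. -/
theorem topCoeff_lieDer {i : ZMod 2} {x : L}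
    (hx : x ∈ (LieSuperalgebra.grading (k := k) (L := L)).gr i) (f : FunAlg h) :
    s.topCoeff (s.lieDer x f) = 0 := by
  rw [s.lieDer_eq_sum hx, map_sum, Finset.sum_eq_zero]
  intro r _
  rw [map_smul, s.topCoeff_pd, smul_zero]

theorem divergence_mem_gr {i : ZMod 2} {x : L}
    (hx : x ∈ (LieSuperalgebra.grading (k := k) (L := L)).gr i) :
    s.divergence x ∈ Coind.gr h (RestrictedRep.trivial k p h.carrier) i := by
  rw [s.divergence_eq hx]
  refine Submodule.sum_mem _ fun r _ => Submodule.smul_mem _ _ ?_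
  have := s.pd_mem_gr r (Coind.act_mem_gr hx (s.crd_mem_gr r))
  have key : ∀ a b : ZMod 2, a + (b + a) = b := by decide
  rwa [key] at this

theorem lieDer_smul {i : ZMod 2} {x : L}
    (hx : x ∈ (LieSuperalgebra.grading (k := k) (L := L)).gr i) (f g : FunAlg h) :
    s.lieDer x (Coind.smul f g) =
      Coind.smul (Coind.act (REnv.ι k p L x) f) g + Coind.smul (Coind.tw i f) (s.lieDer x g) := by
  rw [lieDer, Coind.act_smul hx, Coind.smul_left_comm (s.divergence_mem_gr hx), lieDer,
    Coind.smul_add]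
  abel

/-- The Lie derivative is adjoint to the action on functions. -/
theorem topCoeff_smul_lieDer {i : ZMod 2} {x : L}
    (hx : x ∈ (LieSuperalgebra.grading (k := k) (L := L)).gr i) (f g : FunAlg h) :
    s.topCoeff (Coind.smul f (s.lieDer x g)) =
      -s.topCoeff (Coind.smul (Coind.act (REnv.ι k p L x) (Coind.tw i f)) g) := by
  have := s.topCoeff_lieDer hx (Coind.smul (Coind.tw i f) g)
  rw [s.lieDer_smul hx, Coind.tw_tw_self, map_add] at this
  exact eq_neg_of_add_eq_zero_right this

/-- The divergence as a linear map. -/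
def divergenceₗ : L →ₗ[k] FunAlg h where
  toFun := s.divergence
  map_add' x y := by
    simp only [divergence, s.partialEven_eq, s.partialOdd_eq, map_add, Coind.act_add,
      Finset.sum_add_distrib]
    abel
  map_smul' c x := by
    simp only [divergence, s.partialEven_eq, s.partialOdd_eq, map_smul, Coind.act_scalar,
      RingHom.id_apply, ← Finset.smul_sum, FunAlg.sub_eq, smul_add]
    rw [smul_comm]

/-- The Lie derivative as a linear map. -/
def lieDerₗ : L →ₗ[k] Module.End k (FunAlg h) :=
  LinearMap.mk₂ k s.lieDer
    (fun x y f => by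
      have e : s.divergence (x + y) = s.divergence x + s.divergence y := s.divergenceₗ.map_add x y
      rw [lieDer, lieDer, lieDer, e, map_add, Coind.act_add, Coind.add_smul]; abel)
    (fun c x f => by
      have e : s.divergence (c • x) = c • s.divergence x := s.divergenceₗ.map_smul c x
      rw [lieDer, lieDer, e, map_smul, Coind.act_scalar, Coind.scalar_smul, smul_add])
    (fun x f g => by rw [lieDer, lieDer, lieDer, map_add, Coind.smul_add]; abel)
    (fun c x f => by rw [lieDer, lieDer, map_smul, Coind.smul_scalar, smul_add])

theorem Coind_tw_act {i j : ZMod 2} {x : L}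
    (hx : x ∈ (LieSuperalgebra.grading (k := k) (L := L)).gr i) (μ : Coind h σ) :
    Coind.tw j (Coind.act (REnv.ι k p L x) μ) =
      sgn k (i * j) • Coind.act (REnv.ι k p L x) (Coind.tw j μ) := by
  rw [Coind.act_tw j hx, smul_smul, sgn_mul_self, one_smul]

/-- Tested against all functions, both operators move to the other factor in reverse order. There
the relation is that of `U'(L)`, and nondegeneracy of the integral brings it back. -/
theorem lieDer_comm {i j : ZMod 2} {x y : L}
    (hx : x ∈ (LieSuperalgebra.grading (k := k) (L := L)).gr i)
    (hy : y ∈ (LieSuperalgebra.grading (k := k) (L := L)).gr j) (g : FunAlg h) :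
    s.lieDer x (s.lieDer y g) = sgn k (i * j) • s.lieDer y (s.lieDer x g) +
      s.lieDer (LieSuperalgebra.br (k := k) x y) g := by
  refine s.eq_of_topCoeff fun f => ?_
  have hb := LieSuperalgebra.br_mem (k := k) (L := L) hx hy
  rw [s.topCoeff_smul_lieDer hx, s.topCoeff_smul_lieDer hy, Coind.smul_add, Coind.smul_scalar,
    map_add, map_smul, s.topCoeff_smul_lieDer hy, s.topCoeff_smul_lieDer hx,
    s.topCoeff_smul_lieDer hb, Coind_tw_act hx, Coind_tw_act hy, Coind.tw_tw, Coind.tw_tw,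
    map_smul, map_smul, ← Coind.act_mul, ← Coind.act_mul]
  have e : REnv.ι k p L (LieSuperalgebra.br (k := k) x y) =
      REnv.ι k p L x * REnv.ι k p L y + (-sgn k (i * j)) • (REnv.ι k p L y * REnv.ι k p L x) := by
    rw [REnv.ι_comm k p hx hy]; module
  rw [e, Coind.act_add, Coind.act_scalar, Coind.add_smul, Coind.scalar_smul, Coind.scalar_smul,
    Coind.scalar_smul, map_add, map_smul, map_smul, map_smul, add_comm j i, mul_comm j i]
  simp only [smul_eq_mul]
  linear_combination -(s.topCoeff (Coind.smul (Coind.act (REnv.ι k p L x * REnv.ι k p L y)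
    (Coind.tw (i + j) f)) g)) * sgn_mul_self (k := k) (i * j)

/-- Moving `p` operators to the other factor gives the sign `(-1)^p = -1`, the same as moving the
single operator of `x^[p]`; there both act alike because `x^p = x^[p]` in `U'(L)`. -/
theorem lieDer_pow (x : (LieSuperalgebra.grading (k := k) (L := L)).gr 0) (g : FunAlg h) :
    (s.lieDer (x : L))^[p] g = s.lieDer (RestrictedLieSuperalgebra.pmap (p := p) x : L) g := by
  have key : ∀ (N : ℕ) (f : FunAlg h), s.topCoeff (Coind.smul f ((s.lieDer (x : L))^[N] g)) =
      (-1) ^ N * s.topCoeff (Coind.smul (Coind.act (REnv.ι k p L (x : L) ^ N) f) g) := by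
    intro N
    induction N with
    | zero =>
      intro f
      have : Coind.act (1 : REnv k p L) f = f := by
        apply Subtype.ext; ext v
        change f.1 (v * 1) = f.1 v
        rw [mul_one]
      rw [Function.iterate_zero_apply, pow_zero, pow_zero, one_mul, this]
    | succ N ih =>
      intro f
      rw [Function.iterate_succ_apply', s.topCoeff_smul_lieDer x.2, ih, Coind.zero_tw,
        ← Coind.act_mul, ← pow_succ, pow_succ (-1 : k)]
      ring
  refine s.eq_of_topCoeff fun f => ?_
  have hodd : Odd p := (Fact.out : p.Prime).odd_of_ne_two (Fact.out : 2 < p).ne'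
  rw [key, s.topCoeff_smul_lieDer (RestrictedLieSuperalgebra.pmap (p := p) x).2, REnv.ι_pow,
    Coind.zero_tw, hodd.neg_one_pow, neg_one_mul]

/-- The Lie derivative in coordinates. -/
def lieCoord : L →ₗ[k] Module.End k (MIdx p n m → k) :=
  (s.coordEquiv _).conj.toLinearMap ∘ₗ s.lieDerₗ

theorem lieCoord_coordEquiv (x : L) (f : FunAlg h) :
    s.lieCoord x (s.coordEquiv _ f) = s.coordEquiv _ (s.lieDer x f) := by
  change s.coordEquiv _ (s.lieDer x ((s.coordEquiv _).symm (s.coordEquiv _ f))) = _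
  rw [LinearEquiv.symm_apply_apply]

theorem lieCoord_iterate (x : L) (N : ℕ) (f : FunAlg h) :
    (s.lieCoord x ^ N) (s.coordEquiv _ f) = s.coordEquiv _ ((s.lieDer x)^[N] f) := by
  induction N with
  | zero => rfl
  | succ N ih =>
    rw [pow_succ', Module.End.mul_apply, ih, lieCoord_coordEquiv, Function.iterate_succ_apply']

/-- The action of `U'(L)` by Lie derivatives, in coordinates. -/
def lieAlgCoord : REnv k p L →ₐ[k] Module.End k (MIdx p n m → k) :=
  REnv.lift s.lieCoord
    (fun {i j x y} hx hy => LinearMap.ext fun F => by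
      obtain ⟨f, rfl⟩ := (s.coordEquiv (RestrictedRep.trivial k p h.carrier)).surjective F
      simp only [Module.End.mul_apply, LinearMap.add_apply, LinearMap.smul_apply,
        lieCoord_coordEquiv, s.lieDer_comm hx hy, map_add, map_smul])
    (fun x => LinearMap.ext fun F => by
      obtain ⟨f, rfl⟩ := (s.coordEquiv (RestrictedRep.trivial k p h.carrier)).surjective F
      rw [lieCoord_iterate, lieDer_pow, lieCoord_coordEquiv])

/-- The action of `U'(L)` by Lie derivatives. -/
def lieAct (u : REnv k p L) : FunAlg h →ₗ[k] FunAlg h :=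
  (s.coordEquiv _).symm.toLinearMap ∘ₗ s.lieAlgCoord u ∘ₗ (s.coordEquiv _).toLinearMap

theorem lieAct_apply (u : REnv k p L) (f : FunAlg h) :
    s.lieAct u f = (s.coordEquiv _).symm (s.lieAlgCoord u (s.coordEquiv _ f)) := rfl

theorem lieAct_ι (x : L) (f : FunAlg h) : s.lieAct (REnv.ι k p L x) f = s.lieDer x f := by
  rw [lieAct_apply, lieAlgCoord, REnv.lift_ι, lieCoord_coordEquiv, LinearEquiv.symm_apply_apply]

theorem lieAct_one (f : FunAlg h) : s.lieAct 1 f = f := by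
  rw [lieAct_apply, map_one, Module.End.one_apply, LinearEquiv.symm_apply_apply]

theorem lieAct_mul (u w : REnv k p L) (f : FunAlg h) :
    s.lieAct (u * w) f = s.lieAct u (s.lieAct w f) := by
  rw [lieAct_apply, lieAct_apply, lieAct_apply, map_mul, Module.End.mul_apply,
    LinearEquiv.apply_symm_apply]

theorem lieAct_add (u w : REnv k p L) (f : FunAlg h) :
    s.lieAct (u + w) f = s.lieAct u f + s.lieAct w f := by
  rw [lieAct_apply, lieAct_apply, lieAct_apply, map_add, LinearMap.add_apply, map_add]

theorem lieAct_scalar (c : k) (u : REnv k p L) (f : FunAlg h) :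
    s.lieAct (c • u) f = c • s.lieAct u f := by
  rw [lieAct_apply, lieAct_apply, map_smul, LinearMap.smul_apply, map_smul]

end SupplementBasis

end LieDerivative

/-! ### The isomorphism of the volume forms with a coinduced representation -/

section Chi

variable {k : Type*} {p : ℕ} {L V W Y : Type*} [Field k] [AddCommGroup L] [Module k L]
  [RestrictedLieSuperalgebra k p L] [AddCommGroup V] [Module k V] [AddCommGroup W] [Module k W]
  [AddCommGroup Y] [Module k Y] {h : RestrictedSub k p L} {n m : ℕ}
  [CharP k p] [Fact (2 < p)] [Fact p.Prime]

theorem FunAlg.apply_ι_mul (f : FunAlg h) (x : h.carrier) (u : REnv k p L) :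
    f.1 (REnv.ι k p L (x : L) * u) = 0 := by
  rw [coind_apply f x u]
  simp [RestrictedRep.trivial]

theorem FunAlg.apply_ι (f : FunAlg h) (x : h.carrier) : f.1 (REnv.ι k p L (x : L)) = 0 := by
  rw [← mul_one (REnv.ι k p L (x : L)), FunAlg.apply_ι_mul]

namespace SupplementBasis

variable (s : SupplementBasis h n m)

theorem isMon_nil : IsMon p ([] : List (Fin n ⊕ Fin m)) :=
  ⟨List.Pairwise.nil, fun r => by
    have := (Fact.out : 2 < p)
    rcases r with i | i
    · simp only [List.count_nil, letterBound, Sum.elim_inl]; omega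
    · simp [letterBound]⟩

theorem isMon_singleton (r : Fin n ⊕ Fin m) : IsMon p [r] := by
  refine ⟨by simp, fun t => ?_⟩
  have hp : 2 < p := Fact.out
  have h1 : 2 ≤ letterBound p t := by
    rcases t with i | i
    · exact hp.le
    · exact le_rfl
  exact lt_of_le_of_lt (List.count_le_length) h1

theorem wordProd_singleton (r : Fin n ⊕ Fin m) :
    s.wordProd [r] = REnv.ι k p L (s.gen r) := by simp [wordProd]

theorem crd_ι_gen (r t : Fin n ⊕ Fin m) :
    (s.crd r).1 (REnv.ι k p L (s.gen t)) = if t = r then 1 else 0 := by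
  rw [← s.wordProd_singleton, s.crd_wordProd r (isMon_singleton t)]
  simp

theorem pd_apply_one (r : Fin n ⊕ Fin m) (f : FunAlg h) :
    (s.pd r f).1 1 = f.1 (REnv.ι k p L (s.gen r)) := by
  have hn : IsMon p ([] : List (Fin n ⊕ Fin m)) := isMon_nil
  have h1 := s.apply_of_isMon (s.pd r f) hn
  have hI : hn.idx.exp r + 1 < letterBound p r := by
    have := (Fact.out : 2 < p)
    rw [hn.exp_idx, List.count_nil]
    rcases r with i | i
    · simp only [letterBound, Sum.elim_inl]; omega
    · simp [letterBound]
  have hw : (hn.idx.inc r).word = [r] := by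
    refine (hn.idx.inc r).isMon_word.eq_of_count (isMon_singleton r) fun t => ?_
    rw [MIdx.count_word, MIdx.exp_inc hI, hn.exp_idx, List.count_nil, List.count_singleton]
    by_cases htr : t = r
    · subst htr; simp
    · simp [htr, Ne.symm htr]
  have hs : hn.idx.rsgn k r = 1 := by
    rw [MIdx.rsgn, hn.word_idx]
    simp [rightPar, sgn]
  rw [s.wordProd_nil, s.coord_pd, if_pos hI, hs, one_mul, s.coord_apply, hw,
    s.wordProd_singleton] at h1
  exact h1

/-- The basis of the quotient. -/
def quotBasis : Module.Basis (Fin n ⊕ Fin m) k (L ⧸ h.carrier) :=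
  Module.Basis.mk s.linInd s.span.ge

theorem quotBasis_apply (r : Fin n ⊕ Fin m) : s.quotBasis r = h.carrier.mkQ (s.gen r) := by
  rw [quotBasis, Module.Basis.mk_apply]; rfl

theorem quotBasis_mem (r : Fin n ⊕ Fin m) : s.quotBasis r ∈ h.adQuot.grading.gr (letterPar r) := by
  rw [quotBasis_apply]
  exact ⟨_, s.gen_mem r, rfl⟩

/-- To first order the coordinate functions are the dual basis of `L/h`: they vanish on `h` and take
the values of the dual basis on the supplement. -/
theorem quotBasis_coord (r : Fin n ⊕ Fin m) (x : L) :
    s.quotBasis.coord r (h.carrier.mkQ x) = (s.crd r).1 (REnv.ι k p L x) := by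
  have hle : h.carrier ≤ LinearMap.ker ((s.crd r).1 ∘ₗ REnv.ι k p L) := fun y hy =>
    FunAlg.apply_ι (s.crd r) ⟨y, hy⟩
  have : s.quotBasis.coord r = h.carrier.liftQ ((s.crd r).1 ∘ₗ REnv.ι k p L) hle := by
    refine s.quotBasis.ext fun t => ?_
    rw [Module.Basis.coord_apply, Module.Basis.repr_self, quotBasis_apply, Submodule.mkQ_apply,
      Submodule.liftQ_apply, LinearMap.comp_apply, crd_ι_gen, Finsupp.single_apply]
  rw [this]
  rfl

theorem strad_eq [FiniteDimensional k (L ⧸ h.carrier)] (x : h.carrier) :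
    h.strad.χ x = ∑ r, sgn k (letterPar r) *
      (s.crd r).1 (REnv.ι k p L (LieSuperalgebra.br (k := k) (x : L) (s.gen r))) := by
  change LinearMap.trace k _ ((h.adQuot.grading.flip : Module.End k (L ⧸ h.carrier)) *
    h.adQuot.ρ x) = _
  rw [LinearMap.trace_mul_comm, LinearMap.trace_eq_matrix_trace k s.quotBasis, Matrix.trace]
  refine Finset.sum_congr rfl fun r _ => ?_
  rw [Matrix.diag_apply, LinearMap.toMatrix_apply, Module.End.mul_apply,
    SuperGrading.flip_of_mem _ (s.quotBasis_mem r), map_smul, map_smul, Finsupp.smul_apply,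
    smul_eq_mul, ← s.quotBasis_coord, quotBasis_apply]
  rfl

/-- The value of the divergence at the unit. -/
theorem divergence_apply_one [FiniteDimensional k (L ⧸ h.carrier)] (x : h.carrier) :
    (s.divergence (x : L)).1 1 = -h.strad.χ x := by
  induction x using (LieSuperalgebra.grading (k := k) (L := h.carrier)).induction with
  | hadd x y hx hy =>
    have e : s.divergence ((x : L) + y) = s.divergence (x : L) + s.divergence (y : L) :=
      s.divergenceₗ.map_add _ _
    rw [Submodule.coe_add, e, map_add, neg_add, ← hx, ← hy]
    rfl
  | hom i x hx =>
    have hxL : (x : L) ∈ (LieSuperalgebra.grading (k := k) (L := L)).gr i := hx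
    let ev : FunAlg h →ₗ[k] k := LinearMap.applyₗ (1 : REnv k p L) ∘ₗ (FunAlg h).subtype
    have hev : ∀ f : FunAlg h, ev f = f.1 1 := fun f => rfl
    rw [s.strad_eq, s.divergence_eq hxL, ← hev, map_sum, ← Finset.sum_neg_distrib]
    refine Finset.sum_congr rfl fun r _ => ?_
    rw [map_smul, hev, s.pd_apply_one, smul_eq_mul]
    change _ * (s.crd r).1 (REnv.ι k p L (s.gen r) * REnv.ι k p L (x : L)) = _
    -- The value at `1` of the derivative is that of the coordinate function at `gen r * x`.
    -- Exchanging the factors leaves a term that starts in `h`, where functions vanish, and the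
    -- bracket, whose coordinate is a diagonal entry of the adjoint action.
    rw [REnv.ι_comm k p (s.gen_mem r) hxL, map_add, map_smul, FunAlg.apply_ι_mul, smul_zero,
      zero_add, LieSuperalgebra.br_skew (s.gen_mem r) hxL, map_neg, map_smul, map_neg, map_smul,
      smul_eq_mul, mul_neg, ← mul_assoc, ← sgn_add]
    have key : ∀ a b : ZMod 2, a * (b + 1) + a * b = a := by decide
    rw [key]

/-- The function `u ↦ (L_u f)(1)`. -/
def chiFun : FunAlg h →ₗ[k] REnv k p L →ₗ[k] k :=
  LinearMap.mk₂ k (fun f u => (s.lieAct u f).1 1)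
    (fun f g u => by rw [map_add]; rfl) (fun c f u => by rw [map_smul]; rfl)
    (fun f u w => by rw [s.lieAct_add]; rfl) (fun c f u => by rw [s.lieAct_scalar]; rfl)

theorem chiFun_apply (f : FunAlg h) (u : REnv k p L) : s.chiFun f u = (s.lieAct u f).1 1 := rfl

theorem chiFun_one (f : FunAlg h) : s.chiFun f 1 = f.1 1 := by
  rw [chiFun_apply, s.lieAct_one]

theorem rtrans_chiFun (x : L) (f : FunAlg h) :
    rtrans x (s.chiFun f) = s.chiFun (s.lieDer x f) := by
  ext u
  rw [rtrans_apply, chiFun_apply, chiFun_apply, s.lieAct_mul, s.lieAct_ι]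

theorem chiFun_mul_ι (f : FunAlg h) (u : REnv k p L) (x : L) :
    s.chiFun f (u * REnv.ι k p L x) = s.chiFun (s.lieDer x f) u := by
  rw [← rtrans_apply, rtrans_chiFun]

/-- At `1` an element of `h` acts on functions by zero, so its Lie derivative there is
multiplication by the divergence, the number `-strad`. -/
theorem chiFun_mem [FiniteDimensional k (L ⧸ h.carrier)] (q : ZMod 2) (f : FunAlg h) :
    s.chiFun f ∈ Coind h ((RestrictedRep.trivial k p h.carrier).twist h.strad.neg q) := by
  apply mem_coind
  intro i x hx u
  rw [chiFun_apply, s.lieAct_mul, s.lieAct_ι, lieDer, chiFun_apply]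
  change (Coind.act (REnv.ι k p L (x : L)) (s.lieAct u f)).1 1 +
    (Coind.smul (s.divergence (x : L)) (s.lieAct u f)).1 1 = _
  rw [Coind.act_apply_one, FunAlg.apply_ι, zero_add, Coind.smul_apply_one,
    s.divergence_apply_one]
  simp [RestrictedRep.twist, RestrictedRep.trivial, RestrictedCharacter.neg]

/-- Linearity over `𝒜`: both sides have the same value at `1` and satisfy the same Leibniz rule, by
`lieDer_smul`. -/
theorem chiFun_smul (g f : FunAlg h) :
    s.chiFun (Coind.smul g f) =
      conv (SuperGrading.trivial k) (LinearMap.lsmul k k) g.1 (s.chiFun f) := by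
  ext u
  induction u using REnv.induction_right generalizing g f with
  | hone => rw [chiFun_one, Coind.smul_apply_one, conv_one, chiFun_one, LinearMap.lsmul_apply]
  | hadd u w hu hw => rw [map_add, map_add, hu, hw]
  | hsmul c u hu => rw [map_smul, map_smul, hu]
  | hmul i x hx u hu =>
    rw [chiFun_mul_ι, s.lieDer_smul hx, map_add, LinearMap.add_apply, hu, hu,
      conv_mul_ι _ _ _ _ hx, rtrans_chiFun]
    rfl

theorem divergence_tw {i : ZMod 2} {x : L}
    (hx : x ∈ (LieSuperalgebra.grading (k := k) (L := L)).gr i) (f : FunAlg h) :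
    s.lieDer x (Coind.tw 1 f) = sgn k i • Coind.tw 1 (s.lieDer x f) := by
  rw [lieDer, lieDer, Coind.tw_add, Coind.act_tw 1 hx, Coind.tw_smul,
    Coind.tw_of_mem (s.divergence_mem_gr hx), Coind.scalar_smul, smul_add, smul_smul, mul_one,
    one_mul, sgn_mul_self, one_smul]

theorem chiFun_tw (f : FunAlg h) :
    s.chiFun (Coind.tw 1 f) = homFlip (SuperGrading.trivial k) (s.chiFun f) := by
  ext u
  induction u using REnv.induction_right generalizing f with
  | hone =>
    have e : REnv.parity (1 : REnv k p L) = 1 := map_one _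
    rw [homFlip_apply, e, chiFun_one, chiFun_one, Coind.coe_tw, tw_one, homFlip_apply, e]
    rfl
  | hadd u w hu hw => rw [map_add, map_add, hu, hw]
  | hsmul c u hu => rw [map_smul, map_smul, hu]
  | hmul i x hx u hu =>
    rw [chiFun_mul_ι, s.divergence_tw hx, map_smul, LinearMap.smul_apply, hu,
      ← rtrans_apply x (homFlip _ _), rtrans_homFlip _ hx, rtrans_chiFun, LinearMap.smul_apply]

/-- The kernel is an ideal of `𝒜` and stable under Lie derivatives. These differ from the action by
multiplication with a function, so it is stable under `L` as well; a function in it satisfies `f(u)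
= (u f)(1) = 0`. -/
theorem chiFun_injective : Function.Injective s.chiFun := by
  have hideal : ∀ (u : REnv k p L) (g f : FunAlg h), s.chiFun f = 0 →
      s.chiFun (Coind.smul g f) u = 0 := by
    intro u
    induction u using REnv.induction_right with
    | hone =>
      intro g f hf
      rw [chiFun_one, Coind.smul_apply_one, ← s.chiFun_one f, hf, LinearMap.zero_apply, smul_zero]
    | hadd u w hu hw => intro g f hf; rw [map_add, hu g f hf, hw g f hf, add_zero]
    | hsmul c u hu => intro g f hf; rw [map_smul, hu g f hf, smul_zero]
    | hmul i x hx u hu =>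
      intro g f hf
      have hL : s.chiFun (s.lieDer x f) = 0 := by
        rw [← rtrans_chiFun, hf]; rfl
      rw [chiFun_mul_ι, s.lieDer_smul hx, map_add, LinearMap.add_apply, hu _ f hf, hu _ _ hL,
        add_zero]
  have hval : ∀ (u : REnv k p L) (f : FunAlg h), s.chiFun f = 0 → f.1 u = 0 := by
    intro u
    induction u using REnv.induction_right with
    | hone => intro f hf; rw [← s.chiFun_one, hf, LinearMap.zero_apply]
    | hadd u w hu hw => intro f hf; rw [map_add, hu f hf, hw f hf, add_zero]
    | hsmul c u hu => intro f hf; rw [map_smul, hu f hf, smul_zero]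
    | hmul i x hx u hu =>
      intro f hf
      refine hu (Coind.act (REnv.ι k p L x) f) ?_
      have e : s.chiFun (s.lieDer x f) = s.chiFun (Coind.act (REnv.ι k p L x) f) +
          s.chiFun (Coind.smul (s.divergence x) f) := by rw [lieDer, map_add]
      have hd : s.chiFun (Coind.smul (s.divergence x) f) = 0 :=
        LinearMap.ext fun u => hideal u _ f hf
      rw [← rtrans_chiFun, hf, hd, add_zero] at e
      exact e.symm
  intro f g hfg
  refine Subtype.ext (LinearMap.ext fun u => ?_)
  have h0 : s.chiFun (f + (-1 : k) • g) = 0 := LinearMap.ext fun u => by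
    rw [map_add, map_smul, hfg, LinearMap.add_apply, LinearMap.smul_apply, LinearMap.zero_apply,
      smul_eq_mul]
    ring
  have : f.1 u + (-1 : k) * g.1 u = 0 := hval u _ h0
  linear_combination this

variable [FiniteDimensional k (L ⧸ h.carrier)]

/-- The map from the volume forms to the coinduced representation. -/
def chiHom (q : ZMod 2) : FunAlg h →ₗ[k]
    Coind h ((RestrictedRep.trivial k p h.carrier).twist h.strad.neg q) :=
  LinearMap.codRestrict _ s.chiFun (s.chiFun_mem q)

/-- Source and target have the same finite set of coordinates, so injectivity suffices. -/
theorem chiHom_bijective (q : ZMod 2) : Function.Bijective (s.chiHom q) := by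
  have hinj : Function.Injective (s.chiHom q) := fun f g hfg =>
    s.chiFun_injective (congrArg Subtype.val hfg)
  refine ⟨hinj, fun ω => ?_⟩
  let T : (MIdx p n m → k) →ₗ[k] (MIdx p n m → k) :=
    (s.coordEquiv _).toLinearMap ∘ₗ s.chiHom q ∘ₗ (s.coordEquiv _).symm.toLinearMap
  have hT : Function.Injective T :=
    (s.coordEquiv _).injective.comp (hinj.comp (s.coordEquiv _).symm.injective)
  obtain ⟨F, hF⟩ := LinearMap.injective_iff_surjective.1 hT (s.coordEquiv _ ω)
  exact ⟨_, (s.coordEquiv _).injective hF⟩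

/-- The isomorphism of the volume forms with the coinduced representation. -/
def chi (q : ZMod 2) : FunAlg h ≃ₗ[k]
    Coind h ((RestrictedRep.trivial k p h.carrier).twist h.strad.neg q) :=
  LinearEquiv.ofBijective (s.chiHom q) (s.chiHom_bijective q)

theorem coe_chi (q : ZMod 2) (f : FunAlg h) : (s.chi q f).1 = s.chiFun f := rfl

theorem isChi_chi : s.IsChi (s.chi h.oddDim) := by
  intro f l
  rw [coe_chi, chiFun_apply]
  congr 2
  induction l with
  | nil => rw [List.map_nil, List.prod_nil, s.lieAct_one, List.foldr_nil]
  | cons x l ih =>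
    rw [List.map_cons, List.prod_cons, s.lieAct_mul, ih, s.lieAct_ι, List.foldr_cons]

end SupplementBasis

end Chi

/-! ### Reordering products of coordinate functions -/

section Reordering

variable {k : Type*} {p : ℕ} {L V W Y : Type*} [Field k] [AddCommGroup L] [Module k L]
  [RestrictedLieSuperalgebra k p L] [AddCommGroup V] [Module k V] [AddCommGroup W] [Module k W]
  [AddCommGroup Y] [Module k Y] {h : RestrictedSub k p L} {n m : ℕ}

/-- The word with prescribed exponents along a list of letters. -/
def expWord (d : Fin n ⊕ Fin m → ℕ) (l : List (Fin n ⊕ Fin m)) : List (Fin n ⊕ Fin m) :=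
  l.flatMap fun r => List.replicate (d r) r

/-- The list of all letters. -/
def letters (n m : ℕ) : List (Fin n ⊕ Fin m) :=
  (List.finRange n).map Sum.inl ++ (List.finRange m).map Sum.inr

theorem MIdx.word_eq_expWord (I : MIdx p n m) : I.word = expWord I.exp (letters n m) := by
  rw [word, expWord, letters, List.flatMap_append, List.flatMap_map, List.flatMap_map,
    List.ofFn_eq_map, List.ofFn_eq_map]
  rfl

theorem wordPar_append (v w : List (Fin n ⊕ Fin m)) : wordPar (v ++ w) = wordPar v + wordPar w := by
  simp [wordPar]

theorem wordPar_cons (r : Fin n ⊕ Fin m) (w : List (Fin n ⊕ Fin m)) :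
    wordPar (r :: w) = letterPar r + wordPar w := by
  simp [wordPar]

theorem wordPar_expWord (d : Fin n ⊕ Fin m → ℕ) (l : List (Fin n ⊕ Fin m)) :
    wordPar (expWord d l) = (l.map fun r => d r • letterPar r).sum := by
  induction l with
  | nil => rfl
  | cons r l ih =>
    have e : expWord d (r :: l) = List.replicate (d r) r ++ expWord d l := rfl
    rw [e, wordPar_append, ih, List.map_cons, List.sum_cons]
    simp [wordPar]

/-- The parity of the number of inversions. -/
def invPar (a b : Fin n ⊕ Fin m → ℕ) : List (Fin n ⊕ Fin m) → ZMod 2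
  | [] => 0
  | r :: l => (b r • letterPar r) * wordPar (expWord a l) + invPar a b l

theorem invPar_append_left (a b : Fin n ⊕ Fin m → ℕ) (l : List (Fin n))
    (l' : List (Fin n ⊕ Fin m)) : invPar a b (l.map Sum.inl ++ l') = invPar a b l' := by
  induction l with
  | nil => rfl
  | cons i l ih =>
    rw [List.map_cons, List.cons_append, invPar, ih]
    simp [letterPar]

theorem invPar_right (a b : Fin n ⊕ Fin m → ℕ) {l : List (Fin m)} (hl : l.Pairwise (· < ·)) :
    invPar a b (l.map Sum.inr) = (l.map fun s => (b (Sum.inr s) : ZMod 2) *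
      (l.map fun t => if s < t then (a (Sum.inr t) : ZMod 2) else 0).sum).sum := by
  induction l with
  | nil => rfl
  | cons s l ih =>
    rw [List.pairwise_cons] at hl
    rw [List.map_cons, invPar, ih hl.2, List.map_cons, List.sum_cons, wordPar_expWord]
    congr 1
    · rw [List.map_cons, List.sum_cons, if_neg (lt_irrefl s), zero_add, List.map_map]
      congr 1
      · simp [letterPar]
      · refine congrArg List.sum (List.map_congr_left fun t ht => ?_)
        rw [if_pos (hl.1 t ht)]
        simp [letterPar]
    · refine congrArg List.sum (List.map_congr_left fun t ht => ?_)
      rw [List.map_cons, List.sum_cons, if_neg (lt_asymm (hl.1 t ht)), zero_add]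

/-- Even letters do not contribute, and for odd ones the recursion counts the pairs `s < t` with
`β_s = α_t = 1`. -/
theorem invPar_letters (I J : MIdx p n m) :
    invPar I.exp J.exp (letters n m) = (inversions I.2 J.2 : ZMod 2) := by
  rw [letters, invPar_append_left, invPar_right _ _ (List.pairwise_lt_finRange m), inversions,
    Finset.natCast_card_filter, Fintype.sum_prod_type_right, Fin.sum_univ_def]
  refine congrArg List.sum (List.map_congr_left fun s _ => ?_)
  rw [← Fin.sum_univ_def, Finset.mul_sum]
  refine Finset.sum_congr rfl fun t _ => ?_
  have h1 : ∀ a : Fin 2, (a : ℕ) = 0 ∨ (a : ℕ) = 1 := by decide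
  change ((J.2 s : ℕ) : ZMod 2) * (if s < t then ((I.2 t : ℕ) : ZMod 2) else 0) = _
  rcases h1 (I.2 t) with hI | hI <;> rcases h1 (J.2 s) with hJ | hJ <;> simp [hI, hJ]

variable [CharP k p] [Fact (2 < p)] [Fact p.Prime]

namespace SupplementBasis

variable (s : SupplementBasis h n m) {σ : RestrictedRep k p h.carrier V}

theorem crdWord_scalar (w : List (Fin n ⊕ Fin m)) (c : k) (μ : Coind h σ) :
    s.crdWord w (c • μ) = c • s.crdWord w μ := by
  induction w with
  | nil => rfl
  | cons r w ih => rw [crdWord_cons, ih, Coind.smul_scalar, crdWord_cons]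

theorem crd_smul_crdWord (r : Fin n ⊕ Fin m) (w : List (Fin n ⊕ Fin m)) (μ : Coind h σ) :
    s.crdWord w (Coind.smul (s.crd r) μ) =
      sgn k (letterPar r * wordPar w) • Coind.smul (s.crd r) (s.crdWord w μ) := by
  induction w with
  | nil => simp [wordPar, sgn_zero]; rfl
  | cons t w ih =>
    rw [crdWord_cons, ih, Coind.smul_scalar, Coind.smul_left_comm (s.crd_mem_gr t), s.tw_crd,
      Coind.scalar_smul, smul_smul, ← sgn_add, crdWord_cons, wordPar_cons, mul_add,
      mul_comm (letterPar t), add_comm]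

theorem crdWord_replicate_comm (b : ℕ) (r : Fin n ⊕ Fin m) (w : List (Fin n ⊕ Fin m))
    (μ : Coind h σ) : s.crdWord w (s.crdWord (List.replicate b r) μ) =
      sgn k ((b • letterPar r) * wordPar w) • s.crdWord (List.replicate b r) (s.crdWord w μ) := by
  induction b with
  | zero => simp [sgn_zero]; rfl
  | succ b ih =>
    rw [List.replicate_succ, crdWord_cons, crd_smul_crdWord, ih, Coind.smul_scalar, smul_smul,
      ← sgn_add, crdWord_cons, succ_nsmul, add_mul, add_comm]

/-- The products are merged letter by letter: the block of the second word passes the remaining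
letters of the first one and picks up the sign that `invPar` records. -/
theorem crdWord_expWord (a b : Fin n ⊕ Fin m → ℕ) (l : List (Fin n ⊕ Fin m)) (μ : Coind h σ) :
    s.crdWord (expWord a l) (s.crdWord (expWord b l) μ) =
      sgn k (invPar a b l) • s.crdWord (expWord (fun r => a r + b r) l) μ := by
  induction l with
  | nil => simp [invPar, sgn_zero]; rfl
  | cons r l ih =>
    have e : ∀ d : Fin n ⊕ Fin m → ℕ,
        expWord d (r :: l) = List.replicate (d r) r ++ expWord d l := fun d => rfl
    rw [e, e, e, crdWord_append, crdWord_append, crdWord_append, crdWord_replicate_comm, ih,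
      crdWord_scalar, crdWord_scalar, crdWord_scalar, ← crdWord_append, ← List.replicate_add,
      smul_smul, ← sgn_add]
    rfl

/-- The product of complementary monomials. -/
theorem crdWord_compl {I J : MIdx p n m}
    (hIJ : ∀ r, I.exp r + J.exp r = (MIdx.top : MIdx p n m).exp r) (μ : Coind h σ) :
    s.crdWord I.word (s.crdWord J.word μ) =
      (-1 : k) ^ inversions I.2 J.2 • s.crdWord (MIdx.top : MIdx p n m).word μ := by
  rw [I.word_eq_expWord, J.word_eq_expWord, crdWord_expWord, invPar_letters, sgn_natCast,
    MIdx.word_eq_expWord, funext hIJ]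

variable (k p n m) in
/-- The coefficient of the largest monomial. -/
def _root_.SuperDuality.topConst : k :=
  (MIdx.top : MIdx p n m).wcoef k (MIdx.top : MIdx p n m).word

theorem topConst_ne_zero : topConst k p n m ≠ 0 :=
  MIdx.wcoef_ne_zero_iff.2 fun t => by rw [MIdx.count_word]

theorem topCoeff_crdWord_top (g : FunAlg h) :
    s.topCoeff (s.crdWord (MIdx.top : MIdx p n m).word g) = topConst k p n m * g.1 1 := by
  rw [topCoeff_apply, coord_crdWord, smul_eq_mul, s.coord_apply, topConst]
  congr 1
  have : ((MIdx.top : MIdx p n m).decs (MIdx.top : MIdx p n m).word).word = [] := by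
    refine List.eq_nil_iff_forall_not_mem.2 fun t ht => ?_
    have := List.count_pos_iff.2 ht
    rw [MIdx.count_word, MIdx.exp_decs, MIdx.count_word, Nat.sub_self] at this
    exact lt_irrefl _ this
  rw [this, s.wordProd_nil]

/-- With too many copies of a letter the coefficient vanishes; with too few the unit is evaluated at
a nonempty monomial. -/
theorem topCoeff_crdWord_eq_zero {w : List (Fin n ⊕ Fin m)}
    (hw : ¬ ∀ t, w.count t = (MIdx.top : MIdx p n m).exp t) :
    s.topCoeff (s.crdWord w (Coind.one h)) = 0 := by
  have e : Coind.one h = s.hat (RestrictedRep.trivial k p h.carrier) 1 := by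
    rw [s.hat_scalar, one_smul]
  rw [topCoeff_apply, coord_crdWord, smul_eq_mul]
  by_contra hne
  have h1 := MIdx.wcoef_ne_zero_iff.1 (left_ne_zero_of_mul hne)
  have h2 := right_ne_zero_of_mul hne
  rw [e, s.coord_hat] at h2
  have h3 : ∀ t, ((MIdx.top : MIdx p n m).decs w).exp t = 0 := by
    by_contra hcon
    rw [if_neg hcon] at h2
    exact h2 rfl
  refine hw fun t => le_antisymm (h1 t) ?_
  have := h3 t
  rw [MIdx.exp_decs] at this
  omega

end SupplementBasis

end Reordering

/-! ### The pairing -/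

section Pairing

variable {k : Type*} {p : ℕ} {L V W Y : Type*} [Field k] [AddCommGroup L] [Module k L]
  [RestrictedLieSuperalgebra k p L] [AddCommGroup V] [Module k V] [AddCommGroup W] [Module k W]
  [AddCommGroup Y] [Module k Y] {h : RestrictedSub k p L} {n m : ℕ}

/-- The pairing of a superspace and its dual. -/
def pairB (S : SuperGrading k V) : V →ₗ[k] Module.Dual k V →ₗ[k] k :=
  LinearMap.flip LinearMap.id ∘ₗ S.flip

theorem pairB_apply (S : SuperGrading k V) (v : V) (f : Module.Dual k V) :
    pairB S v f = f (S.flip v) := rfl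

theorem dual_flip_apply (S : SuperGrading k V) (f : Module.Dual k V) (v : V) :
    S.dual.flip f v = f (S.flip v) := by
  induction f using S.dual.induction with
  | hadd f g hf hg => rw [map_add, LinearMap.add_apply, hf, hg, LinearMap.add_apply]
  | hom j f hf =>
    rw [S.dual.flip_of_mem hf, LinearMap.smul_apply]
    induction v using S.induction with
    | hadd v w hv hw => rw [map_add, smul_add, hv, hw, map_add, map_add]
    | hom i v hv =>
      rw [S.flip_of_mem hv, map_smul]
      by_cases hij : i = j
      · rw [hij]
      · have key : ∀ a b : ZMod 2, ¬a = b → a = b + 1 := by decide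
        rw [key i j hij] at hv
        rw [(Submodule.mem_dualAnnihilator f).1 hf v hv, smul_zero, smul_zero]

theorem shift_flip (S : SuperGrading k V) (q : ZMod 2) (v : V) :
    (S.shift q).flip v = sgn k q • S.flip v := by
  induction v using S.induction with
  | hadd v w hv hw => rw [map_add, map_add, hv, hw, smul_add]
  | hom i v hv =>
    have hv' : v ∈ (S.shift q).gr (i + q) := by
      have key : ∀ a b : ZMod 2, a + b + b = a := by decide
      change v ∈ S.gr (i + q + q)
      rwa [key]
    rw [(S.shift q).flip_of_mem hv', S.flip_of_mem hv, smul_smul, sgn_add, mul_comm]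

variable [CharP k p] [Fact (2 < p)]

theorem homFlip_shift (S : SuperGrading k V) (q : ZMod 2) (μ : REnv k p L →ₗ[k] V) :
    homFlip (S.shift q) μ = sgn k q • homFlip S μ := by
  ext u
  rw [homFlip_apply, shift_flip, LinearMap.smul_apply, homFlip_apply]

theorem pairB_flip (S : SuperGrading k V) (v : V) (f : Module.Dual k V) :
    (SuperGrading.trivial k).flip (pairB S v f) = pairB S (S.flip v) (S.dual.flip f) := by
  rw [trivial_flip, pairB_apply, pairB_apply, S.flip_flip, dual_flip_apply]

variable [Fact p.Prime]

/-- An instance of associativity that holds for any bilinear map, since scalars carry no sign. -/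
theorem conv_smul_assoc (S : SuperGrading k V) (B : V →ₗ[k] W →ₗ[k] Y) (f : REnv k p L →ₗ[k] k)
    (μ : REnv k p L →ₗ[k] V) (ν : REnv k p L →ₗ[k] W) :
    conv S B (conv (SuperGrading.trivial k) (LinearMap.lsmul k V) f μ) ν =
      conv (SuperGrading.trivial k) (LinearMap.lsmul k Y) f (conv S B μ ν) :=
  conv_assoc (S := SuperGrading.trivial k) (T := S) (R := S) (B := LinearMap.lsmul k V) (B' := B)
    (C := B) (C' := LinearMap.lsmul k Y) (Coind.trivial_lsmul_flip S)
    (fun c v w => by simp) f μ ν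

/-- A homogeneous function is moved to the front of a convolution. -/
theorem conv_smul_comm (S : SuperGrading k V) (B : V →ₗ[k] W →ₗ[k] Y) {j : ZMod 2}
    {f : REnv k p L →ₗ[k] k} (hf : homFlip (SuperGrading.trivial k) f = sgn k j • f)
    (μ : REnv k p L →ₗ[k] V) (ν : REnv k p L →ₗ[k] W) :
    conv S B μ (conv (SuperGrading.trivial k) (LinearMap.lsmul k W) f ν) =
      conv (SuperGrading.trivial k) (LinearMap.lsmul k Y) f (conv S B (tw S j μ) ν) := by
  have h1 : conv S B (conv S (LinearMap.lsmul k V).flip μ f) ν =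
      conv S B μ (conv (SuperGrading.trivial k) (LinearMap.lsmul k W) f ν) :=
    conv_assoc (S := S) (T := SuperGrading.trivial k) (R := S) (B := (LinearMap.lsmul k V).flip)
      (B' := B) (C := LinearMap.lsmul k W) (C' := B)
      (fun v c => by rw [LinearMap.flip_apply, LinearMap.flip_apply, Coind.trivial_lsmul_flip])
      (fun c v w => by simp) μ f ν
  have h2 := conv_comm (S := S) (B := LinearMap.lsmul k V) hf (tw S j μ)
  have key : ∀ a : ZMod 2, a + a = 0 := by decide
  rw [tw_tw, key, tw_zero] at h2
  rw [← h1, ← h2, conv_smul_assoc]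

variable {π : RestrictedRep k p h.carrier V}

theorem pairB_equivariant_even (χ : RestrictedCharacter k p h.carrier) (q : ZMod 2) :
    ∀ x ∈ (LieSuperalgebra.grading (k := k) (L := h.carrier)).gr 0, ∀ v f,
      ((RestrictedRep.trivial k p h.carrier).twist χ q).ρ x (pairB π.grading v f) =
        pairB π.grading (π.ρ x v) f + pairB π.grading v ((π.dual.twist χ q).ρ x f) := by
  intro x hx v f
  have e : (π.dual.twist χ q).ρ x f = π.dualρ x f + χ.χ x • f := by
    simp [RestrictedRep.twist, RestrictedRep.dual]
  rw [e, map_add, map_smul, pairB_apply, pairB_apply, pairB_apply, π.dualρ_even hx, π.flip_ρ hx,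
    sgn_zero, one_smul]
  simp [RestrictedRep.twist, RestrictedRep.trivial]

/-- For odd elements the contragredient action contains the parity automorphism, which cancels the
one in the Leibniz rule; the two terms add up to zero. -/
theorem pairB_equivariant_odd (χ : RestrictedCharacter k p h.carrier) (q : ZMod 2) :
    ∀ x ∈ (LieSuperalgebra.grading (k := k) (L := h.carrier)).gr 1, ∀ v f,
      ((RestrictedRep.trivial k p h.carrier).twist χ q).ρ x (pairB π.grading v f) =
        pairB π.grading (π.ρ x v) f +
          pairB π.grading (π.grading.flip v) ((π.dual.twist χ q).ρ x f) := by
  intro x hx v f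
  have e : (π.dual.twist χ q).ρ x f = π.dualρ x f := by
    simp [RestrictedRep.twist, RestrictedRep.dual, χ.map_odd hx]
  rw [e, pairB_apply, pairB_apply, pairB_apply, π.dualρ_odd hx, π.grading.flip_flip,
    add_neg_cancel]
  simp [RestrictedRep.twist, RestrictedRep.trivial, χ.map_odd hx]

/-- The product of sections of dual representations. -/
def pairConv (χ : RestrictedCharacter k p h.carrier) (q : ZMod 2) (lam : Coind h π)
    (μ : Coind h (π.dual.twist χ q)) :
    Coind h ((RestrictedRep.trivial k p h.carrier).twist χ q) :=
  ⟨conv π.grading (pairB π.grading) lam.1 μ.1,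
    conv_mem _ (pairB_equivariant_even χ q) (pairB_equivariant_odd χ q) lam μ⟩

/-- The product of sections of dual representations as a function. -/
def pairFun (lam : Coind h π) (ν : Coind h π.dual) : FunAlg h :=
  ⟨conv π.grading (pairB π.grading) lam.1 ν.1, conv_mem _
    (by
      intro x hx v f
      have e : π.dual.ρ x f = π.dualρ x f := rfl
      rw [e, pairB_apply, pairB_apply, pairB_apply, π.dualρ_even hx, π.flip_ρ hx, sgn_zero,
        one_smul, add_neg_cancel]
      simp [RestrictedRep.trivial])
    (by
      intro x hx v f
      have e : π.dual.ρ x f = π.dualρ x f := rfl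
      rw [e, pairB_apply, pairB_apply, pairB_apply, π.dualρ_odd hx, π.grading.flip_flip,
        add_neg_cancel]
      simp [RestrictedRep.trivial]) lam ν⟩

theorem coe_pairFun (lam : Coind h π) (ν : Coind h π.dual) :
    (pairFun lam ν).1 = conv π.grading (pairB π.grading) lam.1 ν.1 := rfl

theorem pairFun_smul (f : FunAlg h) (lam : Coind h π) (ν : Coind h π.dual) :
    pairFun (Coind.smul f lam) ν = Coind.smul f (pairFun lam ν) := by
  apply Subtype.ext
  rw [coe_pairFun, Coind.coe_smul, Coind.coe_smul, coe_pairFun]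
  exact conv_smul_assoc _ _ f.1 lam.1 ν.1

theorem pairFun_smul_right {j : ZMod 2} {f : FunAlg h}
    (hf : f ∈ Coind.gr h (RestrictedRep.trivial k p h.carrier) j) (lam : Coind h π)
    (ν : Coind h π.dual) :
    pairFun lam (Coind.smul f ν) = Coind.smul f (pairFun (Coind.tw j lam) ν) := by
  apply Subtype.ext
  rw [coe_pairFun, Coind.coe_smul, Coind.coe_smul, coe_pairFun, Coind.coe_tw]
  exact conv_smul_comm _ _ (Coind.mem_gr_iff.1 hf) lam.1 ν.1

theorem pairFun_scalar (c : k) (lam : Coind h π) (ν : Coind h π.dual) :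
    pairFun (c • lam) ν = c • pairFun lam ν :=
  Subtype.ext (conv_smul_left _ _ c lam.1 ν.1)

namespace SupplementBasis

variable (s : SupplementBasis h n m)

theorem pairFun_crdWord (w : List (Fin n ⊕ Fin m)) (lam : Coind h π) (ν : Coind h π.dual) :
    pairFun (s.crdWord w lam) ν = s.crdWord w (pairFun lam ν) := by
  induction w with
  | nil => rfl
  | cons r w ih => rw [crdWord_cons, pairFun_smul, ih, crdWord_cons]

theorem pairFun_crdWord_right (w : List (Fin n ⊕ Fin m)) (lam : Coind h π) (ν : Coind h π.dual) :
    pairFun lam (s.crdWord w ν) = s.crdWord w (pairFun (Coind.tw (wordPar w) lam) ν) := by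
  induction w generalizing lam with
  | nil => simp [crdWord, wordPar]
  | cons r w ih =>
    rw [crdWord_cons, pairFun_smul_right (s.crd_mem_gr r), ih, Coind.tw_tw, wordPar_cons,
      crdWord_cons, add_comm]

/-- A convolution with a map that vanishes on nonempty partial monomials only sees its value at `1`,
so the product is supported at the empty monomial. -/
theorem pairFun_hat (v : V) (f : Module.Dual k V) :
    pairFun (s.hat π v) (s.hat π.dual f) = pairB π.grading v f • Coind.one h := by
  rw [← s.hat_scalar]
  refine s.coord_ext fun I => ?_
  rw [s.coord_apply, s.coord_apply, s.hat_wordProd _ _ I.isMon_word, coe_pairFun]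
  by_cases hI : I.word = []
  · rw [if_pos hI, hI, s.wordProd_nil, conv_one, s.hat_one_apply, s.hat_one_apply]
  · rw [if_neg hI, s.conv_wordProd_of_vanish, s.hat_wordProd _ _ I.isMon_word, if_neg hI, map_zero]
    intro v' hv' hne
    rw [s.hat_wordProd _ _ (I.isMon_word.sublist hv'), if_neg hne]

variable [FiniteDimensional k (L ⧸ h.carrier)] (q : ZMod 2)

/-- The function that belongs to a product of sections of dual representations. -/
def pairVol (lam : Coind h π) (μ : Coind h (π.dual.twist h.strad.neg q)) : FunAlg h :=
  (s.chi q).symm (pairConv h.strad.neg q lam μ)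

theorem chiFun_pairVol (lam : Coind h π) (μ : Coind h (π.dual.twist h.strad.neg q)) :
    s.chiFun (s.pairVol q lam μ) = conv π.grading (pairB π.grading) lam.1 μ.1 := by
  rw [← s.coe_chi q, pairVol, LinearEquiv.apply_symm_apply]
  rfl

theorem pairVol_apply_one (lam : Coind h π) (μ : Coind h (π.dual.twist h.strad.neg q)) :
    (s.pairVol q lam μ).1 1 = pairB π.grading (lam.1 1) (μ.1 1) := by
  rw [← s.chiFun_one, chiFun_pairVol, conv_one]

theorem pairVol_smul (f : FunAlg h) (lam : Coind h π) (μ : Coind h (π.dual.twist h.strad.neg q)) :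
    s.pairVol q (Coind.smul f lam) μ = Coind.smul f (s.pairVol q lam μ) := by
  apply s.chiFun_injective
  rw [chiFun_pairVol, s.chiFun_smul, chiFun_pairVol, Coind.coe_smul]
  exact conv_smul_assoc _ _ f.1 lam.1 μ.1

theorem pairVol_smul_right {j : ZMod 2} {f : FunAlg h}
    (hf : f ∈ Coind.gr h (RestrictedRep.trivial k p h.carrier) j) (lam : Coind h π)
    (μ : Coind h (π.dual.twist h.strad.neg q)) :
    s.pairVol q lam (Coind.smul f μ) = Coind.smul f (s.pairVol q (Coind.tw j lam) μ) := by
  apply s.chiFun_injective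
  rw [chiFun_pairVol, s.chiFun_smul, chiFun_pairVol, Coind.coe_smul, Coind.coe_tw]
  exact conv_smul_comm _ _ (Coind.mem_gr_iff.1 hf) lam.1 μ.1

theorem pairVol_crdWord (w : List (Fin n ⊕ Fin m)) (lam : Coind h π)
    (μ : Coind h (π.dual.twist h.strad.neg q)) :
    s.pairVol q (s.crdWord w lam) μ = s.crdWord w (s.pairVol q lam μ) := by
  induction w with
  | nil => rfl
  | cons r w ih => rw [crdWord_cons, pairVol_smul, ih, crdWord_cons]

theorem pairVol_crdWord_right (w : List (Fin n ⊕ Fin m)) (lam : Coind h π)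
    (μ : Coind h (π.dual.twist h.strad.neg q)) :
    s.pairVol q lam (s.crdWord w μ) = s.crdWord w (s.pairVol q (Coind.tw (wordPar w) lam) μ) := by
  induction w generalizing lam with
  | nil => simp [crdWord, wordPar]
  | cons r w ih =>
    rw [crdWord_cons, s.pairVol_smul_right q (s.crd_mem_gr r), ih, Coind.tw_tw, wordPar_cons,
      crdWord_cons, add_comm]

theorem conv_mulLine (lam : REnv k p L →ₗ[k] V) (ν : REnv k p L →ₗ[k] Module.Dual k V)
    (ω : REnv k p L →ₗ[k] k) :
    conv π.grading (pairB π.grading) lam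
        (conv π.grading.dual (LinearMap.lsmul k (Module.Dual k V)).flip ν ω) =
      conv (SuperGrading.trivial k) (LinearMap.lsmul k k)
        (conv π.grading (pairB π.grading) lam ν) ω :=
  (conv_assoc (S := π.grading) (T := π.grading.dual) (R := SuperGrading.trivial k)
    (B := pairB π.grading) (B' := LinearMap.lsmul k k)
    (C := (LinearMap.lsmul k (Module.Dual k V)).flip) (C' := pairB π.grading)
    (pairB_flip π.grading) (fun v f c => by
      rw [LinearMap.lsmul_apply, smul_eq_mul, LinearMap.flip_apply, LinearMap.lsmul_apply, map_smul,
        smul_eq_mul, mul_comm]) lam ν ω).symm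

/-- By associativity, and because `χ` is linear over `𝒜`, the factor `χ(ω)` splits off. The values
on monomials thus reduce to products in `𝒜`. -/
theorem pairVol_mulLine (lam : Coind h π) (ν : Coind h π.dual) :
    s.pairVol q lam (Coind.mulLine ν (s.chi q (Coind.one h))) = pairFun lam ν := by
  apply s.chiFun_injective
  have h1 := s.chiFun_smul (pairFun lam ν) (Coind.one h)
  rw [Coind.smul_one'] at h1
  rw [chiFun_pairVol, h1, coe_pairFun]
  exact conv_mulLine lam.1 ν.1 _

/-- `L` acts on products by the Leibniz rule. -/
theorem lieDer_pairVol {i : ZMod 2} {x : L}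
    (hx : x ∈ (LieSuperalgebra.grading (k := k) (L := L)).gr i) (lam : Coind h π)
    (μ : Coind h (π.dual.twist h.strad.neg q)) :
    s.lieDer x (s.pairVol q lam μ) = s.pairVol q (Coind.act (REnv.ι k p L x) lam) μ +
      s.pairVol q (Coind.tw i lam) (Coind.act (REnv.ι k p L x) μ) := by
  apply s.chiFun_injective
  rw [map_add, chiFun_pairVol, chiFun_pairVol, ← s.rtrans_chiFun, chiFun_pairVol,
    rtrans_conv _ _ _ _ hx]
  rfl

/-- The sign is that of the shift `Π^q` in the second argument; the functions themselves are not
shifted. -/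
theorem pairVol_tw (lam : Coind h π) (μ : Coind h (π.dual.twist h.strad.neg q)) :
    s.pairVol q (Coind.tw 1 lam) (Coind.tw 1 μ) = sgn k q • Coind.tw 1 (s.pairVol q lam μ) := by
  apply s.chiFun_injective
  rw [chiFun_pairVol, map_smul, s.chiFun_tw, chiFun_pairVol, Coind.coe_tw, Coind.coe_tw, tw_one,
    tw_one, homFlip_conv (pairB_flip π.grading), ← conv_smul_right]
  congr 1
  exact homFlip_shift π.grading.dual q μ.1

/-- The Berezin pairing. -/
def berPairing (π : RestrictedRep k p h.carrier V) :
    Coind h π →ₗ[k] Coind h (π.dual.twist h.strad.neg q) →ₗ[k] k :=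
  LinearMap.mk₂ k (fun lam μ => (topConst k p n m)⁻¹ * s.topCoeff (s.pairVol q lam μ))
    (fun a b μ => by
      have : pairConv h.strad.neg q (a + b) μ = pairConv h.strad.neg q a μ +
        pairConv h.strad.neg q b μ := Subtype.ext (conv_add_left _ _ _ _ _)
      rw [pairVol, this, map_add, map_add, mul_add]; rfl)
    (fun c a μ => by
      have : pairConv h.strad.neg q (c • a) μ = c • pairConv h.strad.neg q a μ :=
        Subtype.ext (conv_smul_left _ _ _ _ _)
      rw [pairVol, this, map_smul, map_smul, smul_eq_mul, smul_eq_mul, mul_left_comm]; rfl)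
    (fun a μ ν => by
      have : pairConv h.strad.neg q a (μ + ν) = pairConv h.strad.neg q a μ +
        pairConv h.strad.neg q a ν := Subtype.ext (conv_add_right _ _ _ _ _)
      rw [pairVol, this, map_add, map_add, mul_add]; rfl)
    (fun c a μ => by
      have : pairConv h.strad.neg q a (c • μ) = c • pairConv h.strad.neg q a μ :=
        Subtype.ext (conv_smul_right _ _ _ _ _)
      rw [pairVol, this, map_smul, map_smul, smul_eq_mul, smul_eq_mul, mul_left_comm]; rfl)

theorem berPairing_apply (lam : Coind h π) (μ : Coind h (π.dual.twist h.strad.neg q)) :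
    s.berPairing q π lam μ = (topConst k p n m)⁻¹ * s.topCoeff (s.pairVol q lam μ) := rfl

/-- Both terms together are the integral of the Lie derivative of the product. -/
theorem berPairing_act {i : ZMod 2} {x : L}
    (hx : x ∈ (LieSuperalgebra.grading (k := k) (L := L)).gr i) (lam : Coind h π)
    (μ : Coind h (π.dual.twist h.strad.neg q)) :
    s.berPairing q π (Coind.act (REnv.ι k p L x) lam) μ +
      s.berPairing q π (Coind.tw i lam) (Coind.act (REnv.ι k p L x) μ) = 0 := by
  rw [berPairing_apply, berPairing_apply, ← mul_add, ← map_add, ← s.lieDer_pairVol q hx,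
    s.topCoeff_lieDer hx, mul_zero]

theorem top_exp_inr (t : Fin m) : (MIdx.top : MIdx p n m).exp (Sum.inr t) = 1 := by
  have := MIdx.exp_top (p := p) (n := n) (Sum.inr t)
  simpa [letterBound] using this

/-- The largest monomial contains all `m` odd letters, so the integral has parity `m`. -/
theorem topCoeff_tw (f : FunAlg h) : s.topCoeff (Coind.tw 1 f) = sgn k (m : ZMod 2) * s.topCoeff f := by
  rw [topCoeff_apply, s.coord_tw, topCoeff_apply, smul_eq_mul, wordPar_word, Fintype.sum_sum_type]
  have e : (RestrictedRep.trivial k p h.carrier).grading.flip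
      (s.coord _ f (MIdx.top : MIdx p n m)) = s.coord _ f (MIdx.top : MIdx p n m) := trivial_flip _
  rw [e]
  congr 2
  simp [letterPar, top_exp_inr]

/-- The parity `m` of the integral and the shift of the second argument cancel. This is the point
where the shift must be `Π^m`; evenness and the vanishing of the left kernel rest on it. -/
theorem berPairing_tw (lam : Coind h π) (μ : Coind h (π.dual.twist h.strad.neg (m : ZMod 2))) :
    s.berPairing (m : ZMod 2) π (Coind.tw 1 lam) (Coind.tw 1 μ) =
      s.berPairing (m : ZMod 2) π lam μ := by
  rw [berPairing_apply, pairVol_tw, map_smul, s.topCoeff_tw, smul_eq_mul, ← mul_assoc (sgn k _),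
    sgn_mul_self, one_mul, berPairing_apply]

/-- The largest monomial acts as a delta function at `1`, and the normalisation of the pairing
removes the constant. -/
theorem berPairing_top (lam : Coind h π) (μ : Coind h (π.dual.twist h.strad.neg q)) :
    s.berPairing q π (s.crdWord (MIdx.top : MIdx p n m).word lam) μ =
      pairB π.grading (lam.1 1) (μ.1 1) := by
  rw [berPairing_apply, pairVol_crdWord, topCoeff_crdWord_top, ← mul_assoc,
    inv_mul_cancel₀ topConst_ne_zero, one_mul, pairVol_apply_one]

theorem berPairing_top_right (lam : Coind h π) (μ : Coind h (π.dual.twist h.strad.neg q)) :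
    s.berPairing q π lam (s.crdWord (MIdx.top : MIdx p n m).word μ) =
      pairB π.grading ((Coind.tw (wordPar (MIdx.top : MIdx p n m).word) lam).1 1) (μ.1 1) := by
  rw [berPairing_apply, pairVol_crdWord_right, topCoeff_crdWord_top, ← mul_assoc,
    inv_mul_cancel₀ topConst_ne_zero, one_mul, pairVol_apply_one]

/-- An element of the kernel vanishes at `1`, by pairing it with multiples of the largest monomial.
The kernel is stable under `L` by invariance, so the element vanishes on all of `U'(L)`. -/
theorem berPairing_separatingRight : (s.berPairing q π).SeparatingRight := by
  have key : ∀ (u : REnv k p L) (μ : Coind h (π.dual.twist h.strad.neg q)),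
      (∀ lam, s.berPairing q π lam μ = 0) → μ.1 u = 0 := by
    intro u
    induction u using REnv.induction_right with
    | hone =>
      intro μ hμ
      refine LinearMap.ext fun v => ?_
      have := hμ (s.crdWord (MIdx.top : MIdx p n m).word (s.hat π (π.grading.flip v)))
      rwa [berPairing_top, s.hat_one_apply, pairB_apply, π.grading.flip_flip] at this
    | hadd u w hu hw => intro μ hμ; rw [map_add, hu μ hμ, hw μ hμ, add_zero]
    | hsmul c u hu => intro μ hμ; rw [map_smul, hu μ hμ, smul_zero]
    | hmul i x hx u hu =>
      intro μ hμ
      refine hu (Coind.act (REnv.ι k p L x) μ) fun lam => ?_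
      have := s.berPairing_act q hx (Coind.tw i lam) μ
      rwa [hμ, zero_add, Coind.tw_tw_self] at this
  intro μ hμ
  exact Subtype.ext (LinearMap.ext fun u => key u μ hμ)

theorem berPairing_separatingLeft : (s.berPairing (m : ZMod 2) π).SeparatingLeft := by
  have htw : ∀ (i : ZMod 2) (lam : Coind h π), (∀ μ, s.berPairing (m : ZMod 2) π lam μ = 0) →
      ∀ μ, s.berPairing (m : ZMod 2) π (Coind.tw i lam) μ = 0 := by
    intro i lam hlam μ
    rcases zmod2_cases i with rfl | rfl
    · rw [Coind.zero_tw, hlam]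
    · have := s.berPairing_tw lam (Coind.tw 1 μ)
      rwa [Coind.tw_tw_self, hlam] at this
  have key : ∀ (u : REnv k p L) (lam : Coind h π),
      (∀ μ, s.berPairing (m : ZMod 2) π lam μ = 0) → lam.1 u = 0 := by
    intro u
    induction u using REnv.induction_right with
    | hone =>
      intro lam hlam
      rw [← π.grading.flip_flip (lam.1 1)]
      have : π.grading.flip (lam.1 1) = 0 := by
        refine (Module.forall_dual_apply_eq_zero_iff k _).1 fun f => ?_
        -- Moving the largest monomial to the front twists the first argument; starting from the
        -- twisted element, which also lies in the kernel, removes this twist.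
        have := htw (wordPar (MIdx.top : MIdx p n m).word) lam hlam
          (s.crdWord (MIdx.top : MIdx p n m).word (s.hat _ f))
        rwa [berPairing_top_right, Coind.tw_tw_self, s.hat_one_apply, pairB_apply] at this
      rw [this, map_zero]
    | hadd u w hu hw => intro lam hlam; rw [map_add, hu lam hlam, hw lam hlam, add_zero]
    | hsmul c u hu => intro lam hlam; rw [map_smul, hu lam hlam, smul_zero]
    | hmul i x hx u hu =>
      intro lam hlam
      refine hu (Coind.act (REnv.ι k p L x) lam) fun μ => ?_
      have := s.berPairing_act (m : ZMod 2) hx lam μ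
      rwa [htw i lam hlam, add_zero] at this
  intro lam hlam
  exact Subtype.ext (LinearMap.ext fun u => key u lam hlam)

/-- Applying the parity automorphism to both arguments preserves the pairing but multiplies it by
`-1` for different parities; and `2` is invertible. -/
theorem berPairing_even {i j : ZMod 2} (hij : i ≠ j) {lam : Coind h π}
    (hlam : lam ∈ Coind.gr h π i) {μ : Coind h (π.dual.twist h.strad.neg (m : ZMod 2))}
    (hμ : μ ∈ Coind.gr h (π.dual.twist h.strad.neg (m : ZMod 2)) j) :
    s.berPairing (m : ZMod 2) π lam μ = 0 := by
  have := s.berPairing_tw lam μ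
  rw [Coind.tw_of_mem hlam, Coind.tw_of_mem hμ, map_smul, map_smul, LinearMap.smul_apply,
    smul_smul, one_mul, one_mul, ← sgn_add] at this
  have key : ∀ a b : ZMod 2, a ≠ b → b + a = 1 := by decide
  rw [key i j hij, sgn_one, smul_eq_mul] at this
  have h2 : (2 : k) * s.berPairing (m : ZMod 2) π lam μ = 0 := by linear_combination -this
  exact (mul_eq_zero.1 h2).resolve_left (two_ne k p)

/-- The values of the Berezin pairing on monomials. -/
theorem berPairing_monSmul (I J : MIdx p n m) {i j : ZMod 2} {v : V}
    (hv : v ∈ π.grading.gr i) {f : Module.Dual k V} (hf : f ∈ π.dual.grading.gr j) :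
    s.berPairing q π (s.monSmul I (s.hat π v))
        (Coind.mulLine (s.monSmul J (s.hat π.dual f)) (s.chi q (s.hat _ 1))) =
      if (∀ t, (I.1 t : ℕ) + (J.1 t : ℕ) = p - 1) ∧ ∀ t, (I.2 t : ℕ) + (J.2 t : ℕ) = 1 then
        (-1) ^ inversions I.2 J.2 * sgn k (i * ((∑ t, (J.2 t : ℕ) : ℕ) : ZMod 2)) *
          (sgn k (i * j) * f v)
      else 0 := by
  have hone : s.hat (RestrictedRep.trivial k p h.carrier) 1 = Coind.one h := by
    rw [s.hat_scalar, one_smul]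
  have hB : pairB π.grading v f = sgn k (i * j) * f v := by
    rw [pairB_apply, π.grading.flip_of_mem hv, map_smul, smul_eq_mul]
    by_cases hij : i = j
    · subst hij
      have key : ∀ a : ZMod 2, a * a = a := by decide
      rw [key]
    · have key : ∀ a b : ZMod 2, ¬a = b → a = b + 1 := by decide
      rw [key i j hij] at hv
      rw [(Submodule.mem_dualAnnihilator f).1 hf v hv, mul_zero, mul_zero]
  have hpar : wordPar J.word = ((∑ t, (J.2 t : ℕ) : ℕ) : ZMod 2) := by
    rw [wordPar_word, Fintype.sum_sum_type, Nat.cast_sum]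
    simp [letterPar, MIdx.exp]
  rw [hone, berPairing_apply, pairVol_mulLine, monSmul_eq, monSmul_eq, pairFun_crdWord,
    pairFun_crdWord_right, Coind.tw_of_mem (s.hat_mem_gr hv), pairFun_scalar, pairFun_hat, hB,
    hpar, crdWord_scalar, crdWord_scalar, crdWord_scalar, crdWord_scalar, map_smul, map_smul,
    smul_eq_mul, smul_eq_mul]
  -- The condition says that the two monomials are complementary, that is, that their product is the
  -- largest one up to sign.
  have hiff : ((∀ t, (I.1 t : ℕ) + (J.1 t : ℕ) = p - 1) ∧ ∀ t, (I.2 t : ℕ) + (J.2 t : ℕ) = 1) ↔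
      ∀ r, I.exp r + J.exp r = (MIdx.top : MIdx p n m).exp r := by
    rw [Sum.forall]
    refine and_congr (forall_congr' fun t => ?_) (forall_congr' fun t => ?_)
    · rw [MIdx.top, MIdx.exp_ofExp]; rfl
    · rw [top_exp_inr]; rfl
  split_ifs with hc
  · rw [s.crdWord_compl (hiff.1 hc), map_smul, topCoeff_crdWord_top, Coind.coe_one, counit_one,
      smul_eq_mul, mul_comm i]
    field_simp [topConst_ne_zero (k := k) (p := p) (n := n) (m := m)]
  · rw [← crdWord_append, topCoeff_crdWord_eq_zero, mul_zero, mul_zero, mul_zero]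
    intro H
    refine hc (hiff.2 fun r => ?_)
    rw [← H r, List.count_append, MIdx.count_word, MIdx.count_word]

end SupplementBasis

end Pairing

/-! ### Alternating forms of top degree -/

section TopForms

variable {k W : Type*} [Field k] [AddCommGroup W] [Module k W]

/-- Top alternating forms are determined by their value on a basis. -/
def topFormEquiv {n : ℕ} (B : Module.Basis (Fin n) k W) : (W [⋀^Fin n]→ₗ[k] k) ≃ₗ[k] k where
  toFun ω := ω B
  map_add' _ _ := rfl
  map_smul' _ _ := rfl
  invFun c := c • B.det
  left_inv ω := (ω.eq_smul_basis_det B).symm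
  right_inv c := by simp [B.det_self]

/-- If `f (B i)` replaces `B i` in the basis, only its `i`-th component survives, since the others
repeat a basis vector; summing over `i` gives the trace. -/
theorem altDer_eq_trace_smul {n : ℕ} (B : Module.Basis (Fin n) k W) (f : W →ₗ[k] W)
    (ω : W [⋀^Fin n]→ₗ[k] k) : altDer f ω = LinearMap.trace k W f • ω := by
  apply (topFormEquiv B).injective
  change altDer f ω B = LinearMap.trace k W f • ω B
  rw [altDer_apply, LinearMap.trace_eq_matrix_trace k B, Matrix.trace, smul_eq_mul, Finset.sum_mul]
  refine Finset.sum_congr rfl fun i _ => ?_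
  rw [Matrix.diag_apply, LinearMap.toMatrix_apply]
  conv_lhs => rw [← B.sum_repr (f (B i))]
  rw [← AlternatingMap.coe_multilinearMap, MultilinearMap.map_update_sum, Finset.sum_eq_single i]
  · rw [MultilinearMap.map_update_smul, Function.update_eq_self, smul_eq_mul]
  · intro j _ hj
    rw [MultilinearMap.map_update_smul, AlternatingMap.coe_multilinearMap,
      ω.map_eq_zero_of_eq _ _ hj, smul_zero]
    rw [Function.update_self, Function.update_of_ne hj]
  · simp

end TopForms

/-! ### Supertraces, duals and the Berezinian -/

section Supertrace

variable {k V : Type*} [Field k] [AddCommGroup V] [Module k V] [FiniteDimensional k V]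
  (S : SuperGrading k V)

theorem SuperGrading.trace_proj_comp (i : ZMod 2) (f : V →ₗ[k] V) :
    LinearMap.trace k V (S.proj i ∘ₗ f) = LinearMap.trace k (S.gr i) (S.block i f) := by
  have e : S.proj i ∘ₗ f =
      (S.gr i).subtype ∘ₗ (LinearMap.codRestrict (S.gr i) (S.proj i) (S.proj_mem i) ∘ₗ f) := rfl
  rw [e, LinearMap.trace_comp_comm']
  rfl

theorem SuperGrading.trace_flip_comp (f : V →ₗ[k] V) :
    LinearMap.trace k V (S.flip ∘ₗ f) =
      LinearMap.trace k (S.gr 0) (S.block 0 f) - LinearMap.trace k (S.gr 1) (S.block 1 f) := by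
  rw [SuperGrading.flip, LinearMap.sub_comp, map_sub, S.trace_proj_comp, S.trace_proj_comp]

theorem SuperGrading.dual_flip_apply (f : Module.Dual k V) : S.dual.flip f = f ∘ₗ S.flip := by
  induction f using S.dual.induction with
  | hadd f g hf hg => rw [map_add, hf, hg, LinearMap.add_comp]
  | hom j f hf =>
    rw [S.dual.flip_of_mem hf]
    ext w
    induction w using S.induction with
    | hadd v w hv hw => rw [map_add, hv, hw, map_add]
    | hom l w hw =>
      rw [LinearMap.comp_apply, S.flip_of_mem hw, map_smul, LinearMap.smul_apply]
      by_cases hl : l = j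
      · rw [hl]
      · have hlj : ∀ a b : ZMod 2, ¬a = b → a = b + 1 := by decide
        rw [hlj l j hl] at hw
        rw [(Submodule.mem_dualAnnihilator f).1 hf w hw, smul_zero, smul_zero]

theorem SuperGrading.finrank_dual_gr_one :
    Module.finrank k (S.dual.gr 1) = Module.finrank k (S.gr 1) := by
  have h1 := Subspace.finrank_add_finrank_dualAnnihilator_eq (S.gr 0)
  have h2 := Submodule.finrank_add_eq_of_isCompl S.isCompl
  have e : S.dual.gr 1 = (S.gr 0).dualAnnihilator := by
    change (S.gr (1 + 1)).dualAnnihilator = _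
    rw [one_add_one_zmod2]
  rw [e]
  omega

variable {p : ℕ} [Fact p.Prime] [Fact (2 < p)] [CharP k p] {L : Type*} [AddCommGroup L]
  [Module k L] [RestrictedLieSuperalgebra k p L] (σ : RestrictedRep k p L V)

/-- The supertrace changes sign under passage to the contragredient representation. -/
theorem RestrictedRep.str_dual (x : L) : σ.dual.str.χ x = -σ.str.χ x := by
  induction x using (LieSuperalgebra.grading (k := k) (L := L)).induction with
  | hadd x y hx hy => rw [map_add, map_add, hx, hy, neg_add]
  | hom i x hx =>
    rcases zmod2_cases i with rfl | rfl
    · have e : (σ.grading.dual.flip : Module.End k (Module.Dual k V)) * σ.dual.ρ x =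
          (-1 : k) • Module.Dual.transpose (R := k) (σ.ρ x * (σ.grading.flip : Module.End k V)) := by
        refine LinearMap.ext fun f => LinearMap.ext fun v => ?_
        rw [Module.End.mul_apply, SuperGrading.dual_flip_apply, LinearMap.comp_apply]
        exact (σ.dualρ_even hx f _).trans (neg_one_mul _).symm
      change LinearMap.trace k _ ((σ.grading.dual.flip : Module.End k (Module.Dual k V)) *
        σ.dual.ρ x) = -LinearMap.trace k _ ((σ.grading.flip : Module.End k V) * σ.ρ x)
      rw [e, map_smul, LinearMap.trace_transpose', LinearMap.trace_mul_comm, smul_eq_mul,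
        neg_one_mul]
    · rw [σ.dual.str.map_odd hx, σ.str.map_odd hx, neg_zero]

/-- The two blocks act on top forms by their traces; the difference of these is the supertrace. -/
theorem RestrictedRep.berAct_eq_str_smul (x : L) (z : Ber σ.grading) :
    σ.berAct x z = σ.str.χ x • z := by
  have e : σ.str.χ x = LinearMap.trace k V (σ.grading.flip ∘ₗ σ.ρ x) := rfl
  rw [e, σ.grading.trace_flip_comp]
  refine LinearMap.ext fun ω => ?_
  rw [RestrictedRep.berAct, LinearMap.sub_apply, LinearMap.comp_apply, LinearMap.comp_apply,
    altDer_eq_trace_smul (Module.finBasis k _), altDer_eq_trace_smul (Module.finBasis k _),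
    map_smul, LinearMap.smul_apply, sub_smul]

/-- The Berezinian is one dimensional. -/
def SuperGrading.berEquiv : Ber S ≃ₗ[k] k :=
  (LinearEquiv.arrowCongr (topFormEquiv (Module.finBasis k (S.gr 0)))
    (topFormEquiv (Module.finBasis k (S.gr 1)))).trans (LinearMap.ringLmapEquivSelf k k k)

end Supertrace

/-! ### Homogeneous bases of supplements -/

section Supplement

variable {k : Type*} [Field k] {p : ℕ} [Fact p.Prime] [Fact (2 < p)] [CharP k p] {L : Type*}
  [AddCommGroup L] [Module k L] [RestrictedLieSuperalgebra k p L] (h : RestrictedSub k p L)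
  [FiniteDimensional k (L ⧸ h.carrier)]

/-- The grading of the quotient is the image of that of `L`, so a homogeneous basis of `L/h` lifts
to homogeneous elements. -/
theorem SupplementBasis.exists : ∃ n m : ℕ, Nonempty (SupplementBasis h n m) := by
  let S := h.adQuot.grading
  let b0 := Module.finBasis k (S.gr 0)
  let b1 := Module.finBasis k (S.gr 1)
  let B := (b0.prod b1).map (Submodule.prodEquivOfIsCompl _ _ S.isCompl)
  have h0 : ∀ i, ∃ x ∈ (LieSuperalgebra.grading (k := k) (L := L)).gr 0,
      h.carrier.mkQ x = b0 i := fun i => (b0 i).2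
  have h1 : ∀ i, ∃ x ∈ (LieSuperalgebra.grading (k := k) (L := L)).gr 1,
      h.carrier.mkQ x = b1 i := fun i => (b1 i).2
  choose e he he' using h0
  choose ε hε hε' using h1
  have key : (fun s => h.carrier.mkQ (Sum.elim e ε s)) = B := by
    funext s
    rcases s with i | i
    · simp [B, he', -Submodule.mkQ_apply]
    · simp [B, hε', -Submodule.mkQ_apply]
  exact ⟨_, _, ⟨⟨e, ε, he, hε, key ▸ B.linearIndependent, key ▸ B.span_eq⟩⟩⟩

variable {h}

/-- Linear independence bounds both graded dimensions from below by `n` and `m`, and the total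
dimension is `n + m`. -/
theorem SupplementBasis.finrank_gr_one {n m : ℕ} (s : SupplementBasis h n m) :
    Module.finrank k (h.adQuot.grading.gr 1) = m := by
  have hn : n ≤ Module.finrank k (h.adQuot.grading.gr 0) := by
    have hl : LinearIndependent k
        (fun i : Fin n => (⟨_, s.quotBasis_mem (Sum.inl i)⟩ : h.adQuot.grading.gr 0)) :=
      LinearIndependent.of_comp (h.adQuot.grading.gr 0).subtype
        (s.quotBasis.linearIndependent.comp Sum.inl Sum.inl_injective)
    simpa using hl.fintype_card_le_finrank
  have hm : m ≤ Module.finrank k (h.adQuot.grading.gr 1) := by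
    have hl : LinearIndependent k
        (fun i : Fin m => (⟨_, s.quotBasis_mem (Sum.inr i)⟩ : h.adQuot.grading.gr 1)) :=
      LinearIndependent.of_comp (h.adQuot.grading.gr 1).subtype
        (s.quotBasis.linearIndependent.comp Sum.inr Sum.inr_injective)
    simpa using hl.fintype_card_le_finrank
  have h1 := Module.finrank_eq_card_basis s.quotBasis
  have h2 := Submodule.finrank_add_eq_of_isCompl h.adQuot.grading.isCompl
  rw [Fintype.card_sum, Fintype.card_fin, Fintype.card_fin] at h1
  omega

theorem SupplementBasis.oddDim_eq {n m : ℕ} (s : SupplementBasis h n m) :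
    h.oddDim = (m : ZMod 2) := by
  rw [RestrictedSub.oddDim, s.finrank_gr_one]

end Supplement

/-- The Berezinian of `(L/h)^*` is the character `-strad` up to parity. -/
theorem exists_ber_dual_equiv {k : Type*} [Field k] (p : ℕ) [Fact p.Prime] [Fact (2 < p)]
    [CharP k p] {L : Type*} [AddCommGroup L] [Module k L] [RestrictedLieSuperalgebra k p L]
    (h : RestrictedSub k p L) [FiniteDimensional k (L ⧸ h.carrier)] :
    ∃ φ : Ber h.adQuot.dual.grading ≃ₗ[k] k,
      (∀ (x : h.carrier) (z : Ber h.adQuot.dual.grading), φ (h.adQuot.dual.berAct x z) =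
        ((RestrictedRep.trivial k p h.carrier).twist h.strad.neg h.oddDim).ρ x (φ z)) ∧
      ∀ (i : ZMod 2) (z : Ber h.adQuot.dual.grading), z ∈ berGr h.adQuot.dual.grading i ↔
        φ z ∈ ((RestrictedRep.trivial k p h.carrier).twist h.strad.neg h.oddDim).grading.gr i := by
  refine ⟨h.adQuot.dual.grading.berEquiv, fun x z => ?_, fun i z => ?_⟩
  · rw [RestrictedRep.berAct_eq_str_smul, RestrictedRep.str_dual, map_smul]
    simp [RestrictedRep.twist, RestrictedRep.trivial, RestrictedSub.strad,
      RestrictedCharacter.neg]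
  · have e : ((Module.finrank k (h.adQuot.dual.grading.gr 1) : ℕ) : ZMod 2) = h.oddDim := by
      rw [RestrictedSub.oddDim]
      exact congrArg _ h.adQuot.grading.finrank_dual_gr_one
    have key : ∀ a b : ZMod 2, a = b ↔ a + b = 0 := by decide
    change z ∈ (if i = _ then (⊤ : Submodule k (Ber h.adQuot.dual.grading)) else ⊥) ↔
      _ ∈ (if i + h.oddDim = 0 then (⊤ : Submodule k k) else ⊥)
    rw [e]
    by_cases hi : i = h.oddDim
    · rw [if_pos hi, if_pos ((key _ _).1 hi)]
      simp
    · rw [if_neg hi, if_neg fun h => hi ((key _ _).2 h)]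
      simp

end SuperDuality

end

/-! ### Assembly of the theorem -/

theorem mainTheorem3 {k : Type*} [Field k] (p : ℕ) [Fact p.Prime] [Fact (2 < p)] [CharP k p]
    {L : Type*} [AddCommGroup L] [Module k L] [RestrictedLieSuperalgebra k p L]
    (h : RestrictedSub k p L) [FiniteDimensional k (L ⧸ h.carrier)]
    {V : Type*} [AddCommGroup V] [Module k V] (π : RestrictedRep k p h.carrier V) :
    (∃ φ : Ber h.adQuot.dual.grading ≃ₗ[k] k,
      (∀ (x : h.carrier) (z : Ber h.adQuot.dual.grading), φ (h.adQuot.dual.berAct x z) =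
        ((RestrictedRep.trivial k p h.carrier).twist h.strad.neg h.oddDim).ρ x (φ z)) ∧
      ∀ (i : ZMod 2) (z : Ber h.adQuot.dual.grading), z ∈ berGr h.adQuot.dual.grading i ↔
        φ z ∈ ((RestrictedRep.trivial k p h.carrier).twist h.strad.neg h.oddDim).grading.gr i) ∧
    (∃ n m : ℕ, Nonempty (SupplementBasis h n m)) ∧
    ∀ (n m : ℕ) (b : SupplementBasis h n m),
      Function.Bijective (b.coord (RestrictedRep.trivial k p h.carrier)) ∧
      Function.Bijective (b.coord π) ∧
      Function.Bijective (b.coord π.dual) ∧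
      (∀ i : Fin n, IsSuperDerivation 0 (b.partialEven i) ∧
        (∀ j, b.partialEven i (b.eta j) = if i = j then b.hat _ 1 else 0) ∧
        ∀ t, b.partialEven i (b.zeta t) = 0) ∧
      (∀ s : Fin m, IsSuperDerivation 1 (b.partialOdd s) ∧
        (∀ j, b.partialOdd s (b.eta j) = 0) ∧
        ∀ t, b.partialOdd s (b.zeta t) = if s = t then b.hat _ 1 else 0) ∧
      ∃ χ : FunAlg h ≃ₗ[k]
          Coind h ((RestrictedRep.trivial k p h.carrier).twist h.strad.neg h.oddDim),
        b.IsChi χ ∧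
        ∃ Ψ : Coind h π →ₗ[k] Coind h (π.dual.twist h.strad.neg h.oddDim) →ₗ[k] k,
          b.IsBerezinPairing π χ Ψ ∧
          Ψ.Nondegenerate ∧
          (∀ i j : ZMod 2, i ≠ j → ∀ lam ∈ Coind.gr h π i,
            ∀ μ ∈ Coind.gr h (π.dual.twist h.strad.neg h.oddDim) j, Ψ lam μ = 0) ∧
          (∀ i j : ZMod 2, ∀ X ∈ (LieSuperalgebra.grading (k := k) (L := L)).gr i,
            ∀ lam ∈ Coind.gr h π j, ∀ μ : Coind h (π.dual.twist h.strad.neg h.oddDim),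
              Ψ (Coind.act (REnv.ι k p L X) lam) μ +
                sgn k (i * j) • Ψ lam (Coind.act (REnv.ι k p L X) μ) = 0) := by
  refine ⟨exists_ber_dual_equiv p h, SupplementBasis.exists h, fun n m b =>
    ⟨b.coord_bijective _, b.coord_bijective _, b.coord_bijective _, fun i => ?_, fun s => ?_,
      b.chi h.oddDim, b.isChi_chi, b.berPairing h.oddDim π,
      fun I J i j v hv f hf => b.berPairing_monSmul _ I J hv hf, ⟨?_, b.berPairing_separatingRight _⟩,
      fun i j hij lam hlam μ hμ => ?_, fun i j X hX lam hlam μ => ?_⟩⟩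
  · simp only [b.partialEven_eq, b.hat_scalar, one_smul]
    refine ⟨b.isSuperDerivation_pd (Sum.inl i), fun j => ?_, fun t => ?_⟩
    · exact (b.pd_crd (Sum.inl i) (Sum.inl j)).trans (by simp)
    · exact (b.pd_crd (Sum.inl i) (Sum.inr t)).trans (by simp)
  · simp only [b.partialOdd_eq, b.hat_scalar, one_smul]
    refine ⟨b.isSuperDerivation_pd (Sum.inr s), fun j => ?_, fun t => ?_⟩
    · exact (b.pd_crd (Sum.inr s) (Sum.inl j)).trans (by simp)
    · exact (b.pd_crd (Sum.inr s) (Sum.inr t)).trans (by simp)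
  -- The parity in the statement is intrinsic; here it has to be identified with the number `m` of
  -- odd letters of the basis.
  · rw [b.oddDim_eq]
    exact b.berPairing_separatingLeft
  · revert μ
    rw [b.oddDim_eq]
    exact fun μ hμ => b.berPairing_even hij hlam hμ
  · have := b.berPairing_act h.oddDim hX lam μ
    rwa [Coind.tw_of_mem hlam, map_smul, LinearMap.smul_apply] at this
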